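/- **Conventions.** For a finite set $I$ of positive integers let $-I=\{-k:k\in I\}$ and $\pm I=I\cup(-I)$. Permutations of a finite set of integers are extended by the identity, and $\#(\pi)$ is the number of cycles (fixed points included) on the relevant set. Let $\delta(k)=-k$; for a permutation $\gamma$ of a set containing no pair $k,-k$ write $\gamma_+=\gamma$ and $\gamma_-=\delta\gamma\delta$; for $\varepsilon:I\to\{1,-1\}$ let $\delta_\varepsilon(k)=\varepsilon(|k|)k$. A *premap* on $\pm I$ is a permutation $\pi$ of $\pm I$ with $\delta\pi\delta=\pi^{-1}$ and no cycle containing both $k$ and $-k$; $PM(\pm I)$ is the set of premaps. $\pi/2$ is the restriction of a premap $\pi$ to those cycles whose element of smallest absolute value is positive. For $\gamma\in S(I)$, $\pi\in PM(\pm I)$, $$\chi(\gamma,\pi)=\tfrac12\#(\gamma_+\gamma_-^{-1})+\tfrac12\#(\pi)+\tfrac12\#(\gamma_+^{-1}\pi^{-1}\gamma_-)-|I| .$$ For a matrix $X$ let $X^{(1)}=X$, $X^{(-1)}=X^T$; let $\mathrm{tr}=N^{-1}\mathrm{Tr}$, and let $\mathrm{tr}_\pi(X_k)$ be the product, over the cycles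 $(c_1,\dots,c_m)$ of $\pi$, of $\mathrm{tr}(X^{(c_1)}\cdots X^{(c_m)})$, where $X^{(k)}=X_k$ and $X^{(-k)}=X_k^T$ for $k>0$. $k_r$ is the $r$-th classical (joint) cumulant, and random matrices have entries with moments of all orders. **Genus expansion.** Let $\{X_\lambda\}_{\lambda\in\Lambda}$ be random complex $N\times N$ matrices for each $N\ge1$ on a probability space. We say that they have a *multiplicative genus expansion* $(PM_c,f_c)$ if, for all $N\ge 1$, finite sets $I$ of positive integers, $\gamma\in S(I)$, $\varepsilon:I\to\{1,-1\}$, indices $\lambda_k$ ($k\in I$), and random $N\times N$ matrices $Y_k$ independent of $\{X_\lambda\}$, $$\mathbb E\big(\mathrm{tr}_\gamma(X_{\lambda_k}^{(\varepsilon(k))}Y_k)\big)=\sum_{\pi\in PM_c(\pm I)}N^{\chi(\gamma,\delta_\varepsilon\pi\delta_\varepsilon)-2\#(\gamma)}f_c(\pi)\,\mathbb E\big(\mathrm{tr}_{\gamma_-^{-1}\delta_\varepsilon\pi\delta_\varepsilon\gamma_+/2}(Y_k)\big),\qquad(*)$$ where $PM_c(\pm I)\subseteq PM(\pm I)$; for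 disjoint $J,K$ the $\pi\in PM_c(\pm(J\cup K))$ having no cycle that meets both $\pm J$ and $\pm K$ are exactly the products $\pi_1\pi_2$ with $\pi_1\in PM_c(\pm J)$, $\pi_2\in PM_c(\pm K)$, and then $f_c(\pi)=f_c(\pi_1)f_c(\pi_2)$; and $f_c(\pi)$ (which may depend on $N$ and on the $\lambda_k$) has a limit as $N\to\infty$ for each $\pi$. **Noncrossing permutations.** Let $\gamma,\pi\in S(I)$, let $\pi|_J$ be the permutation obtained by deleting the elements outside $J$ from the cycles of $\pi$, and let the elements named below be distinct. If $\gamma$ has one cycle, $S_{\mathrm{disc-nc}}(\gamma)$ is the set of $\pi$ for which there are neither (i) $a,b,c$ with $\gamma|_{\{a,b,c\}}=\pi|_{\{a,b,c\}}=(a,b,c)$, nor (ii) $a,b,c,d$ with $\gamma|_{\{a,b,c,d\}}=(a,b,c,d)$ and $\pi|_{\{a,b,c,d\}}=(a,c)(b,d)$. If $\gamma$ has two cycles, $S_{\mathrm{ann-nc}}(\gamma)$ is the set of $\pi$ with $\langle\gamma,\pi\rangle$ transitive for which neither (i), (ii), nor any of the following occurs: (iii) $\gamma|_{\{a,b,c,d\}}=(a,b)(c,d)$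 and $\pi|_{\{a,b,c,d\}}=(a,c,b,d)$; (iv) for some $x,y$ in different cycles of $\gamma$, $\lambda_{x,y}|_{\{a,b,c\}}=(a,b,c)$ and $\pi|_{\{a,b,c,x,y\}}=(a,b,c)(x,y)$; (v) for some such $x,y$, $\lambda_{x,y}|_{\{a,b,c,d\}}=(a,b,c,d)$ and $\pi|_{\{a,b,c,d,x,y\}}=(a,c)(b,d)(x,y)$. Here $\lambda_{x,y}$ is the permutation induced on $I\setminus\{x,y\}$ by $\gamma\cdot(x\,y)$ (so it sends $\gamma^{-1}(x)\mapsto\gamma(y)$, $\gamma^{-1}(y)\mapsto\gamma(x)$ when these lie in $I\setminus\{x,y\}$). **Lemma.** (1) Let $\{X_\lambda\}_{\lambda\in\Lambda}$ have a multiplicative genus expansion $(PM_c,f_c)$. Let $A$ be the algebra of noncommutative complex polynomials in indeterminates $x_\lambda=x_\lambda^{(1)}$ and $x_{-\lambda}=x_\lambda^{(-1)}$, $\lambda\in\Lambda$, and put $X_{-\lambda}=X_\lambda^T$. There are a linear tracial $\varphi_1:A\to\mathbb C$ with $\varphi_1(1)=1$, and a bilinear $\varphi_2:A\times A\to\mathbb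 C$, tracial in each argument, with $\varphi_2(1,a)=\varphi_2(a,1)=0$, such that for $m,n\ge1$ $$\varphi_1\big(x_{\lambda_1}^{(\varepsilon(1))}\cdots x_{\lambda_n}^{(\varepsilon(n))}\big)=\sum_{\substack{\pi\in S_{\mathrm{disc-nc}}((1,\dots,n))\\ \delta_\varepsilon\pi_+\pi_-^{-1}\delta_\varepsilon\in PM_c(\pm[n])}}\lim_{N\to\infty}f_c(\delta_\varepsilon\pi_+\pi_-^{-1}\delta_\varepsilon),$$ $$\varphi_2\big(x_{\lambda_1}^{(\varepsilon(1))}\cdots x_{\lambda_m}^{(\varepsilon(m))},\,x_{\lambda_{m+1}}^{(\varepsilon(m+1))}\cdots x_{\lambda_{m+n}}^{(\varepsilon(m+n))}\big)=\sum_{\rho\in\{\gamma,\gamma_{\mathrm{op}}\}}\ \sum_{\substack{\pi\in S_{\mathrm{ann-nc}}(\rho)\\ \delta_\varepsilon\pi_+\pi_-^{-1}\delta_\varepsilon\in PM_c(\pm[m+n])}}\lim_{N\to\infty}f_c(\delta_\varepsilon\pi_+\pi_-^{-1}\delta_\varepsilon),$$ with $\gamma=(1,\dots,m)(m+1,\dots,m+n)$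 and $\gamma_{\mathrm{op}}=(1,\dots,m)(-m-n,\dots,-m-1)$. The ensemble $\{X_\lambda\}_{\lambda\in\pm\Lambda}$ has second-order limit distribution $(A,\varphi_1,\varphi_2)$: for all $p,q,p_1,\dots,p_r\in A$ and $r\ge3$, as $N\to\infty$, $$k_1(\mathrm{tr}\,p(X))\to\varphi_1(p),\quad k_2(\mathrm{Tr}\,p(X),\mathrm{Tr}\,q(X))\to\varphi_2(p,q),\quad k_r(\mathrm{Tr}\,p_1(X),\dots,\mathrm{Tr}\,p_r(X))\to0,$$ and $A$ has a linear involution $a\mapsto a^t$ reversing products with $x_{-\lambda}=x_\lambda^t$. (2) The following ensembles have a multiplicative genus expansion with the data given, and hence a second-order limit distribution as in (1). (a) Real Ginibre matrices $Z$, with entries $N^{-1/2}f_{ij}$, $f_{ij}$ independent $N(0,1)$: $PM_c(\pm I)=\{\rho\delta\rho:\rho\text{ a pairing of }I\}$ (with $\delta$ acting on $\pm I$), $f_c=1$. (b) GOE matrices $2^{-1/2}(Z+Z^T)$, $Z$ real Ginibre: $PM_c(\pm I)$ is the set of premaps on $\pm I$ that are pairings, $f_c=1$. (c) Real Wishart matrices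 $X_\lambda=X^TD_\lambda X$, where $X$ is $M\times N$, $M=M(N)$, with entries $N^{-1/2}f_{ij}$, $f_{ij}$ independent $N(0,1)$, and the $D_\lambda$ are deterministic complex $M\times M$ matrices such that $N^{-1}\mathrm{Tr}(D_{\lambda_1}^{(e_1)}\cdots D_{\lambda_n}^{(e_n)})$ converges as $N\to\infty$ for all $n\ge1$, $\lambda_i\in\Lambda$, $e_i=\pm1$: $PM_c(\pm I)=PM(\pm I)$, $f_c(\pi)=\mathrm{tr}_{\pi^{-1}/2}(D_{\lambda_k}:k\in I)$ with $\mathrm{tr}=N^{-1}\mathrm{Tr}$. -/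

import Mathlib

open MeasureTheory ProbabilityTheory Filter Topology

noncomputable section

namespace RealSecondOrder

/-! ### Signed index sets, permutations and premaps

A permutation of a finite set `S` of integers is a permutation of `ℤ` that fixes every integer
outside `S`. With this convention a permutation `γ` of a set `I` of positive integers is its own
extension `γ₊` to `±I`, and products of permutations of disjoint sets are plain products. -/

/-- The finite set `I` of natural numbers, viewed in `ℤ`. -/
def posPart (I : Finset ℕ) : Finset ℤ := I.image (fun k : ℕ => (k : ℤ))

/-- The set `-I`. -/
def negPart (I : Finset ℕ) : Finset ℤ := I.image (fun k : ℕ => -(k : ℤ))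

/-- The set `±I = I ∪ (-I)`. -/
def pm (I : Finset ℕ) : Finset ℤ := posPart I ∪ negPart I

open scoped Classical in
/-- The set of permutations of the finite set `S`, extended by the identity. -/
def permsOn (S : Finset ℤ) : Finset (Equiv.Perm ℤ) :=
  (Finset.univ : Finset (Equiv.Perm {x // x ∈ S})).image (fun σ => Equiv.Perm.ofSubtype σ)

/-- Membership in `permsOn S`. -/
theorem mem_permsOn {S : Finset ℤ} {π : Equiv.Perm ℤ} :
    π ∈ permsOn S ↔ ∀ k, k ∉ S → π k = k := by
  classical
  unfold permsOn
  constructor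
  · intro h k hk
    obtain ⟨σ, -, rfl⟩ := Finset.mem_image.1 h
    exact Equiv.Perm.ofSubtype_apply_of_not_mem σ hk
  · intro h
    have h1 : ∀ x, π x ∈ S ↔ x ∈ S := by
      intro x
      constructor
      · intro hx
        by_contra hn
        exact hn (by rwa [h x hn] at hx)
      · intro hx
        by_contra hn
        have h2 := π.injective (h (π x) hn)
        exact hn (by rwa [h2])
    refine Finset.mem_image.2 ⟨π.subtypePerm h1, Finset.mem_univ _, ?_⟩
    apply Equiv.Perm.ofSubtype_subtypePerm
    intro x hx
    by_contra hn
    exact hx (h x hn)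

/-- The map `δ : k ↦ -k`. -/
def delta : Equiv.Perm ℤ := Equiv.neg ℤ

/-- The map `δ_ε : k ↦ ε(|k|) k`. -/
def deltaEps (ε : ℕ → ℤˣ) : Equiv.Perm ℤ :=
  Function.Involutive.toPerm (fun k : ℤ => (ε k.natAbs : ℤ) * k) (by
    intro k
    have h : ((ε k.natAbs : ℤ) * k).natAbs = k.natAbs := by
      rw [Int.natAbs_mul, Int.units_natAbs, one_mul]
    simp only [h]
    rw [← mul_assoc, ← Units.val_mul, Int.units_mul_self, Units.val_one, one_mul])

/-- `γ₋ = δ γ₊ δ`. -/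
def minus (γ : Equiv.Perm ℤ) : Equiv.Perm ℤ := delta * γ * delta

/-- `π₊ π₋⁻¹`. -/
def double (π : Equiv.Perm ℤ) : Equiv.Perm ℤ := π * (minus π)⁻¹

open scoped Classical in
/-- `#(π)`: the number of cycles (fixed points included) of `π` as a permutation of `S`. -/
def numCycles (S : Finset ℤ) (π : Equiv.Perm ℤ) : ℕ :=
  (S.image (fun k => S.filter (fun l => π.SameCycle k l))).card

/-- `π` has an orbit that meets both `A` and `B`. -/
def Connects (π : Equiv.Perm ℤ) (A B : Finset ℤ) : Prop :=
  ∃ a ∈ A, ∃ b ∈ B, π.SameCycle a b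

open scoped Classical in
/-- The set `PM(±I)` of premaps on `±I`. -/
def premaps (I : Finset ℕ) : Finset (Equiv.Perm ℤ) :=
  (permsOn (pm I)).filter (fun π =>
    ∀ k ∈ pm I, π k = -(π⁻¹ (-k)) ∧ ¬ π.SameCycle k (-k))

open scoped Classical in
/-- The set of elements of the particular cycles of `π` on `±I`: those cycles whose element of
smallest absolute value is positive. -/
def particular (I : Finset ℕ) (π : Equiv.Perm ℤ) : Finset ℤ :=
  (pm I).filter (fun k => ∃ m ∈ pm I, π.SameCycle k m ∧ 0 < m ∧
    ∀ l ∈ pm I, π.SameCycle k l → |m| ≤ |l|)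

/-- The Euler characteristic
`χ(γ, π) = #(γ₊ γ₋⁻¹)/2 + #(π)/2 + #(γ₊⁻¹ π⁻¹ γ₋)/2 - |I|` of a permutation `γ` of `I` and a premap
`π` on `±I`. All three numbers of cycles are even. -/
def eulerChar (I : Finset ℕ) (γ π : Equiv.Perm ℤ) : ℤ :=
  ((numCycles (pm I) (γ * (minus γ)⁻¹) / 2 : ℕ) : ℤ) + ((numCycles (pm I) π / 2 : ℕ) : ℤ)
    + ((numCycles (pm I) (γ⁻¹ * π⁻¹ * minus γ) / 2 : ℕ) : ℤ) - (I.card : ℤ)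

/-! ### Noncrossing permutations -/

/-- The permutation `π|_J` induced on `J`: `k` is sent to `π^m(k)` with `m` the least positive
integer such that `π^m(k) ∈ J`. -/
def induced (π : Equiv.Perm ℤ) (J : Finset ℤ) (k : ℤ) : ℤ :=
  (π ^ sInf {m : ℕ | 0 < m ∧ (π ^ m) k ∈ J}) k

/-- `σ|_{a,b,c} = (a,b,c)`. -/
def Induces3 (σ : Equiv.Perm ℤ) (a b c : ℤ) : Prop :=
  induced σ {a, b, c} a = b ∧ induced σ {a, b, c} b = c ∧ induced σ {a, b, c} c = a

/-- `σ|_{a,b,c,d} = (a,b,c,d)`. -/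
def Induces4 (σ : Equiv.Perm ℤ) (a b c d : ℤ) : Prop :=
  induced σ {a, b, c, d} a = b ∧ induced σ {a, b, c, d} b = c ∧
    induced σ {a, b, c, d} c = d ∧ induced σ {a, b, c, d} d = a

/-- `σ|_{a,b,c,d} = (a,b)(c,d)`. -/
def Induces22 (σ : Equiv.Perm ℤ) (a b c d : ℤ) : Prop :=
  induced σ {a, b, c, d} a = b ∧ induced σ {a, b, c, d} b = a ∧
    induced σ {a, b, c, d} c = d ∧ induced σ {a, b, c, d} d = c

/-- `σ|_{a,b,c,x,y} = (a,b,c)(x,y)`. -/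
def Induces32 (σ : Equiv.Perm ℤ) (a b c x y : ℤ) : Prop :=
  induced σ {a, b, c, x, y} a = b ∧ induced σ {a, b, c, x, y} b = c ∧
    induced σ {a, b, c, x, y} c = a ∧ induced σ {a, b, c, x, y} x = y ∧
    induced σ {a, b, c, x, y} y = x

/-- `σ|_{a,b,c,d,x,y} = (a,b)(c,d)(x,y)`. -/
def Induces222 (σ : Equiv.Perm ℤ) (a b c d x y : ℤ) : Prop :=
  induced σ {a, b, c, d, x, y} a = b ∧ induced σ {a, b, c, d, x, y} b = a ∧
    induced σ {a, b, c, d, x, y} c = d ∧ induced σ {a, b, c, d, x, y} d = c ∧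
    induced σ {a, b, c, d, x, y} x = y ∧ induced σ {a, b, c, d, x, y} y = x

/-- There are distinct `a, b, c ∈ S` with `γ|_{a,b,c} = (a,b,c) = π|_{a,b,c}`. -/
def DiscNonstandard (S : Finset ℤ) (γ π : Equiv.Perm ℤ) : Prop :=
  ∃ a ∈ S, ∃ b ∈ S, ∃ c ∈ S, [a, b, c].Nodup ∧ Induces3 γ a b c ∧ Induces3 π a b c

/-- There are distinct `a, b, c, d ∈ S` with `γ|_{a,b,c,d} = (a,b,c,d)` and
`π|_{a,b,c,d} = (a,c)(b,d)`. -/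
def DiscCrossing (S : Finset ℤ) (γ π : Equiv.Perm ℤ) : Prop :=
  ∃ a ∈ S, ∃ b ∈ S, ∃ c ∈ S, ∃ d ∈ S, [a, b, c, d].Nodup ∧
    Induces4 γ a b c d ∧ Induces22 π a c b d

open scoped Classical in
/-- `S_disc-nc(γ)` for a permutation `γ` of `S` with one cycle. -/
def discNC (S : Finset ℤ) (γ : Equiv.Perm ℤ) : Finset (Equiv.Perm ℤ) :=
  (permsOn S).filter (fun π => ¬ DiscNonstandard S γ π ∧ ¬ DiscCrossing S γ π)

/-- Annular nonstandard: either the disc condition, or distinct `a, b, c, d` with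
`γ|_{a,b,c,d} = (a,b)(c,d)` and `π|_{a,b,c,d} = (a,c,b,d)`. -/
def AnnularNonstandard (S : Finset ℤ) (γ π : Equiv.Perm ℤ) : Prop :=
  DiscNonstandard S γ π ∨
  ∃ a ∈ S, ∃ b ∈ S, ∃ c ∈ S, ∃ d ∈ S, [a, b, c, d].Nodup ∧
    Induces22 γ a b c d ∧ Induces4 π a c b d

/-- For `x`, `y` in different cycles of `γ`, the permutation induced by `cut γ x y` on the
complement of `{x, y}` is `λ_{x,y}`: it sends `γ⁻¹(x)` to `γ(y)` and `γ⁻¹(y)` to `γ(x)` and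
agrees with `γ` elsewhere. -/
def cut (γ : Equiv.Perm ℤ) (x y : ℤ) : Equiv.Perm ℤ := γ * Equiv.swap x y

/-- Annular crossing, for a permutation `γ` of `S` with two cycles. -/
def AnnularCrossing (S : Finset ℤ) (γ π : Equiv.Perm ℤ) : Prop :=
  DiscCrossing S γ π ∨
  (∃ a ∈ S, ∃ b ∈ S, ∃ c ∈ S, ∃ x ∈ S, ∃ y ∈ S, [a, b, c, x, y].Nodup ∧
    ¬ γ.SameCycle x y ∧ Induces3 (cut γ x y) a b c ∧ Induces32 π a b c x y) ∨
  (∃ a ∈ S, ∃ b ∈ S, ∃ c ∈ S, ∃ d ∈ S, ∃ x ∈ S, ∃ y ∈ S, [a, b, c, d, x, y].Nodup ∧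
    ¬ γ.SameCycle x y ∧ Induces4 (cut γ x y) a b c d ∧ Induces222 π a c b d x y)

/-- The group generated by `γ` and `π` is transitive on `S`. -/
def IsTransitiveOn (S : Finset ℤ) (γ π : Equiv.Perm ℤ) : Prop :=
  ∀ a ∈ S, ∀ b ∈ S, ∃ g ∈ Subgroup.closure ({γ, π} : Set (Equiv.Perm ℤ)), g a = b

open scoped Classical in
/-- `S_ann-nc(γ)`, the connected annular-noncrossing permutations, for a permutation `γ` of `S`
with two cycles. -/
def annNC (S : Finset ℤ) (γ : Equiv.Perm ℤ) : Finset (Equiv.Perm ℤ) :=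
  (permsOn S).filter (fun π =>
    ¬ AnnularNonstandard S γ π ∧ ¬ AnnularCrossing S γ π ∧ IsTransitiveOn S γ π)

/-- The cycle `(m+1, …, m+n)`. -/
def posCycle (m n : ℕ) : Equiv.Perm ℤ :=
  ((List.range n).map (fun i => (m : ℤ) + (i : ℤ) + 1)).formPerm

/-- The cycle `(-m-n, …, -m-1)`. -/
def opCycle (m n : ℕ) : Equiv.Perm ℤ :=
  ((List.range n).map (fun i => (i : ℤ) - ((m : ℤ) + (n : ℤ)))).formPerm

/-! ### Traces along permutations -/

/-- `X^(1) = X` and `X^(-1) = Xᵀ`. -/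
def signPow {d : ℕ} (e : ℤˣ) (X : Matrix (Fin d) (Fin d) ℂ) : Matrix (Fin d) (Fin d) ℂ :=
  if e = 1 then X else X.transpose

/-- `X^(k) = X_k` and `X^(-k) = X_kᵀ` for `k > 0`. -/
def signed {d : ℕ} (X : ℕ → Matrix (Fin d) (Fin d) ℂ) (k : ℤ) : Matrix (Fin d) (Fin d) ℂ :=
  if 0 < k then X k.natAbs else (X k.natAbs).transpose

open scoped Classical in
/-- The normalized trace `tr_π` along the cycles of `π` contained in the `π`-invariant set `S`: the
product, over these cycles `(c₁, …, c_m)`, of `N⁻¹ Tr(X^(c₁) ⋯ X^(c_m))`. Each cycle is listed from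
its least element. -/
def trAlong {d : ℕ} (N : ℕ) (S : Finset ℤ) (π : Equiv.Perm ℤ)
    (X : ℤ → Matrix (Fin d) (Fin d) ℂ) : ℂ :=
  ∏ k ∈ S.filter (fun k => ∀ l ∈ S, π.SameCycle k l → k ≤ l),
    (N : ℂ)⁻¹ * Matrix.trace
      (((List.range (S.filter (fun l => π.SameCycle k l)).card).map
        (fun j => X ((π ^ j) k))).prod)

/-! ### Classical cumulants -/

section Cumulants

variable {Ω : Type*} [MeasurableSpace Ω]

/-- The joint cumulant of the `Z i`, `i ∈ B`, defined by recursion from the moment-cumulant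
formula. -/
def cumulantOn (μ : Measure Ω) {r : ℕ} (Z : Fin r → Ω → ℂ) (B : Finset (Fin r)) : ℂ :=
  (∫ ω, ∏ i ∈ B, Z i ω ∂μ) -
    ∑ π : {π : Finpartition B // π.parts ≠ {B}},
      ∏ V : {V // V ∈ π.1.parts}, cumulantOn μ Z V.1
termination_by B.card
decreasing_by
  apply Finset.card_lt_card
  refine lt_of_le_of_ne (π.1.le V.2) ?_
  intro h
  apply π.2
  have hVB : B ∈ π.1.parts := by
    have h2 := V.2
    rw [h] at h2
    exact h2
  refine Finset.eq_singleton_iff_unique_mem.2 ⟨hVB, ?_⟩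
  intro W hW
  by_contra hne
  have hd : Disjoint W B := π.1.disjoint hW hVB hne
  exact π.1.ne_bot hW (disjoint_self.1 (hd.mono_right (π.1.le hW)))

/-- The classical cumulant `k_r(Z₁, …, Z_r)`. -/
def cumulant (μ : Measure Ω) {r : ℕ} (Z : Fin r → Ω → ℂ) : ℂ :=
  cumulantOn μ Z Finset.univ

/-- The moment-cumulant formula. -/
theorem moment_eq_sum_cumulantOn (μ : Measure Ω) {r : ℕ} (Z : Fin r → Ω → ℂ)
    (B : Finset (Fin r)) (hB : B.Nonempty) :
    ∫ ω, ∏ i ∈ B, Z i ω ∂μ = ∑ π : Finpartition B, ∏ V ∈ π.parts, cumulantOn μ Z V := by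
  classical
  have h0 : B ≠ ⊥ := hB.ne_empty
  have key := Fintype.sum_subtype_add_sum_subtype
    (fun π : Finpartition B => π.parts = {B}) (fun π => ∏ V ∈ π.parts, cumulantOn μ Z V)
  rw [← key]
  have h1 : ∑ π : {π : Finpartition B // π.parts = {B}}, ∏ V ∈ π.1.parts, cumulantOn μ Z V
      = cumulantOn μ Z B := by
    rw [Fintype.sum_eq_single (⟨Finpartition.indiscrete h0, rfl⟩ :
      {π : Finpartition B // π.parts = {B}})]
    · simp [Finpartition.indiscrete]
    · rintro ⟨π, hπ⟩ hne
      exact absurd (Subtype.ext (Finpartition.ext hπ)) hne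
  rw [h1, cumulantOn]
  have h2 : ∀ π : {π : Finpartition B // π.parts ≠ {B}},
      ∏ V : {V // V ∈ π.1.parts}, cumulantOn μ Z V.1 = ∏ V ∈ π.1.parts, cumulantOn μ Z V := by
    intro π
    exact Finset.prod_coe_sort π.1.parts (fun V => cumulantOn μ Z V)
  rw [Finset.sum_congr rfl (fun π _ => h2 π)]
  exact (sub_add_cancel _ _).symm

end Cumulants

/-! ### Ensembles with a genus expansion -/

/-- The combinatorial data of a genus expansion: for each finite set `I` of positive integers a set
`PM I` of premaps on `±I`, and for each matrix size `N`, each such `I` and each assignment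
`k ↦ λ_k` of indices a function `f N I λ` on `PM I`. -/
structure GenusData (Λ : Type*) where
  PM : Finset ℕ → Finset (Equiv.Perm ℤ)
  f : ℕ → Finset ℕ → (ℕ → Λ) → Equiv.Perm ℤ → ℂ

/-- The conditions on the data, multiplicativity of `f` included. -/
structure GenusData.IsMultiplicative {Λ : Type*} (G : GenusData Λ) : Prop where
  /-- Every element of `PM I` is a premap on `±I`. -/
  subset : ∀ I : Finset ℕ, 0 ∉ I → G.PM I ⊆ premaps I
  /-- The elements of `PM (J ∪ K)` not connecting `±J` and `±K` are the products of an element of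
  `PM J` and an element of `PM K`. -/
  split : ∀ J K : Finset ℕ, 0 ∉ J → 0 ∉ K → Disjoint J K → ∀ π : Equiv.Perm ℤ,
    (π ∈ G.PM (J ∪ K) ∧ ¬ Connects π (pm J) (pm K)) ↔
      ∃ π₁ ∈ G.PM J, ∃ π₂ ∈ G.PM K, π = π₁ * π₂
  /-- `f` has a limit as `N → ∞`. -/
  limit : ∀ I : Finset ℕ, 0 ∉ I → ∀ (lam : ℕ → Λ), ∀ π ∈ G.PM I,
    ∃ c : ℂ, Tendsto (fun N => G.f N I lam π) atTop (𝓝 c)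
  /-- `f` is multiplicative. -/
  mul : ∀ J K : Finset ℕ, 0 ∉ J → 0 ∉ K → Disjoint J K → ∀ (N : ℕ), 1 ≤ N →
    ∀ (lam : ℕ → Λ), ∀ π₁ ∈ G.PM J, ∀ π₂ ∈ G.PM K,
      G.f N (J ∪ K) lam (π₁ * π₂) = G.f N J lam π₁ * G.f N K lam π₂

section Ensembles

variable {Ω : Type*} [MeasurableSpace Ω] {Λ : Type*}

/-- A random matrix: its entries are random variables, and they have moments of all orders. -/
def IsRandomMatrix (μ : Measure Ω) {N : ℕ} (Y : Ω → Matrix (Fin N) (Fin N) ℂ) : Prop :=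
  ∀ i j, Measurable (fun ω => Y ω i j) ∧
    ∀ p : ENNReal, p ≠ ⊤ → MemLp (fun ω => Y ω i j) p μ

/-- The random matrices `X_λ` are an ensemble with the genus expansion given by `G`: for all random
matrices `Y_k` independent of the family `(X_λ)`, all permutations `γ` of a finite set `I` of
positive integers, all signs `ε` and all indices `λ_k`,
`E(tr_γ(X_{λ_k}^(ε(k)) Y_k)) = ∑_π N^(χ(γ, δ_ε π δ_ε) - 2 #(γ)) f(π) E(tr_{σ/2}(Y_k))`, where `π` runs
over `PM I` and `σ = γ₋⁻¹ δ_ε π δ_ε γ₊`. -/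
structure IsGenusEnsemble (μ : Measure Ω) (G : GenusData Λ)
    (X : (N : ℕ) → Λ → Ω → Matrix (Fin N) (Fin N) ℂ) : Prop where
  random : ∀ N : ℕ, 1 ≤ N → ∀ l : Λ, IsRandomMatrix μ (X N l)
  data : G.IsMultiplicative
  expansion : ∀ N : ℕ, 1 ≤ N → ∀ I : Finset ℕ, 0 ∉ I → ∀ γ ∈ permsOn (posPart I),
    ∀ (ε : ℕ → ℤˣ) (lam : ℕ → Λ) (Y : ℕ → Ω → Matrix (Fin N) (Fin N) ℂ),
    (∀ k, IsRandomMatrix μ (Y k)) →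
    IndepFun (fun ω (t : Λ × Fin N × Fin N) => X N t.1 ω t.2.1 t.2.2)
      (fun ω (t : ℕ × Fin N × Fin N) => Y t.1 ω t.2.1 t.2.2) μ →
    ∫ ω, trAlong N (posPart I) γ
        (fun k => signPow (ε k.natAbs) (X N (lam k.natAbs) ω) * Y k.natAbs ω) ∂μ
      = ∑ π ∈ G.PM I,
          (N : ℂ) ^ (eulerChar I γ (deltaEps ε * π * deltaEps ε)
              - 2 * (numCycles (posPart I) γ : ℤ))
            * G.f N I lam π
            * ∫ ω, trAlong N
                (particular I ((minus γ)⁻¹ * (deltaEps ε * π * deltaEps ε) * γ))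
                ((minus γ)⁻¹ * (deltaEps ε * π * deltaEps ε) * γ)
                (signed (fun k => Y k ω)) ∂μ

end Ensembles

/-! ### Second-order limit distributions -/

/-- A second-order probability space structure `(A, φ₁, φ₂)` on a unital algebra `A`. -/
structure SecondOrderSpace (A : Type*) [Ring A] [Algebra ℂ A] where
  φ₁ : A →ₗ[ℂ] ℂ
  φ₂ : A →ₗ[ℂ] A →ₗ[ℂ] ℂ
  φ₁_one : φ₁ 1 = 1
  φ₁_tracial : ∀ a b, φ₁ (a * b) = φ₁ (b * a)
  φ₂_tracial_left : ∀ a b c, φ₂ (a * b) c = φ₂ (b * a) c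
  φ₂_tracial_right : ∀ a b c, φ₂ c (a * b) = φ₂ c (b * a)
  φ₂_one_left : ∀ a, φ₂ 1 a = 0
  φ₂_one_right : ∀ a, φ₂ a 1 = 0

section Limits

variable {Ω : Type*} [MeasurableSpace Ω] {Λ : Type*}

/-- The random variable `Tr(p(X))` for a noncommutative polynomial `p` in the `X_λ` and their
transposes; the indeterminate `(λ, e)` stands for `X_{eλ} = X_λ^(e)`. -/
def polyTrace (X : (N : ℕ) → Λ → Ω → Matrix (Fin N) (Fin N) ℂ) (N : ℕ)
    (p : FreeAlgebra ℂ (Λ × ℤˣ)) (ω : Ω) : ℂ :=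
  Matrix.trace (FreeAlgebra.lift ℂ (fun l : Λ × ℤˣ => signPow l.2 (X N l.1 ω)) p)

/-- The family of the `X_λ`, `λ ∈ ±Λ` (with `X_{-λ} = X_λᵀ`), has the second-order limit
distribution `S`, with `x (λ, e) ∈ A` as the limit of `X_λ^(e)`. -/
structure IsSecondOrderLimit (μ : Measure Ω)
    (X : (N : ℕ) → Λ → Ω → Matrix (Fin N) (Fin N) ℂ)
    {A : Type*} [Ring A] [Algebra ℂ A] (S : SecondOrderSpace A) (x : Λ × ℤˣ → A) : Prop where
  first : ∀ p : FreeAlgebra ℂ (Λ × ℤˣ),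
    Tendsto (fun N : ℕ => cumulant μ ![fun ω => (N : ℂ)⁻¹ * polyTrace X N p ω]) atTop
      (𝓝 (S.φ₁ (FreeAlgebra.lift ℂ x p)))
  second : ∀ p q : FreeAlgebra ℂ (Λ × ℤˣ),
    Tendsto (fun N : ℕ => cumulant μ ![polyTrace X N p, polyTrace X N q]) atTop
      (𝓝 (S.φ₂ (FreeAlgebra.lift ℂ x p) (FreeAlgebra.lift ℂ x q)))
  higher : ∀ r : ℕ, 3 ≤ r → ∀ p : Fin r → FreeAlgebra ℂ (Λ × ℤˣ),
    Tendsto (fun N : ℕ => cumulant μ (fun i => polyTrace X N (p i))) atTop (𝓝 0)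
  transpose : ∃ t : A →ₗ[ℂ] A, (∀ a b, t (a * b) = t b * t a) ∧ (∀ a, t (t a) = a) ∧
    ∀ (l : Λ) (e : ℤˣ), x (l, -e) = t (x (l, e))

/-- The monomial `x_{λ_{m+1}}^(ε(m+1)) ⋯ x_{λ_{m+n}}^(ε(m+n))`. -/
def monomial (lam : ℕ → Λ) (ε : ℕ → ℤˣ) (m n : ℕ) : FreeAlgebra ℂ (Λ × ℤˣ) :=
  ((List.range n).map
    (fun i => FreeAlgebra.ι ℂ (lam (m + i + 1), ε (m + i + 1)))).prod

open scoped Classical in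
/-- `∑_π lim_N f(δ_ε π₊ π₋⁻¹ δ_ε)` over those `π ∈ P` with `δ_ε π₊ π₋⁻¹ δ_ε ∈ PM([n])`. -/
def limitSum (G : GenusData Λ) (lam : ℕ → Λ) (ε : ℕ → ℤˣ) (n : ℕ)
    (P : Finset (Equiv.Perm ℤ)) : ℂ :=
  ∑ π ∈ P.filter (fun π => deltaEps ε * double π * deltaEps ε ∈ G.PM (Finset.Icc 1 n)),
    limUnder atTop
      (fun N : ℕ => G.f N (Finset.Icc 1 n) lam (deltaEps ε * double π * deltaEps ε))

/-- The `X_λ` have a second-order limit distribution on the algebra of noncommutative polynomials in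
the `x_λ`, `λ ∈ ±Λ`, given by disc-noncrossing permutations for `φ₁`, and by annular-noncrossing
permutations for both relative orientations of the two circles for `φ₂`. -/
def HasNoncrossingLimit (μ : Measure Ω) (G : GenusData Λ)
    (X : (N : ℕ) → Λ → Ω → Matrix (Fin N) (Fin N) ℂ) : Prop :=
  ∃ S : SecondOrderSpace (FreeAlgebra ℂ (Λ × ℤˣ)),
    IsSecondOrderLimit μ X S (FreeAlgebra.ι ℂ) ∧
    (∀ (n : ℕ), 1 ≤ n → ∀ (lam : ℕ → Λ) (ε : ℕ → ℤˣ),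
      S.φ₁ (monomial lam ε 0 n) =
        limitSum G lam ε n (discNC (posPart (Finset.Icc 1 n)) (posCycle 0 n))) ∧
    (∀ (m n : ℕ), 1 ≤ m → 1 ≤ n → ∀ (lam : ℕ → Λ) (ε : ℕ → ℤˣ),
      S.φ₂ (monomial lam ε 0 m) (monomial lam ε m n) =
        limitSum G lam ε (m + n)
          (annNC (posPart (Finset.Icc 1 (m + n))) (posCycle 0 m * posCycle m n)) +
        limitSum G lam ε (m + n)
          (annNC (posPart (Finset.Icc 1 m) ∪ negPart (Finset.Icc (m + 1) (m + n)))
            (posCycle 0 m * opCycle m n)))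

end Limits

/-! ### The three real matrix models -/

/-- `k ↦ -k` on `±I`, and the identity elsewhere. -/
def negOn (I : Finset ℕ) : Equiv.Perm ℤ :=
  Function.Involutive.toPerm (fun k : ℤ => if k.natAbs ∈ I then -k else k) (by
    intro k
    by_cases h : k.natAbs ∈ I <;> simp [h])

open scoped Classical in
/-- The pairings of the finite set `S`, as permutations all of whose cycles have two elements. -/
def pairings (S : Finset ℤ) : Finset (Equiv.Perm ℤ) :=
  (permsOn S).filter (fun ρ => ∀ k ∈ S, ρ k ≠ k ∧ ρ (ρ k) = k)

open scoped Classical in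
/-- Real Ginibre matrices: `PM(±I) = {ρ δ ρ : ρ a pairing of I}` and `f = 1`. -/
def ginibreData : GenusData Unit where
  PM I := (pairings (posPart I)).image (fun ρ => ρ * negOn I * ρ)
  f _ _ _ _ := 1

open scoped Classical in
/-- GOE matrices: `PM(±I)` is the set of the premaps that are pairings of `±I`, and `f = 1`. -/
def goeData : GenusData Unit where
  PM I := premaps I ∩ pairings (pm I)
  f _ _ _ _ := 1

/-- Real Wishart matrices: `PM(±I)` is the set of all premaps and
`f(π) = tr_{π⁻¹/2}(D_{λ_k} : k ∈ I)`, where `tr` is `N⁻¹` times the trace. -/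
def wishartData {Λ : Type*} (M : ℕ → ℕ)
    (D : (N : ℕ) → Λ → Matrix (Fin (M N)) (Fin (M N)) ℂ) : GenusData Λ where
  PM := premaps
  f N I lam π := trAlong N (particular I π⁻¹) π⁻¹ (signed (fun k => D N (lam k)))

section Models

variable {Ω : Type*} [MeasurableSpace Ω]

/-- The `M × N` random matrix `X` has entries `N^(-1/2) f_ij` with independent standard normal
random variables `f_ij`. -/
def IsGaussianMatrix (μ : Measure Ω) {M N : ℕ} (X : Ω → Matrix (Fin M) (Fin N) ℝ) : Prop :=
  ∃ f : Fin M × Fin N → Ω → ℝ, (∀ t, Measurable (f t)) ∧ iIndepFun f μ ∧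
    (∀ t, μ.map (f t) = gaussianReal 0 1) ∧
    ∀ ω i j, X ω i j = (Real.sqrt N)⁻¹ * f (i, j) ω

/-- `Z` is a real Ginibre matrix of each size. -/
def ginibre (Z : (N : ℕ) → Ω → Matrix (Fin N) (Fin N) ℝ) :
    (N : ℕ) → Unit → Ω → Matrix (Fin N) (Fin N) ℂ :=
  fun N _ ω => (Z N ω).map (fun x : ℝ => (x : ℂ))

/-- The GOE matrix `2^(-1/2) (Z + Zᵀ)`. -/
def goe (Z : (N : ℕ) → Ω → Matrix (Fin N) (Fin N) ℝ) :
    (N : ℕ) → Unit → Ω → Matrix (Fin N) (Fin N) ℂ :=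
  fun N _ ω => ((Real.sqrt 2)⁻¹ • (Z N ω + (Z N ω).transpose)).map (fun x : ℝ => (x : ℂ))

/-- The real Wishart matrices `Xᵀ D_λ X`, with the same `M × N` matrix `X` for all `λ`. -/
def wishart {Λ : Type*} (M : ℕ → ℕ)
    (D : (N : ℕ) → Λ → Matrix (Fin (M N)) (Fin (M N)) ℂ)
    (X : (N : ℕ) → Ω → Matrix (Fin (M N)) (Fin N) ℝ) :
    (N : ℕ) → Λ → Ω → Matrix (Fin N) (Fin N) ℂ :=
  fun N l ω => ((X N ω).map (fun x : ℝ => (x : ℂ))).transpose * D N l *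
    (X N ω).map (fun x : ℝ => (x : ℂ))

end Models

/-- The deterministic matrices `D_λ` and their transposes have a limit distribution: for every
`n ≥ 1` and all indices and signs, `N⁻¹ Tr(D_{λ_1}^(e_1) ⋯ D_{λ_n}^(e_n))` converges. -/
def HasDeterministicLimit {Λ : Type*} (M : ℕ → ℕ)
    (D : (N : ℕ) → Λ → Matrix (Fin (M N)) (Fin (M N)) ℂ) : Prop :=
  ∀ w : List (Λ × ℤˣ), w ≠ [] → ∃ c : ℂ,
    Tendsto (fun N : ℕ => (N : ℂ)⁻¹ *
      Matrix.trace ((w.map (fun l => signPow l.2 (D N l.1))).prod)) atTop (𝓝 c)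

end RealSecondOrder

end

/-! With all `Y_k = 1` and unnormalized traces, the genus expansion writes the moment of `r` traces
of words as the sum over the premaps `π` of `N^(χ - r) f(π)`, where `χ` is taken for the permutation
`γ` with one cycle per trace and for `δ_ε π δ_ε`. Over disjoint index sets `χ` is additive, `f` is
multiplicative, and the premaps that do not connect the two sets are exactly the products. Sorting
the premaps by the block of traces connected to a given one therefore reproduces the recursion
between moments and cumulants, so that the cumulant is the sum over the premaps connecting all `r`
cycles (`sum_PM_eq`, `cumulantOn_polyTrace`).

The power of `N` is controlled by Euler's inequality. `χ` is the number of orbits of `⟨γ₊γ₋⁻¹, π⟩`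
on `±I` minus half of a nonnegative integer, the `defect` (`two_mul_eulerChar`, `defect_nonneg`). If
`π` connects all cycles of `γ`, every point lies in the orbit of a fixed point or of its negative;
hence there are at most two orbits, `χ ≤ 2`, and the `r`-th cumulant is of order `N^(2 - r)`. In the
limit only `χ = 2` survives: two orbits and defect zero. The two orbits are then exchanged by `δ`,
each is a half `S` of `±I`, and `π` is the double `p₊p₋⁻¹` of a planar permutation `p` of `S`
(`exists_double_iff`). For one cycle `S = I`. For two cycles `S` contains the first cycle and either
the second one or its negative; these are the orientations `γ` and `γ_op`, and no premap occurs for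
both (`eulerChar_annular`).

It remains to see that planarity, that is defect zero, is the same as the absence of the forbidden
patterns. Deleting points never increases the defect, and each pattern has positive defect on its
own few points, or after a cut along the two-cycle `(x y)`. Conversely, fixed points of `π` and
points `k` with `π (γ k) = k` can be deleted without changing the defect. On a single cycle without
forbidden patterns one of these always exists (`exists_adjacent`). On two cycles either one exists,
or `π` has a two-cycle joining the two circles (`exists_twoCycle`), and cutting along it leaves a
single cycle.

The functionals `φ₁` and `φ₂` are defined as the limits. These exist for words by the above and for
polynomials by multilinearity, and the trace property and the vanishing at 1 hold already for each
`N`.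

For the models it suffices to know the mixed moments of the entries (`isGenusEnsemble_of_entries`):
expanding the traces into indices on `±I`, each premap contributes the indicator of an index
condition, and the sum over indices yields the trace along `γ₋⁻¹ δ_ε π δ_ε γ₊`. The moments come
from Wick's formula. A Ginibre pairing `ρ` gives the premap `ρδρ`; a GOE matrix is a sum of a
Ginibre matrix and its transpose, and the sum over signs gives all pairing premaps; a Wishart matrix
uses two Gaussian entries per factor, and pairings of `±I` multiplied by `δ` are precisely the
premaps. -/

namespace RealSecondOrder

/-! ### Counting the classes of an equivalence relation on a finite set -/

open Equiv.Perm in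
/-- The equivalence relation of lying on the same cycle. -/
abbrev cyc (π : Equiv.Perm ℤ) : Setoid ℤ := SameCycle.setoid π

open scoped Classical in
/-- The number of classes of `r` that meet `S`. -/
noncomputable def nclass (S : Finset ℤ) (r : Setoid ℤ) : ℕ :=
  (S.image (fun k => S.filter (fun l => r k l))).card

theorem numCycles_eq_nclass (S : Finset ℤ) (π : Equiv.Perm ℤ) :
    numCycles S π = nclass S (cyc π) := rfl

theorem cyc_iff {π : Equiv.Perm ℤ} {x y : ℤ} : cyc π x y ↔ π.SameCycle x y := Iff.rfl

/-- The size of an image depends only on the kernel of the map. Class counts are compared through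
this when the classes are recorded as subsets of different ambient sets. -/
theorem card_image_le_of_ker {α β : Type*} [DecidableEq α] [DecidableEq β] {U : Finset ℤ} {f : ℤ → α} {g : ℤ → β}
    (h : ∀ x ∈ U, ∀ y ∈ U, g x = g y → f x = f y) : (U.image f).card ≤ (U.image g).card := by
  have h' : ∀ B ∈ U.image g, ∃ x ∈ U, g x = B := fun B hB => Finset.mem_image.1 hB
  choose! p hpU hp using h'
  have : U.image f ⊆ (U.image g).image (fun B => f (p B)) := by
    intro A hA
    obtain ⟨x, hx, rfl⟩ := Finset.mem_image.1 hA
    have hg := Finset.mem_image_of_mem g hx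
    exact Finset.mem_image.2 ⟨g x, hg, h _ (hpU _ hg) _ hx (hp _ hg)⟩
  exact (Finset.card_le_card this).trans Finset.card_image_le

section Classes

variable {S : Finset ℤ} {r r' : Setoid ℤ}

open scoped Classical in
theorem filter_class_eq_iff {x y : ℤ} (hy : y ∈ S) :
    S.filter (fun l => r x l) = S.filter (fun l => r y l) ↔ r x y := by
  constructor
  · intro h
    have : y ∈ S.filter (fun l => r x l) := by
      rw [h]; exact Finset.mem_filter.2 ⟨hy, r.refl y⟩
    exact (Finset.mem_filter.1 this).2
  · intro h
    ext l
    simp only [Finset.mem_filter, and_congr_right_iff]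
    intro _
    exact ⟨fun h' => r.trans (r.symm h) h', fun h' => r.trans h h'⟩

theorem nclass_congr (h : ∀ x ∈ S, ∀ y ∈ S, (r x y ↔ r' x y)) : nclass S r = nclass S r' := by
  classical
  unfold nclass
  congr 1
  apply Finset.image_congr
  intro x hx
  ext y
  simp only [Finset.mem_filter, and_congr_right_iff]
  intro hy
  exact h x hx y hy

theorem nclass_le_card {T : Finset ℤ} (h : ∀ x ∈ S, ∃ t ∈ T, r x t) : nclass S r ≤ T.card := by
  classical
  choose! f hfT hf using h
  have : S.image (fun k => S.filter (fun l => r k l)) ⊆ T.image (fun k => S.filter (fun l => r k l)) := by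
    intro A hA
    obtain ⟨x, hx, rfl⟩ := Finset.mem_image.1 hA
    refine Finset.mem_image.2 ⟨f x, hfT x hx, ?_⟩
    ext l
    simp only [Finset.mem_filter, and_congr_right_iff]
    intro _
    exact ⟨fun h' => r.trans (hf x hx) h', fun h' => r.trans (r.symm (hf x hx)) h'⟩
  exact (Finset.card_le_card this).trans Finset.card_image_le

theorem nclass_le_one_iff : nclass S r ≤ 1 ↔ ∀ x ∈ S, ∀ y ∈ S, r x y := by
  classical
  constructor
  · intro h x hx y hy
    exact (filter_class_eq_iff hy).1 (Finset.card_le_one.1 h _ (Finset.mem_image_of_mem _ hx) _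
      (Finset.mem_image_of_mem _ hy))
  · intro h
    refine Finset.card_le_one.2 ?_
    intro A hA B hB
    obtain ⟨x, hx, rfl⟩ := Finset.mem_image.1 hA
    obtain ⟨y, hy, rfl⟩ := Finset.mem_image.1 hB
    exact (filter_class_eq_iff hy).2 (h x hx y hy)

theorem nclass_pos (h : S.Nonempty) : 0 < nclass S r := by
  classical
  exact Finset.card_pos.2 (h.image _)

theorem nclass_eq_card (h : ∀ x ∈ S, ∀ y ∈ S, r x y → x = y) : nclass S r = S.card := by
  classical
  apply Finset.card_image_of_injOn
  intro x hx y hy hxy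
  exact h x hx y hy ((filter_class_eq_iff hy).1 hxy)

theorem nclass_union {A B : Finset ℤ} (h : ∀ x ∈ A, ∀ y ∈ B, ¬ r x y) :
    nclass (A ∪ B) r = nclass A r + nclass B r := by
  classical
  -- Classes are subsets of `A ∪ B` on the left and of `T` on the right; the kernels of the two maps
  -- on `T` agree.
  have key : ∀ (T : Finset ℤ), T ⊆ A ∪ B →
      (T.image (fun k => (A ∪ B).filter (fun l => r k l))).card = nclass T r := by
    intro T hT
    unfold nclass
    apply le_antisymm <;> apply card_image_le_of_ker <;> intro x hx y hy hxy
    · exact (filter_class_eq_iff (hT hy)).2 ((filter_class_eq_iff hy).1 hxy)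
    · exact (filter_class_eq_iff hy).2 ((filter_class_eq_iff (hT hy)).1 hxy)
  rw [← key A Finset.subset_union_left, ← key B Finset.subset_union_right]
  unfold nclass
  rw [Finset.image_union, Finset.card_union_of_disjoint]
  rw [Finset.disjoint_left]
  intro U hU hV
  obtain ⟨x, hx, rfl⟩ := Finset.mem_image.1 hU
  obtain ⟨y, hy, hxy⟩ := Finset.mem_image.1 hV
  exact h x hx y hy
    (r.symm ((filter_class_eq_iff (Finset.mem_union_left _ hx)).1 hxy))

/-- The relation obtained from `r` by identifying the classes of `a` and `b`. -/
def glue (r : Setoid ℤ) (a b : ℤ) : Setoid ℤ where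
  r x y := r x y ∨ (r x a ∧ r b y) ∨ (r x b ∧ r a y)
  iseqv := by
    have hs : ∀ {x y}, r x y → r y x := fun h => r.symm h
    have ht : ∀ {x y z}, r x y → r y z → r x z := fun h h' => r.trans h h'
    refine ⟨fun x => Or.inl (r.refl x), ?_, ?_⟩
    · rintro x y (h | ⟨h, h'⟩ | ⟨h, h'⟩)
      · exact Or.inl (hs h)
      · exact Or.inr (Or.inr ⟨hs h', hs h⟩)
      · exact Or.inr (Or.inl ⟨hs h', hs h⟩)
    · rintro x y z (h | ⟨h, h'⟩ | ⟨h, h'⟩) (k | ⟨k, k'⟩ | ⟨k, k'⟩)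
      · exact Or.inl (ht h k)
      · exact Or.inr (Or.inl ⟨ht h k, k'⟩)
      · exact Or.inr (Or.inr ⟨ht h k, k'⟩)
      · exact Or.inr (Or.inl ⟨h, ht h' k⟩)
      · exact Or.inr (Or.inl ⟨h, k'⟩)
      · exact Or.inl (ht h k')
      · exact Or.inr (Or.inr ⟨h, ht h' k⟩)
      · exact Or.inl (ht h k')
      · exact Or.inr (Or.inr ⟨h, k'⟩)

theorem le_glue (r : Setoid ℤ) (a b : ℤ) : r ≤ glue r a b := fun _ _ h => Or.inl h

theorem glue_rel (r : Setoid ℤ) (a b : ℤ) : glue r a b a b :=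
  Or.inr (Or.inl ⟨r.refl a, r.refl b⟩)

theorem glue_le {r s : Setoid ℤ} {a b : ℤ} (h : r ≤ s) (hab : s a b) : glue r a b ≤ s := by
  rintro x y (h' | ⟨h1, h2⟩ | ⟨h1, h2⟩)
  · exact h h'
  · exact s.trans (h h1) (s.trans hab (h h2))
  · exact s.trans (h h1) (s.trans (s.symm hab) (h h2))

theorem glue_eq_self {r : Setoid ℤ} {a b : ℤ} (h : r a b) : glue r a b = r :=
  le_antisymm (glue_le le_rfl h) (le_glue r a b)

/-- Outside the class of `b` the two relations have equally many classes. The class of `b` is one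
more class of `r`, whereas for `glue r a b` it is absorbed by the class of `a`, which meets the
complement because `a` and `b` are not related. -/
theorem nclass_glue {a b : ℤ} (ha : a ∈ S) (hb : b ∈ S) (hab : ¬ r a b) :
    nclass S (glue r a b) + 1 = nclass S r := by
  classical
  set c := fun k => S.filter (fun l => r k l) with hc
  set c' := fun k => S.filter (fun l => glue r a b k l) with hc'
  have hcc : ∀ x ∈ S, ∀ y ∈ S, c x = c y ↔ r x y := fun x _ y hy => filter_class_eq_iff hy
  have hcc' : ∀ x ∈ S, ∀ y ∈ S, c' x = c' y ↔ glue r a b x y :=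
    fun x _ y hy => filter_class_eq_iff hy
  let U := S.filter (fun x => ¬ r x b)
  have hbU : c b ∉ U.image c := by
    intro h
    obtain ⟨x, hx, hxb⟩ := Finset.mem_image.1 h
    obtain ⟨hxS, hx⟩ := Finset.mem_filter.1 hx
    exact hx ((hcc x hxS b hb).1 hxb)
  have h1 : S.image c = insert (c b) (U.image c) := by
    ext A
    simp only [Finset.mem_image, Finset.mem_insert]
    constructor
    · rintro ⟨x, hx, rfl⟩
      by_cases h : r x b
      · exact Or.inl ((hcc x hx b hb).2 h)
      · exact Or.inr ⟨x, Finset.mem_filter.2 ⟨hx, h⟩, rfl⟩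
    · rintro (rfl | ⟨x, hx, rfl⟩)
      · exact ⟨b, hb, rfl⟩
      · exact ⟨x, (Finset.mem_filter.1 hx).1, rfl⟩
  have h2 : S.image c' = U.image c' := by
    ext A
    simp only [Finset.mem_image]
    constructor
    · rintro ⟨x, hx, rfl⟩
      by_cases h : r x b
      · refine ⟨a, Finset.mem_filter.2 ⟨ha, hab⟩, (hcc' a ha x hx).2 ?_⟩
        exact Or.inr (Or.inl ⟨r.refl a, r.symm h⟩)
      · exact ⟨x, Finset.mem_filter.2 ⟨hx, h⟩, rfl⟩
    · rintro ⟨x, hx, rfl⟩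
      exact ⟨x, (Finset.mem_filter.1 hx).1, rfl⟩
  have h3 : (U.image c').card = (U.image c).card := by
    apply le_antisymm <;> apply card_image_le_of_ker <;> intro x hx y hy hxy <;>
      obtain ⟨hx, hxb⟩ := Finset.mem_filter.1 hx <;> obtain ⟨hy, hyb⟩ := Finset.mem_filter.1 hy
    · exact (hcc' x hx y hy).2 (Or.inl ((hcc x hx y hy).1 hxy))
    · rcases (hcc' x hx y hy).1 hxy with h | ⟨h, h'⟩ | ⟨h, h'⟩
      · exact (hcc x hx y hy).2 h
      · exact absurd (r.symm h') hyb
      · exact absurd h hxb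
  change (S.image c').card + 1 = (S.image c).card
  rw [h1, h2, h3, Finset.card_insert_of_notMem hbU]

end Classes

/-! ### Cycles of permutations and multiplication by a transposition -/

section Perms

variable {S : Finset ℤ} {π σ : Equiv.Perm ℤ}

theorem one_mem_permsOn : (1 : Equiv.Perm ℤ) ∈ permsOn S := mem_permsOn.2 fun _ _ => rfl

theorem mul_mem_permsOn (h : π ∈ permsOn S) (h' : σ ∈ permsOn S) : π * σ ∈ permsOn S := by
  rw [mem_permsOn] at *
  intro k hk
  rw [Equiv.Perm.mul_apply, h' k hk, h k hk]

theorem inv_mem_permsOn (h : π ∈ permsOn S) : π⁻¹ ∈ permsOn S := by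
  rw [mem_permsOn] at *
  intro k hk
  rw [Equiv.Perm.inv_eq_iff_eq, h k hk]

theorem swap_mem_permsOn {a b : ℤ} (ha : a ∈ S) (hb : b ∈ S) : Equiv.swap a b ∈ permsOn S := by
  rw [mem_permsOn]
  intro k hk
  exact Equiv.swap_apply_of_ne_of_ne (fun h => hk (h ▸ ha)) (fun h => hk (h ▸ hb))

theorem permsOn_mono {T : Finset ℤ} (h : S ⊆ T) : permsOn S ⊆ permsOn T := by
  intro π hπ
  rw [mem_permsOn] at *
  exact fun k hk => hπ k (fun h' => hk (h h'))

theorem apply_mem_of_mem_permsOn (h : π ∈ permsOn S) {x : ℤ} (hx : x ∈ S) : π x ∈ S := by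
  by_contra hn
  have := mem_permsOn.1 h _ hn
  exact hn (by rwa [π.injective this])

theorem isOfFinOrder_of_mem_permsOn (h : π ∈ permsOn S) : IsOfFinOrder π := by
  classical
  unfold permsOn at h
  obtain ⟨σ, -, rfl⟩ := Finset.mem_image.1 h
  exact MonoidHom.isOfFinOrder Equiv.Perm.ofSubtype (isOfFinOrder_of_finite σ)

theorem exists_pow_of_sameCycle (hπ : IsOfFinOrder π) {x y : ℤ} (h : π.SameCycle x y) :
    ∃ n : ℕ, (π ^ n) x = y := by
  obtain ⟨i, hi⟩ := h
  have : π ^ i ∈ Submonoid.powers π := hπ.mem_powers_iff_mem_zpowers.2 ⟨i, rfl⟩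
  obtain ⟨n, hn⟩ := this
  refine ⟨n, ?_⟩
  change (fun n => π ^ n) n = π ^ i at hn
  rw [← hi, ← hn]

theorem exists_pow_pos_of_sameCycle (hπ : IsOfFinOrder π) {x y : ℤ} (h : π.SameCycle x y) :
    ∃ n : ℕ, 0 < n ∧ (π ^ n) x = y := by
  obtain ⟨n, hn⟩ := exists_pow_of_sameCycle hπ h
  refine ⟨n + orderOf π, by have := hπ.orderOf_pos; omega, ?_⟩
  rw [pow_add, pow_orderOf_eq_one, mul_one, hn]

theorem sameCycle_pow (π : Equiv.Perm ℤ) (n : ℕ) (x : ℤ) : π.SameCycle x ((π ^ n) x) :=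
  ⟨n, by simp⟩

theorem sameCycle_apply_self (π : Equiv.Perm ℤ) (x : ℤ) : π.SameCycle x (π x) := ⟨1, by simp⟩

theorem mem_of_sameCycle (h : π ∈ permsOn S) {x y : ℤ} (hxy : π.SameCycle x y) (hx : x ∈ S) :
    y ∈ S := by
  obtain ⟨n, rfl⟩ := exists_pow_of_sameCycle (isOfFinOrder_of_mem_permsOn h) hxy
  induction n with
  | zero => simpa using hx
  | succ n ih =>
    rw [pow_succ', Equiv.Perm.mul_apply]
    exact apply_mem_of_mem_permsOn h (ih (sameCycle_pow _ _ _))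

theorem cyc_le {r : Setoid ℤ} (h : ∀ x, r x (π x)) : cyc π ≤ r := by
  have hn : ∀ (n : ℕ) x, r x ((π ^ n) x) := by
    intro n
    induction n with
    | zero => intro x; exact r.refl x
    | succ n ih =>
      intro x
      rw [pow_succ', Equiv.Perm.mul_apply]
      exact r.trans (ih x) (h _)
  rintro x y ⟨i, hi⟩
  obtain ⟨n, rfl | rfl⟩ := i.eq_nat_or_neg
  · rw [zpow_natCast] at hi
    exact hi ▸ hn n x
  · have : x = (π ^ n) y := by rw [← hi]; simp
    rw [this]
    exact r.symm (hn n y)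

/-- Finite order makes every cycle a forward orbit, so forward invariance of `P` is enough to
separate two points. -/
theorem not_sameCycle_of_invariant (hπ : IsOfFinOrder π) {P : ℤ → Prop}
    (hP : ∀ x, P x → P (π x)) {a b : ℤ} (ha : P a) (hb : ¬ P b) : ¬ π.SameCycle a b := by
  intro h
  obtain ⟨n, rfl⟩ := exists_pow_of_sameCycle hπ h
  refine hb ?_
  clear h hb
  induction n with
  | zero => simpa using ha
  | succ n ih => rw [pow_succ', Equiv.Perm.mul_apply]; exact hP _ ih

theorem eq_of_sameCycle_of_fixed {a b : ℤ} (ha : π a = a) (h : π.SameCycle a b) : a = b := by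
  obtain ⟨i, rfl⟩ := h
  exact (Function.IsFixedPt.perm_zpow ha i).symm

/-- Starting at `b`, the product follows the `σ`-cycle of `b`, which avoids `a`, until it is about
to close up; there the transposition diverts it to `a`. -/
theorem sameCycle_swap_mul (hσ : IsOfFinOrder σ) {a b : ℤ} (h : ¬ σ.SameCycle a b) :
    (Equiv.swap a b * σ).SameCycle a b := by
  classical
  have hex : ∃ m, 0 < m ∧ (σ ^ m) b = b :=
    exists_pow_pos_of_sameCycle hσ (Equiv.Perm.SameCycle.refl _ _)
  set m := Nat.find hex with hm
  obtain ⟨hm0, hmb⟩ := Nat.find_spec hex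
  have hna : ∀ i : ℕ, (σ ^ i) b ≠ a := fun i hi => h (hi ▸ (sameCycle_pow σ i b).symm)
  have key : ∀ i < m, ((Equiv.swap a b * σ) ^ i) b = (σ ^ i) b := by
    intro i
    induction i with
    | zero => intro _; rfl
    | succ i ih =>
      intro hi
      have h1 : (σ ^ (i + 1)) b ≠ b := fun hb => Nat.find_min hex hi ⟨i.succ_pos, hb⟩
      have h2 := hna (i + 1)
      rw [pow_succ', Equiv.Perm.mul_apply, ih (by omega), Equiv.Perm.mul_apply]
      rw [pow_succ', Equiv.Perm.mul_apply] at h1 h2 ⊢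
      exact Equiv.swap_apply_of_ne_of_ne h2 h1
  obtain ⟨k, hk⟩ : ∃ k, m = k + 1 := ⟨m - 1, by omega⟩
  have : ((Equiv.swap a b * σ) ^ m) b = a := by
    rw [hk, pow_succ', Equiv.Perm.mul_apply, key k (by omega), Equiv.Perm.mul_apply,
      ← Equiv.Perm.mul_apply σ, ← pow_succ', ← hk, hmb, Equiv.swap_apply_right]
  have h3 := sameCycle_pow (Equiv.swap a b * σ) m b
  rw [this] at h3
  exact h3.symm

/-- The arc of `σ` from `a` up to the point before `b` is invariant under the product: the step into
`b` is diverted back to `a`. The point `b` is not on this arc. -/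
theorem not_sameCycle_swap_mul (hσ : σ ∈ permsOn S) {a b : ℤ} (ha : a ∈ S) (hb : b ∈ S)
    (hab : a ≠ b) (h : σ.SameCycle a b) : ¬ (Equiv.swap a b * σ).SameCycle a b := by
  classical
  have hex : ∃ m, 0 < m ∧ (σ ^ m) a = b :=
    exists_pow_pos_of_sameCycle (isOfFinOrder_of_mem_permsOn hσ) h
  set m := Nat.find hex with hm
  obtain ⟨hm0, hmb⟩ := Nat.find_spec hex
  have hmin : ∀ i, 0 < i → i < m → (σ ^ i) a ≠ b := fun i h0 hi hb =>
    Nat.find_min hex hi ⟨h0, hb⟩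
  have hna : ∀ i, 0 < i → i < m → (σ ^ i) a ≠ a := by
    intro i h0 hi hia
    refine hmin (m - i) (by omega) (by omega) ?_
    have : (σ ^ (m - i)) ((σ ^ i) a) = b := by
      rw [← Equiv.Perm.mul_apply, ← pow_add, Nat.sub_add_cancel hi.le, hmb]
    rwa [hia] at this
  refine not_sameCycle_of_invariant
    (isOfFinOrder_of_mem_permsOn (mul_mem_permsOn (swap_mem_permsOn ha hb) hσ))
    (P := fun x => ∃ j < m, (σ ^ j) a = x) ?_ ⟨0, hm0, rfl⟩ ?_
  · rintro x ⟨j, hj, rfl⟩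
    rw [Equiv.Perm.mul_apply, ← Equiv.Perm.mul_apply σ, ← pow_succ']
    by_cases h' : j + 1 < m
    · exact ⟨j + 1, h', (Equiv.swap_apply_of_ne_of_ne (hna _ j.succ_pos h')
        (hmin _ j.succ_pos h')).symm⟩
    · refine ⟨0, hm0, ?_⟩
      rw [show j + 1 = m by omega, hmb, Equiv.swap_apply_right]
      rfl
  · rintro ⟨j, hj, hjb⟩
    rcases Nat.eq_zero_or_pos j with rfl | h0
    · exact hab hjb
    · exact hmin j h0 hj hjb

theorem cyc_swap_mul (hσ : IsOfFinOrder σ) {a b : ℤ} (h : ¬ σ.SameCycle a b) :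
    cyc (Equiv.swap a b * σ) = glue (cyc σ) a b := by
  have h0 := sameCycle_swap_mul hσ h
  apply le_antisymm
  · apply cyc_le
    intro x
    have hx : glue (cyc σ) a b x (σ x) := le_glue _ _ _ (sameCycle_apply_self σ x)
    refine (glue (cyc σ) a b).trans hx ?_
    rw [Equiv.Perm.mul_apply]
    by_cases h1 : σ x = a
    · rw [h1, Equiv.swap_apply_left]; exact glue_rel _ _ _
    by_cases h2 : σ x = b
    · rw [h2, Equiv.swap_apply_right]; exact (glue _ _ _).symm (glue_rel _ _ _)
    rw [Equiv.swap_apply_of_ne_of_ne h1 h2]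
  · refine glue_le (cyc_le fun x => ?_) h0
    have hx := sameCycle_apply_self (Equiv.swap a b * σ) x
    rw [Equiv.Perm.mul_apply] at hx
    change (Equiv.swap a b * σ).SameCycle x (σ x)
    by_cases h1 : σ x = a
    · rw [h1, Equiv.swap_apply_left] at hx
      rw [h1]
      exact hx.trans h0.symm
    by_cases h2 : σ x = b
    · rw [h2, Equiv.swap_apply_right] at hx
      rw [h2]
      exact hx.trans h0
    rwa [Equiv.swap_apply_of_ne_of_ne h1 h2] at hx

theorem nclass_swap_mul_of_not (hσ : σ ∈ permsOn S) {a b : ℤ} (ha : a ∈ S) (hb : b ∈ S)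
    (h : ¬ σ.SameCycle a b) :
    nclass S (cyc (Equiv.swap a b * σ)) + 1 = nclass S (cyc σ) := by
  rw [cyc_swap_mul (isOfFinOrder_of_mem_permsOn hσ) h]
  exact nclass_glue ha hb h

/-- Multiplying twice by the transposition gives back `σ`, so splitting a cycle is merging read
backwards. -/
theorem nclass_swap_mul_of_sameCycle (hσ : σ ∈ permsOn S) {a b : ℤ} (ha : a ∈ S) (hb : b ∈ S)
    (hab : a ≠ b) (h : σ.SameCycle a b) :
    nclass S (cyc (Equiv.swap a b * σ)) = nclass S (cyc σ) + 1 := by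
  rw [← nclass_swap_mul_of_not (mul_mem_permsOn (swap_mem_permsOn ha hb) hσ) ha hb
    (not_sameCycle_swap_mul hσ ha hb hab h), Equiv.swap_mul_self_mul]

theorem nclass_equiv (e : Equiv.Perm ℤ) {T : Finset ℤ} {r r' : Setoid ℤ}
    (hT : ∀ x, e x ∈ T ↔ x ∈ S) (h : ∀ x ∈ S, ∀ y ∈ S, (r x y ↔ r' (e x) (e y))) :
    nclass S r = nclass T r' := by
  classical
  have hTS : T = S.image e := by
    ext y
    rw [Finset.mem_image]
    exact ⟨fun hy => ⟨e.symm y, (hT _).1 (by simpa using hy), by simp⟩,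
      fun ⟨x, hx, hxy⟩ => hxy ▸ (hT x).2 hx⟩
  subst hTS
  unfold nclass
  rw [Finset.image_image]
  have hm : ∀ x ∈ S, e x ∈ S.image e := fun x hx => Finset.mem_image_of_mem _ hx
  apply le_antisymm <;> apply card_image_le_of_ker <;> intro x hx y hy hxy
  · exact (filter_class_eq_iff hy).2 ((h x hx y hy).2 ((filter_class_eq_iff (hm y hy)).1 hxy))
  · exact (filter_class_eq_iff (hm y hy)).2 ((h x hx y hy).1 ((filter_class_eq_iff hy).1 hxy))

theorem nclass_cyc_inv (π : Equiv.Perm ℤ) : nclass S (cyc π⁻¹) = nclass S (cyc π) :=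
  nclass_congr fun _ _ _ _ => by simp [cyc_iff, Equiv.Perm.sameCycle_inv]

theorem nclass_cyc_conj (g : Equiv.Perm ℤ) (hg : ∀ x, g x ∈ S ↔ x ∈ S) (π : Equiv.Perm ℤ) :
    nclass S (cyc (g * π * g⁻¹)) = nclass S (cyc π) :=
  (nclass_equiv g hg fun x _ y _ => by
    simp [cyc_iff, Equiv.Perm.sameCycle_conj]).symm

theorem apply_mem_iff_of_mem_permsOn (h : π ∈ permsOn S) (x : ℤ) : π x ∈ S ↔ x ∈ S := by
  refine ⟨fun hx => ?_, apply_mem_of_mem_permsOn h⟩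
  have := apply_mem_of_mem_permsOn (inv_mem_permsOn h) hx
  simpa using this

theorem nclass_cyc_mul_comm (h : π ∈ permsOn S) (σ : Equiv.Perm ℤ) :
    nclass S (cyc (π * σ)) = nclass S (cyc (σ * π)) := by
  rw [← nclass_cyc_conj π (apply_mem_iff_of_mem_permsOn h) (σ * π)]
  congr 2
  group

theorem nclass_cyc_one : nclass S (cyc 1) = S.card :=
  nclass_eq_card fun _ _ _ _ h => eq_of_sameCycle_of_fixed rfl h

end Perms

/-! ### The genus defect of a pair of permutations -/

section Defect

variable {S : Finset ℤ} {γ π : Equiv.Perm ℤ}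

/-- The relation of lying on the same orbit of the group generated by `γ` and `π`. -/
def join (γ π : Equiv.Perm ℤ) : Setoid ℤ := cyc γ ⊔ cyc π

theorem join_comm (γ π : Equiv.Perm ℤ) : join γ π = join π γ := sup_comm _ _

theorem cyc_le_join_left (γ π : Equiv.Perm ℤ) : cyc γ ≤ join γ π := le_sup_left

theorem cyc_le_join_right (γ π : Equiv.Perm ℤ) : cyc π ≤ join γ π := le_sup_right

theorem join_le {r : Setoid ℤ} (h : ∀ x, r x (γ x)) (h' : ∀ x, r x (π x)) : join γ π ≤ r :=
  sup_le (cyc_le h) (cyc_le h')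

theorem join_left (γ π : Equiv.Perm ℤ) (x : ℤ) : join γ π x (γ x) :=
  cyc_le_join_left γ π (sameCycle_apply_self γ x)

theorem join_right (γ π : Equiv.Perm ℤ) (x : ℤ) : join γ π x (π x) :=
  cyc_le_join_right γ π (sameCycle_apply_self π x)

theorem join_swap_mul (hπ : IsOfFinOrder π) {a b : ℤ} (h : ¬ π.SameCycle a b) :
    join γ (Equiv.swap a b * π) = glue (join γ π) a b := by
  unfold join
  rw [cyc_swap_mul hπ h]
  apply le_antisymm
  · refine sup_le (le_sup_left.trans (le_glue _ _ _)) (glue_le (le_sup_right.trans (le_glue _ _ _))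
      (glue_rel _ _ _))
  · exact glue_le (sup_le_sup_left (le_glue _ _ _) _)
      ((le_sup_right : glue (cyc π) a b ≤ _) (glue_rel _ _ _))

/-- Twice the number of orbits of `⟨γ, π⟩` minus the Euler characteristic
`#(γ) + #(π) + #(γ⁻¹ π⁻¹) - |S|`. -/
noncomputable def defect (S : Finset ℤ) (γ π : Equiv.Perm ℤ) : ℤ :=
  2 * nclass S (join γ π) + S.card - nclass S (cyc γ) - nclass S (cyc π) - nclass S (cyc (π * γ))

theorem defect_comm (hγ : γ ∈ permsOn S) : defect S γ π = defect S π γ := by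
  unfold defect
  rw [join_comm, nclass_cyc_mul_comm hγ]
  ring

theorem defect_one (γ : Equiv.Perm ℤ) : defect S γ 1 = 0 := by
  unfold defect
  have : join γ 1 = cyc γ := by
    refine le_antisymm (sup_le le_rfl (cyc_le fun x => ?_)) le_sup_left
    exact (cyc γ).refl x
  rw [this, nclass_cyc_one, one_mul]
  ring

/-- The transposition merges two cycles of `π` and splits one of `π * γ`. The orbits stay the same,
since a cycle of `π * γ` is contained in one orbit. -/
theorem defect_swap_mul_of_sameCycle (hγ : γ ∈ permsOn S) (hπ : π ∈ permsOn S) {a b : ℤ}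
    (ha : a ∈ S) (hb : b ∈ S) (h : ¬ π.SameCycle a b) (h' : (π * γ).SameCycle a b) :
    defect S γ (Equiv.swap a b * π) = defect S γ π := by
  have hab : a ≠ b := fun e => h (e ▸ Equiv.Perm.SameCycle.refl _ _)
  unfold defect
  have hj : join γ π a b := by
    have : cyc (π * γ) ≤ join γ π := cyc_le fun x =>
      (join γ π).trans (join_left γ π x) (join_right γ π (γ x))
    exact this h'
  rw [join_swap_mul (isOfFinOrder_of_mem_permsOn hπ) h, glue_eq_self hj, mul_assoc,
    nclass_swap_mul_of_sameCycle (mul_mem_permsOn hπ hγ) ha hb hab h',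
    ← nclass_swap_mul_of_not hπ ha hb h]
  push_cast
  ring

/-- Two orbits become one, which lowers the defect by 2; `π` and `π * γ` lose one cycle each, which
restores it. -/
theorem defect_swap_mul_of_not_join (hγ : γ ∈ permsOn S) (hπ : π ∈ permsOn S) {a b : ℤ}
    (ha : a ∈ S) (hb : b ∈ S) (h : ¬ join γ π a b) :
    defect S γ (Equiv.swap a b * π) = defect S γ π := by
  have h1 : ¬ π.SameCycle a b := fun h' => h (cyc_le_join_right γ π h')
  have h2 : ¬ (π * γ).SameCycle a b := by
    have : cyc (π * γ) ≤ join γ π := cyc_le fun x =>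
      (join γ π).trans (join_left γ π x) (join_right γ π (γ x))
    exact fun h' => h (this h')
  unfold defect
  rw [join_swap_mul (isOfFinOrder_of_mem_permsOn hπ) h1, mul_assoc,
    ← nclass_swap_mul_of_not (mul_mem_permsOn hπ hγ) ha hb h2,
    ← nclass_swap_mul_of_not hπ ha hb h1, ← nclass_glue ha hb h]
  push_cast
  ring

/-- Both `π` and `π * γ` lose a cycle while the orbits stay the same: a handle is attached. All
positivity results for forbidden patterns come from this case. -/
theorem defect_swap_mul_of_join (hγ : γ ∈ permsOn S) (hπ : π ∈ permsOn S) {a b : ℤ}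
    (ha : a ∈ S) (hb : b ∈ S) (h : ¬ π.SameCycle a b) (h' : ¬ (π * γ).SameCycle a b)
    (hj : join γ π a b) :
    defect S γ (Equiv.swap a b * π) = defect S γ π + 2 := by
  unfold defect
  rw [join_swap_mul (isOfFinOrder_of_mem_permsOn hπ) h, glue_eq_self hj, mul_assoc,
    ← nclass_swap_mul_of_not (mul_mem_permsOn hπ hγ) ha hb h',
    ← nclass_swap_mul_of_not hπ ha hb h]
  push_cast
  ring

theorem defect_le_swap_mul (hγ : γ ∈ permsOn S) (hπ : π ∈ permsOn S) {a b : ℤ}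
    (ha : a ∈ S) (hb : b ∈ S) (h : ¬ π.SameCycle a b) :
    defect S γ π ≤ defect S γ (Equiv.swap a b * π) := by
  by_cases h1 : (π * γ).SameCycle a b
  · exact (defect_swap_mul_of_sameCycle hγ hπ ha hb h h1).ge
  by_cases h2 : join γ π a b
  · rw [defect_swap_mul_of_join hγ hπ ha hb h h1 h2]; omega
  · exact (defect_swap_mul_of_not_join hγ hπ ha hb h2).ge

/-- The permutation obtained from `π` by making `k` a fixed point. -/
def del (k : ℤ) (π : Equiv.Perm ℤ) : Equiv.Perm ℤ := Equiv.swap k (π k) * π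

theorem del_apply_self (k : ℤ) (π : Equiv.Perm ℤ) : del k π k = k := by
  simp [del]

theorem swap_mul_del (k : ℤ) (π : Equiv.Perm ℤ) : Equiv.swap k (π k) * del k π = π := by
  simp [del]

theorem del_eq_self {k : ℤ} (h : π k = k) : del k π = π := by
  unfold del
  rw [h, Equiv.swap_self]
  rfl

theorem del_apply_of_ne {k x : ℤ} (hx : x ≠ k) (h : π x ≠ k) : del k π x = π x := by
  unfold del
  rw [Equiv.Perm.mul_apply, Equiv.swap_apply_of_ne_of_ne h (fun h' => hx (π.injective h'))]

theorem del_apply_of_eq {k x : ℤ} (h : π x = k) : del k π x = π k := by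
  unfold del
  rw [Equiv.Perm.mul_apply, h, Equiv.swap_apply_left]

theorem del_mem_permsOn_erase {k : ℤ} (hπ : π ∈ permsOn S) : del k π ∈ permsOn (S.erase k) := by
  rw [mem_permsOn] at *
  intro x hx
  by_cases hxk : x = k
  · rw [hxk, del_apply_self]
  · have hxS : x ∉ S := fun h => hx (Finset.mem_erase.2 ⟨hxk, h⟩)
    rw [del_apply_of_ne hxk (by rwa [hπ x hxS]), hπ x hxS]

theorem del_mem_permsOn {k : ℤ} (hπ : π ∈ permsOn S) : del k π ∈ permsOn S :=
  permsOn_mono (Finset.erase_subset _ _) (del_mem_permsOn_erase hπ)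

/-- `π` arises from `del k π` by a transposition that merges the fixed point `k` into another cycle,
and merging cycles of `π` never lowers the defect. -/
theorem defect_del_le (hγ : γ ∈ permsOn S) (hπ : π ∈ permsOn S) (k : ℤ) :
    defect S γ (del k π) ≤ defect S γ π := by
  by_cases h : π k = k
  · rw [del_eq_self h]
  have hk : k ∈ S := by
    by_contra hk
    exact h (mem_permsOn.1 hπ k hk)
  conv_rhs => rw [← swap_mul_del k π]
  refine defect_le_swap_mul hγ (del_mem_permsOn hπ) hk (apply_mem_of_mem_permsOn hπ hk) ?_
  exact fun h' => h (eq_of_sameCycle_of_fixed (del_apply_self k π) h').symm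

/-- Deleting all points one by one does not increase the defect and ends at `π = 1`, where it
vanishes. -/
theorem defect_nonneg (hγ : γ ∈ permsOn S) (hπ : π ∈ permsOn S) : 0 ≤ defect S γ π := by
  suffices h : ∀ T : Finset ℤ, T ⊆ S → ∀ π ∈ permsOn T, 0 ≤ defect S γ π from
    h S subset_rfl π hπ
  intro T
  induction T using Finset.induction_on with
  | empty =>
    intro _ π hπ
    have : π = 1 := Equiv.ext fun x => mem_permsOn.1 hπ x (by simp)
    rw [this, defect_one]
  | insert k T hk ih =>
    intro hT π hπ
    refine (ih ((Finset.subset_insert _ _).trans hT) (del k π) ?_).trans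
      (defect_del_le hγ (permsOn_mono hT hπ) k)
    have := del_mem_permsOn_erase (k := k) hπ
    rwa [Finset.erase_insert hk] at this

/-- Deleting a fixed point of `π` does not change the defect. -/
theorem defect_del_of_fixed (hγ : γ ∈ permsOn S) (hπ : π ∈ permsOn S) {k : ℤ} (hk : π k = k) :
    defect S (del k γ) π = defect S γ π := by
  by_cases h : γ k = k
  · rw [del_eq_self h]
  have hkS : k ∈ S := by
    by_contra hk
    exact h (mem_permsOn.1 hγ k hk)
  rw [defect_comm (del_mem_permsOn hγ), defect_comm hγ]
  conv_rhs => rw [← swap_mul_del k γ]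
  refine (defect_swap_mul_of_not_join hπ (del_mem_permsOn hγ) hkS
    (apply_mem_of_mem_permsOn hγ hkS) ?_).symm
  intro h'
  -- Both `π` and `del k γ` fix `k`, so `k` is an orbit by itself and is not joined to `γ k`.
  -- Reattaching `k` to `γ` therefore merges two orbits.
  have hle : join π (del k γ) ≤ Setoid.ker (fun x : ℤ => x = k) := by
    refine join_le ?_ ?_ <;> intro x
    · change (x = k) = (π x = k)
      rw [eq_iff_iff]
      exact ⟨fun h => h ▸ hk, fun h => π.injective (h.trans hk.symm)⟩
    · change (x = k) = (del k γ x = k)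
      rw [eq_iff_iff]
      exact ⟨fun h => h ▸ del_apply_self k γ,
        fun h => (del k γ).injective (h.trans (del_apply_self k γ).symm)⟩
  have h2 : (k = k) = (γ k = k) := hle h'
  exact h (h2 ▸ rfl)

/-- Deleting `k` with `π (γ k) = k` does not change the defect. -/
theorem defect_del_del_of_fixed (hγ : γ ∈ permsOn S) (hπ : π ∈ permsOn S) {k : ℤ}
    (hk : π (γ k) = k) (hγk : γ k ≠ k) : defect S (del k γ) (del k π) = defect S γ π := by
  have hπk : π k ≠ k := fun h => hγk (π.injective (hk.trans h.symm))
  have hkS : k ∈ S := by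
    by_contra h
    exact hπk (mem_permsOn.1 hπ k h)
  rw [defect_del_of_fixed hγ (del_mem_permsOn hπ) (del_apply_self k π)]
  conv_rhs => rw [← swap_mul_del k π]
  refine (defect_swap_mul_of_sameCycle hγ (del_mem_permsOn hπ) hkS
    (apply_mem_of_mem_permsOn hπ hkS) ?_ ?_).symm
  · exact fun h' => hπk (eq_of_sameCycle_of_fixed (del_apply_self k π) h').symm
  -- Since `π (γ k) = k`, the product `del k π * γ` sends `k` to `π k`.
  · have := sameCycle_apply_self (del k π * γ) k
    rwa [Equiv.Perm.mul_apply, del_apply_of_eq hk] at this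

theorem cyc_mul_swap (hγ : IsOfFinOrder γ) {x y : ℤ} (h : ¬ γ.SameCycle x y) :
    cyc (γ * Equiv.swap x y) = glue (cyc γ) x y := by
  have h1 : ¬ γ.SameCycle (γ x) (γ y) := by
    rwa [Equiv.Perm.sameCycle_apply_left, Equiv.Perm.sameCycle_apply_right]
  rw [show γ * Equiv.swap x y = Equiv.swap (γ x) (γ y) * γ from Equiv.mul_swap_eq_swap_mul _ _ _,
    cyc_swap_mul hγ h1]
  apply le_antisymm
  · refine glue_le (le_glue _ _ _) (Or.inr (Or.inl ⟨?_, ?_⟩))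
    · exact (sameCycle_apply_self γ x).symm
    · exact sameCycle_apply_self γ y
  · refine glue_le (le_glue _ _ _) (Or.inr (Or.inl ⟨?_, ?_⟩))
    · exact sameCycle_apply_self γ x
    · exact (sameCycle_apply_self γ y).symm

/-- A two-cycle of `π` connecting two cycles of `γ` can be used to cut along it. -/
theorem defect_mul_swap (hγ : γ ∈ permsOn S) (hπ : π ∈ permsOn S) {x y : ℤ} (hx : x ∈ S)
    (hy : y ∈ S) (hπx : π x = x) (hπy : π y = y) (h : ¬ γ.SameCycle x y) :
    defect S γ (π * Equiv.swap x y) = defect S (cut γ x y) π := by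
  have hxy : x ≠ y := fun e => h (e ▸ Equiv.Perm.SameCycle.refl _ _)
  have hc : π * Equiv.swap x y = Equiv.swap x y * π := by
    rw [Equiv.mul_swap_eq_swap_mul, hπx, hπy]
  have h1 : ¬ π.SameCycle x y := fun h' => hxy (eq_of_sameCycle_of_fixed hπx h')
  have hs := swap_mem_permsOn hx hy
  have hfγ := isOfFinOrder_of_mem_permsOn hγ
  have hfπ := isOfFinOrder_of_mem_permsOn hπ
  unfold defect cut
  -- The cycles of the product and the orbits are equally many on the two sides (`e1`, `e2`). On the
  -- left `π` loses a cycle, on the right `γ` does (`e3`, `e4`).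
  have e1 : nclass S (cyc (π * Equiv.swap x y * γ)) = nclass S (cyc (π * (γ * Equiv.swap x y))) := by
    rw [hc, mul_assoc, nclass_cyc_mul_comm hs, mul_assoc]
  have e2 : join γ (π * Equiv.swap x y) = join (γ * Equiv.swap x y) π := by
    rw [hc, join_swap_mul hfπ h1, join_comm (γ * _), join, join,
      cyc_mul_swap hfγ h]
    apply le_antisymm
    · exact glue_le (sup_le ((le_glue _ _ _).trans le_sup_right) le_sup_left)
        ((le_sup_right : glue (cyc γ) x y ≤ _) (glue_rel _ _ _))
    · exact sup_le ((cyc_le_join_right _ _).trans (le_glue _ _ _))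
        (glue_le ((cyc_le_join_left _ _).trans (le_glue _ _ _)) (glue_rel _ _ _))
  have e3 := nclass_swap_mul_of_not hπ hx hy h1
  rw [← hc] at e3
  have e4 : nclass S (cyc (γ * Equiv.swap x y)) + 1 = nclass S (cyc γ) := by
    rw [cyc_mul_swap hfγ h, nclass_glue hx hy h]
  rw [e1, e2, ← e3, ← e4]
  push_cast
  ring

end Defect

/-! ### Induced permutations and first return paths -/

section Induced

variable {σ : Equiv.Perm ℤ} {J : Finset ℤ}

/-- `b` is reached from `x` by iterating `σ`, without meeting `J` in between. -/
def Reach (σ : Equiv.Perm ℤ) (J : Finset ℤ) (x b : ℤ) : Prop :=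
  ∃ n : ℕ, 0 < n ∧ (σ ^ n) x = b ∧ ∀ i, 0 < i → i < n → (σ ^ i) x ∉ J

theorem pow_succ_apply (σ : Equiv.Perm ℤ) (n : ℕ) (x : ℤ) : (σ ^ (n + 1)) x = (σ ^ n) (σ x) := by
  rw [pow_succ, Equiv.Perm.mul_apply]

theorem pow_succ_apply' (σ : Equiv.Perm ℤ) (n : ℕ) (x : ℤ) : (σ ^ (n + 1)) x = σ ((σ ^ n) x) := by
  rw [pow_succ', Equiv.Perm.mul_apply]

theorem pow_add_apply (σ : Equiv.Perm ℤ) (m n : ℕ) (x : ℤ) :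
    (σ ^ (m + n)) x = (σ ^ m) ((σ ^ n) x) := by
  rw [pow_add, Equiv.Perm.mul_apply]

theorem Reach.single (σ : Equiv.Perm ℤ) (J : Finset ℤ) (x : ℤ) : Reach σ J x (σ x) :=
  ⟨1, one_pos, by simp, fun i h h' => by omega⟩

theorem Reach.trans {x b c : ℤ} (h : Reach σ J x b) (hb : b ∉ J) (h' : Reach σ J b c) :
    Reach σ J x c := by
  obtain ⟨n, hn, rfl, h1⟩ := h
  obtain ⟨m, hm, rfl, h2⟩ := h'
  refine ⟨m + n, by omega, pow_add_apply _ _ _ _, fun i hi hi' => ?_⟩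
  rcases lt_trichotomy i n with h | rfl | h
  · exact h1 i hi h
  · exact hb
  · have := h2 (i - n) (by omega) (by omega)
    rwa [← pow_add_apply, Nat.sub_add_cancel h.le] at this

theorem Reach.mono {K : Finset ℤ} {x b : ℤ} (h : Reach σ J x b) (hK : K ⊆ J) : Reach σ K x b := by
  obtain ⟨n, hn, hb, h1⟩ := h
  exact ⟨n, hn, hb, fun i hi hi' h' => h1 i hi hi' (hK h')⟩

theorem induced_eq_of_reach {x b : ℤ} (h : Reach σ J x b) (hb : b ∈ J) : induced σ J x = b := by
  obtain ⟨n, hn, rfl, h1⟩ := h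
  have : sInf {m : ℕ | 0 < m ∧ (σ ^ m) x ∈ J} = n := by
    apply le_antisymm
    · exact Nat.sInf_le ⟨hn, hb⟩
    · refine le_csInf ⟨n, hn, hb⟩ ?_
      rintro i ⟨hi, hi'⟩
      by_contra hlt
      exact h1 i hi (not_le.1 hlt) hi'
  unfold induced
  rw [this]

theorem reach_induced (hσ : IsOfFinOrder σ) {x : ℤ} (hx : x ∈ J) :
    Reach σ J x (induced σ J x) ∧ induced σ J x ∈ J := by
  obtain ⟨n, hn, hnx⟩ := exists_pow_pos_of_sameCycle hσ (Equiv.Perm.SameCycle.refl σ x)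
  have hne : {m : ℕ | 0 < m ∧ (σ ^ m) x ∈ J}.Nonempty := ⟨n, hn, by rwa [hnx]⟩
  have h := Nat.sInf_mem hne
  exact ⟨⟨_, h.1, rfl, fun i hi hi' hi'' => Nat.notMem_of_lt_sInf hi' ⟨hi, hi''⟩⟩, h.2⟩

/-- Deletion of `k` only shortcuts the passages of the path through `k`, and `k` is not a point of
`J`. -/
theorem reach_del {k x b : ℤ} (hk : k ∉ J) (hx : x ≠ k) (hb : b ∈ J) (h : Reach σ J x b) :
    Reach (del k σ) J x b := by
  obtain ⟨n, hn, hb', h1⟩ := h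
  induction n using Nat.strong_induction_on generalizing x with
  | _ n ih =>
    have hbk : b ≠ k := fun h => hk (h ▸ hb)
    obtain ⟨n, rfl⟩ : ∃ m, n = m + 1 := ⟨n - 1, by omega⟩
    rcases Nat.eq_zero_or_pos n with rfl | hn0
    · rw [zero_add, pow_one] at hb'
      have := Reach.single (del k σ) J x
      rwa [del_apply_of_ne hx (by rwa [hb']), hb'] at this
    have hσx : σ x ∉ J := by simpa using h1 1 one_pos (by omega)
    by_cases hxk : σ x = k
    · obtain ⟨n, rfl⟩ : ∃ m, n = m + 1 := ⟨n - 1, by omega⟩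
      have hs := Reach.single (del k σ) J x
      rw [del_apply_of_eq hxk] at hs
      have hkk : σ k ≠ k := fun h => hx (σ.injective (hxk.trans h.symm))
      rw [pow_succ_apply, hxk, pow_succ_apply] at hb'
      rcases Nat.eq_zero_or_pos n with rfl | hn1
      · rw [pow_zero, Equiv.Perm.one_apply] at hb'
        rwa [hb'] at hs
      · have hσk : σ k ∉ J := by
          have := h1 2 two_pos (by omega)
          rwa [pow_succ_apply, hxk, pow_one] at this
        refine hs.trans hσk (ih n (by omega) hkk hn1 hb' fun i hi hi' => ?_)
        have := h1 (i + 2) (by omega) (by omega)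
        rwa [pow_succ_apply, hxk, pow_succ_apply] at this
    · have hs := Reach.single (del k σ) J x
      rw [del_apply_of_ne hx hxk] at hs
      refine hs.trans hσx (ih n (by omega) hxk hn0 (by rwa [← pow_succ_apply]) fun i hi hi' => ?_)
      rw [← pow_succ_apply]
      exact h1 _ (by omega) (by omega)

theorem induced_del (hσ : IsOfFinOrder σ) {k x : ℤ} (hk : k ∉ J) (hx : x ∈ J) :
    induced (del k σ) J x = induced σ J x :=
  have h := reach_induced hσ hx
  induced_eq_of_reach (reach_del hk (fun e => hk (e ▸ hx)) h.2 h.1) h.2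

theorem induced_eq_apply {x : ℤ} (h : σ x ∈ J) : induced σ J x = σ x :=
  induced_eq_of_reach (Reach.single σ J x) h

end Induced

/-! ### Forbidden patterns have positive defect -/

section Patterns

variable {S : Finset ℤ} {γ π : Equiv.Perm ℤ}

/-- The points outside `J` are deleted one after another. Each deletion preserves the induced map on
`J` and does not increase the defect. The bound is uniform in `γ`, so that `γ` and `π` can be
restricted in turn. -/
theorem exists_restrict (hπ : π ∈ permsOn S) {J : Finset ℤ} (hJ : J ⊆ S) :
    ∃ π' ∈ permsOn J, (∀ k ∈ J, π' k = induced π J k) ∧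
      ∀ γ ∈ permsOn S, defect S γ π' ≤ defect S γ π := by
  suffices h : ∀ T : Finset ℤ, T ⊆ S → Disjoint T J → ∀ π ∈ permsOn (J ∪ T),
      ∃ π' ∈ permsOn J, (∀ k ∈ J, π' k = induced π J k) ∧
        ∀ γ ∈ permsOn S, defect S γ π' ≤ defect S γ π by
    refine h (S \ J) Finset.sdiff_subset Finset.sdiff_disjoint π ?_
    rwa [Finset.union_sdiff_of_subset hJ]
  intro T
  induction T using Finset.induction_on with
  | empty =>
    intro _ _ π hπ
    rw [Finset.union_empty] at hπ
    exact ⟨π, hπ, fun k hk => (induced_eq_apply (apply_mem_of_mem_permsOn hπ hk)).symm,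
      fun _ _ => le_rfl⟩
  | insert k T hk ih =>
    intro hT hd π hπ
    rw [Finset.disjoint_insert_left] at hd
    have hJT : J ∪ insert k T ⊆ S := Finset.union_subset hJ hT
    obtain ⟨π', h1, h2, h3⟩ := ih ((Finset.subset_insert _ _).trans hT) hd.2 (del k π) (by
      have := del_mem_permsOn_erase (k := k) hπ
      rwa [Finset.union_insert, Finset.erase_insert] at this
      simp [hd.1, hk])
    refine ⟨π', h1, fun x hx => ?_, fun γ hγ => (h3 γ hγ).trans
      (defect_del_le hγ (permsOn_mono hJT hπ) k)⟩
    rw [h2 x hx, induced_del (isOfFinOrder_of_mem_permsOn hπ) hd.1 hx]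

theorem exists_restrict_both (hγ : γ ∈ permsOn S) (hπ : π ∈ permsOn S) {J : Finset ℤ}
    (hJ : J ⊆ S) :
    ∃ γ' ∈ permsOn J, ∃ π' ∈ permsOn J, (∀ k ∈ J, γ' k = induced γ J k) ∧
      (∀ k ∈ J, π' k = induced π J k) ∧ defect S γ' π' ≤ defect S γ π := by
  obtain ⟨γ', h1, h2, h3⟩ := exists_restrict hγ hJ
  obtain ⟨π', h1', h2', h3'⟩ := exists_restrict hπ hJ
  refine ⟨γ', h1, π', h1', h2, h2', (h3' γ' (permsOn_mono hJ h1)).trans ?_⟩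
  rw [defect_comm (permsOn_mono hJ h1), defect_comm hγ]
  exact h3 π hπ

/-- After restriction to `{a, b, c}` both permutations are the same three-cycle, and `π' = (a b)(b
c)`. The factor `(a b)` attaches a handle: `(b c)γ'` fixes `b`, and `γ'` joins `a` to `b`. -/
theorem defect_pos_of_induces3 (hγ : γ ∈ permsOn S) (hπ : π ∈ permsOn S) {a b c : ℤ}
    (ha : a ∈ S) (hb : b ∈ S) (hc : c ∈ S) (hd : [a, b, c].Nodup) (h : Induces3 γ a b c)
    (h' : Induces3 π a b c) : 0 < defect S γ π := by
  have hJ : ({a, b, c} : Finset ℤ) ⊆ S := by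
    intro x hx
    simp only [Finset.mem_insert, Finset.mem_singleton] at hx
    rcases hx with rfl | rfl | rfl <;> assumption
  obtain ⟨γ', h1, π', h2, h3, h4, h5⟩ := exists_restrict_both hγ hπ hJ
  refine lt_of_lt_of_le ?_ h5
  obtain ⟨e1, e2, e3⟩ := h
  obtain ⟨f1, f2, f3⟩ := h'
  rw [← h3 _ (by simp)] at e1 e2 e3
  rw [← h4 _ (by simp)] at f1 f2 f3
  simp only [List.nodup_cons, List.mem_cons, List.not_mem_nil, or_false, not_or,
    not_false_eq_true, List.nodup_nil, and_true] at hd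
  obtain ⟨⟨hab, hac⟩, hbc⟩ := hd
  have hp : π' = Equiv.swap a b * Equiv.swap b c := by
    ext x
    rw [Equiv.Perm.mul_apply]
    by_cases hx : x ∈ ({a, b, c} : Finset ℤ)
    · simp only [Finset.mem_insert, Finset.mem_singleton] at hx
      rcases hx with rfl | rfl | rfl
      · rw [f1, Equiv.swap_apply_of_ne_of_ne hab hac, Equiv.swap_apply_left]
      · rw [f2, Equiv.swap_apply_left, Equiv.swap_apply_of_ne_of_ne (Ne.symm hac) (Ne.symm hbc)]
      · rw [f3, Equiv.swap_apply_right, Equiv.swap_apply_right]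
    · rw [mem_permsOn.1 h2 x hx]
      simp only [Finset.mem_insert, Finset.mem_singleton, not_or] at hx
      rw [Equiv.swap_apply_of_ne_of_ne hx.2.1 hx.2.2, Equiv.swap_apply_of_ne_of_ne hx.1 hx.2.1]
  have hγ' := permsOn_mono hJ h1
  have hs := swap_mem_permsOn hb hc
  rw [hp, defect_swap_mul_of_join hγ' hs ha hb]
  · have := defect_nonneg hγ' hs
    omega
  · exact fun h => hab (eq_of_sameCycle_of_fixed (Equiv.swap_apply_of_ne_of_ne hab hac) h)
  · refine fun h => hab (eq_of_sameCycle_of_fixed ?_ h.symm).symm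
    rw [Equiv.Perm.mul_apply, e2, Equiv.swap_apply_right]
  · exact e1 ▸ join_left γ' _ a

/-- After restriction `π' = (a c)(b d)`. The factor `(a c)` attaches a handle, because `{a, d}` is
invariant under `(b d)γ'` and thus `a` and `c` lie on different cycles of it. -/
theorem defect_pos_of_induces4 (hγ : γ ∈ permsOn S) (hπ : π ∈ permsOn S) {a b c d : ℤ}
    (ha : a ∈ S) (hb : b ∈ S) (hc : c ∈ S) (hd : d ∈ S) (hn : [a, b, c, d].Nodup)
    (h : Induces4 γ a b c d) (h' : Induces22 π a c b d) : 0 < defect S γ π := by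
  have hJ : ({a, b, c, d} : Finset ℤ) ⊆ S := by
    intro x hx
    simp only [Finset.mem_insert, Finset.mem_singleton] at hx
    rcases hx with rfl | rfl | rfl | rfl <;> assumption
  have hset : ({a, c, b, d} : Finset ℤ) = {a, b, c, d} := by
    ext x; simp only [Finset.mem_insert, Finset.mem_singleton]; tauto
  obtain ⟨γ', h1, π', h2, h3, h4, h5⟩ := exists_restrict_both hγ hπ hJ
  refine lt_of_lt_of_le ?_ h5
  obtain ⟨e1, e2, e3, e4⟩ := h
  obtain ⟨f1, f2, f3, f4⟩ := h'
  rw [hset] at f1 f2 f3 f4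
  rw [← h3 _ (by simp)] at e1 e2 e3 e4
  rw [← h4 _ (by simp)] at f1 f2 f3 f4
  simp only [List.nodup_cons, List.mem_cons, List.not_mem_nil, or_false, not_or,
    not_false_eq_true, List.nodup_nil, and_true] at hn
  obtain ⟨⟨hab, hac, had⟩, ⟨hbc, hbd⟩, hcd⟩ := hn
  have hp : π' = Equiv.swap a c * Equiv.swap b d := by
    ext x
    rw [Equiv.Perm.mul_apply]
    by_cases hx : x ∈ ({a, b, c, d} : Finset ℤ)
    · simp only [Finset.mem_insert, Finset.mem_singleton] at hx
      rcases hx with rfl | rfl | rfl | rfl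
      · rw [f1, Equiv.swap_apply_of_ne_of_ne hab had, Equiv.swap_apply_left]
      · rw [f3, Equiv.swap_apply_left, Equiv.swap_apply_of_ne_of_ne (Ne.symm had) (Ne.symm hcd)]
      · rw [f2, Equiv.swap_apply_of_ne_of_ne (Ne.symm hbc) hcd, Equiv.swap_apply_right]
      · rw [f4, Equiv.swap_apply_right, Equiv.swap_apply_of_ne_of_ne (Ne.symm hab) hbc]
    · rw [mem_permsOn.1 h2 x hx]
      simp only [Finset.mem_insert, Finset.mem_singleton, not_or] at hx
      rw [Equiv.swap_apply_of_ne_of_ne hx.2.1 hx.2.2.2,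
        Equiv.swap_apply_of_ne_of_ne hx.1 hx.2.2.1]
  have hγ' := permsOn_mono hJ h1
  have hs := swap_mem_permsOn hb hd
  rw [hp, defect_swap_mul_of_join hγ' hs ha hc]
  · have := defect_nonneg hγ' hs
    omega
  · exact fun h => hac (eq_of_sameCycle_of_fixed (Equiv.swap_apply_of_ne_of_ne hab had) h)
  · refine not_sameCycle_of_invariant (isOfFinOrder_of_mem_permsOn (mul_mem_permsOn hs hγ'))
      (P := fun x => x = a ∨ x = d) ?_ (Or.inl rfl) ?_
    · rintro x (rfl | rfl)
      · right; rw [Equiv.Perm.mul_apply, e1, Equiv.swap_apply_left]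
      · left; rw [Equiv.Perm.mul_apply, e4, Equiv.swap_apply_of_ne_of_ne hab had]
    · rintro (h | h)
      · exact hac h.symm
      · exact hcd h
  · exact (join γ' _).trans (e1 ▸ join_left γ' _ a) (e2 ▸ join_left γ' _ b)

/-- After restriction `π' = (a c)σ`, where `σ` is `π'` with `a` deleted. Here `σγ'` fixes `c`, while
`a` and `c` are joined through `γ' a = b` and `σ c = b`; so `(a c)` attaches a handle. -/
theorem defect_pos_of_induces22 (hγ : γ ∈ permsOn S) (hπ : π ∈ permsOn S) {a b c d : ℤ}
    (ha : a ∈ S) (hb : b ∈ S) (hc : c ∈ S) (hd : d ∈ S) (hn : [a, b, c, d].Nodup)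
    (h : Induces22 γ a b c d) (h' : Induces4 π a c b d) : 0 < defect S γ π := by
  have hJ : ({a, b, c, d} : Finset ℤ) ⊆ S := by
    intro x hx
    simp only [Finset.mem_insert, Finset.mem_singleton] at hx
    rcases hx with rfl | rfl | rfl | rfl <;> assumption
  have hset : ({a, c, b, d} : Finset ℤ) = {a, b, c, d} := by
    ext x; simp only [Finset.mem_insert, Finset.mem_singleton]; tauto
  obtain ⟨γ', h1, π', h2, h3, h4, h5⟩ := exists_restrict_both hγ hπ hJ
  refine lt_of_lt_of_le ?_ h5
  obtain ⟨e1, e2, e3, e4⟩ := h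
  obtain ⟨f1, f2, f3, f4⟩ := h'
  rw [hset] at f1 f2 f3 f4
  rw [← h3 _ (by simp)] at e1 e2 e3 e4
  rw [← h4 _ (by simp)] at f1 f2 f3 f4
  simp only [List.nodup_cons, List.mem_cons, List.not_mem_nil, or_false, not_or,
    not_false_eq_true, List.nodup_nil, and_true] at hn
  obtain ⟨⟨hab, hac, had⟩, ⟨hbc, hbd⟩, hcd⟩ := hn
  have hp := swap_mul_del a π'
  rw [f1] at hp
  set σ := del a π' with hσ
  have hπ' := permsOn_mono hJ h2
  have hσS : σ ∈ permsOn S := del_mem_permsOn hπ'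
  have hγ' := permsOn_mono hJ h1
  have s1 : σ a = a := del_apply_self _ _
  have s2 : σ c = b := by rw [hσ, del_apply_of_ne (Ne.symm hac) (by rw [f2]; exact Ne.symm hab), f2]
  have s3 : σ d = c := by rw [hσ, del_apply_of_eq f4, f1]
  rw [← hp, defect_swap_mul_of_join hγ' hσS ha hc]
  · have := defect_nonneg hγ' hσS
    omega
  · exact fun h => hac (eq_of_sameCycle_of_fixed s1 h)
  · refine fun h => hac (eq_of_sameCycle_of_fixed ?_ h.symm).symm
    rw [Equiv.Perm.mul_apply, e3, s3]
  · exact (join γ' _).trans (e1 ▸ join_left γ' _ a) ((join γ' _).symm (s2 ▸ join_right γ' _ c))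

theorem not_discNonstandard_of_defect (hγ : γ ∈ permsOn S) (hπ : π ∈ permsOn S)
    (h : defect S γ π = 0) : ¬ DiscNonstandard S γ π := by
  rintro ⟨a, ha, b, hb, c, hc, hn, h1, h2⟩
  exact (defect_pos_of_induces3 hγ hπ ha hb hc hn h1 h2).ne' h

theorem not_discCrossing_of_defect (hγ : γ ∈ permsOn S) (hπ : π ∈ permsOn S)
    (h : defect S γ π = 0) : ¬ DiscCrossing S γ π := by
  rintro ⟨a, ha, b, hb, c, hc, d, hd, hn, h1, h2⟩
  exact (defect_pos_of_induces4 hγ hπ ha hb hc hd hn h1 h2).ne' h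

theorem not_annularNonstandard_of_defect (hγ : γ ∈ permsOn S) (hπ : π ∈ permsOn S)
    (h : defect S γ π = 0) : ¬ AnnularNonstandard S γ π := by
  rintro (h0 | ⟨a, ha, b, hb, c, hc, d, hd, hn, h1, h2⟩)
  · exact not_discNonstandard_of_defect hγ hπ h h0
  · exact (defect_pos_of_induces22 hγ hπ ha hb hc hd hn h1 h2).ne' h

/-- If `π` is restricted to a set on which it has the two-cycle `(x y)`, one may cut along it. -/
theorem exists_restrict_cut (hγ : γ ∈ permsOn S) (hπ : π ∈ permsOn S) {J : Finset ℤ} (hJ : J ⊆ S)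
    {x y : ℤ} (hx : x ∈ J) (hy : y ∈ J) (hxy : induced π J x = y) (hyx : induced π J y = x)
    (h : ¬ γ.SameCycle x y) :
    ∃ π' ∈ permsOn (J \ {x, y}), (∀ k ∈ J \ {x, y}, π' k = induced π J k) ∧
      defect S (cut γ x y) π' ≤ defect S γ π := by
  obtain ⟨π', h1, h2, h3⟩ := exists_restrict hπ hJ
  have hπx : π' x = y := (h2 x hx).trans hxy
  have hπy : π' y = x := (h2 y hy).trans hyx
  have hv : (π' * Equiv.swap x y) ∈ permsOn J := mul_mem_permsOn h1 (swap_mem_permsOn hx hy)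
  have hvx : (π' * Equiv.swap x y) x = x := by simp [hπy]
  have hvy : (π' * Equiv.swap x y) y = y := by simp [hπx]
  refine ⟨π' * Equiv.swap x y, ?_, ?_, ?_⟩
  · rw [mem_permsOn]
    intro k hk
    by_cases hkJ : k ∈ J
    · have : k = x ∨ k = y := by
        by_contra hne
        push Not at hne
        exact hk (by simp [hkJ, hne])
      rcases this with rfl | rfl <;> assumption
    · exact mem_permsOn.1 hv k hkJ
  · intro k hk
    simp only [Finset.mem_sdiff, Finset.mem_insert, Finset.mem_singleton, not_or] at hk
    rw [Equiv.Perm.mul_apply, Equiv.swap_apply_of_ne_of_ne hk.2.1 hk.2.2, h2 k hk.1]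
  · rw [← defect_mul_swap hγ (permsOn_mono hJ hv) (hJ hx) (hJ hy) hvx hvy h, mul_assoc,
      Equiv.swap_mul_self, mul_one]
    exact h3 γ hγ

/-- On the points of the pattern `(x y)` is a two-cycle of `π` joining two cycles of `γ`. Cutting
along it turns patterns (iv) and (v) into disc patterns for `cut γ x y`, and these have positive
defect. -/
theorem not_annularCrossing_of_defect (hγ : γ ∈ permsOn S) (hπ : π ∈ permsOn S)
    (h : defect S γ π = 0) : ¬ AnnularCrossing S γ π := by
  rintro (h0 | ⟨a, ha, b, hb, c, hc, x, hx, y, hy, hn, hxy, h1, h2, h3, h4, h5, h6⟩ |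
    ⟨a, ha, b, hb, c, hc, d, hd, x, hx, y, hy, hn, hxy, h1, h2, h3, h4, h5, h6, h7⟩)
  · exact not_discCrossing_of_defect hγ hπ h h0
  · have hJ : ({a, b, c, x, y} : Finset ℤ) ⊆ S := by
      intro z hz
      simp only [Finset.mem_insert, Finset.mem_singleton] at hz
      rcases hz with rfl | rfl | rfl | rfl | rfl <;> assumption
    obtain ⟨π', k1, k2, k3⟩ := exists_restrict_cut hγ hπ hJ (by simp) (by simp) h5 h6 hxy
    rw [h] at k3
    simp only [List.nodup_cons, List.mem_cons, List.not_mem_nil, or_false, not_or,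
      not_false_eq_true, List.nodup_nil, and_true] at hn
    obtain ⟨⟨hab, hac, hax, hay⟩, ⟨hbc, hbx, hby⟩, ⟨hcx, hcy⟩, -⟩ := hn
    refine absurd k3 (not_le.2 (defect_pos_of_induces3 (mul_mem_permsOn hγ (swap_mem_permsOn hx hy))
      (permsOn_mono (Finset.sdiff_subset.trans hJ) k1) ha hb hc (by simp [hab, hac, hbc]) h1 ?_))
    rw [← k2 a (by simp [hax, hay])] at h2
    rw [← k2 b (by simp [hbx, hby])] at h3
    rw [← k2 c (by simp [hcx, hcy])] at h4
    refine ⟨?_, ?_, ?_⟩ <;> rw [induced_eq_apply] <;> simp [h2, h3, h4]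
  · have hJ : ({a, c, b, d, x, y} : Finset ℤ) ⊆ S := by
      intro z hz
      simp only [Finset.mem_insert, Finset.mem_singleton] at hz
      rcases hz with rfl | rfl | rfl | rfl | rfl | rfl <;> assumption
    obtain ⟨π', k1, k2, k3⟩ := exists_restrict_cut hγ hπ hJ (by simp) (by simp) h6 h7 hxy
    rw [h] at k3
    have hn' := hn
    simp only [List.nodup_cons, List.mem_cons, List.not_mem_nil, or_false, not_or,
      not_false_eq_true, List.nodup_nil, and_true] at hn
    obtain ⟨⟨hab, hac, had, hax, hay⟩, ⟨hbc, hbd, hbx, hby⟩, ⟨hcd, hcx, hcy⟩, ⟨hdx, hdy⟩, -⟩ := hn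
    refine absurd k3 (not_le.2 (defect_pos_of_induces4 (mul_mem_permsOn hγ (swap_mem_permsOn hx hy))
      (permsOn_mono (Finset.sdiff_subset.trans hJ) k1) ha hb hc hd
      (by simp [hab, hac, hbc, had, hbd, hcd]) h1 ?_))
    rw [← k2 a (by simp [hax, hay])] at h2
    rw [← k2 b (by simp [hbx, hby])] at h4
    rw [← k2 c (by simp [hcx, hcy])] at h3
    rw [← k2 d (by simp [hdx, hdy])] at h5
    refine ⟨?_, ?_, ?_, ?_⟩ <;> rw [induced_eq_apply] <;> simp [h2, h3, h4, h5]

end Patterns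

/-! ### Positions along a cycle -/

section Periods

variable {σ : Equiv.Perm ℤ} {J : Finset ℤ} {x : ℤ} {m : ℕ}

/-- `m` is the length of the cycle of `σ` through `x`. -/
structure IsPeriod (σ : Equiv.Perm ℤ) (x : ℤ) (m : ℕ) : Prop where
  pos : 0 < m
  eq : (σ ^ m) x = x
  ne : ∀ i, 0 < i → i < m → (σ ^ i) x ≠ x

theorem exists_isPeriod (hσ : IsOfFinOrder σ) (x : ℤ) : ∃ m, IsPeriod σ x m := by
  classical
  have hex := exists_pow_pos_of_sameCycle hσ (Equiv.Perm.SameCycle.refl σ x)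
  exact ⟨Nat.find hex, (Nat.find_spec hex).1, (Nat.find_spec hex).2,
    fun i hi hi' h => Nat.find_min hex hi' ⟨hi, h⟩⟩

theorem IsPeriod.inj (h : IsPeriod σ x m) {i j : ℕ} (hi : i < m) (hj : j < m)
    (hij : (σ ^ i) x = (σ ^ j) x) : i = j := by
  wlog hlt : i < j generalizing i j with H
  · rcases Nat.lt_trichotomy i j with h1 | h1 | h1
    · exact absurd h1 hlt
    · exact h1
    · exact (H hj hi hij.symm h1).symm
  exfalso
  refine h.ne (j - i) (by omega) (by omega) ((σ ^ i).injective ?_)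
  rw [← pow_add_apply, Nat.add_sub_cancel' hlt.le, hij]

theorem IsPeriod.exists_of_sameCycle (h : IsPeriod σ x m) (hσ : IsOfFinOrder σ) {y : ℤ}
    (hy : σ.SameCycle x y) : ∃ i < m, (σ ^ i) x = y := by
  classical
  have hex := exists_pow_of_sameCycle hσ hy
  refine ⟨Nat.find hex, ?_, Nat.find_spec hex⟩
  by_contra hlt
  rw [not_lt] at hlt
  refine Nat.find_min hex (m := Nat.find hex - m) (by have := h.pos; omega) ?_
  have := Nat.find_spec hex
  rwa [← Nat.sub_add_cancel hlt, pow_add_apply, h.eq] at this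

/-- The shorter of the two arcs: `i ↦ j` along the cycle of `x`. -/
theorem reach_of_lt {i j : ℕ} (hij : i < j) (hJ : ∀ e, i < e → e < j → (σ ^ e) x ∉ J) :
    Reach σ J ((σ ^ i) x) ((σ ^ j) x) := by
  refine ⟨j - i, by omega, ?_, fun e h h' => ?_⟩
  · rw [← pow_add_apply, Nat.sub_add_cancel hij.le]
  · rw [← pow_add_apply]
    exact hJ _ (by omega) (by omega)

theorem IsPeriod.reach_triple (h : IsPeriod σ x m) {j l : ℕ} (hj : 0 < j) (hjl : j < l)
    (hl : l < m) (hJ : ∀ e < m, (σ ^ e) x ∈ J → e = 0 ∨ e = j ∨ e = l) :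
    Reach σ J x ((σ ^ j) x) ∧ Reach σ J ((σ ^ j) x) ((σ ^ l) x) ∧ Reach σ J ((σ ^ l) x) x := by
  refine ⟨?_, ?_, ?_⟩
  · refine reach_of_lt (i := 0) hj fun e h1 h2 h3 => ?_
    have := hJ e (by omega) h3; omega
  · refine reach_of_lt hjl fun e h1 h2 h3 => ?_
    have := hJ e (by omega) h3; omega
  · have := reach_of_lt (σ := σ) (x := x) (J := J) hl fun e h1 h2 h3 => by
      have := hJ e (by omega) h3; omega
    rwa [h.eq] at this

theorem IsPeriod.reach_quad (h : IsPeriod σ x m) {j l n : ℕ} (hj : 0 < j) (hjl : j < l)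
    (hln : l < n) (hn : n < m) (hJ : ∀ e < m, (σ ^ e) x ∈ J → e = 0 ∨ e = j ∨ e = l ∨ e = n) :
    Reach σ J x ((σ ^ j) x) ∧ Reach σ J ((σ ^ j) x) ((σ ^ l) x) ∧
      Reach σ J ((σ ^ l) x) ((σ ^ n) x) ∧ Reach σ J ((σ ^ n) x) x := by
  refine ⟨?_, ?_, ?_, ?_⟩
  · refine reach_of_lt (i := 0) hj fun e h1 h2 h3 => ?_
    have := hJ e (by omega) h3; omega
  · refine reach_of_lt hjl fun e h1 h2 h3 => ?_
    have := hJ e (by omega) h3; omega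
  · refine reach_of_lt hln fun e h1 h2 h3 => ?_
    have := hJ e (by omega) h3; omega
  · have := reach_of_lt (σ := σ) (x := x) (J := J) hn fun e h1 h2 h3 => by
      have := hJ e (by omega) h3; omega
    rwa [h.eq] at this

/-- On the cycle of `x` the set `J` has no points besides `x` and `y`, so the walk from `x` cannot
meet `J` before `y`. -/
theorem reach_pair (hσ : IsOfFinOrder σ) {x y : ℤ} (hxy : σ.SameCycle x y) (hne : x ≠ y)
    (hJ : ∀ w ∈ J, σ.SameCycle x w → w = x ∨ w = y) : Reach σ J x y := by
  obtain ⟨m, hm⟩ := exists_isPeriod hσ x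
  obtain ⟨i, hi, rfl⟩ := hm.exists_of_sameCycle hσ hxy
  have h0 : 0 < i := by
    rcases Nat.eq_zero_or_pos i with rfl | h
    · exact absurd rfl hne
    · exact h
  refine reach_of_lt (i := 0) h0 fun e h1 h2 h3 => ?_
  rcases hJ _ h3 (sameCycle_pow σ e x) with h | h
  · exact hm.ne e h1 (by omega) h
  · exact h2.ne (hm.inj (by omega) hi h)

theorem induced_pair (hσ : IsOfFinOrder σ) {x y : ℤ} (hxy : σ.SameCycle x y) (hne : x ≠ y)
    (hy : y ∈ J) (hJ : ∀ w ∈ J, σ.SameCycle x w → w = x ∨ w = y) : induced σ J x = y :=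
  induced_eq_of_reach (reach_pair hσ hxy hne hJ) hy

theorem IsPeriod.pow_eq_iff (h : IsPeriod σ x m) {i j : ℕ} (hi : i < m) (hj : j < m) :
    (σ ^ i) x = (σ ^ j) x ↔ i = j := ⟨h.inj hi hj, fun e => by rw [e]⟩

theorem IsPeriod.pow_eq_self_iff (h : IsPeriod σ x m) {i : ℕ} (hi : i < m) :
    (σ ^ i) x = x ↔ i = 0 := h.pow_eq_iff hi (j := 0) h.pos

theorem IsPeriod.induces3 (h : IsPeriod σ x m) {j l : ℕ} (hj : 0 < j) (hjl : j < l) (hl : l < m) :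
    Induces3 σ x ((σ ^ j) x) ((σ ^ l) x) := by
  obtain ⟨h1, h2, h3⟩ := h.reach_triple (J := {x, (σ ^ j) x, (σ ^ l) x}) hj hjl hl (by
    intro e he h'
    simp only [Finset.mem_insert, Finset.mem_singleton] at h'
    rwa [h.pow_eq_self_iff he, h.pow_eq_iff he (by omega), h.pow_eq_iff he hl] at h')
  exact ⟨induced_eq_of_reach h1 (by simp), induced_eq_of_reach h2 (by simp),
    induced_eq_of_reach h3 (by simp)⟩

theorem IsPeriod.induces4 (h : IsPeriod σ x m) {j l n : ℕ} (hj : 0 < j) (hjl : j < l) (hln : l < n)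
    (hn : n < m) : Induces4 σ x ((σ ^ j) x) ((σ ^ l) x) ((σ ^ n) x) := by
  obtain ⟨h1, h2, h3, h4⟩ := h.reach_quad
    (J := {x, (σ ^ j) x, (σ ^ l) x, (σ ^ n) x}) hj hjl hln hn (by
    intro e he h'
    simp only [Finset.mem_insert, Finset.mem_singleton] at h'
    rwa [h.pow_eq_self_iff he, h.pow_eq_iff he (by omega), h.pow_eq_iff he (by omega),
      h.pow_eq_iff he hn] at h')
  exact ⟨induced_eq_of_reach h1 (by simp), induced_eq_of_reach h2 (by simp),
    induced_eq_of_reach h3 (by simp), induced_eq_of_reach h4 (by simp)⟩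

theorem Induces3.rotate {a b c : ℤ} (h : Induces3 σ a b c) : Induces3 σ b c a := by
  have : ({b, c, a} : Finset ℤ) = {a, b, c} := by
    ext x; simp only [Finset.mem_insert, Finset.mem_singleton]; tauto
  unfold Induces3 at *
  rw [this]
  exact ⟨h.2.1, h.2.2, h.1⟩

theorem induces22 (hσ : IsOfFinOrder σ) {a b c d : ℤ} (hab : σ.SameCycle a b) (hne : a ≠ b)
    (hcd : σ.SameCycle c d) (hne' : c ≠ d) (hac : ¬ σ.SameCycle a c) : Induces22 σ a b c d := by
  have had : ¬ σ.SameCycle a d := fun h => hac (h.trans hcd.symm)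
  have hbc : ¬ σ.SameCycle b c := fun h => hac (hab.trans h)
  have hbd : ¬ σ.SameCycle b d := fun h => had (hab.trans h)
  have hca : ¬ σ.SameCycle c a := fun h => hac h.symm
  have hda : ¬ σ.SameCycle d a := fun h => had h.symm
  have hcb : ¬ σ.SameCycle c b := fun h => hbc h.symm
  have hdb : ¬ σ.SameCycle d b := fun h => hbd h.symm
  refine ⟨induced_pair hσ hab hne (by simp) ?_, induced_pair hσ hab.symm hne.symm (by simp) ?_,
    induced_pair hσ hcd hne' (by simp) ?_, induced_pair hσ hcd.symm hne'.symm (by simp) ?_⟩ <;>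
    intro w hw hw' <;> simp only [Finset.mem_insert, Finset.mem_singleton] at hw <;>
    rcases hw with rfl | rfl | rfl | rfl <;> simp_all

end Periods

/-! ### Existence of adjacent pairs by a minimal gap -/

section Adjacent

variable {A : Finset ℤ} {γ π : Equiv.Perm ℤ}

/-- The cycle of `π` through `x` meets another cycle of `γ`. -/
def Spoke (γ π : Equiv.Perm ℤ) (x : ℤ) : Prop := ∃ y, π.SameCycle x y ∧ ¬ γ.SameCycle x y

/-- The elements strictly between `π k` and `k` are not on the cycle of `π` through `k`. -/
theorem not_sameCycle_of_gap (hγ : γ ∈ permsOn A) (hπ : π ∈ permsOn A)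
    (hns : ¬ DiscNonstandard A γ π) {k : ℤ} (hk : k ∈ A) {m d i : ℕ} (hm : IsPeriod γ (π k) m)
    (hd : (γ ^ d) (π k) = k) (hdm : d < m) (hi : 0 < i) (hid : i < d) :
    ¬ π.SameCycle k ((γ ^ i) (π k)) := by
  intro h
  obtain ⟨M, hM⟩ := exists_isPeriod (isOfFinOrder_of_mem_permsOn hπ) k
  obtain ⟨s, hs, hsk⟩ := hM.exists_of_sameCycle (isOfFinOrder_of_mem_permsOn hπ) h
  have n1 : π k ≠ (γ ^ i) (π k) := fun e => hm.ne i hi (by omega) e.symm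
  have n2 : π k ≠ k := fun e => hm.ne d (by omega) hdm (by rw [hd, e])
  have n3 : (γ ^ i) (π k) ≠ k := fun e => by
    have := hm.inj (i := i) (j := d) (by omega) hdm (by rw [e, hd])
    omega
  have hs0 : s ≠ 0 := by rintro rfl; exact n3 hsk.symm
  have hs1 : s ≠ 1 := by
    rintro rfl
    rw [pow_one] at hsk
    exact n1 hsk
  have hq := apply_mem_of_mem_permsOn hπ hk
  -- In the order of `γ` the points are `π k`, the gap point, `k`. Along `π` the walk from `k` meets
  -- `π k` at once and the gap point only later, so the cyclic order is the same: this is pattern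
  -- (i).
  refine hns ⟨π k, hq, _, mem_of_sameCycle hγ (sameCycle_pow γ i _) hq, k, hk,
    by simp [n1, n2, n3], ?_, ?_⟩
  · have := hm.induces3 hi hid hdm
    rwa [hd] at this
  · have := hM.induces3 (j := 1) one_pos (by omega) hs
    rw [hsk, pow_one] at this
    exact this.rotate

/-- Among the pairs `k, π k` enclosing no spoke on the cycle of `γ` there is an adjacent one. -/
theorem exists_adjacent (hγ : γ ∈ permsOn A) (hπ : π ∈ permsOn A)
    (hns : ¬ DiscNonstandard A γ π) (hcr : ¬ DiscCrossing A γ π) (hfix : ∀ k ∈ A, π k ≠ k)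
    (h : ∃ k ∈ A, ∃ d, 0 < d ∧ (γ ^ d) (π k) = k ∧
      ∀ i, 0 < i → i < d → (γ ^ i) (π k) ≠ k ∧ ¬ Spoke γ π ((γ ^ i) (π k))) :
    ∃ k ∈ A, γ (π k) = k := by
  classical
  have hfγ := isOfFinOrder_of_mem_permsOn hγ
  have hfπ := isOfFinOrder_of_mem_permsOn hπ
  -- Among the pairs `k, π k` whose gap contains no spoke, one with the least distance `d` from `π
  -- k` to `k` is chosen.
  have hex : ∃ d, ∃ k ∈ A, 0 < d ∧ (γ ^ d) (π k) = k ∧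
      ∀ i, 0 < i → i < d → (γ ^ i) (π k) ≠ k ∧ ¬ Spoke γ π ((γ ^ i) (π k)) := by
    obtain ⟨k, hk, d, h⟩ := h
    exact ⟨d, k, hk, h⟩
  have hmin := fun d => Nat.find_min hex (m := d)
  obtain ⟨k, hk, hd0, hd, hgap⟩ := Nat.find_spec hex
  set d := Nat.find hex with hddef
  by_cases hd1 : d = 1
  · exact ⟨k, hk, by rwa [hd1, pow_one] at hd⟩
  exfalso
  obtain ⟨m, hm⟩ := exists_isPeriod hfγ (π k)
  have hqA := apply_mem_of_mem_permsOn hπ hk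
  -- Equality would make `k` a fixed point of `π`, and for `d > m` the point `k` would already occur
  -- inside the gap.
  have hdm : d < m := by
    by_contra hlt
    rw [not_lt] at hlt
    rcases hlt.eq_or_lt with e | hlt
    · have h1 := hm.eq
      rw [e, hd] at h1
      exact hfix k hk h1.symm
    · refine (hgap (d - m) (by omega) (by have := hm.pos; omega)).1 ?_
      rwa [← Nat.sub_add_cancel hlt.le, pow_add_apply, hm.eq] at hd
  -- If `d > 1`, the point `j` just before `k` lies inside the gap. Its `π`-cycle is not that of `k`
  -- and has no spoke; by noncrossing it stays inside the gap, and there it contains a pair at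
  -- smaller distance.
  set j := (γ ^ (d - 1)) (π k) with hj
  have hjA : j ∈ A := mem_of_sameCycle hγ (sameCycle_pow γ _ _) hqA
  have hjk : ¬ π.SameCycle k j :=
    not_sameCycle_of_gap hγ hπ hns hk hm hd hdm (by omega) (by omega)
  have hjs := (hgap (d - 1) (by omega) (by omega)).2
  -- the positions of the elements of the cycle of `j`
  have hpos : ∀ y, π.SameCycle j y → ∃ e, 0 < e ∧ e < d ∧ (γ ^ e) (π k) = y := by
    intro y hy
    have hjy : γ.SameCycle j y := by
      by_contra hn
      exact hjs ⟨y, hy, hn⟩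
    obtain ⟨e, he, rfl⟩ := hm.exists_of_sameCycle hfγ ((sameCycle_pow γ (d - 1) (π k)).trans hjy)
    have hkq := sameCycle_apply_self π k
    have he0 : e ≠ 0 := by
      rintro rfl
      exact hjk (hkq.trans hy.symm)
    have hed : e ≠ d := by
      rintro rfl
      rw [hd] at hy
      exact hjk hy.symm
    refine ⟨e, by omega, ?_, rfl⟩
    by_contra hlt
    have hyA : (γ ^ e) (π k) ∈ A := mem_of_sameCycle hγ (sameCycle_pow γ _ _) hqA
    have nn : ∀ {u v : ℕ}, u < m → v < m → u ≠ v → (γ ^ u) (π k) ≠ (γ ^ v) (π k) :=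
      fun hu hv huv e => huv (hm.inj hu hv e)
    have n1 : π k ≠ j := nn (u := 0) hm.pos (by omega) (by omega)
    have n2 : π k ≠ k := hfix k hk
    have n3 : π k ≠ (γ ^ e) (π k) := nn (u := 0) hm.pos he (by omega)
    have n4 : j ≠ k := by
      have := nn (u := d - 1) (v := d) (by omega) hdm (by omega)
      rwa [hd] at this
    have n5 : j ≠ (γ ^ e) (π k) := nn (by omega) he (by omega)
    have n6 : k ≠ (γ ^ e) (π k) := by
      have := nn (u := d) (v := e) hdm he (by omega)
      rwa [hd] at this
    -- A point of the cycle of `j` beyond `k` would make the pairs `π k, k` and `j, γ^e(π k)` cross.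
    refine hcr ⟨π k, hqA, j, hjA, k, hk, _, hyA, by simp [n1, n2, n3, n4, n5, n6], ?_, ?_⟩
    · have := hm.induces4 (j := d - 1) (l := d) (n := e) (by omega) (by omega) (by omega) he
      rwa [hd] at this
    · exact induces22 hfπ hkq.symm n2 hy n5 (fun h => hjk (hkq.trans h))
  -- the last of these elements
  let E := (Finset.range d).filter (fun e => 0 < e ∧ π.SameCycle j ((γ ^ e) (π k)))
  have hE : E.Nonempty := ⟨d - 1, Finset.mem_filter.2 ⟨Finset.mem_range.2 (by omega), by omega,
    Equiv.Perm.SameCycle.refl _ _⟩⟩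
  obtain ⟨e, heE, hemax⟩ := E.exists_max_image id hE
  obtain ⟨hed, he0, hje⟩ := Finset.mem_filter.1 heE
  rw [Finset.mem_range] at hed
  set y := (γ ^ e) (π k) with hy
  have hyA : y ∈ A := mem_of_sameCycle hγ (sameCycle_pow γ _ _) hqA
  have hjπy : π.SameCycle j (π y) := hje.trans (sameCycle_apply_self π y)
  obtain ⟨e', he'0, he'd, he'⟩ := hpos _ hjπy
  have hle : e' ≤ e := hemax e' (Finset.mem_filter.2 ⟨Finset.mem_range.2 he'd, he'0, he' ▸ hjπy⟩)
  have hne : e' ≠ e := by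
    rintro rfl
    exact hfix y hyA he'.symm
  -- With `y` the last point of the cycle of `j` in the gap, `π y` comes strictly before `y`. The
  -- pair `y, π y` then has distance `e - e' < d` and encloses no spoke.
  refine hmin (e - e') (by omega) ⟨y, hyA, by omega, ?_, fun i hi hi' => ?_⟩
  · rw [← he', ← pow_add_apply, Nat.sub_add_cancel hle]
  · rw [← he', ← pow_add_apply]
    refine ⟨fun h => ?_, (hgap _ (by omega) (by omega)).2⟩
    have := hm.inj (by omega) (by omega) h
    omega

end Adjacent

/-! ### Deleting points; the disc case -/

section Deletion

variable {S A : Finset ℤ} {γ π : Equiv.Perm ℤ}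

theorem sameCycle_del {k a b : ℤ} (hγ : IsOfFinOrder (del k γ)) (ha : a ≠ k) (hb : b ≠ k) :
    (del k γ).SameCycle a b ↔ γ.SameCycle a b := by
  by_cases h : γ k = k
  · rw [del_eq_self h]
  have hk : ∀ {c}, c ≠ k → ¬ (del k γ).SameCycle k c := fun hc h' =>
    hc (eq_of_sameCycle_of_fixed (del_apply_self k γ) h').symm
  have hc := cyc_swap_mul hγ (hk h)
  rw [swap_mul_del] at hc
  rw [← cyc_iff, ← cyc_iff, hc]
  constructor
  · exact fun h => Or.inl h
  · rintro (h | ⟨h, -⟩ | ⟨-, h⟩)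
    · exact h
    · exact absurd h.symm (hk ha)
    · exact absurd h (hk hb)

/-- A pattern avoiding `k` is seen by the induced permutations alone, and these do not change when
`k` is deleted. The three lemmas on the other patterns rest on the same remark. -/
theorem discNonstandard_of_del (hγ : γ ∈ permsOn A) (hπ : π ∈ permsOn A) {k : ℤ}
    (h : DiscNonstandard (A.erase k) (del k γ) (del k π)) : DiscNonstandard A γ π := by
  obtain ⟨a, ha, b, hb, c, hc, hn, h1, h2⟩ := h
  have fγ := isOfFinOrder_of_mem_permsOn hγ
  have fπ := isOfFinOrder_of_mem_permsOn hπ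
  rw [Finset.mem_erase] at ha hb hc
  have hk : k ∉ ({a, b, c} : Finset ℤ) := by simp [ha.1.symm, hb.1.symm, hc.1.symm]
  refine ⟨a, ha.2, b, hb.2, c, hc.2, hn, ?_, ?_⟩ <;> unfold Induces3 at *
  · simpa [induced_del fγ hk] using h1
  · simpa [induced_del fπ hk] using h2

theorem discCrossing_of_del (hγ : γ ∈ permsOn A) (hπ : π ∈ permsOn A) {k : ℤ}
    (h : DiscCrossing (A.erase k) (del k γ) (del k π)) : DiscCrossing A γ π := by
  obtain ⟨a, ha, b, hb, c, hc, d, hd, hn, h1, h2⟩ := h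
  have fγ := isOfFinOrder_of_mem_permsOn hγ
  have fπ := isOfFinOrder_of_mem_permsOn hπ
  rw [Finset.mem_erase] at ha hb hc hd
  have hk : k ∉ ({a, b, c, d} : Finset ℤ) := by simp [ha.1.symm, hb.1.symm, hc.1.symm, hd.1.symm]
  have hk' : k ∉ ({a, c, b, d} : Finset ℤ) := by simp [ha.1.symm, hb.1.symm, hc.1.symm, hd.1.symm]
  refine ⟨a, ha.2, b, hb.2, c, hc.2, d, hd.2, hn, ?_, ?_⟩
  · unfold Induces4 at *
    simpa [induced_del fγ hk] using h1
  · unfold Induces22 at *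
    simpa [induced_del fπ hk'] using h2

theorem annularNonstandard_of_del (hγ : γ ∈ permsOn A) (hπ : π ∈ permsOn A) {k : ℤ}
    (h : AnnularNonstandard (A.erase k) (del k γ) (del k π)) : AnnularNonstandard A γ π := by
  rcases h with h | ⟨a, ha, b, hb, c, hc, d, hd, hn, h1, h2⟩
  · exact Or.inl (discNonstandard_of_del hγ hπ h)
  have fγ := isOfFinOrder_of_mem_permsOn hγ
  have fπ := isOfFinOrder_of_mem_permsOn hπ
  rw [Finset.mem_erase] at ha hb hc hd
  have hk : k ∉ ({a, b, c, d} : Finset ℤ) := by simp [ha.1.symm, hb.1.symm, hc.1.symm, hd.1.symm]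
  have hk' : k ∉ ({a, c, b, d} : Finset ℤ) := by simp [ha.1.symm, hb.1.symm, hc.1.symm, hd.1.symm]
  refine Or.inr ⟨a, ha.2, b, hb.2, c, hc.2, d, hd.2, hn, ?_, ?_⟩
  · unfold Induces22 at *
    simpa [induced_del fγ hk] using h1
  · unfold Induces4 at *
    simpa [induced_del fπ hk'] using h2

theorem cut_del {k x y : ℤ} (hx : x ≠ k) (hy : y ≠ k) : cut (del k γ) x y = del k (cut γ x y) := by
  unfold cut del
  rw [mul_assoc, Equiv.Perm.mul_apply γ, Equiv.swap_apply_of_ne_of_ne hx.symm hy.symm]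

theorem annularCrossing_of_del (hγ : γ ∈ permsOn A) (hπ : π ∈ permsOn A) {k : ℤ}
    (h : AnnularCrossing (A.erase k) (del k γ) (del k π)) : AnnularCrossing A γ π := by
  have fγ := isOfFinOrder_of_mem_permsOn hγ
  have fγ' := isOfFinOrder_of_mem_permsOn (del_mem_permsOn (k := k) hγ)
  have fπ := isOfFinOrder_of_mem_permsOn hπ
  rcases h with h | ⟨a, ha, b, hb, c, hc, x, hx, y, hy, hn, hxy, h1, h2⟩ |
    ⟨a, ha, b, hb, c, hc, d, hd, x, hx, y, hy, hn, hxy, h1, h2⟩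
  · exact Or.inl (discCrossing_of_del hγ hπ h)
  · rw [Finset.mem_erase] at ha hb hc hx hy
    have fc := isOfFinOrder_of_mem_permsOn (mul_mem_permsOn hγ (swap_mem_permsOn hx.2 hy.2))
    have hk : k ∉ ({a, b, c} : Finset ℤ) := by simp [ha.1.symm, hb.1.symm, hc.1.symm]
    have hk' : k ∉ ({a, b, c, x, y} : Finset ℤ) := by
      simp [ha.1.symm, hb.1.symm, hc.1.symm, hx.1.symm, hy.1.symm]
    rw [sameCycle_del fγ' hx.1 hy.1] at hxy
    rw [cut_del hx.1 hy.1] at h1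
    refine Or.inr (Or.inl ⟨a, ha.2, b, hb.2, c, hc.2, x, hx.2, y, hy.2, hn, hxy, ?_, ?_⟩)
    · unfold Induces3 at *
      simpa [induced_del (σ := cut γ x y) fc hk] using h1
    · unfold Induces32 at *
      simpa [induced_del fπ hk'] using h2
  · rw [Finset.mem_erase] at ha hb hc hd hx hy
    have fc := isOfFinOrder_of_mem_permsOn (mul_mem_permsOn hγ (swap_mem_permsOn hx.2 hy.2))
    have hk : k ∉ ({a, b, c, d} : Finset ℤ) := by
      simp [ha.1.symm, hb.1.symm, hc.1.symm, hd.1.symm]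
    have hk' : k ∉ ({a, c, b, d, x, y} : Finset ℤ) := by
      simp [ha.1.symm, hb.1.symm, hc.1.symm, hd.1.symm, hx.1.symm, hy.1.symm]
    rw [sameCycle_del fγ' hx.1 hy.1] at hxy
    rw [cut_del hx.1 hy.1] at h1
    refine Or.inr (Or.inr ⟨a, ha.2, b, hb.2, c, hc.2, d, hd.2, x, hx.2, y, hy.2, hn, hxy, ?_, ?_⟩)
    · unfold Induces4 at *
      simpa [induced_del (σ := cut γ x y) fc hk] using h1
    · unfold Induces222 at *
      simpa [induced_del fπ hk'] using h2

/-- Deletion of a fixed point of `π`, or of `k` with `π (γ k) = k`. -/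
theorem defect_eq_zero_of_del (hAS : A ⊆ S) (hγ : γ ∈ permsOn A) (hπ : π ∈ permsOn A) {k : ℤ}
    (hk : π k = k ∨ (π (γ k) = k ∧ γ k ≠ k)) (h : defect S (del k γ) (del k π) = 0) :
    defect S γ π = 0 := by
  have hγ' := permsOn_mono hAS hγ
  have hπ' := permsOn_mono hAS hπ
  rcases hk with hk | ⟨hk, hk'⟩
  · rwa [del_eq_self hk, defect_del_of_fixed hγ' hπ' hk] at h
  · rwa [defect_del_del_of_fixed hγ' hπ' hk hk'] at h

/-- Induction on the number of points: a fixed point of `π`, or a point `k` with `π (γ k) = k`, can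
be deleted without affecting the defect or creating patterns. If `π` has no fixed point,
`exists_adjacent` applies to any `k`, because `γ` has a single cycle and there are no spokes. -/
theorem defect_eq_zero_of_disc (hAS : A ⊆ S) (hγ : γ ∈ permsOn A) (hπ : π ∈ permsOn A)
    (hc : ∀ x ∈ A, ∀ y ∈ A, γ.SameCycle x y) (hns : ¬ DiscNonstandard A γ π)
    (hcr : ¬ DiscCrossing A γ π) : defect S γ π = 0 := by
  induction hn : A.card generalizing A γ π with
  | zero =>
    rw [Finset.card_eq_zero] at hn
    subst hn
    have : π = 1 := Equiv.ext fun x => mem_permsOn.1 hπ x (by simp)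
    rw [this, defect_one]
  | succ n ih =>
    have fγ := isOfFinOrder_of_mem_permsOn hγ
    obtain ⟨k, hkA, hk⟩ : ∃ k ∈ A, π k = k ∨ (π (γ k) = k ∧ γ k ≠ k) := by
      by_cases hfix : ∃ k ∈ A, π k = k
      · obtain ⟨k, hk, hk'⟩ := hfix
        exact ⟨k, hk, Or.inl hk'⟩
      push Not at hfix
      obtain ⟨k, hk⟩ : A.Nonempty := by rw [← Finset.card_pos]; omega
      obtain ⟨k, hk, h⟩ := exists_adjacent hγ hπ hns hcr hfix (by
        obtain ⟨m, hm⟩ := exists_isPeriod fγ (π k)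
        obtain ⟨d, hd, hdk⟩ := hm.exists_of_sameCycle fγ
          (hc _ (apply_mem_of_mem_permsOn hπ hk) _ hk)
        refine ⟨k, hk, d, ?_, hdk, fun i hi hid => ⟨fun e => ?_, ?_⟩⟩
        · rcases Nat.eq_zero_or_pos d with rfl | h
          · exact absurd hdk (hfix k hk)
          · exact h
        · exact hid.ne (hm.inj (by omega) hd (e.trans hdk.symm))
        · rintro ⟨y, hy, hy'⟩
          have hi := mem_of_sameCycle hγ (sameCycle_pow γ i _) (apply_mem_of_mem_permsOn hπ hk)
          exact hy' (hc _ hi _ (mem_of_sameCycle hπ hy hi)))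
      -- From `γ (π k) = k` it follows that `π k` is sent to itself by first `γ` and then `π`, so `π
      -- k` is the point to delete.
      refine ⟨π k, apply_mem_of_mem_permsOn hπ hk, Or.inr ⟨by rw [h], ?_⟩⟩
      rw [h]
      exact (hfix k hk).symm
    refine defect_eq_zero_of_del hAS hγ hπ hk (ih ((Finset.erase_subset _ _).trans hAS)
      (del_mem_permsOn_erase hγ) (del_mem_permsOn_erase hπ) ?_
      (fun h => hns (discNonstandard_of_del hγ hπ h)) (fun h => hcr (discCrossing_of_del hγ hπ h))
      (by rw [Finset.card_erase_of_mem hkA]; omega))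
    intro x hx y hy
    rw [Finset.mem_erase] at hx hy
    rw [sameCycle_del (isOfFinOrder_of_mem_permsOn (del_mem_permsOn hγ)) hx.1 hy.1]
    exact hc x hx.2 y hy.2

end Deletion

/-! ### The annular case: spokes, two-cycles and cutting -/

section Annular

variable {S A : Finset ℤ} {γ π : Equiv.Perm ℤ}

/-- The path starts away from `u` and `v` and avoids `J`, hence `u` and `v`, up to its end. These
two points are the only ones where `cut γ u v` differs from `γ`. -/
theorem reach_cut {J : Finset ℤ} {u v x b : ℤ} (hu : u ∈ J) (hv : v ∈ J) (hxu : x ≠ u)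
    (hxv : x ≠ v) (h : Reach γ J x b) : Reach (cut γ u v) J x b := by
  obtain ⟨n, hn, rfl, h1⟩ := h
  have key : ∀ i ≤ n, (cut γ u v ^ i) x = (γ ^ i) x := by
    intro i
    induction i with
    | zero => intro _; rfl
    | succ i ih =>
      intro hi
      rw [pow_succ_apply', ih (by omega), pow_succ_apply', cut, Equiv.Perm.mul_apply]
      congr 1
      have : (γ ^ i) x ≠ u ∧ (γ ^ i) x ≠ v := by
        rcases Nat.eq_zero_or_pos i with rfl | h0
        · exact ⟨hxu, hxv⟩
        · exact ⟨fun e => h1 i h0 (by omega) (e ▸ hu), fun e => h1 i h0 (by omega) (e ▸ hv)⟩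
      exact Equiv.swap_apply_of_ne_of_ne this.1 this.2
  exact ⟨n, hn, key n le_rfl, fun i hi hi' => by rw [key i hi'.le]; exact h1 i hi hi'⟩

/-- `cut γ u v` sends `v` to `γ u`, so from `v` it continues as `γ` does from `u`. -/
theorem reach_cut_left {J : Finset ℤ} {u v b : ℤ} (hu : u ∈ J) (hv : v ∈ J)
    (h : Reach γ J u b) : Reach (cut γ u v) J v b := by
  have hs := Reach.single (cut γ u v) J v
  rw [cut, Equiv.Perm.mul_apply, Equiv.swap_apply_right] at hs
  obtain ⟨n, hn, hb, h1⟩ := h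
  obtain ⟨n, rfl⟩ : ∃ m, n = m + 1 := ⟨n - 1, by omega⟩
  rcases Nat.eq_zero_or_pos n with rfl | h0
  · rw [zero_add, pow_one] at hb
    rwa [← hb]
  have h2 : γ u ∉ J := by simpa using h1 1 one_pos (by omega)
  refine hs.trans h2 (reach_cut hu hv (fun e => h2 (by rw [e]; exact hu))
    (fun e => h2 (by rw [e]; exact hv))
    ⟨n, h0, by rwa [← pow_succ_apply], fun i hi hi' => ?_⟩)
  rw [← pow_succ_apply]
  exact h1 _ (by omega) (by omega)

theorem reach_cut_right {J : Finset ℤ} {u v b : ℤ} (hu : u ∈ J) (hv : v ∈ J)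
    (h : Reach γ J v b) : Reach (cut γ u v) J u b := by
  have : cut γ u v = cut γ v u := by unfold cut; rw [Equiv.swap_comm]
  rw [this]
  exact reach_cut_left hv hu h

/-- The arc from `p = π k` to `k` contains the foot `j` of a spoke to `z`, and the cycle of `k` also
reaches the other circle, at `y`. After a cut along `j, z` both permutations induce the cyclic order
`k, p, y`, which is pattern (iv). -/
theorem annularCrossing_of_three (fγ : IsOfFinOrder γ) (fπ : IsOfFinOrder π) {k p j y z : ℤ}
    (hk : k ∈ A) (pA : p ∈ A) (jA : j ∈ A) (yA : y ∈ A) (zA : z ∈ A) {m d i : ℕ}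
    (hm : IsPeriod γ p m) (hi : 0 < i) (hid : i < d) (hdm : d < m) (hj : (γ ^ i) p = j)
    (hdk : (γ ^ d) p = k) (hp : π k = p) (hjk : ¬ π.SameCycle k j) (hky : π.SameCycle k y)
    (hky' : ¬ γ.SameCycle k y) (hjz : π.SameCycle j z) (hjz' : ¬ γ.SameCycle j z)
    (gzy : γ.SameCycle z y) (hyz : y ≠ z) (npy : p ≠ y) : AnnularCrossing A γ π := by
  have gpj : γ.SameCycle p j := hj ▸ sameCycle_pow γ _ _
  have hkp : γ.SameCycle k p := (hdk ▸ sameCycle_pow γ d p : γ.SameCycle p k).symm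
  have pkp : π.SameCycle k p := hp ▸ sameCycle_apply_self π k
  have npj : ¬ π.SameCycle p j := fun h => hjk (pkp.trans h)
  have gjk : γ.SameCycle j k := gpj.symm.trans hkp.symm
  have hkp' : k ≠ p := fun e => hm.ne d (by omega) hdm (hdk.trans e)
  have ne_of_not : ∀ {σ : Equiv.Perm ℤ} {x y : ℤ}, ¬ σ.SameCycle x y → x ≠ y :=
    fun h e => h (e ▸ Equiv.Perm.SameCycle.refl _ _)
  have nky : k ≠ y := ne_of_not hky'
  have nkj : k ≠ j := ne_of_not hjk
  have nkz : k ≠ z := ne_of_not (σ := γ) fun h => hjz' (gjk.trans h)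
  have nyj : y ≠ j := ne_of_not (σ := γ) fun h => hky' (gjk.symm.trans h.symm)
  have npj' : p ≠ j := ne_of_not npj
  have npz : p ≠ z := ne_of_not (σ := γ) fun h => hjz' (gpj.symm.trans h)
  have njz : j ≠ z := ne_of_not hjz'
  refine (Or.inr (Or.inl ⟨k, hk, p, pA, y, yA, j, jA, z, zA,
    by simp [hkp', nky, nkj, nkz, npy, npj', npz, nyj, hyz, njz], hjz', ?_, ?_⟩))
  · have hcyc : ∀ w ∈ ({k, p, y, j, z} : Finset ℤ), γ.SameCycle p w → w = p ∨ w = j ∨ w = k := by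
      intro w hw hw'
      simp only [Finset.mem_insert, Finset.mem_singleton] at hw
      rcases hw with rfl | rfl | rfl | rfl | rfl
      · simp
      · simp
      · exact absurd (hkp.trans hw') hky'
      · simp
      · exact absurd (gpj.symm.trans hw') hjz'
    obtain ⟨r1, r2, r3⟩ := hm.reach_triple (J := {k, p, y, j, z}) hi hid hdm (by
      intro e he h'
      rcases hcyc _ h' (sameCycle_pow γ e p) with h | h | h
      · exact Or.inl ((hm.pow_eq_self_iff he).1 h)
      · exact Or.inr (Or.inl (hm.inj he (by omega) (h.trans hj.symm)))
      · exact Or.inr (Or.inr (hm.inj he hdm (h.trans hdk.symm))))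
    rw [hdk] at r2 r3
    rw [hj] at r1 r2
    have hzc : ∀ w ∈ ({k, p, y, j, z} : Finset ℤ), γ.SameCycle z w → w = z ∨ w = y := by
      intro w hw hw'
      simp only [Finset.mem_insert, Finset.mem_singleton] at hw
      rcases hw with rfl | rfl | rfl | rfl | rfl
      · exact absurd (gjk.trans hw'.symm) hjz'
      · exact absurd (gpj.symm.trans hw'.symm) hjz'
      · simp
      · exact absurd hw'.symm hjz'
      · simp
    have r4 : Reach γ {k, p, y, j, z} z y := reach_pair fγ gzy hyz.symm hzc
    have r5 : Reach γ {k, p, y, j, z} y z :=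
      reach_pair fγ gzy.symm hyz fun w hw hw' => (hzc w hw (gzy.trans hw')).symm
    have hjJ : j ∈ ({k, p, y, j, z} : Finset ℤ) := by simp
    have hzJ : z ∈ ({k, p, y, j, z} : Finset ℤ) := by simp
    have hsub : ({k, p, y} : Finset ℤ) ⊆ {k, p, y, j, z} := by
      intro w hw
      simp only [Finset.mem_insert, Finset.mem_singleton] at hw ⊢
      grind
    -- The cut permutation goes from `k` to `p` as `γ` does. From `p`, once at `j`, it continues on
    -- the other circle behind `z` up to `y`. From `y`, once at `z`, it continues behind `j` up to
    -- `k`.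
    have q1 := (reach_cut hjJ hzJ nkj nkz r3).mono hsub
    have q2 := ((reach_cut hjJ hzJ npj' npz r1).mono hsub).trans
      (by simp [nkj.symm, npj'.symm, nyj.symm]) ((reach_cut_right hjJ hzJ r4).mono hsub)
    have q3 := ((reach_cut hjJ hzJ nyj hyz r5).mono hsub).trans
      (by simp [nkz.symm, npz.symm, hyz.symm]) ((reach_cut_left hjJ hzJ r2).mono hsub)
    exact ⟨induced_eq_of_reach q1 (by simp), induced_eq_of_reach q2 (by simp),
      induced_eq_of_reach q3 (by simp)⟩
  · obtain ⟨M, hM⟩ := exists_isPeriod fπ k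
    obtain ⟨s, hs, hsy⟩ := hM.exists_of_sameCycle fπ hky
    have hs0 : s ≠ 0 := by rintro rfl; exact nky hsy
    have hs1 : s ≠ 1 := by rintro rfl; exact npy (hp.symm.trans hsy)
    have hcyc : ∀ w ∈ ({k, p, y, j, z} : Finset ℤ), π.SameCycle k w → w = k ∨ w = p ∨ w = y := by
      intro w hw hw'
      simp only [Finset.mem_insert, Finset.mem_singleton] at hw
      rcases hw with rfl | rfl | rfl | rfl | rfl
      · simp
      · simp
      · simp
      · exact absurd hw' hjk
      · exact absurd (hw'.trans hjz.symm) hjk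
    have hzc : ∀ w ∈ ({k, p, y, j, z} : Finset ℤ), π.SameCycle j w → w = j ∨ w = z := by
      intro w hw hw'
      simp only [Finset.mem_insert, Finset.mem_singleton] at hw
      rcases hw with rfl | rfl | rfl | rfl | rfl
      · exact absurd hw'.symm hjk
      · exact absurd hw'.symm npj
      · exact absurd (hky.trans hw'.symm) hjk
      · simp
      · simp
    obtain ⟨r1, r2, r3⟩ := hM.reach_triple (J := {k, p, y, j, z}) (j := 1) (l := s)
      one_pos (by omega) hs (by
      intro e he h'
      rcases hcyc _ h' (sameCycle_pow π e k) with h | h | h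
      · exact Or.inl ((hM.pow_eq_self_iff he).1 h)
      · exact Or.inr (Or.inl (hM.inj (j := 1) he (by omega) (h.trans hp.symm)))
      · exact Or.inr (Or.inr (hM.inj he hs (h.trans hsy.symm))))
    rw [hsy] at r2 r3
    rw [pow_one, hp] at r1 r2
    exact ⟨induced_eq_of_reach r1 (by simp), induced_eq_of_reach r2 (by simp),
      induced_eq_of_reach r3 (by simp), induced_pair fπ hjz njz (by simp) hzc,
      induced_pair fπ hjz.symm njz.symm (by simp)
        fun w hw hw' => (hzc w hw (hjz.trans hw')).symm⟩

set_option maxHeartbeats 1000000 in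
-- The points `p` and `q` of one `π`-cycle divide their circle into two arcs, containing the feet
-- `j` and `j₂` of spokes to `z` and `z₂`. After a cut along `j, z` the cyclic order is `q, j₂, p,
-- z₂`, and the pairs `q, p` and `j₂, z₂` cross: this is pattern (v).
theorem annularCrossing_of_four (fγ : IsOfFinOrder γ) (fπ : IsOfFinOrder π) {p j q j₂ z z₂ : ℤ}
    (pA : p ∈ A) (jA : j ∈ A) (qA : q ∈ A) (j₂A : j₂ ∈ A) (zA : z ∈ A) (z₂A : z₂ ∈ A)
    {m i e i' : ℕ} (hm : IsPeriod γ p m) (hi : 0 < i) (hie : i < e) (hi' : 0 < i') (hem : e + i' < m)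
    (hj : (γ ^ i) p = j) (heq : (γ ^ e) p = q) (hj₂e : (γ ^ (e + i')) p = j₂)
    (ppq : π.SameCycle p q) (npq : p ≠ q) (npj : ¬ π.SameCycle p j) (hjk₂ : ¬ π.SameCycle p j₂)
    (hjj : ¬ π.SameCycle j j₂) (hjz : π.SameCycle j z) (hjz' : ¬ γ.SameCycle j z)
    (hjz₂ : π.SameCycle j₂ z₂) (hjz₂' : ¬ γ.SameCycle j₂ z₂) (gzz₂ : γ.SameCycle z z₂)
    (hzz : z ≠ z₂) (njj₂ : j ≠ j₂) : AnnularCrossing A γ π := by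
  have gpj : γ.SameCycle p j := hj ▸ sameCycle_pow γ _ _
  have gpq : γ.SameCycle p q := heq ▸ sameCycle_pow γ _ _
  have gpj₂ : γ.SameCycle p j₂ := hj₂e ▸ sameCycle_pow γ _ _
  have he : e < m := by omega
  have ne_of_not : ∀ {σ : Equiv.Perm ℤ} {x y : ℤ}, ¬ σ.SameCycle x y → x ≠ y :=
    fun h e => h (e ▸ Equiv.Perm.SameCycle.refl _ _)
  have npj' : p ≠ j := ne_of_not npj
  have npj₂ : p ≠ j₂ := ne_of_not hjk₂
  have njq : j ≠ q := ne_of_not (σ := π) fun h => npj (ppq.trans h.symm)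
  have nqj₂ : q ≠ j₂ := ne_of_not (σ := π) fun h => hjk₂ (ppq.trans h)
  have gz : ∀ {w}, γ.SameCycle p w → w ≠ z := fun h e => hjz' (gpj.symm.trans (e ▸ h))
  have gz₂ : ∀ {w}, γ.SameCycle p w → w ≠ z₂ := fun h e => hjz₂' (gpj₂.symm.trans (e ▸ h))
  have npz := gz (Equiv.Perm.SameCycle.refl γ p)
  have npz₂ := gz₂ (Equiv.Perm.SameCycle.refl γ p)
  have nqz := gz gpq
  have nqz₂ := gz₂ gpq
  have njz := gz gpj
  have njz₂ := gz₂ gpj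
  have nj₂z := gz gpj₂
  have nj₂z₂ := gz₂ gpj₂
  refine (Or.inr (Or.inr ⟨q, qA, j₂, j₂A, p, pA, z₂, z₂A, j, jA, z, zA, ?_, hjz', ?_, ?_⟩))
  · simp [nqj₂, npq.symm, nqz₂, njq.symm, nqz, npj₂.symm, nj₂z₂, njj₂.symm, nj₂z, npz₂, npj', npz,
      njz₂.symm, hzz.symm, njz]
  · have hcyc : ∀ w ∈ ({q, j₂, p, z₂, j, z} : Finset ℤ), γ.SameCycle p w →
        w = p ∨ w = j ∨ w = q ∨ w = j₂ := by
      intro w hw hw'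
      have h3 := gz hw'
      have h4 := gz₂ hw'
      simp only [Finset.mem_insert, Finset.mem_singleton] at hw
      grind
    obtain ⟨r1, r2, r3, r4⟩ := hm.reach_quad (J := {q, j₂, p, z₂, j, z}) hi hie
      (n := e + i') (by omega) hem (by
      intro u hu h'
      rcases hcyc _ h' (sameCycle_pow γ u p) with h | h | h | h
      · exact Or.inl ((hm.pow_eq_self_iff hu).1 h)
      · exact Or.inr (Or.inl (hm.inj hu (by omega) (h.trans hj.symm)))
      · exact Or.inr (Or.inr (Or.inl (hm.inj hu he (h.trans heq.symm))))
      · exact Or.inr (Or.inr (Or.inr (hm.inj hu hem (h.trans hj₂e.symm)))))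
    rw [heq] at r2 r3
    rw [hj₂e] at r3 r4
    rw [hj] at r1 r2
    have hzc : ∀ w ∈ ({q, j₂, p, z₂, j, z} : Finset ℤ), γ.SameCycle z w → w = z ∨ w = z₂ := by
      intro w hw hw'
      simp only [Finset.mem_insert, Finset.mem_singleton] at hw
      have : ∀ {v}, γ.SameCycle p v → w ≠ v := fun h h' =>
        hjz' ((gpj.symm.trans h).trans (h' ▸ hw'.symm))
      have a1 := this (Equiv.Perm.SameCycle.refl γ p)
      have a2 := this gpq
      have a3 := this gpj
      have a4 := this gpj₂
      grind
    have r5 : Reach γ {q, j₂, p, z₂, j, z} z z₂ := reach_pair fγ gzz₂ hzz hzc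
    have r6 : Reach γ {q, j₂, p, z₂, j, z} z₂ z :=
      reach_pair fγ gzz₂.symm hzz.symm fun w hw hw' => (hzc w hw (gzz₂.trans hw')).symm
    have hjJ : j ∈ ({q, j₂, p, z₂, j, z} : Finset ℤ) := by simp
    have hzJ : z ∈ ({q, j₂, p, z₂, j, z} : Finset ℤ) := by simp
    have hsub : ({q, j₂, p, z₂} : Finset ℤ) ⊆ {q, j₂, p, z₂, j, z} := by
      intro w hw
      simp only [Finset.mem_insert, Finset.mem_singleton] at hw ⊢
      grind
    have q1 := (reach_cut hjJ hzJ njq.symm nqz r3).mono hsub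
    have q2 := (reach_cut hjJ hzJ njj₂.symm nj₂z r4).mono hsub
    have q3 := ((reach_cut hjJ hzJ npj' npz r1).mono hsub).trans
      (by simp [njq, njj₂, npj'.symm, njz₂]) ((reach_cut_right hjJ hzJ r5).mono hsub)
    have q4 := ((reach_cut hjJ hzJ njz₂.symm hzz.symm r6).mono hsub).trans
      (by simp [nqz.symm, nj₂z.symm, npz.symm, hzz]) ((reach_cut_left hjJ hzJ r2).mono hsub)
    exact ⟨induced_eq_of_reach q1 (by simp), induced_eq_of_reach q2 (by simp),
      induced_eq_of_reach q3 (by simp), induced_eq_of_reach q4 (by simp)⟩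
  · have c1 : ∀ w ∈ ({q, p, j₂, z₂, j, z} : Finset ℤ), π.SameCycle p w → w = p ∨ w = q := by
      intro w hw hw'
      simp only [Finset.mem_insert, Finset.mem_singleton] at hw
      have b1 : w ≠ j := fun e => npj (e ▸ hw')
      have b2 : w ≠ j₂ := fun e => hjk₂ (e ▸ hw')
      have b3 : w ≠ z := fun e => npj ((e ▸ hw').trans hjz.symm)
      have b4 : w ≠ z₂ := fun e => hjk₂ ((e ▸ hw').trans hjz₂.symm)
      grind
    have c2 : ∀ w ∈ ({q, p, j₂, z₂, j, z} : Finset ℤ), π.SameCycle j w → w = j ∨ w = z := by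
      intro w hw hw'
      simp only [Finset.mem_insert, Finset.mem_singleton] at hw
      have b1 : w ≠ p := fun e => npj (e ▸ hw').symm
      have b2 : w ≠ j₂ := fun e => hjj (e ▸ hw')
      have b3 : w ≠ q := fun e => npj (ppq.trans (e ▸ hw').symm)
      have b4 : w ≠ z₂ := fun e => hjj ((e ▸ hw').trans hjz₂.symm)
      grind
    have c3 : ∀ w ∈ ({q, p, j₂, z₂, j, z} : Finset ℤ), π.SameCycle j₂ w → w = j₂ ∨ w = z₂ := by
      intro w hw hw'
      simp only [Finset.mem_insert, Finset.mem_singleton] at hw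
      have b1 : w ≠ p := fun e => hjk₂ (e ▸ hw').symm
      have b2 : w ≠ j := fun e => hjj (e ▸ hw').symm
      have b3 : w ≠ q := fun e => hjk₂ (ppq.trans (e ▸ hw').symm)
      have b4 : w ≠ z := fun e => hjj (hjz.trans (e ▸ hw').symm)
      grind
    exact ⟨induced_pair fπ ppq.symm npq.symm (by simp)
        fun w hw hw' => (c1 w hw (ppq.trans hw')).symm,
      induced_pair fπ ppq npq (by simp) c1,
      induced_pair fπ hjz₂ nj₂z₂ (by simp) c3,
      induced_pair fπ hjz₂.symm nj₂z₂.symm (by simp)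
        fun w hw hw' => (c3 w hw (hjz₂.trans hw')).symm,
      induced_pair fπ hjz njz (by simp) c2,
      induced_pair fπ hjz.symm njz.symm (by simp)
        fun w hw hw' => (c2 w hw (hjz.trans hw')).symm⟩

/-- In the situation without fixed points and adjacent elements there is a two-cycle connecting the
two circles. -/
theorem exists_twoCycle (hγ : γ ∈ permsOn A) (hπ : π ∈ permsOn A)
    (h2 : ∀ x ∈ A, ∀ y ∈ A, ∀ z ∈ A, ¬ γ.SameCycle x y → γ.SameCycle x z ∨ γ.SameCycle y z)
    (hns : ¬ AnnularNonstandard A γ π) (hcr : ¬ AnnularCrossing A γ π)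
    (hfix : ∀ k ∈ A, π k ≠ k) (hadj : ∀ k ∈ A, γ (π k) ≠ k) (hA : A.Nonempty) :
    ∃ x ∈ A, ¬ γ.SameCycle x (π x) ∧ π (π x) = x := by
  have fγ := isOfFinOrder_of_mem_permsOn hγ
  have fπ := isOfFinOrder_of_mem_permsOn hπ
  have hns' : ¬ DiscNonstandard A γ π := fun h => hns (Or.inl h)
  have hcr' : ¬ DiscCrossing A γ π := fun h => hcr (Or.inl h)
  have πA : ∀ {x}, x ∈ A → π x ∈ A := fun h => apply_mem_of_mem_permsOn hπ h
  by_cases hE : ∃ k ∈ A, γ.SameCycle k (π k)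
  swap
  -- If `π` changes the circle at every point, `k` and `π² k` lie on one circle and `π k` and `π³ k`
  -- on the other. A `π`-cycle that is not a two-cycle would then show pattern (iii).
  · push Not at hE
    obtain ⟨k, hk⟩ := hA
    refine ⟨k, hk, hE k hk, ?_⟩
    by_contra hne
    have a1 := πA hk
    have a2 := πA a1
    have a3 := πA a2
    have s2 : γ.SameCycle k (π (π k)) :=
      (h2 k hk _ a1 _ a2 (hE k hk)).resolve_right (hE _ a1)
    have s3 : γ.SameCycle (π k) (π (π (π k))) :=
      (h2 _ a1 _ a2 _ a3 (hE _ a1)).resolve_right (hE _ a2)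
    have d3 : ¬ γ.SameCycle k (π (π (π k))) := fun h => hE k hk (h.trans s3.symm)
    have n02 : k ≠ π (π k) := fun e => hne e.symm
    have n13 : π k ≠ π (π (π k)) := fun e => n02 (π.injective e)
    have n01 : k ≠ π k := fun e => hfix k hk e.symm
    have n03 : k ≠ π (π (π k)) := fun e => d3 (e ▸ Equiv.Perm.SameCycle.refl _ _)
    have n21 : π (π k) ≠ π k := fun e => n01 (π.injective e).symm
    have n23 : π (π k) ≠ π (π (π k)) := fun e => n21 (π.injective e).symm
    obtain ⟨m, hm⟩ := exists_isPeriod fπ k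
    have hm3 : 3 < m := by
      by_contra hlt
      have := hm.pos
      have he := hm.eq
      interval_cases m
      · exact n01 he.symm
      · exact n02 he.symm
      · exact n03 he.symm
    refine hns (Or.inr ⟨k, hk, _, a2, _, a1, _, a3, by simp [n02, n01, n03, n21, n23, n13], ?_, ?_⟩)
    · exact induces22 fγ s2 n02 s3 n13 (hE k hk)
    · exact hm.induces4 (j := 1) (l := 2) (n := 3) (by omega) (by omega) (by omega) hm3
  exfalso
  -- every pair on the same circle encloses a spoke
  have hspoke : ∀ k ∈ A, γ.SameCycle k (π k) → ∃ m d i, IsPeriod γ (π k) m ∧ (γ ^ d) (π k) = k ∧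
      d < m ∧ 0 < i ∧ i < d ∧ Spoke γ π ((γ ^ i) (π k)) := by
    intro k hk hs
    obtain ⟨m, hm⟩ := exists_isPeriod fγ (π k)
    obtain ⟨d, hd, hdk⟩ := hm.exists_of_sameCycle fγ hs.symm
    by_contra hcon
    push Not at hcon
    have hd0 : 0 < d := by
      rcases Nat.eq_zero_or_pos d with rfl | h
      · exact absurd hdk (hfix k hk)
      · exact h
    obtain ⟨k', hk', h'⟩ := exists_adjacent hγ hπ hns' hcr' hfix ⟨k, hk, d, hd0, hdk,
      fun i hi hid => ⟨fun e => hid.ne (hm.inj (by omega) hd (e.trans hdk.symm)),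
        hcon m d i hm hdk hd hi hid⟩⟩
    exact hadj k' hk' h'
  obtain ⟨k, hk, hkp⟩ := hE
  obtain ⟨m, d, i, hm, hdk, hdm, hi, hid, z, hjz, hjz'⟩ := hspoke k hk hkp
  have hjk := not_sameCycle_of_gap hγ hπ hns' hk hm hdk hdm hi hid
  set p := π k with hp
  set j := (γ ^ i) p with hj
  have pA : p ∈ A := πA hk
  have jA : j ∈ A := mem_of_sameCycle hγ (sameCycle_pow γ _ _) pA
  have zA : z ∈ A := mem_of_sameCycle hπ hjz jA
  have gpj : γ.SameCycle p j := sameCycle_pow γ _ _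
  have pkp : π.SameCycle k p := sameCycle_apply_self π k
  have npj : ¬ π.SameCycle p j := fun h => hjk (pkp.trans h)
  have hkp' : k ≠ p := fun e => hfix k hk e.symm
  have ne_of_not : ∀ {σ : Equiv.Perm ℤ} {x y : ℤ}, ¬ σ.SameCycle x y → x ≠ y :=
    fun h e => h (e ▸ Equiv.Perm.SameCycle.refl _ _)
  -- The arc from `p = π k` to `k` contains the foot `j` of a spoke. If the cycle of `k` reaches the
  -- other circle, pattern (iv) occurs. Otherwise `p` and `π p` are on one circle as well, and the
  -- arc from `π p` to `p` contains the foot `j₂` of a second spoke.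
  by_cases hy : ∃ y, π.SameCycle k y ∧ ¬ γ.SameCycle k y
  · obtain ⟨y, hky, hky'⟩ := hy
    have yA : y ∈ A := mem_of_sameCycle hπ hky hk
    have gjk : γ.SameCycle j k := gpj.symm.trans hkp.symm
    have gzy : γ.SameCycle z y := by
      refine (h2 j jA z zA y yA hjz').resolve_left fun h => hky' (gjk.symm.trans h)
    have hyz : y ≠ z := by
      rintro rfl
      exact hjk (hky.trans hjz.symm)
    have npy : p ≠ y := ne_of_not (σ := γ) fun h => hky' (hkp.trans h)
    exact hcr (annularCrossing_of_three fγ fπ hk pA jA yA zA hm hi hid hdm hj.symm hdk hp.symm hjk hky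
      hky' hjz hjz' gzy hyz npy)
  · push Not at hy
    obtain ⟨m', d', i', hm', hdk', hdm', hi', hid', z₂, hjz₂, hjz₂'⟩ :=
      hspoke p pA (hkp.symm.trans (hy _ (pkp.trans (sameCycle_apply_self π p))))
    have hjk₂ := not_sameCycle_of_gap hγ hπ hns' pA hm' hdk' hdm' hi' hid'
    set q := π p with hq
    have qA : q ∈ A := πA pA
    have gpq : γ.SameCycle p q := hkp.symm.trans (hy _ (pkp.trans (sameCycle_apply_self π p)))
    have ppq : π.SameCycle p q := sameCycle_apply_self π p
    have npq : p ≠ q := fun e => hfix p pA e.symm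
    obtain ⟨e, he, heq⟩ := hm.exists_of_sameCycle fγ gpq
    have he0 : e ≠ 0 := by rintro rfl; exact npq heq
    -- `q = π p` is on the `π`-cycle of `k`, so it does not lie strictly inside the gap from `p` to
    -- `k`. Consequently the arcs containing `j` and `j₂` are disjoint.
    have hde : d ≤ e := by
      by_contra hlt
      refine not_sameCycle_of_gap hγ hπ hns' hk hm hdk hdm (i := e) (by omega) (by omega) ?_
      rw [heq]
      exact pkp.trans ppq
    -- the arc from `π p` to `p`
    have hd'e : d' = m - e := by
      have h1 : (γ ^ (m - e)) q = p := by
        rw [← heq, ← pow_add_apply, Nat.sub_add_cancel he.le, hm.eq]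
      have hmm : m - e < m' := by
        by_contra hlt
        rw [not_lt] at hlt
        refine hm.ne (e + m') (by omega) ?_ ?_
        · by_contra hlt2
          have : m' = m - e := by omega
          rw [← this, hm'.eq] at h1
          exact npq h1.symm
        · have := hm'.eq
          rw [← heq, ← pow_add_apply, add_comm] at this
          have h4 : e + m' = 0 ∨ e + m' = m := by
            by_contra hcon
            push Not at hcon
            have := hm.inj (i := e + m') (j := e) (by omega) he this
            have := hm'.pos
            omega
          rcases h4 with h4 | h4
          · omega
          · rw [h4, hm.eq]
      exact hm'.inj hdm' hmm (hdk'.trans h1.symm)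
    set j₂ := (γ ^ i') q with hj₂
    have hj₂e : (γ ^ (e + i')) p = j₂ := by
      rw [hj₂, ← heq, ← pow_add_apply, add_comm]
    have hem : e + i' < m := by omega
    have hie : i < e := by omega
    have j₂A : j₂ ∈ A := mem_of_sameCycle hγ (sameCycle_pow γ _ _) qA
    have z₂A : z₂ ∈ A := mem_of_sameCycle hπ hjz₂ j₂A
    have gpj₂ : γ.SameCycle p j₂ := hj₂e ▸ sameCycle_pow γ _ _
    have npj' : p ≠ j := ne_of_not npj
    have npj₂ : p ≠ j₂ := ne_of_not hjk₂
    have njq : j ≠ q := ne_of_not (σ := π) fun h => npj (ppq.trans h.symm)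
    have nqj₂ : q ≠ j₂ := ne_of_not (σ := π) fun h => hjk₂ (ppq.trans h)
    have njj₂ : j ≠ j₂ := fun h => by
      have := hm.inj (i := i) (j := e + i') (by omega) hem (h.trans hj₂e.symm)
      omega
    -- If both feet belong to one cycle, it crosses the pair `p, q` already on the circle. Otherwise
    -- the two spokes end at different points of the other circle.
    by_cases hjj : π.SameCycle j j₂
    · refine hcr (Or.inl ⟨p, pA, j, jA, q, qA, j₂, j₂A,
        by simp [npj', npq, npj₂, njq, njj₂, nqj₂], ?_, ?_⟩)
      · have := hm.induces4 hi hie (n := e + i') (by omega) hem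
        rwa [heq, hj₂e] at this
      · exact induces22 fπ ppq npq hjj njj₂ npj
    have gzz₂ : γ.SameCycle z z₂ := by
      refine (h2 j jA z zA z₂ z₂A hjz').resolve_left fun h => hjz₂' ?_
      exact gpj₂.symm.trans (gpj.trans h)
    have hzz : z ≠ z₂ := by
      rintro rfl
      exact hjj (hjz.trans hjz₂.symm)
    exact hcr (annularCrossing_of_four fγ fπ pA jA qA j₂A zA z₂A hm hi hie hi' hem hj.symm heq hj₂e ppq
      npq npj hjk₂ hjj hjz hjz' hjz₂ hjz₂' gzz₂ hzz njj₂)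

/-- Outside the two-cycle `(x y)` of `π` the permutations `π` and `π * (x y)` coincide, and such a
path never enters `{x, y}`. Enlarging `J` by `x` and `y` is therefore harmless. -/
theorem reach_of_twoCycle {J K : Finset ℤ} {x y a b : ℤ} (hx : π x = y) (hy : π y = x)
    (hax : a ≠ x) (hay : a ≠ y) (hK : ∀ w ∈ K, w ∈ J ∨ w = x ∨ w = y)
    (h : Reach (π * Equiv.swap x y) J a b) : Reach π K a b := by
  obtain ⟨n, hn, rfl, h1⟩ := h
  have hp : ∀ i, ((π * Equiv.swap x y) ^ i) a = (π ^ i) a ∧ (π ^ i) a ≠ x ∧ (π ^ i) a ≠ y := by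
    intro i
    induction i with
    | zero => exact ⟨rfl, hax, hay⟩
    | succ i ih =>
      rw [pow_succ_apply', pow_succ_apply', ih.1, Equiv.Perm.mul_apply,
        Equiv.swap_apply_of_ne_of_ne ih.2.1 ih.2.2]
      exact ⟨rfl, fun e => ih.2.2 (π.injective (e.trans hy.symm)),
        fun e => ih.2.1 (π.injective (e.trans hx.symm))⟩
  refine ⟨n, hn, (hp n).1.symm, fun i hi hi' h' => ?_⟩
  rcases hK _ h' with h | h
  · exact h1 i hi hi' ((hp i).1 ▸ h)
  · exact h.elim (hp i).2.1 (hp i).2.2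

set_option maxHeartbeats 1000000 in
-- Induction by deletion as for the disc. When nothing can be deleted, `exists_twoCycle` gives a
-- two-cycle `(x y)` of `π` between the circles. Cutting along it preserves the defect and makes `γ`
-- a single cycle on the remaining points; a disc pattern there would be pattern (iv) or (v) of the
-- annulus.
theorem defect_eq_zero_of_annular (hAS : A ⊆ S) (hγ : γ ∈ permsOn A) (hπ : π ∈ permsOn A)
    (h2 : ∀ x ∈ A, ∀ y ∈ A, ∀ z ∈ A, ¬ γ.SameCycle x y → γ.SameCycle x z ∨ γ.SameCycle y z)
    (hns : ¬ AnnularNonstandard A γ π) (hcr : ¬ AnnularCrossing A γ π) : defect S γ π = 0 := by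
  induction hn : A.card generalizing A γ π with
  | zero =>
    rw [Finset.card_eq_zero] at hn
    subst hn
    have : π = 1 := Equiv.ext fun x => mem_permsOn.1 hπ x (by simp)
    rw [this, defect_one]
  | succ n ih =>
    have fγ := isOfFinOrder_of_mem_permsOn hγ
    by_cases hex : ∃ k ∈ A, π k = k ∨ (π (γ k) = k ∧ γ k ≠ k)
    · obtain ⟨k, hkA, hk⟩ := hex
      refine defect_eq_zero_of_del hAS hγ hπ hk (ih ((Finset.erase_subset _ _).trans hAS)
        (del_mem_permsOn_erase hγ) (del_mem_permsOn_erase hπ) ?_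
        (fun h => hns (annularNonstandard_of_del hγ hπ h))
        (fun h => hcr (annularCrossing_of_del hγ hπ h))
        (by rw [Finset.card_erase_of_mem hkA]; omega))
      have fd := isOfFinOrder_of_mem_permsOn (del_mem_permsOn (k := k) hγ)
      intro x hx y hy z hz
      rw [Finset.mem_erase] at hx hy hz
      rw [sameCycle_del fd hx.1 hy.1, sameCycle_del fd hx.1 hz.1, sameCycle_del fd hy.1 hz.1]
      exact h2 x hx.2 y hy.2 z hz.2
    push Not at hex
    have hfix : ∀ k ∈ A, π k ≠ k := fun k hk => (hex k hk).1
    obtain ⟨x, hxA, hxy, hyx⟩ := exists_twoCycle hγ hπ h2 hns hcr hfix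
      (fun k hk e => (hfix k hk).symm (by
        have := (hex _ (apply_mem_of_mem_permsOn hπ hk)).2 (by rw [e])
        exact e.symm.trans this))
      (by rw [← Finset.card_pos]; omega)
    set y := π x with hy
    have hyA : y ∈ A := apply_mem_of_mem_permsOn hπ hxA
    have hne : x ≠ y := fun e => hfix x hxA e.symm
    set π' := π * Equiv.swap x y with hπ'def
    have hπx : π' x = x := by rw [hπ'def]; simp [hyx]
    have hπy : π' y = y := by rw [hπ'def]; simp [hy]
    have hπ' : π' ∈ permsOn A := mul_mem_permsOn hπ (swap_mem_permsOn hxA hyA)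
    have hππ : π = π' * Equiv.swap x y := by rw [hπ'def, mul_assoc, Equiv.swap_mul_self, mul_one]
    have hc : cut γ x y ∈ permsOn A := mul_mem_permsOn hγ (swap_mem_permsOn hxA hyA)
    have fc := isOfFinOrder_of_mem_permsOn hc
    have hc1 : del x (cut γ x y) ∈ permsOn (A.erase x) := del_mem_permsOn_erase hc
    have fc1 := isOfFinOrder_of_mem_permsOn hc1
    have hc2 : del y (del x (cut γ x y)) ∈ permsOn ((A.erase x).erase y) :=
      del_mem_permsOn_erase hc1
    have fc2 := isOfFinOrder_of_mem_permsOn hc2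
    have fπ' := isOfFinOrder_of_mem_permsOn hπ'
    have hsub : (A.erase x).erase y ⊆ A := (Finset.erase_subset _ _).trans (Finset.erase_subset _ _)
    -- After the cut, `x` and `y` are fixed points of `π'` and are deleted from the cut permutation
    -- as well.
    rw [hππ, defect_mul_swap (permsOn_mono hAS hγ) (permsOn_mono hAS hπ') (hAS hxA) (hAS hyA) hπx hπy
      hxy, ← defect_del_of_fixed (permsOn_mono hAS hc) (permsOn_mono hAS hπ') hπx,
      ← defect_del_of_fixed (permsOn_mono ((Finset.erase_subset _ _).trans hAS) hc1)
        (permsOn_mono hAS hπ') hπy]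
    have hmem : ∀ {w}, w ∈ (A.erase x).erase y → w ∈ A ∧ w ≠ x ∧ w ≠ y := fun hw => by
      rw [Finset.mem_erase, Finset.mem_erase] at hw
      exact ⟨hw.2.2, hw.2.1, hw.1⟩
    have hind : ∀ {J : Finset ℤ} {w : ℤ}, x ∉ J → y ∉ J → w ∈ J →
        induced (del y (del x (cut γ x y))) J w = induced (cut γ x y) J w := by
      intro J w hx hy hw
      rw [induced_del fc1 hy hw, induced_del fc hx hw]
    have hindπ : ∀ {J K : Finset ℤ} {w : ℤ}, x ∉ J → y ∉ J → w ∈ J → J ⊆ K →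
        (∀ w ∈ K, w ∈ J ∨ w = x ∨ w = y) → induced π K w = induced π' J w := by
      intro J K w hx' hy' hw hJK hK
      obtain ⟨r1, r2⟩ := reach_induced fπ' hw
      exact induced_eq_of_reach (reach_of_twoCycle rfl hyx (fun e => hx' (e ▸ hw))
        (fun e => hy' (by rw [hy, ← e]; exact hw)) hK r1) (hJK r2)
    refine defect_eq_zero_of_disc (hsub.trans hAS) hc2 ?_ ?_ ?_ ?_
    · rw [mem_permsOn]
      intro k hk
      by_cases h1 : k = x
      · rw [h1, hπx]
      by_cases h2 : k = y
      · rw [h2, hπy]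
      exact mem_permsOn.1 hπ' k fun h => hk (by simp [h, h1, h2])
    · intro a ha b hb
      obtain ⟨haA, hax, hay⟩ := hmem ha
      obtain ⟨hbA, hbx, hby⟩ := hmem hb
      rw [sameCycle_del fc2 hay hby, sameCycle_del fc1 hax hbx, ← cyc_iff, cut, cyc_mul_swap fγ hxy]
      have hxx : ∀ w ∈ A, glue (cyc γ) x y x w := by
        intro w hw
        rcases h2 x hxA y hyA w hw hxy with h | h
        · exact Or.inl h
        · exact Or.inr (Or.inl ⟨(cyc γ).refl x, h⟩)
      exact (glue (cyc γ) x y).trans ((glue (cyc γ) x y).symm (hxx a haA)) (hxx b hbA)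
    · rintro ⟨a, ha, b, hb, c, hc, hn, h3, h4⟩
      obtain ⟨haA, hax, hay⟩ := hmem ha
      obtain ⟨hbA, hbx, hby⟩ := hmem hb
      obtain ⟨hcA, hcx, hcy⟩ := hmem hc
      have hxJ : x ∉ ({a, b, c} : Finset ℤ) := by simp [hax.symm, hbx.symm, hcx.symm]
      have hyJ : y ∉ ({a, b, c} : Finset ℤ) := by simp [hay.symm, hby.symm, hcy.symm]
      refine hcr (Or.inr (Or.inl ⟨a, haA, b, hbA, c, hcA, x, hxA, y, hyA, ?_, hxy, ?_, ?_⟩))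
      · simp only [List.nodup_cons, List.mem_cons, List.not_mem_nil, or_false, not_or,
          not_false_eq_true, List.nodup_nil, and_true] at hn ⊢
        exact ⟨⟨hn.1.1, hn.1.2, hax, hay⟩, ⟨hn.2, hbx, hby⟩, ⟨hcx, hcy⟩, hne⟩
      · unfold Induces3 at *
        rwa [hind hxJ hyJ (by simp), hind hxJ hyJ (by simp), hind hxJ hyJ (by simp)] at h3
      · have hs : ({a, b, c} : Finset ℤ) ⊆ {a, b, c, x, y} := by
          intro w hw
          simp only [Finset.mem_insert, Finset.mem_singleton] at hw ⊢
          grind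
        have hs' : ∀ w ∈ ({a, b, c, x, y} : Finset ℤ), w ∈ ({a, b, c} : Finset ℤ) ∨ w = x ∨ w = y := by
          intro w hw
          simp only [Finset.mem_insert, Finset.mem_singleton] at hw ⊢
          grind
        unfold Induces3 at h4
        unfold Induces32
        rw [hindπ hxJ hyJ (by simp) hs hs', hindπ hxJ hyJ (by simp) hs hs',
          hindπ hxJ hyJ (by simp) hs hs', induced_eq_apply (x := x) (by simp [← hy]),
          induced_eq_apply (x := y) (by simp [hyx])]
        exact ⟨h4.1, h4.2.1, h4.2.2, rfl, hyx⟩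
    · rintro ⟨a, ha, b, hb, c, hc, d, hd, hn, h3, h4⟩
      obtain ⟨haA, hax, hay⟩ := hmem ha
      obtain ⟨hbA, hbx, hby⟩ := hmem hb
      obtain ⟨hcA, hcx, hcy⟩ := hmem hc
      obtain ⟨hdA, hdx, hdy⟩ := hmem hd
      have hxJ : x ∉ ({a, b, c, d} : Finset ℤ) := by simp [hax.symm, hbx.symm, hcx.symm, hdx.symm]
      have hyJ : y ∉ ({a, b, c, d} : Finset ℤ) := by simp [hay.symm, hby.symm, hcy.symm, hdy.symm]
      have hxJ' : x ∉ ({a, c, b, d} : Finset ℤ) := by simp [hax.symm, hbx.symm, hcx.symm, hdx.symm]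
      have hyJ' : y ∉ ({a, c, b, d} : Finset ℤ) := by simp [hay.symm, hby.symm, hcy.symm, hdy.symm]
      refine hcr (Or.inr (Or.inr ⟨a, haA, b, hbA, c, hcA, d, hdA, x, hxA, y, hyA, ?_, hxy, ?_, ?_⟩))
      · simp only [List.nodup_cons, List.mem_cons, List.not_mem_nil, or_false, not_or,
          not_false_eq_true, List.nodup_nil, and_true] at hn ⊢
        exact ⟨⟨hn.1.1, hn.1.2.1, hn.1.2.2, hax, hay⟩, ⟨hn.2.1.1, hn.2.1.2, hbx, hby⟩,
          ⟨hn.2.2, hcx, hcy⟩, ⟨hdx, hdy⟩, hne⟩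
      · unfold Induces4 at *
        rwa [hind hxJ hyJ (by simp), hind hxJ hyJ (by simp), hind hxJ hyJ (by simp),
          hind hxJ hyJ (by simp)] at h3
      · have hs : ({a, c, b, d} : Finset ℤ) ⊆ {a, c, b, d, x, y} := by
          intro w hw
          simp only [Finset.mem_insert, Finset.mem_singleton] at hw ⊢
          grind
        have hs' : ∀ w ∈ ({a, c, b, d, x, y} : Finset ℤ),
            w ∈ ({a, c, b, d} : Finset ℤ) ∨ w = x ∨ w = y := by
          intro w hw
          simp only [Finset.mem_insert, Finset.mem_singleton] at hw ⊢
          grind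
        unfold Induces22 at h4
        unfold Induces222
        rw [hindπ hxJ' hyJ' (by simp) hs hs', hindπ hxJ' hyJ' (by simp) hs hs',
          hindπ hxJ' hyJ' (by simp) hs hs', hindπ hxJ' hyJ' (by simp) hs hs',
          induced_eq_apply (x := x) (by simp [← hy]),
          induced_eq_apply (x := y) (by simp [hyx])]
        exact ⟨h4.1, h4.2.1, h4.2.2.1, h4.2.2.2, rfl, hyx⟩

theorem isTransitiveOn_iff : IsTransitiveOn S γ π ↔ ∀ a ∈ S, ∀ b ∈ S, join γ π a b := by
  have h1 : ∀ g ∈ Subgroup.closure ({γ, π} : Set (Equiv.Perm ℤ)), ∀ x, join γ π x (g x) := by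
    intro g hg
    induction hg using Subgroup.closure_induction with
    | mem g hg =>
      rcases hg with rfl | hg
      · exact join_left _ _
      · rw [Set.mem_singleton_iff] at hg
        subst hg
        exact join_right _ _
    | one => exact fun x => (join γ π).refl x
    | mul g h _ _ ihg ihh => exact fun x => (join γ π).trans (ihh x) (ihg (h x))
    | inv g _ ih =>
      intro x
      have := ih (g⁻¹ x)
      rw [show g (g⁻¹ x) = x by simp] at this
      exact (join γ π).symm this
  let r : Setoid ℤ :=
    { r := fun x y => ∃ g ∈ Subgroup.closure ({γ, π} : Set (Equiv.Perm ℤ)), g x = y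
      iseqv := ⟨fun x => ⟨1, one_mem _, rfl⟩,
        fun ⟨g, hg, e⟩ => ⟨g⁻¹, inv_mem hg, by rw [← e]; simp⟩,
        fun ⟨g, hg, e⟩ ⟨g', hg', e'⟩ => ⟨g' * g, mul_mem hg' hg, by
          rw [Equiv.Perm.mul_apply, e, e']⟩⟩ }
  have h2 : join γ π ≤ r := join_le (fun x => ⟨γ, Subgroup.subset_closure (by simp), rfl⟩)
    (fun x => ⟨π, Subgroup.subset_closure (by simp), rfl⟩)
  constructor
  · intro h a ha b hb
    obtain ⟨g, hg, rfl⟩ := h a ha b hb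
    exact h1 g hg a
  · exact fun h a ha b hb => h2 (h a ha b hb)

/-- This trades pattern avoidance for a number that can be compared with the Euler characteristic.
-/
theorem mem_discNC_iff (hγ : γ ∈ permsOn S) (hc : ∀ x ∈ S, ∀ y ∈ S, γ.SameCycle x y) :
    π ∈ discNC S γ ↔ π ∈ permsOn S ∧ defect S γ π = 0 := by
  classical
  unfold discNC
  rw [Finset.mem_filter]
  refine and_congr_right fun hπ => ⟨fun h => ?_, fun h => ⟨?_, ?_⟩⟩
  · exact defect_eq_zero_of_disc subset_rfl hγ hπ hc h.1 h.2
  · exact not_discNonstandard_of_defect hγ hπ h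
  · exact not_discCrossing_of_defect hγ hπ h

theorem mem_annNC_iff (hγ : γ ∈ permsOn S)
    (h2 : ∀ x ∈ S, ∀ y ∈ S, ∀ z ∈ S, ¬ γ.SameCycle x y → γ.SameCycle x z ∨ γ.SameCycle y z) :
    π ∈ annNC S γ ↔ π ∈ permsOn S ∧ defect S γ π = 0 ∧ ∀ a ∈ S, ∀ b ∈ S, join γ π a b := by
  classical
  unfold annNC
  rw [Finset.mem_filter, isTransitiveOn_iff]
  refine and_congr_right fun hπ => ⟨fun h => ⟨?_, h.2.2⟩, fun h => ⟨?_, ?_, h.2⟩⟩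
  · exact defect_eq_zero_of_annular subset_rfl hγ hπ h2 h.1 h.2.1
  · exact not_annularNonstandard_of_defect hγ hπ h.1
  · exact not_annularCrossing_of_defect hγ hπ h.1

end Annular

/-! ### Premaps and halves of the signed index set -/

section Premaps

variable {I J K : Finset ℕ} {S : Finset ℤ} {γ π σ p : Equiv.Perm ℤ}

theorem mem_pm {x : ℤ} : x ∈ pm I ↔ x.natAbs ∈ I := by
  simp only [pm, posPart, negPart, Finset.mem_union, Finset.mem_image]
  constructor
  · rintro (⟨k, hk, rfl⟩ | ⟨k, hk, rfl⟩) <;> simpa using hk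
  · intro h
    rcases le_total 0 x with h' | h'
    · exact Or.inl ⟨_, h, by omega⟩
    · exact Or.inr ⟨_, h, by omega⟩

theorem mem_posPart {x : ℤ} : x ∈ posPart I ↔ 0 ≤ x ∧ x.natAbs ∈ I := by
  simp only [posPart, Finset.mem_image]
  constructor
  · rintro ⟨k, hk, rfl⟩; simpa using hk
  · exact fun h => ⟨_, h.2, by omega⟩

theorem mem_negPart {x : ℤ} : x ∈ negPart I ↔ x ≤ 0 ∧ x.natAbs ∈ I := by
  simp only [negPart, Finset.mem_image]
  constructor
  · rintro ⟨k, hk, rfl⟩; simpa using hk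
  · exact fun h => ⟨_, h.2, by omega⟩

theorem neg_mem_pm {x : ℤ} : -x ∈ pm I ↔ x ∈ pm I := by simp [mem_pm]

theorem posPart_subset_pm : posPart I ⊆ pm I := Finset.subset_union_left

theorem pm_union : pm (J ∪ K) = pm J ∪ pm K := by
  ext x; simp [mem_pm]

theorem posPart_union : posPart (J ∪ K) = posPart J ∪ posPart K := by
  ext x; simp only [mem_posPart, Finset.mem_union]; tauto

theorem disjoint_pm (h : Disjoint J K) : Disjoint (pm J) (pm K) := by
  rw [Finset.disjoint_left] at *
  intro x hx hx'
  exact h (mem_pm.1 hx) (mem_pm.1 hx')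

theorem disjoint_posPart (h : Disjoint J K) : Disjoint (posPart J) (posPart K) :=
  (disjoint_pm h).mono posPart_subset_pm posPart_subset_pm

theorem ne_zero_of_mem_pm (h0 : 0 ∉ I) {x : ℤ} (hx : x ∈ pm I) : x ≠ 0 := by
  rintro rfl
  exact h0 (mem_pm.1 hx)

theorem delta_apply (x : ℤ) : delta x = -x := rfl

theorem delta_inv : delta⁻¹ = delta := rfl

theorem minus_apply (γ : Equiv.Perm ℤ) (x : ℤ) : minus γ x = -(γ (-x)) := rfl

theorem minus_eq_conj (γ : Equiv.Perm ℤ) : minus γ = delta * γ * delta⁻¹ := rfl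

theorem minus_mul (γ π : Equiv.Perm ℤ) : minus (γ * π) = minus γ * minus π := by
  rw [minus_eq_conj, minus_eq_conj, minus_eq_conj]; group

theorem minus_inv (γ : Equiv.Perm ℤ) : minus γ⁻¹ = (minus γ)⁻¹ := by
  rw [minus_eq_conj, minus_eq_conj]; group

theorem minus_minus (γ : Equiv.Perm ℤ) : minus (minus γ) = γ := by
  ext x; simp [minus_apply]

theorem minus_mem_permsOn (h : γ ∈ permsOn (pm I)) : minus γ ∈ permsOn (pm I) := by
  rw [mem_permsOn] at *
  intro k hk
  rw [minus_apply, h _ (by rwa [neg_mem_pm]), neg_neg]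

/-- It is enough to exclude `π k = -k`: if `πⁿ⁺²(x) = -x`, then `π(-π x) = -x` allows the path to be
shortened at both ends, giving `πⁿ(π x) = -π x`. The descent ends at `n = 0` or `n = 1`. -/
theorem mem_premaps_iff (h0 : 0 ∉ I) :
    π ∈ premaps I ↔ π ∈ permsOn (pm I) ∧ minus π = π⁻¹ ∧ ∀ k ∈ pm I, π k ≠ -k := by
  classical
  unfold premaps
  rw [Finset.mem_filter]
  refine and_congr_right fun hπ => ⟨fun h => ⟨?_, fun k hk e => ?_⟩, fun ⟨h1, h2⟩ k hk => ⟨?_, ?_⟩⟩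
  · have key : ∀ x, π x = -(π⁻¹ (-x)) := by
      intro x
      by_cases hx : x ∈ pm I
      · exact (h x hx).1
      · rw [mem_permsOn.1 hπ x hx,
          mem_permsOn.1 (inv_mem_permsOn hπ) (-x) (by rwa [neg_mem_pm]), neg_neg]
    ext x
    rw [minus_apply, key, neg_neg, neg_neg]
  · exact (h k hk).2 (e ▸ sameCycle_apply_self π k)
  · rw [← h1, minus_apply, neg_neg, neg_neg]
  · intro hs
    have hinv : ∀ x, π (-(π x)) = -x := by
      intro x
      have : -(π (-(π x))) = π⁻¹ (π x) := by rw [← h1, minus_apply]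
      rw [Equiv.Perm.inv_def, Equiv.symm_apply_apply] at this
      omega
    have key : ∀ n : ℕ, ∀ x ∈ pm I, (π ^ n) x ≠ -x := by
      intro n
      induction n using Nat.strong_induction_on with
      | _ n ih =>
        intro x hx e
        rcases n with _ | _ | n
        · rw [pow_zero, Equiv.Perm.one_apply] at e
          exact ne_zero_of_mem_pm h0 hx (by omega)
        · rw [zero_add, pow_one] at e
          exact h2 x hx e
        · refine ih n (by omega) (π x) (apply_mem_of_mem_permsOn hπ hx) (π.injective ?_)
          rw [hinv, ← pow_succ_apply', ← pow_succ_apply, e]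
    obtain ⟨n, hn⟩ := exists_pow_of_sameCycle (isOfFinOrder_of_mem_permsOn hπ) hs
    exact key n k hk hn

theorem not_sameCycle_neg (h : π ∈ premaps I) {k : ℤ} (hk : k ∈ pm I) : ¬ π.SameCycle k (-k) := by
  classical
  unfold premaps at h
  exact ((Finset.mem_filter.1 h).2 k hk).2

theorem premap_permsOn (h : π ∈ premaps I) : π ∈ permsOn (pm I) := by
  classical
  exact (Finset.mem_filter.1 h).1

theorem sameCycle_neg_iff (h : minus π = π⁻¹) {x y : ℤ} :
    π.SameCycle (-x) (-y) ↔ π.SameCycle x y := by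
  rw [← Equiv.Perm.sameCycle_inv (f := π) (x := x), ← h, minus_eq_conj, Equiv.Perm.sameCycle_conj]
  rfl

theorem inv_mem_premaps (h0 : 0 ∉ I) (h : π ∈ premaps I) : π⁻¹ ∈ premaps I := by
  rw [mem_premaps_iff h0] at *
  refine ⟨inv_mem_permsOn h.1, by rw [minus_inv, h.2.1], fun k hk e => h.2.2 k hk ?_⟩
  have h3 : minus π k = -k := by rw [h.2.1, e]
  have h4 := h.2.2 (-k) (neg_mem_pm.2 hk)
  rw [minus_apply] at h3
  omega

/-- `γ₋⁻¹ π γ₊`. -/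
def twist (γ π : Equiv.Perm ℤ) : Equiv.Perm ℤ := (minus γ)⁻¹ * π * γ

theorem twist_mem_premaps (h0 : 0 ∉ I) (hγ : γ ∈ permsOn (pm I)) (h : π ∈ premaps I) :
    twist γ π ∈ premaps I := by
  rw [mem_premaps_iff h0] at *
  refine ⟨mul_mem_permsOn (mul_mem_permsOn (inv_mem_permsOn (minus_mem_permsOn hγ)) h.1) hγ, ?_,
    fun k hk e => ?_⟩
  · unfold twist
    rw [minus_mul, minus_mul, minus_inv, minus_minus, h.2.1]
    group
  · refine h.2.2 (γ k) (apply_mem_of_mem_permsOn hγ hk) ?_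
    unfold twist at e
    rw [Equiv.Perm.mul_apply, Equiv.Perm.mul_apply, Equiv.Perm.inv_eq_iff_eq, minus_apply,
      neg_neg] at e
    exact e

/-- `S` contains exactly one of `k` and `-k` for each `k ∈ I`. -/
structure IsHalf (I : Finset ℕ) (S : Finset ℤ) : Prop where
  mem_iff : ∀ x, x ∈ pm I ↔ x ∈ S ∨ -x ∈ S
  not_neg : ∀ x ∈ S, -x ∉ S

theorem isHalf_posPart (h0 : 0 ∉ I) : IsHalf I (posPart I) := by
  refine ⟨fun x => ?_, fun x hx hx' => ?_⟩
  · simp only [mem_pm, mem_posPart, Int.natAbs_neg]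
    rcases le_total 0 x with h | h <;> constructor <;> intro h' <;> grind
  · rw [mem_posPart] at hx hx'
    have : x = 0 := by omega
    exact h0 (by simpa [this] using hx.2)

theorem IsHalf.subset (h : IsHalf I S) : S ⊆ pm I := fun x hx => (h.mem_iff x).2 (Or.inl hx)

/-- The set `-S`. -/
def negSet (S : Finset ℤ) : Finset ℤ := S.map delta.toEmbedding

theorem mem_negSet {x : ℤ} : x ∈ negSet S ↔ -x ∈ S := by
  unfold negSet
  simp only [Finset.mem_map, Equiv.coe_toEmbedding, delta_apply]
  exact ⟨fun ⟨y, hy, e⟩ => by rwa [← e, neg_neg], fun h => ⟨-x, h, neg_neg x⟩⟩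

theorem IsHalf.union_eq (h : IsHalf I S) : pm I = S ∪ negSet S := by
  ext x
  rw [h.mem_iff, Finset.mem_union, mem_negSet]

/-- The relation `r'` on `S` is the relation `r` on `-S` transported by negation. -/
theorem IsHalf.nclass_eq (h : IsHalf I S) {r r' : Setoid ℤ}
    (hr : ∀ x ∈ S, ∀ y ∈ S, (r' x y ↔ r (-x) (-y))) (hn : ∀ x ∈ S, ∀ y ∈ S, ¬ r x (-y)) :
    nclass (pm I) r = nclass S r + nclass S r' := by
  rw [h.union_eq, nclass_union]
  · congr 1
    refine (nclass_equiv delta (fun x => ?_) fun x hx y hy => ?_).symm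
    · rw [mem_negSet, delta_apply, neg_neg]
    · exact hr x hx y hy
  · intro x hx y hy hxy
    rw [mem_negSet] at hy
    exact hn x hx _ hy (by rwa [neg_neg])

/-- Negation carries cycles of `π` to cycles, and an element of least absolute value to such an
element; so the cycle of `x` or that of `-x` has a positive one. If both did, the two absolute
values would agree, and some `m` and `-m` would share a cycle. -/
theorem particular_isHalf (h0 : 0 ∉ I) (h : π ∈ premaps I) : IsHalf I (particular I π) := by
  classical
  have hneg := ((mem_premaps_iff h0).1 h).2.1
  have hmin : ∀ k ∈ pm I, ∃ m ∈ pm I, π.SameCycle k m ∧ ∀ l ∈ pm I, π.SameCycle k l → |m| ≤ |l| := by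
    intro k hk
    obtain ⟨m, hm, hmm⟩ := ((pm I).filter (fun l => π.SameCycle k l)).exists_min_image
      (fun l => |l|) ⟨k, Finset.mem_filter.2 ⟨hk, Equiv.Perm.SameCycle.refl _ _⟩⟩
    obtain ⟨h1, h2⟩ := Finset.mem_filter.1 hm
    exact ⟨m, h1, h2, fun l hl hl' => hmm l (Finset.mem_filter.2 ⟨hl, hl'⟩)⟩
  have hs : ∀ {x y}, π.SameCycle (-x) y ↔ π.SameCycle x (-y) := by
    intro x y
    rw [← sameCycle_neg_iff hneg, neg_neg]
  constructor
  · intro x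
    unfold particular
    simp only [Finset.mem_filter, neg_mem_pm]
    constructor
    · intro hx
      obtain ⟨m, hm, hxm, hmm⟩ := hmin x hx
      rcases lt_or_gt_of_ne (ne_zero_of_mem_pm h0 hm) with hlt | hlt
      · refine Or.inr ⟨hx, -m, neg_mem_pm.2 hm, by rwa [hs, neg_neg], by omega, fun l hl hl' => ?_⟩
        rw [abs_neg, ← abs_neg l]
        exact hmm _ (neg_mem_pm.2 hl) (hs.1 hl')
      · exact Or.inl ⟨hx, m, hm, hxm, hlt, hmm⟩
    · rintro (h | h) <;> exact h.1
  · intro x hx hx'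
    unfold particular at hx hx'
    simp only [Finset.mem_filter, neg_mem_pm] at hx hx'
    obtain ⟨hx, m, hm, hxm, hm0, hmm⟩ := hx
    obtain ⟨-, m', hm', hxm', hm0', hmm'⟩ := hx'
    have h1 := hmm _ (neg_mem_pm.2 hm') (hs.1 hxm')
    have h2 := hmm' _ (neg_mem_pm.2 hm) (by rwa [hs, neg_neg])
    rw [abs_neg, abs_of_pos hm0, abs_of_pos hm0'] at h1 h2
    have : m = m' := by omega
    subst this
    exact not_sameCycle_neg h hm (hxm.symm.trans (hs.1 hxm'))

theorem particular_saturated {x y : ℤ} (hx : x ∈ particular I π) (hy : y ∈ pm I)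
    (hxy : π.SameCycle x y) : y ∈ particular I π := by
  classical
  unfold particular at *
  rw [Finset.mem_filter] at *
  obtain ⟨-, m, hm, hxm, hm0, hmm⟩ := hx
  exact ⟨hy, m, hm, hxy.symm.trans hxm, hm0, fun l hl hl' => hmm l hl (hxy.trans hl')⟩

theorem numCycles_premap (h0 : 0 ∉ I) (h : π ∈ premaps I) :
    numCycles (pm I) π = 2 * numCycles (particular I π) π := by
  have hneg := ((mem_premaps_iff h0).1 h).2.1
  have hh := particular_isHalf h0 h
  rw [numCycles_eq_nclass, hh.nclass_eq (r' := cyc π), two_mul]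
  · rfl
  · intro x _ y _
    rw [cyc_iff, cyc_iff, sameCycle_neg_iff hneg]
  · intro x hx y hy hxy
    exact hh.not_neg y hy (particular_saturated hx (neg_mem_pm.2 (hh.subset hy)) hxy)

/-- The cycles of a premap come in pairs exchanged by negation, so the truncated division in
`eulerChar` is exact. -/
theorem two_mul_numCycles_div (h0 : 0 ∉ I) (h : π ∈ premaps I) :
    2 * (((numCycles (pm I) π / 2 : ℕ) : ℤ)) = nclass (pm I) (cyc π) := by
  have h1 := numCycles_premap h0 h
  rw [← numCycles_eq_nclass, h1]
  push_cast
  omega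

theorem permsOn_pm_of_posPart (h : γ ∈ permsOn (posPart I)) : γ ∈ permsOn (pm I) :=
  permsOn_mono posPart_subset_pm h

/-! ### Doubling a permutation of a half -/

section Double

theorem double_apply_mem (hS : IsHalf I S) (hγ : γ ∈ permsOn S) {x : ℤ} (hx : x ∈ S) :
    double γ x = γ x := by
  have : minus γ x = x := by
    rw [minus_apply, mem_permsOn.1 hγ _ (hS.not_neg x hx), neg_neg]
  rw [double, Equiv.Perm.mul_apply, Equiv.Perm.inv_eq_iff_eq.2 this.symm]

theorem double_apply_neg (hS : IsHalf I S) (hγ : γ ∈ permsOn S) {x : ℤ} (hx : x ∈ S) :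
    double γ (-x) = -(γ⁻¹ x) := by
  have h1 : (minus γ)⁻¹ (-x) = -(γ⁻¹ x) := by
    rw [← minus_inv, minus_apply, neg_neg]
  rw [double, Equiv.Perm.mul_apply, h1]
  exact mem_permsOn.1 hγ _ (hS.not_neg _ (apply_mem_of_mem_permsOn (inv_mem_permsOn hγ) hx))

theorem double_mem_premaps (h0 : 0 ∉ I) (hS : IsHalf I S) (hγ : γ ∈ permsOn S) :
    double γ ∈ premaps I := by
  have hγ' := permsOn_mono hS.subset hγ
  rw [mem_premaps_iff h0]
  refine ⟨mul_mem_permsOn hγ' (inv_mem_permsOn (minus_mem_permsOn hγ')), ?_, fun k hk e => ?_⟩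
  · unfold double
    rw [minus_mul, minus_inv, minus_minus]
    rw [mul_inv_rev, inv_inv]
  · rcases (hS.mem_iff k).1 hk with h | h
    · rw [double_apply_mem hS hγ h] at e
      exact hS.not_neg k h (e ▸ apply_mem_of_mem_permsOn hγ h)
    · have h1 := double_apply_neg hS hγ h
      rw [neg_neg, e] at h1
      have h2 := apply_mem_of_mem_permsOn (inv_mem_permsOn hγ) h
      rw [← neg_eq_iff_eq_neg.2 h1.symm.symm] at h2
      · exact hS.not_neg _ h (by simpa using h2)

theorem double_injOn (hS : IsHalf I S) (hγ : γ ∈ permsOn S) (hp : p ∈ permsOn S)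
    (h : double γ = double p) : γ = p := by
  ext x
  by_cases hx : x ∈ S
  · rw [← double_apply_mem hS hγ hx, h, double_apply_mem hS hp hx]
  · rw [mem_permsOn.1 hγ x hx, mem_permsOn.1 hp x hx]

/-- The relation `π(-x) = -π⁻¹(x)` determines `π` on `-S` from its restriction to `S`, and it is the
relation satisfied by a double. -/
theorem exists_double_eq (h0 : 0 ∉ I) (hS : IsHalf I S) (h : π ∈ premaps I)
    (hinv : ∀ x ∈ S, π x ∈ S) : ∃ p ∈ permsOn S, double p = π := by
  have hπ := (mem_premaps_iff h0).1 h
  have hfin := isOfFinOrder_of_mem_permsOn hπ.1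
  have hiff : ∀ x, π x ∈ S ↔ x ∈ S := by
    intro x
    refine ⟨fun hx => ?_, hinv x⟩
    obtain ⟨n, hn⟩ := exists_pow_of_sameCycle hfin (sameCycle_apply_self π x).symm
    rw [← hn]
    clear hn
    induction n with
    | zero => exact hx
    | succ n ih => rw [pow_succ_apply']; exact hinv _ ih
  let p := Equiv.Perm.ofSubtype (π.subtypePerm hiff)
  have hp : ∀ x ∈ S, p x = π x := fun x hx =>
    Equiv.Perm.ofSubtype_apply_of_mem (π.subtypePerm hiff) hx
  have hpS : p ∈ permsOn S := mem_permsOn.2 fun k hk =>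
    Equiv.Perm.ofSubtype_apply_of_not_mem (π.subtypePerm hiff) hk
  refine ⟨p, hpS, ?_⟩
  ext x
  by_cases hx : x ∈ pm I
  · rcases (hS.mem_iff x).1 hx with h | h
    · rw [double_apply_mem hS hpS h, hp x h]
    · have h1 := double_apply_neg hS hpS h
      rw [neg_neg] at h1
      have h2 : p⁻¹ (-x) = π⁻¹ (-x) := by
        rw [Equiv.Perm.inv_eq_iff_eq, hp _ ((hiff _).1 (by simpa using h))]
        simp
      rw [h1, h2, ← hπ.2.1, minus_apply, neg_neg, neg_neg]
  · rw [mem_permsOn.1 hπ.1 x hx,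
      mem_permsOn.1 (premap_permsOn (double_mem_premaps h0 hS hpS)) x hx]

/-- The double of a permutation acts on `S` as the permutation itself and on `-S` as the negative of
its inverse. The orbits of the doubles are thus those on `S` together with their negatives. -/
theorem join_double_iff (hS : IsHalf I S) (hγ : γ ∈ permsOn S) (hp : p ∈ permsOn S) :
    (∀ x ∈ S, ∀ y ∈ S, (join (double γ) (double p) x y ↔ join γ p x y)) ∧
    (∀ x ∈ S, ∀ y ∈ S, (join (double γ) (double p) (-x) (-y) ↔ join γ p x y)) ∧
    (∀ x ∈ S, ∀ y ∈ S, ¬ join (double γ) (double p) x (-y)) := by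
  classical
  let f : ℤ → ℤ := fun x => if x ∈ S then x else -x
  let g : ℤ → ℤ := fun x => if x ∈ S then x else if -x ∈ S then -x else x
  -- `g` folds `-S` onto `S`; the second factor of `t` remembers the side, so that `t` also
  -- separates `S` from `-S`.
  let t : Setoid ℤ := Setoid.comap g (join γ p) ⊓ Setoid.ker (fun x => x ∈ S)
  have hg1 : ∀ x ∈ S, g x = x := fun x hx => by simp [g, hx]
  have hg2 : ∀ x ∈ S, g (-x) = x := fun x hx => by simp [g, hx, hS.not_neg x hx]
  have hstep : ∀ σ ∈ permsOn S, (∀ x, join γ p x (σ x)) → ∀ x, t x (double σ x) := by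
    intro σ hσ hj x
    by_cases hx : x ∈ S
    · have hx' := apply_mem_of_mem_permsOn hσ hx
      rw [double_apply_mem hS hσ hx]
      refine ⟨?_, ?_⟩
      · change join γ p (g x) (g (σ x))
        rw [hg1 x hx, hg1 _ hx']
        exact hj x
      · change (x ∈ S) = (σ x ∈ S)
        simp [hx, hx']
    · by_cases hx' : -x ∈ S
      · have h1 := double_apply_neg hS hσ hx'
        have h2 := apply_mem_of_mem_permsOn (inv_mem_permsOn hσ) hx'
        rw [neg_neg] at h1
        rw [h1]
        refine ⟨?_, ?_⟩
        · change join γ p (g x) (g (-(σ⁻¹ (-x))))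
          rw [hg2 _ h2]
          have h3 := hg2 _ hx'
          rw [neg_neg] at h3
          rw [h3]
          have := hj (σ⁻¹ (-x))
          rw [show σ (σ⁻¹ (-x)) = -x by simp] at this
          exact (join γ p).symm this
        · change (x ∈ S) = (-(σ⁻¹ (-x)) ∈ S)
          rw [eq_iff_iff]
          exact ⟨fun h => absurd h hx, fun h => absurd h (hS.not_neg _ h2)⟩
      · have : double σ x = x := by
          have h1 : minus σ x = x := by rw [minus_apply, mem_permsOn.1 hσ _ hx', neg_neg]
          rw [double, Equiv.Perm.mul_apply, Equiv.Perm.inv_eq_iff_eq.2 h1.symm,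
            mem_permsOn.1 hσ _ hx]
        rw [this]
  have hle : join (double γ) (double p) ≤ t :=
    join_le (hstep γ hγ (join_left γ p)) (hstep p hp (join_right γ p))
  have hle2 : join γ p ≤ join (double γ) (double p) := by
    have h2 : ∀ σ ∈ permsOn S, (∀ x, join (double γ) (double p) x (double σ x)) →
        ∀ x, join (double γ) (double p) x (σ x) := by
      intro σ hσ hj x
      by_cases hx : x ∈ S
      · rw [← double_apply_mem hS hσ hx]; exact hj x
      · rw [mem_permsOn.1 hσ x hx]
    exact join_le (h2 γ hγ (join_left _ _)) (h2 p hp (join_right _ _))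
  have hle3 : join γ p ≤ Setoid.comap (fun x => if x ∈ S then -x else x)
      (join (double γ) (double p)) := by
    have h2 : ∀ σ ∈ permsOn S, (∀ x, join (double γ) (double p) x (double σ x)) →
        ∀ x, Setoid.comap (fun x => if x ∈ S then -x else x)
          (join (double γ) (double p)) x (σ x) := by
      intro σ hσ hj x
      change join (double γ) (double p) (if x ∈ S then -x else x) (if σ x ∈ S then -(σ x) else σ x)
      by_cases hx : x ∈ S
      · have hx' := apply_mem_of_mem_permsOn hσ hx
        rw [if_pos hx, if_pos hx']
        have := hj (-(σ x))
        rw [double_apply_neg hS hσ hx', Equiv.Perm.inv_def, Equiv.symm_apply_apply] at this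
        exact (join _ _).symm this
      · rw [mem_permsOn.1 hσ x hx]
    exact join_le (h2 γ hγ (join_left _ _)) (h2 p hp (join_right _ _))
  refine ⟨fun x hx y hy => ⟨fun h => ?_, fun h => hle2 h⟩,
    fun x hx y hy => ⟨fun h => ?_, fun h => ?_⟩, fun x hx y hy h => ?_⟩
  · have h1 : join γ p (g x) (g y) := (hle h).1
    rwa [hg1 x hx, hg1 y hy] at h1
  · have h1 : join γ p (g (-x)) (g (-y)) := (hle h).1
    rwa [hg2 x hx, hg2 y hy] at h1
  · have h1 : join (double γ) (double p) (if x ∈ S then -x else x) (if y ∈ S then -y else y) := hle3 h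
    rwa [if_pos hx, if_pos hy] at h1
  · have h1 : (x ∈ S) = (-y ∈ S) := (hle h).2
    exact hS.not_neg y hy (h1 ▸ hx)

theorem nclass_join_double (hS : IsHalf I S) (hγ : γ ∈ permsOn S) (hp : p ∈ permsOn S) :
    nclass (pm I) (join (double γ) (double p)) = 2 * nclass S (join γ p) := by
  obtain ⟨h1, h2, h3⟩ := join_double_iff hS hγ hp
  rw [hS.nclass_eq (r' := join γ p) (fun x hx y hy => (h2 x hx y hy).symm) h3,
    nclass_congr (r' := join γ p) h1, two_mul]

theorem join_self (γ : Equiv.Perm ℤ) : join γ γ = cyc γ := sup_idem _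

theorem nclass_cyc_double (hS : IsHalf I S) (hγ : γ ∈ permsOn S) :
    nclass (pm I) (cyc (double γ)) = 2 * nclass S (cyc γ) := by
  rw [← join_self, nclass_join_double hS hγ hγ, join_self]

theorem sameCycle_congr (hσ : IsOfFinOrder σ) (hπ : IsOfFinOrder π) (hS : ∀ x ∈ S, σ x ∈ S)
    (h : ∀ x ∈ S, σ x = π x) {x y : ℤ} (hx : x ∈ S) : σ.SameCycle x y ↔ π.SameCycle x y := by
  have key : ∀ n : ℕ, (σ ^ n) x = (π ^ n) x ∧ (σ ^ n) x ∈ S := by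
    intro n
    induction n with
    | zero => exact ⟨rfl, hx⟩
    | succ n ih =>
      rw [pow_succ_apply', pow_succ_apply', ← ih.1]
      exact ⟨h _ ih.2, hS _ ih.2⟩
  constructor
  · intro h'
    obtain ⟨n, rfl⟩ := exists_pow_of_sameCycle hσ h'
    rw [(key n).1]
    exact sameCycle_pow _ _ _
  · intro h'
    obtain ⟨n, rfl⟩ := exists_pow_of_sameCycle hπ h'
    rw [← (key n).1]
    exact sameCycle_pow _ _ _

/-- On `S` the product is `p * γ`. On `-S` it is the negative of `(γ * p)⁻¹`, which has as many
cycles. -/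
theorem nclass_cyc_double_mul (h0 : 0 ∉ I) (hS : IsHalf I S) (hγ : γ ∈ permsOn S)
    (hp : p ∈ permsOn S) : nclass (pm I) (cyc (double p * double γ)) = 2 * nclass S (cyc (p * γ)) := by
  have hdγ := premap_permsOn (double_mem_premaps h0 hS hγ)
  have hdp := premap_permsOn (double_mem_premaps h0 hS hp)
  have f1 := isOfFinOrder_of_mem_permsOn (mul_mem_permsOn hdp hdγ)
  have f2 := isOfFinOrder_of_mem_permsOn (mul_mem_permsOn hp hγ)
  have hq : (γ * p)⁻¹ ∈ permsOn S := inv_mem_permsOn (mul_mem_permsOn hγ hp)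
  have f3 := isOfFinOrder_of_mem_permsOn
    (minus_mem_permsOn (permsOn_mono hS.subset hq))
  have h1 : ∀ x ∈ S, (double p * double γ) x = (p * γ) x := by
    intro x hx
    rw [Equiv.Perm.mul_apply, double_apply_mem hS hγ hx,
      double_apply_mem hS hp (apply_mem_of_mem_permsOn hγ hx), Equiv.Perm.mul_apply]
  have h1' : ∀ x ∈ S, (double p * double γ) x ∈ S := fun x hx => by
    rw [h1 x hx]; exact apply_mem_of_mem_permsOn (mul_mem_permsOn hp hγ) hx
  have h2 : ∀ x ∈ negSet S, (double p * double γ) x = minus (γ * p)⁻¹ x := by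
    intro x hx
    rw [mem_negSet] at hx
    have e := double_apply_neg hS hγ hx
    rw [neg_neg] at e
    rw [Equiv.Perm.mul_apply, e,
      double_apply_neg hS hp (apply_mem_of_mem_permsOn (inv_mem_permsOn hγ) hx), minus_apply,
      mul_inv_rev, Equiv.Perm.mul_apply]
  have h2' : ∀ x ∈ negSet S, (double p * double γ) x ∈ negSet S := by
    intro x hx
    rw [h2 x hx, mem_negSet, minus_apply, neg_neg]
    exact apply_mem_of_mem_permsOn hq (mem_negSet.1 hx)
  rw [hS.nclass_eq (r' := cyc (γ * p)⁻¹), nclass_cyc_inv, nclass_cyc_mul_comm hγ,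
    nclass_congr (r' := cyc (p * γ)), two_mul]
  · intro x hx y _
    exact sameCycle_congr f1 f2 h1' h1 hx
  · intro x hx y _
    rw [cyc_iff, cyc_iff, sameCycle_congr f1 f3 h2' h2 (by rwa [mem_negSet, neg_neg]),
      minus_eq_conj, Equiv.Perm.sameCycle_conj, delta_inv, delta_apply, delta_apply, neg_neg,
      neg_neg]
  · intro x hx y hy hxy
    exact hS.not_neg y hy (by
      obtain ⟨n, hn⟩ := exists_pow_of_sameCycle f1 hxy
      rw [← hn]
      clear hn
      induction n with
      | zero => exact hx
      | succ n ih => rw [pow_succ_apply']; exact h1' _ ih)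

theorem double_one : double 1 = 1 := by rw [double, minus_eq_conj]; group

theorem IsHalf.card_eq (hS : IsHalf I S) : (pm I).card = 2 * S.card := by
  rw [← nclass_cyc_one, ← nclass_cyc_one]
  have := nclass_cyc_double hS (γ := 1) one_mem_permsOn
  rwa [double_one] at this

theorem card_pm (h0 : 0 ∉ I) : (pm I).card = 2 * I.card := by
  rw [(isHalf_posPart h0).card_eq, posPart, Finset.card_image_of_injective _ Nat.cast_injective]

theorem defect_double (h0 : 0 ∉ I) (hS : IsHalf I S) (hγ : γ ∈ permsOn S) (hp : p ∈ permsOn S) :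
    defect (pm I) (double γ) (double p) = 2 * defect S γ p := by
  unfold defect
  rw [nclass_join_double hS hγ hp, nclass_cyc_double hS hγ, nclass_cyc_double hS hp,
    nclass_cyc_double_mul h0 hS hγ hp, hS.card_eq]
  push_cast
  ring

end Double

/-! ### The Euler characteristic in terms of orbits and defect -/

section EulerCharacteristic

/-- The third count in `χ` belongs to the inverse of `γ₋⁻¹ π γ₊`. By cyclic invariance it is the
number of cycles of `π γ₊γ₋⁻¹`, which is the product entering the defect of `double γ` and `π`. -/
theorem two_mul_eulerChar (h0 : 0 ∉ I) (hγ : γ ∈ permsOn (posPart I)) (hπ : π ∈ premaps I) :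
    2 * eulerChar I γ π =
      2 * nclass (pm I) (join (double γ) π) - defect (pm I) (double γ) π := by
  have hγ' := permsOn_pm_of_posPart hγ
  have h1 := two_mul_numCycles_div h0 hπ
  have h2 := two_mul_numCycles_div h0 (double_mem_premaps h0 (isHalf_posPart h0) hγ)
  have h3 := two_mul_numCycles_div h0 (inv_mem_premaps h0 (twist_mem_premaps h0 hγ' hπ))
  have e : (twist γ π)⁻¹ = γ⁻¹ * π⁻¹ * minus γ := by unfold twist; group
  have e2 : nclass (pm I) (cyc (twist γ π)⁻¹) = nclass (pm I) (cyc (π * double γ)) := by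
    rw [nclass_cyc_inv, twist, mul_assoc,
      nclass_cyc_mul_comm (inv_mem_permsOn (minus_mem_permsOn hγ')), double, mul_assoc]
  rw [e2, e] at h3
  unfold double at h2
  unfold eulerChar defect
  have hc := card_pm h0
  rw [hc]
  unfold double at h3 ⊢
  rw [Nat.cast_mul, Nat.cast_ofNat]
  linarith

theorem eulerChar_le_two (h0 : 0 ∉ I) (hγ : γ ∈ permsOn (posPart I)) (hπ : π ∈ premaps I)
    (hc : nclass (pm I) (join (double γ) π) ≤ 2) :
    eulerChar I γ π ≤ 2 ∧ (eulerChar I γ π = 2 ↔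
      nclass (pm I) (join (double γ) π) = 2 ∧ defect (pm I) (double γ) π = 0) := by
  have h1 := two_mul_eulerChar h0 hγ hπ
  have h2 := defect_nonneg
    (premap_permsOn (double_mem_premaps h0 (isHalf_posPart h0) hγ)) (premap_permsOn hπ)
  omega

theorem join_neg_iff (h : minus γ = γ⁻¹) (h' : minus π = π⁻¹) {x y : ℤ} :
    join γ π (-x) (-y) ↔ join γ π x y := by
  have key : ∀ x y, join γ π x y → join γ π (-x) (-y) := by
    have hle : join γ π ≤ Setoid.comap (fun x : ℤ => -x) (join γ π) := by
      refine sup_le ?_ ?_ <;> intro x y hxy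
      · exact cyc_le_join_left γ π ((sameCycle_neg_iff h).2 hxy)
      · exact cyc_le_join_right γ π ((sameCycle_neg_iff h').2 hxy)
    exact fun x y hxy => hle hxy
  refine ⟨fun h => ?_, key x y⟩
  have := key _ _ h
  rwa [neg_neg, neg_neg] at this

/-- The premaps with two orbits and vanishing defect for which `S` is one of the orbits are the
doubles of the planar permutations of `S`. -/
theorem exists_double_iff (h0 : 0 ∉ I) (hS : IsHalf I S) (hne : S.Nonempty) (hγ : γ ∈ permsOn S)
    (hπ : π ∈ premaps I) :
    (nclass (pm I) (join (double γ) π) = 2 ∧ defect (pm I) (double γ) π = 0 ∧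
        ∀ a ∈ S, ∀ b ∈ S, join (double γ) π a b) ↔
      ∃ p ∈ permsOn S, defect S γ p = 0 ∧ (∀ a ∈ S, ∀ b ∈ S, join γ p a b) ∧ double p = π := by
  constructor
  · rintro ⟨h2, hd, hj⟩
    have n1 := ((mem_premaps_iff h0).1 (double_mem_premaps h0 hS hγ)).2.1
    have n2 := ((mem_premaps_iff h0).1 hπ).2.1
    -- If a point of `S` were joined to a point of `-S`, symmetry under negation would leave a
    -- single orbit.
    have hsep : ∀ x ∈ S, ∀ y ∈ S, ¬ join (double γ) π x (-y) := by
      intro x hx y hy hxy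
      have h1 : nclass (pm I) (join (double γ) π) ≤ 1 := by
        rw [nclass_le_one_iff]
        have hall : ∀ z ∈ pm I, join (double γ) π x z := by
          intro z hz
          rcases (hS.mem_iff z).1 hz with h | h
          · exact hj x hx z h
          · have h3 := (join_neg_iff n1 n2).2 (hj y hy _ h)
            rw [neg_neg] at h3
            exact (join _ _).trans hxy h3
        exact fun a ha b hb => (join _ _).trans ((join _ _).symm (hall a ha)) (hall b hb)
      omega
    obtain ⟨p, hp, rfl⟩ := exists_double_eq h0 hS hπ fun x hx => by
      have hx' := apply_mem_of_mem_permsOn (premap_permsOn hπ) (hS.subset hx)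
      rcases (hS.mem_iff _).1 hx' with h | h
      · exact h
      · refine absurd (join_right (double γ) π x) ?_
        have := hsep x hx _ h
        rwa [neg_neg] at this
    refine ⟨p, hp, ?_, fun a ha b hb => ?_, rfl⟩
    · rw [defect_double h0 hS hγ hp] at hd
      omega
    · exact ((join_double_iff hS hγ hp).1 a ha b hb).1 (hj a ha b hb)
  · rintro ⟨p, hp, hd, hj, rfl⟩
    refine ⟨?_, ?_, fun a ha b hb => ((join_double_iff hS hγ hp).1 a ha b hb).2 (hj a ha b hb)⟩
    · rw [nclass_join_double hS hγ hp]
      have h1 := nclass_le_one_iff.2 hj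
      have h2 := nclass_pos (r := join γ p) hne
      omega
    · rw [defect_double h0 hS hγ hp, hd, mul_zero]

theorem permsOn_comm {A B : Finset ℤ} (h : Disjoint A B) (hγ : γ ∈ permsOn A) (hπ : π ∈ permsOn B) :
    γ * π = π * γ := by
  ext x
  rw [Equiv.Perm.mul_apply, Equiv.Perm.mul_apply]
  by_cases hx : x ∈ A
  · rw [mem_permsOn.1 hπ x (Finset.disjoint_left.1 h hx),
      mem_permsOn.1 hπ _ (Finset.disjoint_left.1 h (apply_mem_of_mem_permsOn hγ hx))]
  · rw [mem_permsOn.1 hγ x hx]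
    by_cases hx' : x ∈ B
    · rw [mem_permsOn.1 hγ _ (Finset.disjoint_right.1 h (apply_mem_of_mem_permsOn hπ hx'))]
    · rw [mem_permsOn.1 hπ x hx', mem_permsOn.1 hγ x hx]

theorem mul_apply_left {A B : Finset ℤ} (h : Disjoint A B) (hπ : π ∈ permsOn B) {x : ℤ}
    (hx : x ∈ A) : (γ * π) x = γ x := by
  rw [Equiv.Perm.mul_apply, mem_permsOn.1 hπ x (Finset.disjoint_left.1 h hx)]

theorem mul_apply_right {A B : Finset ℤ} (h : Disjoint A B) (hγ : γ ∈ permsOn A)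
    (hπ : π ∈ permsOn B) {x : ℤ} (hx : x ∈ B) : (γ * π) x = π x := by
  rw [permsOn_comm h hγ hπ]
  exact mul_apply_left h.symm hγ hx

theorem mul_mem_permsOn_union {A B : Finset ℤ} (hγ : γ ∈ permsOn A) (hπ : π ∈ permsOn B) :
    γ * π ∈ permsOn (A ∪ B) :=
  mul_mem_permsOn (permsOn_mono Finset.subset_union_left hγ)
    (permsOn_mono Finset.subset_union_right hπ)

theorem sameCycle_mul_left {A B : Finset ℤ} (h : Disjoint A B) (hγ : γ ∈ permsOn A)
    (hπ : π ∈ permsOn B) {x y : ℤ} (hx : x ∈ A) :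
    (γ * π).SameCycle x y ↔ γ.SameCycle x y := by
  refine (sameCycle_congr (isOfFinOrder_of_mem_permsOn hγ)
    (isOfFinOrder_of_mem_permsOn (mul_mem_permsOn_union hγ hπ))
    (fun x hx => apply_mem_of_mem_permsOn hγ hx) (fun x hx => ?_) hx).symm
  exact (mul_apply_left h hπ hx).symm

theorem sameCycle_mul_right {A B : Finset ℤ} (h : Disjoint A B) (hγ : γ ∈ permsOn A)
    (hπ : π ∈ permsOn B) {x y : ℤ} (hx : x ∈ B) :
    (γ * π).SameCycle x y ↔ π.SameCycle x y := by
  rw [permsOn_comm h hγ hπ]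
  exact sameCycle_mul_left h.symm hπ hγ hx

theorem numCycles_mul {A B : Finset ℤ} (h : Disjoint A B) (hγ : γ ∈ permsOn A)
    (hπ : π ∈ permsOn B) : numCycles (A ∪ B) (γ * π) = numCycles A γ + numCycles B π := by
  rw [numCycles_eq_nclass, nclass_union]
  · congr 1
    · change nclass A (cyc (γ * π)) = nclass A (cyc γ)
      exact nclass_congr fun x hx y _ => sameCycle_mul_left h hγ hπ hx
    · change nclass B (cyc (γ * π)) = nclass B (cyc π)
      exact nclass_congr fun x hx y _ => sameCycle_mul_right h hγ hπ hx
  · intro x hx y hy hxy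
    rw [cyc_iff, sameCycle_mul_left h hγ hπ hx] at hxy
    exact Finset.disjoint_left.1 h (mem_of_sameCycle hγ hxy hx) hy

theorem numCycles_even (h0 : 0 ∉ I) (h : π ∈ premaps I) : 2 ∣ numCycles (pm I) π :=
  ⟨_, numCycles_premap h0 h⟩

/-- All cycle counts are additive over disjoint sets. The permutations being counted are premaps, so
their counts are even and the halves add up as well. -/
theorem eulerChar_mul {γ' π' : Equiv.Perm ℤ} (hJ : 0 ∉ J) (h : Disjoint J K)
    (hγ : γ ∈ permsOn (posPart J)) (hγ' : γ' ∈ permsOn (posPart K)) (hπ : π ∈ premaps J)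
    (hπ' : π' ∈ premaps K) :
    eulerChar (J ∪ K) (γ * γ') (π * π') = eulerChar J γ π + eulerChar K γ' π' := by
  have hd := disjoint_pm h
  have g1 := permsOn_pm_of_posPart hγ
  have g2 := permsOn_pm_of_posPart hγ'
  have p1 := premap_permsOn hπ
  have p2 := premap_permsOn hπ'
  have m1 := minus_mem_permsOn g1
  have m2 := minus_mem_permsOn g2
  have e1 : γ * γ' * (minus (γ * γ'))⁻¹ = (γ * (minus γ)⁻¹) * (γ' * (minus γ')⁻¹) := by
    rw [minus_mul, permsOn_comm hd m1 m2, mul_inv_rev, mul_assoc, ← mul_assoc γ',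
      permsOn_comm hd.symm g2 (inv_mem_permsOn m1)]
    group
  have e2 : (γ * γ')⁻¹ * (π * π')⁻¹ * minus (γ * γ') =
      (γ⁻¹ * π⁻¹ * minus γ) * (γ'⁻¹ * π'⁻¹ * minus γ') := by
    have c1 := permsOn_comm hd (mul_mem_permsOn (inv_mem_permsOn g1) (inv_mem_permsOn p1))
      (inv_mem_permsOn g2)
    have c2 := permsOn_comm hd (mul_mem_permsOn (inv_mem_permsOn p1) m1)
      (inv_mem_permsOn p2)
    have c3 := permsOn_comm hd m1 (mul_mem_permsOn (inv_mem_permsOn g2) (inv_mem_permsOn p2))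
    have c4 := permsOn_comm hd (inv_mem_permsOn g1) (inv_mem_permsOn g2)
    have c5 := permsOn_comm hd (inv_mem_permsOn p1) (inv_mem_permsOn p2)
    have c6 := permsOn_comm hd (inv_mem_permsOn p1) (inv_mem_permsOn g2)
    calc (γ * γ')⁻¹ * (π * π')⁻¹ * minus (γ * γ')
        = (γ'⁻¹ * γ⁻¹) * (π'⁻¹ * π⁻¹) * (minus γ * minus γ') := by
          rw [mul_inv_rev, mul_inv_rev, minus_mul]
      _ = (γ⁻¹ * γ'⁻¹) * (π⁻¹ * π'⁻¹) * (minus γ * minus γ') := by rw [c4, c5]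
      _ = γ⁻¹ * (γ'⁻¹ * π⁻¹) * (π'⁻¹ * minus γ) * minus γ' := by group
      _ = γ⁻¹ * (π⁻¹ * γ'⁻¹) * (π'⁻¹ * minus γ) * minus γ' := by rw [c6]
      _ = γ⁻¹ * π⁻¹ * ((γ'⁻¹ * π'⁻¹) * minus γ) * minus γ' := by group
      _ = γ⁻¹ * π⁻¹ * (minus γ * (γ'⁻¹ * π'⁻¹)) * minus γ' := by rw [c3]
      _ = _ := by group
  unfold eulerChar
  rw [pm_union, e1, e2, numCycles_mul hd (mul_mem_permsOn g1 (inv_mem_permsOn m1))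
    (mul_mem_permsOn g2 (inv_mem_permsOn m2)), numCycles_mul hd p1 p2,
    numCycles_mul hd (mul_mem_permsOn (mul_mem_permsOn (inv_mem_permsOn g1) (inv_mem_permsOn p1)) m1)
    (mul_mem_permsOn (mul_mem_permsOn (inv_mem_permsOn g2) (inv_mem_permsOn p2)) m2),
    Finset.card_union_of_disjoint h]
  have t1 := numCycles_even hJ (double_mem_premaps hJ (isHalf_posPart hJ) hγ)
  have t2 := numCycles_even hJ hπ
  have t3 := numCycles_even hJ (inv_mem_premaps hJ (twist_mem_premaps hJ g1 hπ))
  have e : (twist γ π)⁻¹ = γ⁻¹ * π⁻¹ * minus γ := by unfold twist; group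
  rw [e] at t3
  unfold double at t1
  rw [Nat.add_div_of_dvd_right t1, Nat.add_div_of_dvd_right t2, Nat.add_div_of_dvd_right t3]
  push_cast
  ring

end EulerCharacteristic

/-! ### Conjugation by signs -/

section Signs

variable (ε : ℕ → ℤˣ)

theorem deltaEps_apply (x : ℤ) : deltaEps ε x = (ε x.natAbs : ℤ) * x := rfl

theorem deltaEps_eq (x : ℤ) : deltaEps ε x = x ∨ deltaEps ε x = -x := by
  rw [deltaEps_apply]
  rcases Int.units_eq_one_or (ε x.natAbs) with h | h <;> simp [h]

theorem natAbs_deltaEps (x : ℤ) : (deltaEps ε x).natAbs = x.natAbs := by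
  rcases deltaEps_eq ε x with h | h <;> simp [h]

theorem deltaEps_deltaEps (x : ℤ) : deltaEps ε (deltaEps ε x) = x := by
  rw [deltaEps_apply, natAbs_deltaEps, deltaEps_apply, ← mul_assoc, ← Units.val_mul,
    Int.units_mul_self, Units.val_one, one_mul]

theorem deltaEps_inv : (deltaEps ε)⁻¹ = deltaEps ε := rfl

theorem deltaEps_neg (x : ℤ) : deltaEps ε (-x) = -deltaEps ε x := by
  rw [deltaEps_apply, deltaEps_apply, Int.natAbs_neg, mul_neg]

theorem deltaEps_mem_pm {x : ℤ} : deltaEps ε x ∈ pm I ↔ x ∈ pm I := by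
  rw [mem_pm, mem_pm, natAbs_deltaEps]

/-- `δ_ε π δ_ε`. -/
abbrev signConj (ε : ℕ → ℤˣ) (π : Equiv.Perm ℤ) : Equiv.Perm ℤ := deltaEps ε * π * deltaEps ε

theorem signConj_signConj (π : Equiv.Perm ℤ) : signConj ε (signConj ε π) = π := by
  ext x
  simp only [signConj, Equiv.Perm.mul_apply, deltaEps_deltaEps]

theorem signConj_mul (π σ : Equiv.Perm ℤ) : signConj ε (π * σ) = signConj ε π * signConj ε σ := by
  ext x
  simp only [signConj, Equiv.Perm.mul_apply, deltaEps_deltaEps]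

theorem signConj_inv (π : Equiv.Perm ℤ) : signConj ε π⁻¹ = (signConj ε π)⁻¹ := by
  rw [signConj, signConj, mul_inv_rev, mul_inv_rev, deltaEps_inv, mul_assoc]

theorem signConj_mem_premaps (h0 : 0 ∉ I) (h : π ∈ premaps I) : signConj ε π ∈ premaps I := by
  rw [mem_premaps_iff h0] at *
  refine ⟨mem_permsOn.2 fun k hk => ?_, ?_, fun k hk e => ?_⟩
  · simp only [signConj, Equiv.Perm.mul_apply]
    rw [mem_permsOn.1 h.1 _ (by rwa [deltaEps_mem_pm]), deltaEps_deltaEps]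
  · rw [← signConj_inv, ← h.2.1]
    ext x
    simp only [signConj, Equiv.Perm.mul_apply, minus_apply, deltaEps_neg]
  · refine h.2.2 (deltaEps ε k) ((deltaEps_mem_pm ε).2 hk) ?_
    have := congrArg (deltaEps ε) e
    simpa only [signConj, Equiv.Perm.mul_apply, deltaEps_deltaEps, deltaEps_neg] using this

theorem sameCycle_signConj {x y : ℤ} :
    (signConj ε π).SameCycle x y ↔ π.SameCycle (deltaEps ε x) (deltaEps ε y) := by
  have : signConj ε π = deltaEps ε * π * (deltaEps ε)⁻¹ := rfl
  rw [this, Equiv.Perm.sameCycle_conj]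
  rfl

theorem numCycles_signConj : numCycles (pm I) (signConj ε π) = numCycles (pm I) π :=
  nclass_cyc_conj (deltaEps ε) (fun _ => deltaEps_mem_pm ε) π

theorem connects_signConj : Connects (signConj ε π) (pm J) (pm K) ↔ Connects π (pm J) (pm K) := by
  constructor
  · rintro ⟨a, ha, b, hb, h⟩
    exact ⟨_, (deltaEps_mem_pm ε).2 ha, _, (deltaEps_mem_pm ε).2 hb, (sameCycle_signConj ε).1 h⟩
  · rintro ⟨a, ha, b, hb, h⟩
    refine ⟨_, (deltaEps_mem_pm ε).2 ha, _, (deltaEps_mem_pm ε).2 hb, (sameCycle_signConj ε).2 ?_⟩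
    rwa [deltaEps_deltaEps, deltaEps_deltaEps]

end Signs

end Premaps

/-! ### Premaps of Euler characteristic two for one and two cycles -/

section Cycles

variable {I J K : Finset ℕ} {S : Finset ℤ} {γ π σ p a b : Equiv.Perm ℤ}

theorem double_mul (h : Disjoint J K) (ha : a ∈ permsOn (pm J)) (hb : b ∈ permsOn (pm K)) :
    double (a * b) = double a * double b := by
  have hd := disjoint_pm h
  have m1 := minus_mem_permsOn ha
  have m2 := minus_mem_permsOn hb
  unfold double
  rw [minus_mul, permsOn_comm hd m1 m2, mul_inv_rev, mul_assoc, ← mul_assoc b,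
    permsOn_comm hd.symm hb (inv_mem_permsOn m1)]
  group

/-- Reversing a cycle and negating its entries exchanges the two factors of the double, which
commute. This is why `γ` and `γ_op` have the same double and belong to the same Euler
characteristic. -/
theorem double_minus_inv (hb : b ∈ permsOn (posPart K)) (h0 : 0 ∉ K) :
    double (minus b⁻¹) = double b := by
  have hdis : Disjoint (posPart K) (negSet (posPart K)) := by
    rw [Finset.disjoint_left]
    intro x hx hx'
    exact (isHalf_posPart h0).not_neg x hx (mem_negSet.1 hx')
  have hm : minus b ∈ permsOn (negSet (posPart K)) := by
    rw [mem_permsOn]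
    intro x hx
    rw [minus_apply, mem_permsOn.1 hb _ (fun h => hx (mem_negSet.2 h)), neg_neg]
  rw [double, double, minus_minus, minus_inv, inv_inv, permsOn_comm hdis hb (inv_mem_permsOn hm)]

theorem posPart_nonempty (h : I.Nonempty) : (posPart I).Nonempty := h.image _

theorem minus_double (γ : Equiv.Perm ℤ) : minus (double γ) = (double γ)⁻¹ := by
  rw [double, minus_mul, minus_inv, minus_minus, mul_inv_rev, inv_inv]

theorem exists_join_of_cycle (h0 : 0 ∉ I) (hγ : γ ∈ permsOn (posPart I)) {A : Finset ℤ}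
    (hA : A ⊆ posPart I) (hinv : ∀ x ∈ A, γ x ∈ A) (hc : ∀ x ∈ A, ∀ y ∈ A, γ.SameCycle x y) {x y : ℤ} (hx : x ∈ A) (hy : y ∈ A) :
    join (double γ) π x y := by
  apply cyc_le_join_left
  have hh := isHalf_posPart h0
  exact (sameCycle_congr (isOfFinOrder_of_mem_permsOn hγ)
    (isOfFinOrder_of_mem_permsOn (premap_permsOn (double_mem_premaps h0 hh hγ))) hinv
    (fun x hx => (double_apply_mem hh hγ (hA hx)).symm) hx).1 (hc x hx y hy)

/-- The planar case: `γ` has a single cycle. -/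
theorem eulerChar_disc (h0 : 0 ∉ I) (hne : I.Nonempty) (hγ : γ ∈ permsOn (posPart I))
    (hc : ∀ x ∈ posPart I, ∀ y ∈ posPart I, γ.SameCycle x y) (hπ : π ∈ premaps I) :
    eulerChar I γ π ≤ 2 ∧
      (eulerChar I γ π = 2 ↔ ∃ p ∈ discNC (posPart I) γ, double p = π) := by
  have hh := isHalf_posPart h0
  obtain ⟨x₀, hx₀⟩ := posPart_nonempty hne
  have hj : ∀ x ∈ posPart I, ∀ y ∈ posPart I, join (double γ) π x y := fun x hx y hy =>
    exists_join_of_cycle h0 hγ subset_rfl (fun _ h => apply_mem_of_mem_permsOn hγ h) hc hx hy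
  have n2 := ((mem_premaps_iff h0).1 hπ).2.1
  -- Since `γ` is a single cycle, every point is in the orbit of `x₀` or of `-x₀`.
  have h2 : nclass (pm I) (join (double γ) π) ≤ 2 := by
    refine (nclass_le_card (T := {x₀, -x₀}) fun x hx => ?_).trans Finset.card_le_two
    rcases (hh.mem_iff x).1 hx with h | h
    · exact ⟨x₀, by simp, hj _ h _ hx₀⟩
    · refine ⟨-x₀, by simp, ?_⟩
      have := (join_neg_iff (minus_double γ) n2).2 (hj _ h _ hx₀)
      rwa [neg_neg] at this
  obtain ⟨h3, h4⟩ := eulerChar_le_two h0 hγ hπ h2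
  refine ⟨h3, h4.trans ?_⟩
  have h5 := exists_double_iff h0 hh ⟨x₀, hx₀⟩ hγ hπ
  constructor
  · rintro ⟨h6, h7⟩
    obtain ⟨p, hp, hd, -, e⟩ := h5.1 ⟨h6, h7, hj⟩
    exact ⟨p, (mem_discNC_iff hγ hc).2 ⟨hp, hd⟩, e⟩
  · rintro ⟨p, hp, e⟩
    rw [mem_discNC_iff hγ hc] at hp
    have := h5.2 ⟨p, hp.1, hp.2, fun a ha b hb => cyc_le_join_left _ _ (hc a ha b hb), e⟩
    exact ⟨this.1, this.2.1⟩

theorem isHalf_annular (hJ : 0 ∉ J) (hK : 0 ∉ K) (h : Disjoint J K) :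
    IsHalf (J ∪ K) (posPart J ∪ negPart K) := by
  constructor
  · intro x
    simp only [mem_pm, Finset.mem_union, mem_posPart, mem_negPart, Int.natAbs_neg]
    rcases le_total 0 x with h | h <;> constructor <;> intro h' <;> grind
  · intro x hx hx'
    simp only [Finset.mem_union, mem_posPart, mem_negPart, Int.natAbs_neg] at hx hx'
    have h1 : x.natAbs ∈ J → x.natAbs ∉ K := fun q => Finset.disjoint_left.1 h q
    have h2 : x.natAbs ∈ J ∨ x.natAbs ∈ K := by grind
    have h3 : x ≠ 0 := by
      rintro rfl
      rcases h2 with h2 | h2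
      · exact hJ h2
      · exact hK h2
    grind

theorem minus_inv_mem_permsOn (hb : b ∈ permsOn (posPart K)) : minus b⁻¹ ∈ permsOn (negPart K) := by
  rw [mem_permsOn]
  intro x hx
  have : b⁻¹ (-x) = -x := mem_permsOn.1 (inv_mem_permsOn hb) _ (by
    rw [mem_posPart]; rw [mem_negPart] at hx; rw [Int.natAbs_neg]; grind)
  rw [minus_apply, this, neg_neg]

theorem disjoint_posPart_negPart (h : Disjoint J K) : Disjoint (posPart J) (negPart K) :=
  (disjoint_pm h).mono Finset.subset_union_left Finset.subset_union_right

theorem double_op (hK : 0 ∉ K) (h : Disjoint J K) (ha : a ∈ permsOn (posPart J))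
    (hb : b ∈ permsOn (posPart K)) : double (a * minus b⁻¹) = double (a * b) := by
  rw [double_mul h (permsOn_pm_of_posPart ha) (permsOn_pm_of_posPart hb), double_mul h
    (permsOn_pm_of_posPart ha) (minus_mem_permsOn (inv_mem_permsOn (permsOn_pm_of_posPart hb))),
    double_minus_inv hb hK]

theorem sameCycle_minus_inv {x y : ℤ} :
    (minus b⁻¹).SameCycle x y ↔ b.SameCycle (-x) (-y) := by
  rw [minus_eq_conj, Equiv.Perm.sameCycle_conj, Equiv.Perm.sameCycle_inv]
  rfl

/-- Two single cycles on disjoint sets. -/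
theorem sameCycle_mul_of_cycles {A B : Finset ℤ} (h : Disjoint A B) (ha : a ∈ permsOn A)
    (hb : b ∈ permsOn B) (hca : ∀ x ∈ A, ∀ y ∈ A, a.SameCycle x y)
    (hcb : ∀ x ∈ B, ∀ y ∈ B, b.SameCycle x y) :
    ∀ x ∈ A ∪ B, ∀ y ∈ A ∪ B, ∀ z ∈ A ∪ B, ¬ (a * b).SameCycle x y →
      (a * b).SameCycle x z ∨ (a * b).SameCycle y z := by
  have hA : ∀ x ∈ A, ∀ y ∈ A, (a * b).SameCycle x y := fun x hx y hy =>
    (sameCycle_mul_left h ha hb hx).2 (hca x hx y hy)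
  have hB : ∀ x ∈ B, ∀ y ∈ B, (a * b).SameCycle x y := fun x hx y hy =>
    (sameCycle_mul_right h ha hb hx).2 (hcb x hx y hy)
  intro x hx y hy z hz hxy
  rw [Finset.mem_union] at hx hy hz
  grind

/-- The annular case: `γ` has two cycles, connected by `π`. -/
theorem eulerChar_annular (hJ : 0 ∉ J) (hK : 0 ∉ K) (h : Disjoint J K) (hJn : J.Nonempty)
    (hKn : K.Nonempty) (ha : a ∈ permsOn (posPart J)) (hb : b ∈ permsOn (posPart K))
    (hca : ∀ x ∈ posPart J, ∀ y ∈ posPart J, a.SameCycle x y)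
    (hcb : ∀ x ∈ posPart K, ∀ y ∈ posPart K, b.SameCycle x y) (hπ : π ∈ premaps (J ∪ K)) :
    (Connects π (pm J) (pm K) → eulerChar (J ∪ K) (a * b) π ≤ 2) ∧
    ((Connects π (pm J) (pm K) ∧ eulerChar (J ∪ K) (a * b) π = 2) ↔
      (∃ p ∈ annNC (posPart (J ∪ K)) (a * b), double p = π) ∨
        ∃ p ∈ annNC (posPart J ∪ negPart K) (a * minus b⁻¹), double p = π) ∧
    ¬ ((∃ p ∈ annNC (posPart (J ∪ K)) (a * b), double p = π) ∧
        ∃ p ∈ annNC (posPart J ∪ negPart K) (a * minus b⁻¹), double p = π) := by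
  have h0 : 0 ∉ J ∪ K := by simp [hJ, hK]
  have hh1 := isHalf_posPart h0
  have hh2 := isHalf_annular hJ hK h
  obtain ⟨x₀, hx₀⟩ := posPart_nonempty hJn
  obtain ⟨y₀, hy₀⟩ := posPart_nonempty hKn
  have hd := disjoint_posPart h
  have hd' := disjoint_posPart_negPart h
  have hγ : a * b ∈ permsOn (posPart (J ∪ K)) := by
    rw [posPart_union]; exact mul_mem_permsOn_union ha hb
  have hbm := minus_inv_mem_permsOn hb
  have hγ' : a * minus b⁻¹ ∈ permsOn (posPart J ∪ negPart K) := mul_mem_permsOn_union ha hbm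
  have hop := double_op hK h ha hb
  have hcm : ∀ x ∈ negPart K, ∀ y ∈ negPart K, (minus b⁻¹).SameCycle x y := by
    intro x hx y hy
    rw [sameCycle_minus_inv]
    refine hcb _ ?_ _ ?_ <;> rw [mem_negPart] at * <;> rw [mem_posPart, Int.natAbs_neg] <;> grind
  have m1 := mem_annNC_iff (π := π) hγ (by
    rw [posPart_union]; exact sameCycle_mul_of_cycles hd ha hb hca hcb)
  have hann1 : ∀ p, p ∈ annNC (posPart (J ∪ K)) (a * b) ↔ _ := fun p => mem_annNC_iff (π := p) hγ (by
    rw [posPart_union]; exact sameCycle_mul_of_cycles hd ha hb hca hcb)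
  have hann2 : ∀ p, p ∈ annNC (posPart J ∪ negPart K) (a * minus b⁻¹) ↔ _ := fun p =>
    mem_annNC_iff (π := p) hγ' (sameCycle_mul_of_cycles hd' ha hbm hca hcm)
  set r := join (double (a * b)) π with hr
  have n2 := ((mem_premaps_iff h0).1 hπ).2.1
  have hneg : ∀ {x y}, r (-x) (-y) ↔ r x y := join_neg_iff (minus_double _) n2
  have hneg' : ∀ {x y}, r x y → r (-x) (-y) := fun h => hneg.2 h
  have hJr : ∀ x ∈ posPart J, r x x₀ := fun x hx =>
    exists_join_of_cycle h0 hγ (A := posPart J) (by rw [posPart_union]; exact Finset.subset_union_left)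
      (fun x hx => by rw [mul_apply_left hd hb hx]; exact apply_mem_of_mem_permsOn ha hx)
      (fun x hx y hy => (sameCycle_mul_left hd ha hb hx).2 (hca x hx y hy)) hx hx₀
  have hKr : ∀ x ∈ posPart K, r x y₀ := fun x hx =>
    exists_join_of_cycle h0 hγ (A := posPart K) (by rw [posPart_union]; exact Finset.subset_union_right)
      (fun x hx => by rw [mul_apply_right hd ha hb hx]; exact apply_mem_of_mem_permsOn hb hx)
      (fun x hx y hy => (sameCycle_mul_right hd ha hb hx).2 (hcb x hx y hy)) hx hy₀
  have hJr' : ∀ x ∈ pm J, r x x₀ ∨ r x (-x₀) := fun x hx => by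
    rcases ((isHalf_posPart hJ).mem_iff x).1 hx with h | h
    · exact Or.inl (hJr x h)
    · have := hneg' (hJr _ h)
      rw [neg_neg] at this
      exact Or.inr this
  have hKr' : ∀ x ∈ pm K, r x y₀ ∨ r x (-y₀) := fun x hx => by
    rcases ((isHalf_posPart hK).mem_iff x).1 hx with h | h
    · exact Or.inl (hKr x h)
    · have := hneg' (hKr _ h)
      rw [neg_neg] at this
      exact Or.inr this
  have hs : ∀ {x y}, r x y → r y x := fun h => r.symm h
  have ht : ∀ {x y z}, r x y → r y z → r x z := fun h h' => r.trans h h'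
  have hconn : Connects π (pm J) (pm K) → r x₀ y₀ ∨ r x₀ (-y₀) := by
    rintro ⟨x, hx, y, hy, hxy⟩
    have hxy' : r x y := cyc_le_join_right _ _ hxy
    rcases hJr' x hx with h1 | h1 <;> rcases hKr' y hy with h2 | h2
    · exact Or.inl (ht (hs h1) (ht hxy' h2))
    · exact Or.inr (ht (hs h1) (ht hxy' h2))
    · have := hneg' (ht (hs h1) (ht hxy' h2))
      rw [neg_neg] at this
      exact Or.inr this
    · have := hneg' (ht (hs h1) (ht hxy' h2))
      rw [neg_neg, neg_neg] at this
      exact Or.inl this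
  -- If `π` connects nothing, both `π` and `double (a * b)` preserve `±J`, and no orbit leaves `±J`.
  have hconn' : r x₀ y₀ ∨ r x₀ (-y₀) → Connects π (pm J) (pm K) := by
    intro hj
    by_contra hn
    have hpres : ∀ x, x ∈ pm J ↔ π x ∈ pm J := by
      have key : ∀ x ∈ pm J, ∀ y, π.SameCycle x y → y ∈ pm J := by
        intro x hx y hxy
        have hy := mem_of_sameCycle (premap_permsOn hπ) hxy (by
          rw [pm_union]; exact Finset.mem_union_left _ hx)
        rw [pm_union, Finset.mem_union] at hy
        exact hy.resolve_right fun hy => hn ⟨x, hx, y, hy, hxy⟩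
      exact fun x => ⟨fun hx => key x hx _ (sameCycle_apply_self π x),
        fun hx => key _ hx _ (sameCycle_apply_self π x).symm⟩
    have hpres' : ∀ x, x ∈ pm J ↔ double (a * b) x ∈ pm J := by
      intro x
      rw [double_mul h (permsOn_pm_of_posPart ha) (permsOn_pm_of_posPart hb)]
      have q1 : double a ∈ permsOn (pm J) :=
        premap_permsOn (double_mem_premaps hJ (isHalf_posPart hJ) ha)
      have q2 : double b ∈ permsOn (pm K) :=
        premap_permsOn (double_mem_premaps hK (isHalf_posPart hK) hb)
      rw [Equiv.Perm.mul_apply, apply_mem_iff_of_mem_permsOn q1]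
      by_cases hx : x ∈ pm K
      · have h1 := Finset.disjoint_right.1 (disjoint_pm h) hx
        have h2 := Finset.disjoint_right.1 (disjoint_pm h) (apply_mem_of_mem_permsOn q2 hx)
        exact iff_of_false h1 h2
      · rw [mem_permsOn.1 q2 x hx]
    have hle : r ≤ Setoid.ker (fun x => x ∈ pm J) := by
      refine join_le (fun x => ?_) (fun x => ?_)
      · exact propext (hpres' x)
      · exact propext (hpres x)
    have hx : x₀ ∈ pm J := posPart_subset_pm hx₀
    have hy : y₀ ∈ pm K := posPart_subset_pm hy₀
    have hy' : -y₀ ∈ pm K := neg_mem_pm.2 hy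
    rcases hj with hj | hj
    · exact Finset.disjoint_left.1 (disjoint_pm h) ((hle hj).mp hx) hy
    · exact Finset.disjoint_left.1 (disjoint_pm h) ((hle hj).mp hx) hy'
  have hc2 : Connects π (pm J) (pm K) → nclass (pm (J ∪ K)) r ≤ 2 := by
    intro hC
    refine (nclass_le_card (T := {x₀, -x₀}) fun x hx => ?_).trans Finset.card_le_two
    rw [pm_union, Finset.mem_union] at hx
    have : r x x₀ ∨ r x (-x₀) := by
      rcases hx with hx | hx
      · exact hJr' x hx
      · rcases hKr' x hx with h1 | h1 <;> rcases hconn hC with h2 | h2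
        · exact Or.inl (ht h1 (hs h2))
        · have := hneg' h2
          rw [neg_neg] at this
          exact Or.inr (ht h1 (hs this))
        · exact Or.inr (ht h1 (hs (hneg' h2)))
        · exact Or.inl (ht h1 (hs h2))
    rcases this with h | h
    · exact ⟨_, by simp, h⟩
    · exact ⟨_, by simp, h⟩
  have hall1 : r x₀ y₀ ↔ ∀ x ∈ posPart (J ∪ K), ∀ y ∈ posPart (J ∪ K), r x y := by
    rw [posPart_union]
    refine ⟨fun hj => ?_, fun hj => hj _ (Finset.mem_union_left _ hx₀) _ (Finset.mem_union_right _ hy₀)⟩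
    have : ∀ x ∈ posPart J ∪ posPart K, r x x₀ := by
      intro x hx
      rcases Finset.mem_union.1 hx with hx | hx
      · exact hJr x hx
      · exact ht (hKr x hx) (hs hj)
    exact fun x hx y hy => ht (this x hx) (hs (this y hy))
  have hny : -y₀ ∈ negPart K := by
    rw [mem_negPart, Int.natAbs_neg]; rw [mem_posPart] at hy₀; grind
  have hall2 : r x₀ (-y₀) ↔ ∀ x ∈ posPart J ∪ negPart K, ∀ y ∈ posPart J ∪ negPart K, r x y := by
    refine ⟨fun hj => ?_, fun hj => hj _ (Finset.mem_union_left _ hx₀) _ (Finset.mem_union_right _ hny)⟩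
    have : ∀ x ∈ posPart J ∪ negPart K, r x x₀ := by
      intro x hx
      rcases Finset.mem_union.1 hx with hx | hx
      · exact hJr x hx
      · have hx' : -x ∈ posPart K := by
          rw [mem_posPart, Int.natAbs_neg]; rw [mem_negPart] at hx; grind
        have := hneg' (hKr _ hx')
        rw [neg_neg] at this
        exact ht this (hs hj)
    exact fun x hx y hy => ht (this x hx) (hs (this y hy))
  have e1 := exists_double_iff h0 hh1 (posPart_nonempty (hJn.inl)) hγ hπ
  have e2 := exists_double_iff h0 hh2 ((posPart_nonempty hJn).inl) hγ' hπ
  rw [hop] at e2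
  rw [← hr, ← hall1] at e1
  rw [← hr, ← hall2] at e2
  -- The two families correspond to the two possible half orbits: the orbit of `x₀` contains `y₀`
  -- for `γ`, and `-y₀` for `γ_op`.
  have f1 : (∃ p ∈ annNC (posPart (J ∪ K)) (a * b), double p = π) ↔
      nclass (pm (J ∪ K)) r = 2 ∧ defect (pm (J ∪ K)) (double (a * b)) π = 0 ∧ r x₀ y₀ := by
    rw [e1]
    exact exists_congr fun p => by rw [hann1]; simp only [and_assoc]
  have f2 : (∃ p ∈ annNC (posPart J ∪ negPart K) (a * minus b⁻¹), double p = π) ↔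
      nclass (pm (J ∪ K)) r = 2 ∧ defect (pm (J ∪ K)) (double (a * b)) π = 0 ∧ r x₀ (-y₀) := by
    rw [e2]
    exact exists_congr fun p => by rw [hann2]; simp only [and_assoc]
  rw [f1, f2]
  refine ⟨fun hC => (eulerChar_le_two h0 hγ hπ (hc2 hC)).1, ⟨?_, ?_⟩, ?_⟩
  · rintro ⟨hC, h2⟩
    obtain ⟨h3, h4⟩ := (eulerChar_le_two h0 hγ hπ (hc2 hC)).2.1 h2
    exact (hconn hC).imp (fun h => ⟨h3, h4, h⟩) (fun h => ⟨h3, h4, h⟩)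
  · intro hj
    have hC : Connects π (pm J) (pm K) := hconn' (hj.imp (fun h => h.2.2) (fun h => h.2.2))
    refine ⟨hC, (eulerChar_le_two h0 hγ hπ (hc2 hC)).2.2 ?_⟩
    rcases hj with hj | hj
    · exact ⟨hj.1, hj.2.1⟩
    · exact ⟨hj.1, hj.2.1⟩
  -- If `x₀` is joined to both `y₀` and `-y₀`, it is joined to `-x₀`, and only one orbit is left.
  · rintro ⟨⟨h1, -, h2⟩, -, -, h3⟩
    have h4 := hneg' h2
    have h5 : r x₀ (-x₀) := ht h3 (hs h4)
    have hC := hconn' (Or.inl h2)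
    have : nclass (pm (J ∪ K)) r ≤ 1 := by
      rw [nclass_le_one_iff]
      have : ∀ x ∈ pm (J ∪ K), r x x₀ := by
        intro x hx
        rw [pm_union, Finset.mem_union] at hx
        rcases hx with hx | hx
        · rcases hJr' x hx with h | h
          · exact h
          · exact ht h (hs h5)
        · rcases hKr' x hx with h | h
          · exact ht h (hs h2)
          · exact ht h (hs h3)
      exact fun x hx y hy => ht (this x hx) (hs (this y hy))
    omega

end Cycles

/-! ### The cycles on intervals -/

section Intervals

theorem mem_posPart_Icc {m n : ℕ} {x : ℤ} :
    x ∈ posPart (Finset.Icc (m + 1) (m + n)) ↔ ∃ i < n, x = (m : ℤ) + (i : ℕ) + 1 := by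
  rw [mem_posPart, Finset.mem_Icc]
  constructor
  · intro h
    exact ⟨x.natAbs - (m + 1), by omega, by omega⟩
  · rintro ⟨i, hi, rfl⟩
    omega

/-- In the definition the list of naturals is coerced to integers as a whole, by a monadic lift;
here the cast is moved inside the map. -/
theorem posCycle_eq_formPerm (m n : ℕ) :
    posCycle m n = ((List.range n).map (fun i : ℕ => (m : ℤ) + (i : ℤ) + 1)).formPerm := by
  unfold posCycle
  congr 1
  change List.map _ (List.flatMap (pure ∘ Nat.cast) _) = _
  rw [List.flatMap_pure_eq_map, List.map_map]
  rfl

theorem opCycle_eq_formPerm (m n : ℕ) :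
    opCycle m n = ((List.range n).map (fun i : ℕ => (i : ℤ) - ((m : ℤ) + (n : ℤ)))).formPerm := by
  unfold opCycle
  congr 1
  change List.map _ (List.flatMap (pure ∘ Nat.cast) _) = _
  rw [List.flatMap_pure_eq_map, List.map_map]
  rfl

theorem posList_nodup (m n : ℕ) :
    ((List.range n).map (fun i : ℕ => (m : ℤ) + (i : ℤ) + 1)).Nodup :=
  List.Nodup.map (fun i j h => by simpa using h) List.nodup_range

theorem posCycle_mem (m n : ℕ) :
    posCycle m n ∈ permsOn (posPart (Finset.Icc (m + 1) (m + n))) := by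
  rw [mem_permsOn]
  intro x hx
  rw [posCycle_eq_formPerm]
  apply List.formPerm_apply_of_notMem
  rw [mem_posPart_Icc] at hx
  simp only [List.mem_map, List.mem_range, not_exists, not_and]
  exact fun i hi e => hx ⟨i, hi, e.symm⟩

theorem posCycle_pow_apply {m n i : ℕ} (hi : i < n) (j : ℕ) :
    (posCycle m n ^ j) ((m : ℤ) + i + 1) = (m : ℤ) + ((i + j) % n : ℕ) + 1 := by
  have h := List.formPerm_pow_apply_getElem _ (posList_nodup m n) j i (by simpa using hi)
  rw [posCycle_eq_formPerm]
  simpa using h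

theorem posCycle_sameCycle (m n : ℕ) : ∀ x ∈ posPart (Finset.Icc (m + 1) (m + n)),
    ∀ y ∈ posPart (Finset.Icc (m + 1) (m + n)), (posCycle m n).SameCycle x y := by
  have key : ∀ x ∈ posPart (Finset.Icc (m + 1) (m + n)),
      (posCycle m n).SameCycle ((m : ℤ) + (0 : ℕ) + 1) x := by
    intro x hx
    obtain ⟨i, hi, rfl⟩ := mem_posPart_Icc.1 hx
    have h := sameCycle_pow (posCycle m n) i ((m : ℤ) + (0 : ℕ) + 1)
    rwa [posCycle_pow_apply (by omega), zero_add, Nat.mod_eq_of_lt hi] at h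
  exact fun x hx y hy => (key x hx).symm.trans (key y hy)

/-- The list `-m-n, …, -m-1` is the list `m+1, …, m+n` reversed and negated. Reversal inverts the
cycle, and negation conjugates it by `δ`. -/
theorem opCycle_eq (m n : ℕ) : opCycle m n = minus (posCycle m n)⁻¹ := by
  rw [opCycle_eq_formPerm, posCycle_eq_formPerm, ← List.formPerm_reverse]
  have hlist : (List.range n).map (fun i : ℕ => (i : ℤ) - ((m : ℤ) + (n : ℤ))) =
      (((List.range n).map (fun i : ℕ => (m : ℤ) + (i : ℤ) + 1)).reverse).map delta := by
    apply List.ext_getElem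
    · simp
    · intro i h1 h2
      simp only [List.length_map, List.length_range] at h1
      simp only [List.getElem_map, List.getElem_range, List.getElem_reverse, List.length_map,
        List.length_range, delta_apply]
      omega
  rw [hlist]
  set l := ((List.range n).map (fun i : ℕ => (m : ℤ) + (i : ℤ) + 1)).reverse with hl
  have hnd : l.Nodup := List.nodup_reverse.2 (posList_nodup m n)
  clear_value l
  clear hl hlist
  ext x
  rw [minus_apply]
  by_cases hx : -x ∈ l
  · obtain ⟨i, hi, e⟩ := List.getElem_of_mem hx
    rw [← e, List.formPerm_apply_getElem _ hnd]
    have hnd' : (l.map delta).Nodup := hnd.map delta.injective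
    have e' : x = (l.map delta)[i]'(by simpa using hi) := by
      rw [List.getElem_map, e, delta_apply, neg_neg]
    conv_lhs => rw [e']
    rw [List.formPerm_apply_getElem _ hnd', List.getElem_map, delta_apply]
    simp
  · rw [List.formPerm_apply_of_notMem hx, neg_neg]
    apply List.formPerm_apply_of_notMem
    intro h
    obtain ⟨y, hy, e⟩ := List.mem_map.1 h
    rw [delta_apply] at e
    exact hx (by rwa [← e, neg_neg])

end Intervals

/-! ### The limit sums as sums over premaps -/

section LimitSums

variable {Λ : Type*} {I : Finset ℕ} {S : Finset ℤ}

open scoped Classical in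
-- The change of variable `p ↦ δ_ε p₊p₋⁻¹ δ_ε` is injective on the permutations of a half. It makes
-- sums for different halves comparable, since both become sums over subsets of the same set of
-- premaps.
theorem limitSum_eq (G : GenusData Λ) (lam : ℕ → Λ) (ε : ℕ → ℤˣ) (n : ℕ)
    {P : Finset (Equiv.Perm ℤ)} (hS : IsHalf (Finset.Icc 1 n) S) (hP : P ⊆ permsOn S) :
    limitSum G lam ε n P =
      ∑ π ∈ (G.PM (Finset.Icc 1 n)).filter (fun π => ∃ p ∈ P, double p = signConj ε π),
        limUnder atTop (fun N : ℕ => G.f N (Finset.Icc 1 n) lam π) := by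
  unfold limitSum
  refine Finset.sum_bij (fun p _ => signConj ε (double p)) ?_ ?_ ?_ ?_
  · intro p hp
    rw [Finset.mem_filter] at hp ⊢
    exact ⟨hp.2, p, hp.1, (signConj_signConj ε _).symm⟩
  · intro p hp q hq e
    rw [Finset.mem_filter] at hp hq
    refine double_injOn hS (hP hp.1) (hP hq.1) ?_
    have := congrArg (signConj ε) e
    rwa [signConj_signConj, signConj_signConj] at this
  · intro π hπ
    obtain ⟨h1, p, hp, e⟩ := Finset.mem_filter.1 hπ
    refine ⟨p, ?_, ?_⟩
    · rw [Finset.mem_filter]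
      refine ⟨hp, ?_⟩
      change signConj ε (double p) ∈ _
      rwa [e, signConj_signConj]
    · rw [e, signConj_signConj]
  · intro p _
    rfl

open scoped Classical in
theorem limitSum_disc (G : GenusData Λ) (hG : G.IsMultiplicative) (lam : ℕ → Λ) (ε : ℕ → ℤˣ)
    (n : ℕ) (hn : 1 ≤ n) :
    limitSum G lam ε n (discNC (posPart (Finset.Icc 1 n)) (posCycle 0 n)) =
      ∑ π ∈ (G.PM (Finset.Icc 1 n)).filter
          (fun π => eulerChar (Finset.Icc 1 n) (posCycle 0 n) (signConj ε π) = 2),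
        limUnder atTop (fun N : ℕ => G.f N (Finset.Icc 1 n) lam π) := by
  have h0 : 0 ∉ Finset.Icc 1 n := by simp
  rw [limitSum_eq G lam ε n (isHalf_posPart h0) (P := discNC _ _) (Finset.filter_subset _ _)]
  congr 1
  refine Finset.filter_congr fun π hπ => ?_
  have h1 := posCycle_mem 0 n
  have h2 := posCycle_sameCycle 0 n
  rw [zero_add, zero_add] at h1 h2
  exact (eulerChar_disc h0 ⟨1, by simp [hn]⟩ h1 h2
    (signConj_mem_premaps ε h0 (hG.subset _ h0 hπ))).2.symm

theorem Icc_union_Icc (m n : ℕ) :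
    Finset.Icc 1 m ∪ Finset.Icc (m + 1) (m + n) = Finset.Icc 1 (m + n) := by
  ext x; simp only [Finset.mem_union, Finset.mem_Icc]; omega

open scoped Classical in
-- By `eulerChar_annular` the two orientations select disjoint sets of premaps, whose union consists
-- of the connecting ones with `χ = 2`.
theorem limitSum_annular (G : GenusData Λ) (hG : G.IsMultiplicative) (lam : ℕ → Λ) (ε : ℕ → ℤˣ)
    (m n : ℕ) (hm : 1 ≤ m) (hn : 1 ≤ n) :
    limitSum G lam ε (m + n)
          (annNC (posPart (Finset.Icc 1 (m + n))) (posCycle 0 m * posCycle m n)) +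
        limitSum G lam ε (m + n)
          (annNC (posPart (Finset.Icc 1 m) ∪ negPart (Finset.Icc (m + 1) (m + n)))
            (posCycle 0 m * opCycle m n)) =
      ∑ π ∈ (G.PM (Finset.Icc 1 (m + n))).filter (fun π =>
          Connects π (pm (Finset.Icc 1 m)) (pm (Finset.Icc (m + 1) (m + n))) ∧
          eulerChar (Finset.Icc 1 (m + n)) (posCycle 0 m * posCycle m n) (signConj ε π) = 2),
        limUnder atTop (fun N : ℕ => G.f N (Finset.Icc 1 (m + n)) lam π) := by
  have h0 : 0 ∉ Finset.Icc 1 (m + n) := by simp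
  have hJ : 0 ∉ Finset.Icc 1 m := by simp
  have hK : 0 ∉ Finset.Icc (m + 1) (m + n) := by simp
  have hd : Disjoint (Finset.Icc 1 m) (Finset.Icc (m + 1) (m + n)) := by
    rw [Finset.disjoint_left]; intro x; simp only [Finset.mem_Icc]; omega
  have hh2 := isHalf_annular hJ hK hd
  rw [Icc_union_Icc] at hh2
  rw [limitSum_eq G lam ε _ (isHalf_posPart h0) (P := annNC _ _) (Finset.filter_subset _ _),
    limitSum_eq G lam ε _ hh2 (P := annNC _ _) (Finset.filter_subset _ _)]
  have h1 := posCycle_mem 0 m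
  have h2 := posCycle_sameCycle 0 m
  rw [zero_add, zero_add] at h1 h2
  have key : ∀ π ∈ G.PM (Finset.Icc 1 (m + n)), _ := fun π hπ =>
    eulerChar_annular (π := signConj ε π) hJ hK hd ⟨1, by simp [hm]⟩ ⟨m + 1, by simp [hn]⟩ h1
      (posCycle_mem m n) h2 (posCycle_sameCycle m n) (by
        rw [Icc_union_Icc]; exact signConj_mem_premaps ε h0 (hG.subset _ h0 hπ))
  simp only [Icc_union_Icc, connects_signConj, ← opCycle_eq] at key
  rw [← Finset.sum_union]
  · rw [← Finset.filter_or]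
    congr 1
    exact Finset.filter_congr fun π hπ => (key π hπ).2.1.symm
  · rw [Finset.disjoint_filter]
    exact fun π hπ q1 q2 => (key π hπ).2.2 ⟨q1, q2⟩

end LimitSums

/-! ### Random variables with moments of all orders -/

section Moments

variable {Ω : Type*} [MeasurableSpace Ω] {μ : Measure Ω}

/-- `f` has moments of all orders. -/
def HasMoments (μ : Measure Ω) (f : Ω → ℂ) : Prop := ∀ p : ENNReal, p ≠ ⊤ → MemLp f p μ

theorem HasMoments.add {f g : Ω → ℂ} (hf : HasMoments μ f) (hg : HasMoments μ g) :
    HasMoments μ (fun ω => f ω + g ω) := fun p hp => (hf p hp).add (hg p hp)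

theorem HasMoments.mul {f g : Ω → ℂ} (hf : HasMoments μ f) (hg : HasMoments μ g) :
    HasMoments μ (fun ω => f ω * g ω) := by
  intro p hp
  have h2 : 2 * p ≠ ⊤ := ENNReal.mul_ne_top (by simp) hp
  have : ENNReal.HolderTriple (2 * p) (2 * p) p := ⟨by
    rw [ENNReal.mul_inv (by simp) (by simp), ← add_mul, ENNReal.inv_two_add_inv_two, one_mul]⟩
  exact (hg _ h2).mul (hf _ h2)

theorem HasMoments.const [IsFiniteMeasure μ] (c : ℂ) : HasMoments μ (fun _ => c) :=
  fun _ _ => memLp_const c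

theorem HasMoments.const_mul {f : Ω → ℂ} (hf : HasMoments μ f) (c : ℂ) :
    HasMoments μ (fun ω => c * f ω) := fun p hp => (hf p hp).const_mul c

theorem HasMoments.sum {ι : Type*} {s : Finset ι} {f : ι → Ω → ℂ}
    (hf : ∀ i ∈ s, HasMoments μ (f i)) : HasMoments μ (fun ω => ∑ i ∈ s, f i ω) :=
  fun p hp => memLp_finsetSum s fun i hi => hf i hi p hp

theorem HasMoments.prod [IsFiniteMeasure μ] {ι : Type*} {s : Finset ι} {f : ι → Ω → ℂ}
    (hf : ∀ i ∈ s, HasMoments μ (f i)) : HasMoments μ (fun ω => ∏ i ∈ s, f i ω) := by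
  classical
  induction s using Finset.induction_on with
  | empty => simpa using HasMoments.const 1
  | insert a s ha ih =>
    have h1 := (hf a (Finset.mem_insert_self a s)).mul
      (ih fun i hi => hf i (Finset.mem_insert_of_mem hi))
    refine fun p hp => (h1 p hp).ae_eq (Eventually.of_forall fun ω => ?_)
    simp only [Finset.prod_insert ha]

theorem HasMoments.integrable {f : Ω → ℂ} (hf : HasMoments μ f) : Integrable f μ :=
  memLp_one_iff_integrable.1 (hf 1 (by simp))

end Moments

/-! ### Partitions sorted by the block of a given element -/

section Partitions

variable {α : Type*} [DecidableEq α] {R : Type*} [CommSemiring R]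

/-- The partitions of `B` are the pairs of a part containing `a` and a partition of the rest. -/
theorem sum_finpartition_eq (κ : Finset α → R) {B : Finset α} {a : α} (ha : a ∈ B) :
    ∑ π : Finpartition B, ∏ V ∈ π.parts, κ V =
      ∑ V ∈ B.powerset.filter (fun V => a ∈ V),
        κ V * ∑ π : Finpartition (B \ V), ∏ W ∈ π.parts, κ W := by
  simp_rw [Finset.mul_sum]
  rw [Finset.sum_sigma']
  symm
  have hmem : ∀ x : (V : Finset α) × Finpartition (B \ V),
      x ∈ (B.powerset.filter (fun V => a ∈ V)).sigma (fun V => Finset.univ) ↔ x.1 ⊆ B ∧ a ∈ x.1 := by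
    intro x
    rw [Finset.mem_sigma, Finset.mem_filter, Finset.mem_powerset]
    simp
  let e : ∀ x : (V : Finset α) × Finpartition (B \ V),
      x ∈ (B.powerset.filter (fun V => a ∈ V)).sigma (fun V => Finset.univ) → Finpartition B :=
    fun x hx => x.2.extend (b := x.1) (Finset.nonempty_iff_ne_empty.1 ⟨a, ((hmem x).1 hx).2⟩)
      Finset.sdiff_disjoint (Finset.sdiff_union_of_subset ((hmem x).1 hx).1)
  have hparts : ∀ x hx, (e x hx).parts = insert x.1 x.2.parts := fun _ _ => rfl
  have hnot : ∀ x : (V : Finset α) × Finpartition (B \ V), a ∈ x.1 → x.1 ∉ x.2.parts :=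
    fun x hx h => (Finset.mem_sdiff.1 (x.2.le h hx)).2 hx
  refine Finset.sum_bij e (fun _ _ => Finset.mem_univ _) ?_ ?_ ?_
  · rintro ⟨V, π⟩ hx ⟨V', π'⟩ hx' h
    have h1 : insert V π.parts = insert V' π'.parts := by
      rw [← hparts _ hx, ← hparts _ hx', h]
    have h2 := ((hmem _).1 hx).2
    have h3 := ((hmem _).1 hx').2
    have h4 : V = V' := by
      have h5 : V ∈ insert V' π'.parts := h1 ▸ Finset.mem_insert_self _ _
      rcases Finset.mem_insert.1 h5 with h5 | h5
      · exact h5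
      · exact absurd h3 (Finset.mem_sdiff.1 (π'.le h5 h2)).2
    subst h4
    have h6 : π.parts = π'.parts := by
      rw [← Finset.erase_insert (hnot ⟨V, π⟩ h2), h1, Finset.erase_insert (hnot ⟨V, π'⟩ h2)]
    rw [Finpartition.ext h6]
  · intro π _
    have hV : π.part a ∈ π.parts := π.part_mem.2 ha
    have haV : a ∈ π.part a := π.mem_part_self.2 ha
    have hx := (hmem ⟨π.part a, π.avoid (π.part a)⟩).2 ⟨π.part_subset a, haV⟩
    refine ⟨_, hx, ?_⟩
    apply Finpartition.ext
    rw [hparts _ hx]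
    ext W
    simp only [Finset.mem_insert, Finpartition.mem_avoid]
    have hdis : ∀ D ∈ π.parts, D ≠ π.part a → D \ π.part a = D := fun D hD hne =>
      sdiff_eq_left.2 (π.disjoint hD hV hne)
    constructor
    · rintro (rfl | ⟨D, hD, hle, rfl⟩)
      · exact hV
      · rwa [hdis D hD (fun h => hle h.le)]
    · intro hW
      by_cases h : W = π.part a
      · exact Or.inl h
      · refine Or.inr ⟨W, hW, fun hle => ?_, hdis W hW h⟩
        exact π.ne_bot hW (disjoint_self.1 ((π.disjoint hW hV h).mono_right hle))
  · intro x hx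
    rw [hparts x hx, Finset.prod_insert (hnot x ((hmem x).1 hx).2)]

end Partitions

/-! ### Cumulants through their recursion -/

section Cumulants

variable {Ω : Type*} [MeasurableSpace Ω] {μ : Measure Ω} [IsProbabilityMeasure μ] {r : ℕ}

/-- The case `B = ∅` is included, where both sides are 1 because `μ` is a probability measure. The
recursion needs it for the complement of a full block. -/
theorem moment_eq_sum_finpartition (Z : Fin r → Ω → ℂ) (B : Finset (Fin r)) :
    ∫ ω, ∏ i ∈ B, Z i ω ∂μ = ∑ π : Finpartition B, ∏ V ∈ π.parts, cumulantOn μ Z V := by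
  rcases B.eq_empty_or_nonempty with rfl | h
  · rw [← Finset.bot_eq_empty, Fintype.sum_unique]
    simp only [Finset.bot_eq_empty, Finset.prod_empty, integral_const, probReal_univ, one_smul]
    exact Finset.prod_empty.symm
  · exact moment_eq_sum_cumulantOn μ Z B h

/-- The recursion for moments in terms of the cumulants of the sets that contain a given index. -/
theorem moment_eq_sum_cumulantOn_mul (Z : Fin r → Ω → ℂ) {B : Finset (Fin r)} {a : Fin r}
    (ha : a ∈ B) :
    ∫ ω, ∏ i ∈ B, Z i ω ∂μ = ∑ V ∈ B.powerset.filter (fun V => a ∈ V),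
      cumulantOn μ Z V * ∫ ω, ∏ i ∈ B \ V, Z i ω ∂μ := by
  simp_rw [moment_eq_sum_finpartition]
  exact sum_finpartition_eq _ ha

/-- The recursion determines the cumulants. -/
theorem cumulantOn_eq_of_recursion (Z : Fin r → Ω → ℂ) (K : Finset (Fin r) → ℂ)
    (h : ∀ B : Finset (Fin r), B.Nonempty → ∃ a ∈ B,
      ∫ ω, ∏ i ∈ B, Z i ω ∂μ = ∑ V ∈ B.powerset.filter (fun V => a ∈ V),
        K V * ∫ ω, ∏ i ∈ B \ V, Z i ω ∂μ) {B : Finset (Fin r)} (hB : B.Nonempty) :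
    cumulantOn μ Z B = K B := by
  induction B using Finset.strongInduction with
  | H B ih =>
    obtain ⟨a, ha, h1⟩ := h B hB
    have h2 := moment_eq_sum_cumulantOn_mul (μ := μ) Z ha
    rw [h1] at h2
    have hBm : B ∈ B.powerset.filter (fun V => a ∈ V) := by simp [ha]
    rw [← Finset.add_sum_erase _ _ hBm, ← Finset.add_sum_erase _ _ hBm] at h2
    have h3 : ∑ V ∈ (B.powerset.filter (fun V => a ∈ V)).erase B,
        K V * ∫ ω, ∏ i ∈ B \ V, Z i ω ∂μ = ∑ V ∈ (B.powerset.filter (fun V => a ∈ V)).erase B,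
        cumulantOn μ Z V * ∫ ω, ∏ i ∈ B \ V, Z i ω ∂μ := by
      refine Finset.sum_congr rfl fun V hV => ?_
      simp only [Finset.mem_erase, Finset.mem_filter, Finset.mem_powerset] at hV
      rw [ih V (hV.2.1.ssubset_of_ne hV.1) ⟨a, hV.2.2⟩]
    rw [h3] at h2
    have h4 := add_right_cancel h2
    simpa using h4.symm

theorem moment_update_linear (Z : Fin r → Ω → ℂ) (hZ : ∀ j, HasMoments μ (Z j)) {U V : Ω → ℂ}
    (hU : HasMoments μ U) (hV : HasMoments μ V) (c : ℂ) {i : Fin r} {B : Finset (Fin r)}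
    (hi : i ∈ B) :
    ∫ ω, ∏ j ∈ B, Function.update Z i (fun ω => c * U ω + V ω) j ω ∂μ =
      c * ∫ ω, ∏ j ∈ B, Function.update Z i U j ω ∂μ + ∫ ω, ∏ j ∈ B, Function.update Z i V j ω ∂μ := by
  have key : ∀ (W : Ω → ℂ) (ω : Ω), ∏ j ∈ B, Function.update Z i W j ω =
      W ω * ∏ j ∈ B.erase i, Z j ω := by
    intro W ω
    rw [← Finset.mul_prod_erase _ _ hi, Function.update_self]
    congr 1
    exact Finset.prod_congr rfl fun j hj => by
      rw [Function.update_of_ne (Finset.ne_of_mem_erase hj)]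
  simp_rw [key]
  have hP : HasMoments μ (fun ω => ∏ j ∈ B.erase i, Z j ω) := HasMoments.prod fun j _ => hZ j
  rw [← integral_const_mul, ← integral_add ((hU.mul hP).const_mul c).integrable
    (hV.mul hP).integrable]
  congr 1
  ext ω
  ring

/-- Cumulants are linear in each variable. -/
theorem cumulantOn_update_linear (Z : Fin r → Ω → ℂ) (hZ : ∀ j, HasMoments μ (Z j)) {U V : Ω → ℂ}
    (hU : HasMoments μ U) (hV : HasMoments μ V) (c : ℂ) {i : Fin r} {B : Finset (Fin r)}
    (hi : i ∈ B) :
    cumulantOn μ (Function.update Z i (fun ω => c * U ω + V ω)) B =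
      c * cumulantOn μ (Function.update Z i U) B + cumulantOn μ (Function.update Z i V) B := by
  set Z' := Function.update Z i (fun ω => c * U ω + V ω) with hZ'
  -- The candidate is the linear expression on sets containing `i` and the cumulant itself
  -- elsewhere. With the recursion taken at `i`, every block is of the first kind and the
  -- complementary moments do not involve the variable `i`.
  have hrec := cumulantOn_eq_of_recursion (μ := μ) Z' (fun B => if i ∈ B then
      c * cumulantOn μ (Function.update Z i U) B + cumulantOn μ (Function.update Z i V) B
      else cumulantOn μ Z' B) ?_ ⟨i, hi⟩
  · rw [hrec, if_pos hi]
  · intro B hB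
    by_cases hiB : i ∈ B
    · refine ⟨i, hiB, ?_⟩
      rw [moment_update_linear Z hZ hU hV c hiB, moment_eq_sum_cumulantOn_mul _ hiB,
        moment_eq_sum_cumulantOn_mul (Function.update Z i V) hiB, Finset.mul_sum,
        ← Finset.sum_add_distrib]
      refine Finset.sum_congr rfl fun W hW => ?_
      have hW' := (Finset.mem_filter.1 hW).2
      have hm : ∀ Y : Ω → ℂ, ∫ ω, ∏ j ∈ B \ W, Function.update Z i Y j ω ∂μ =
          ∫ ω, ∏ j ∈ B \ W, Z j ω ∂μ := by
        intro Y
        congr 1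
        ext ω
        refine Finset.prod_congr rfl fun j hj => ?_
        rw [Function.update_of_ne]
        rintro rfl
        exact (Finset.mem_sdiff.1 hj).2 hW'
      rw [if_pos hW', hm, hm, hm]
      ring
    · obtain ⟨a, ha⟩ := hB
      refine ⟨a, ha, (moment_eq_sum_cumulantOn_mul _ ha).trans ?_⟩
      refine Finset.sum_congr rfl fun W hW => ?_
      rw [if_neg fun h => hiB (Finset.mem_powerset.1 (Finset.mem_filter.1 hW).1 h)]

/-- A cumulant of order at least two with a constant among its variables vanishes. -/
theorem cumulantOn_eq_zero_of_const (Z : Fin r → Ω → ℂ) {i : Fin r} {c : ℂ}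
    (hc : Z i = fun _ => c) {B : Finset (Fin r)} (hi : i ∈ B) (hB : B ≠ {i}) :
    cumulantOn μ Z B = 0 := by
  -- With the recursion taken at `i`, only the block `{i}` contributes: the constant factors out of
  -- the moment.
  have hrec := cumulantOn_eq_of_recursion (μ := μ) Z (fun B => if i ∈ B then
      (if B = {i} then c else 0) else cumulantOn μ Z B) ?_ ⟨i, hi⟩
  · rw [hrec, if_pos hi, if_neg hB]
  · intro B hB
    by_cases hiB : i ∈ B
    · refine ⟨i, hiB, ?_⟩
      rw [Finset.sum_eq_single {i}]
      · rw [if_pos (by simp), if_pos rfl, ← integral_const_mul]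
        congr 1
        ext ω
        rw [← Finset.mul_prod_erase _ _ hiB, hc, Finset.sdiff_singleton_eq_erase]
      · intro W hW hne
        rw [if_pos (Finset.mem_filter.1 hW).2, if_neg hne, zero_mul]
      · intro h
        exact absurd (by simpa using hiB) h
    · obtain ⟨a, ha⟩ := hB
      refine ⟨a, ha, (moment_eq_sum_cumulantOn_mul _ ha).trans ?_⟩
      refine Finset.sum_congr rfl fun W hW => ?_
      rw [if_neg fun h => hiB (Finset.mem_powerset.1 (Finset.mem_filter.1 hW).1 h)]

end Cumulants

/-! ### Connected components of a premap on a family of index sets -/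

section Families

variable {r : ℕ} {Λ : Type*}

/-- The union of the index sets `I i`, `i ∈ B`. -/
def unionOn (I : Fin r → Finset ℕ) (B : Finset (Fin r)) : Finset ℕ := B.biUnion I

variable {I : Fin r → Finset ℕ} {A B V : Finset (Fin r)} {π π₁ π₂ : Equiv.Perm ℤ}

theorem unionOn_union : unionOn I (A ∪ B) = unionOn I A ∪ unionOn I B := Finset.union_biUnion

theorem mem_unionOn {k : ℕ} : k ∈ unionOn I B ↔ ∃ i ∈ B, k ∈ I i := Finset.mem_biUnion

theorem mem_pm_unionOn {x : ℤ} : x ∈ pm (unionOn I B) ↔ ∃ i ∈ B, x ∈ pm (I i) := by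
  simp only [mem_pm, mem_unionOn]

theorem disjoint_unionOn (hI : Pairwise (Function.onFun Disjoint I)) (h : Disjoint A B) :
    Disjoint (unionOn I A) (unionOn I B) := by
  rw [Finset.disjoint_left]
  intro x hx hx'
  obtain ⟨i, hi, hxi⟩ := mem_unionOn.1 hx
  obtain ⟨j, hj, hxj⟩ := mem_unionOn.1 hx'
  have hij : i ≠ j := fun e => Finset.disjoint_left.1 h hi (e ▸ hj)
  exact Finset.disjoint_left.1 (hI hij) hxi hxj

theorem zero_notMem_unionOn (h0 : ∀ i, 0 ∉ I i) : 0 ∉ unionOn I B := by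
  rw [mem_unionOn]
  rintro ⟨i, -, h⟩
  exact h0 i h

theorem Connects.symm {A B : Finset ℤ} (h : Connects π A B) : Connects π B A := by
  obtain ⟨a, ha, b, hb, hab⟩ := h
  exact ⟨b, hb, a, ha, hab.symm⟩

/-- `π` connects the sets `I i`, `i ∈ B`. -/
def ConnectsAll (I : Fin r → Finset ℕ) (B : Finset (Fin r)) (π : Equiv.Perm ℤ) : Prop :=
  ∀ U ⊆ B, U.Nonempty → U ≠ B → Connects π (pm (unionOn I U)) (pm (unionOn I (B \ U)))

/-- `π` does not connect the sets with index in `U` to the other sets with index in `B`. -/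
def IsClosedOn (I : Fin r → Finset ℕ) (B : Finset (Fin r)) (π : Equiv.Perm ℤ) (U : Finset (Fin r)) :
    Prop :=
  U ⊆ B ∧ ¬ Connects π (pm (unionOn I U)) (pm (unionOn I (B \ U)))

open scoped Classical in
/-- The indices of the sets connected by `π` to the set with index `a`. -/
noncomputable def component (I : Fin r → Finset ℕ) (B : Finset (Fin r)) (a : Fin r) (π : Equiv.Perm ℤ) :
    Finset (Fin r) :=
  B.filter (fun i => ∀ U, IsClosedOn I B π U → a ∈ U → i ∈ U)

theorem component_subset_of_isClosedOn {a : Fin r} {U : Finset (Fin r)} (hU : IsClosedOn I B π U)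
    (ha : a ∈ U) : component I B a π ⊆ U := by
  classical
  intro i hi
  exact (Finset.mem_filter.1 hi).2 U hU ha

theorem mem_component_self {a : Fin r} (ha : a ∈ B) : a ∈ component I B a π := by
  classical
  exact Finset.mem_filter.2 ⟨ha, fun _ _ h => h⟩

theorem isClosedOn_component {a : Fin r} : IsClosedOn I B π (component I B a π) := by
  classical
  refine ⟨Finset.filter_subset _ _, ?_⟩
  rintro ⟨x, hx, y, hy, hxy⟩
  obtain ⟨i, hi, hxi⟩ := mem_pm_unionOn.1 hx
  obtain ⟨j, hj, hyj⟩ := mem_pm_unionOn.1 hy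
  rw [Finset.mem_sdiff] at hj
  have : ∃ U, IsClosedOn I B π U ∧ a ∈ U ∧ j ∉ U := by
    by_contra hn
    push Not at hn
    exact hj.2 (Finset.mem_filter.2 ⟨hj.1, hn⟩)
  obtain ⟨U, hU, haU, hjU⟩ := this
  exact hU.2 ⟨x, mem_pm_unionOn.2 ⟨i, (Finset.mem_filter.1 hi).2 U hU haU, hxi⟩,
    y, mem_pm_unionOn.2 ⟨j, Finset.mem_sdiff.2 ⟨hj.1, hjU⟩, hyj⟩, hxy⟩

theorem not_connects_sdiff {U : Finset (Fin r)} (hUB : U ⊆ B)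
    (h : ¬ Connects π (pm (unionOn I U)) (pm (unionOn I (B \ U)))) :
    ¬ Connects π (pm (unionOn I (B \ U))) (pm (unionOn I (B \ (B \ U)))) := by
  rw [Finset.sdiff_sdiff_eq_self hUB]
  exact fun hc => h hc.symm

/-- The product does not connect `V` to its complement, so the component of `a` lies in `V`. It is
all of `V` exactly if no proper subset of `V` containing `a` is closed under the connections made by
`π₁`. -/
theorem component_mul (hI : Pairwise (Function.onFun Disjoint I)) {a : Fin r} (haV : a ∈ V)
    (hV : V ⊆ B) (h1 : π₁ ∈ permsOn (pm (unionOn I V)))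
    (h2 : π₂ ∈ permsOn (pm (unionOn I (B \ V)))) :
    component I B a (π₁ * π₂) = V ↔ ConnectsAll I V π₁ := by
  have hd := disjoint_pm (disjoint_unionOn hI (Finset.disjoint_sdiff (s := V) (t := B)))
  have hsc : ∀ {x y}, x ∈ pm (unionOn I V) → ((π₁ * π₂).SameCycle x y ↔ π₁.SameCycle x y) :=
    fun hx => sameCycle_mul_left hd h1 h2 hx
  have hVc : IsClosedOn I B (π₁ * π₂) V := by
    refine ⟨hV, ?_⟩
    rintro ⟨x, hx, y, hy, hxy⟩
    exact Finset.disjoint_left.1 hd (mem_of_sameCycle h1 ((hsc hx).1 hxy) hx) hy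
  have hsub := component_subset_of_isClosedOn hVc haV
  constructor
  · intro h U hU hne hUV
    by_contra hn
    have key : ∀ W ⊆ V, a ∈ W → W ≠ V →
        ¬ Connects π₁ (pm (unionOn I W)) (pm (unionOn I (V \ W))) → False := by
      intro W hW haW hWV hn
      have hcl : IsClosedOn I B (π₁ * π₂) W := by
        refine ⟨hW.trans hV, ?_⟩
        rintro ⟨x, hx, y, hy, hxy⟩
        have hx' : x ∈ pm (unionOn I V) := by
          obtain ⟨i, hi, hxi⟩ := mem_pm_unionOn.1 hx
          exact mem_pm_unionOn.2 ⟨i, hW hi, hxi⟩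
        have hxy' := (hsc hx').1 hxy
        obtain ⟨j, hj, hyj⟩ := mem_pm_unionOn.1 hy
        obtain ⟨k, hk, hyk⟩ := mem_pm_unionOn.1 (mem_of_sameCycle h1 hxy' hx')
        have hjk : j = k := by
          by_contra hne
          exact Finset.disjoint_left.1 (disjoint_pm (hI hne)) hyj hyk
        subst hjk
        exact hn ⟨x, hx, y, mem_pm_unionOn.2
          ⟨j, Finset.mem_sdiff.2 ⟨hk, (Finset.mem_sdiff.1 hj).2⟩, hyj⟩, hxy'⟩
      have := component_subset_of_isClosedOn hcl haW
      rw [h] at this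
      exact hWV (Finset.Subset.antisymm hW this)
    by_cases haU : a ∈ U
    · exact key U hU haU hUV hn
    -- Connection is symmetric, so a separated set not containing `a` may be replaced by its
    -- complement in `V`.
    · refine key (V \ U) Finset.sdiff_subset (Finset.mem_sdiff.2 ⟨haV, haU⟩) (fun e => ?_)
        (not_connects_sdiff hU hn)
      obtain ⟨u, hu⟩ := hne
      have := e.symm ▸ hU hu
      exact (Finset.mem_sdiff.1 this).2 hu
  · intro h
    by_contra hne
    obtain ⟨x, hx, y, hy, hxy⟩ := h _ hsub ⟨a, mem_component_self (hV haV)⟩ hne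
    have hx' : x ∈ pm (unionOn I V) := by
      obtain ⟨i, hi, hxi⟩ := mem_pm_unionOn.1 hx
      exact mem_pm_unionOn.2 ⟨i, hsub hi, hxi⟩
    obtain ⟨j, hj, hyj⟩ := mem_pm_unionOn.1 hy
    rw [Finset.mem_sdiff] at hj
    exact isClosedOn_component.2 ⟨x, hx, y,
      mem_pm_unionOn.2 ⟨j, Finset.mem_sdiff.2 ⟨hV hj.1, hj.2⟩, hyj⟩, (hsc hx').2 hxy⟩

open scoped Classical in
/-- Sums of multiplicative weights over all `π ∈ PM(±I_B)` in terms of those over the `π` that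
connect the index sets. -/
theorem sum_PM_eq (G : GenusData Λ) (hG : G.IsMultiplicative) (h0 : ∀ i, 0 ∉ I i)
    (hI : Pairwise (Function.onFun Disjoint I)) (w : Finset (Fin r) → Equiv.Perm ℤ → ℂ)
    (hw : ∀ V B, V ⊆ B → ∀ π₁ ∈ G.PM (unionOn I V), ∀ π₂ ∈ G.PM (unionOn I (B \ V)),
      w B (π₁ * π₂) = w V π₁ * w (B \ V) π₂) {a : Fin r} (ha : a ∈ B) :
    ∑ π ∈ G.PM (unionOn I B), w B π = ∑ V ∈ B.powerset.filter (fun V => a ∈ V),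
      (∑ π ∈ (G.PM (unionOn I V)).filter (fun π => ConnectsAll I V π), w V π) *
        ∑ π ∈ G.PM (unionOn I (B \ V)), w (B \ V) π := by
  -- The premaps are sorted by the component `V` of `a`. Those with component `V` are the products
  -- of a premap connecting `V` and an arbitrary premap on the rest.
  have hmaps : ∀ π ∈ G.PM (unionOn I B),
      component I B a π ∈ B.powerset.filter (fun V => a ∈ V) := fun π _ =>
    Finset.mem_filter.2 ⟨Finset.mem_powerset.2 isClosedOn_component.1, mem_component_self ha⟩
  rw [← Finset.sum_fiberwise_of_maps_to hmaps]
  refine Finset.sum_congr rfl fun V hV => ?_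
  rw [Finset.mem_filter, Finset.mem_powerset] at hV
  obtain ⟨hVB, haV⟩ := hV
  rw [Finset.sum_mul_sum, ← Finset.sum_product']
  have hd := disjoint_unionOn hI (Finset.disjoint_sdiff (s := V) (t := B))
  have hz1 : 0 ∉ unionOn I V := zero_notMem_unionOn h0
  have hz2 : 0 ∉ unionOn I (B \ V) := zero_notMem_unionOn h0
  have hu : unionOn I V ∪ unionOn I (B \ V) = unionOn I B := by
    rw [← unionOn_union, Finset.union_sdiff_of_subset hVB]
  have hsplit := hG.split _ _ hz1 hz2 hd
  rw [hu] at hsplit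
  have hp1 : ∀ π ∈ G.PM (unionOn I V), π ∈ permsOn (pm (unionOn I V)) := fun π h =>
    premap_permsOn (hG.subset _ hz1 h)
  have hp2 : ∀ π ∈ G.PM (unionOn I (B \ V)), π ∈ permsOn (pm (unionOn I (B \ V))) := fun π h =>
    premap_permsOn (hG.subset _ hz2 h)
  symm
  refine Finset.sum_bij (fun x _ => x.1 * x.2) ?_ ?_ ?_ ?_
  · intro x hx
    rw [Finset.mem_product, Finset.mem_filter] at hx
    refine Finset.mem_filter.2 ⟨((hsplit _).2 ⟨x.1, hx.1.1, x.2, hx.2, rfl⟩).1, ?_⟩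
    exact (component_mul hI haV hVB (hp1 _ hx.1.1) (hp2 _ hx.2)).2 hx.1.2
  · rintro ⟨x, y⟩ hx ⟨x', y'⟩ hx' e
    simp only [Finset.mem_product, Finset.mem_filter] at hx hx' e
    have hdp := disjoint_pm hd
    have e1 : x = x' := by
      ext k
      by_cases hk : k ∈ pm (unionOn I V)
      · rw [← mul_apply_left hdp (hp2 _ hx.2) hk, e, mul_apply_left hdp (hp2 _ hx'.2) hk]
      · rw [mem_permsOn.1 (hp1 _ hx.1.1) k hk, mem_permsOn.1 (hp1 _ hx'.1.1) k hk]
    subst e1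
    rw [mul_left_cancel e]
  · intro π hπ
    obtain ⟨hπ, hc⟩ := Finset.mem_filter.1 hπ
    have hcl := isClosedOn_component (I := I) (B := B) (a := a) (π := π)
    rw [hc] at hcl
    obtain ⟨π₁, h1, π₂, h2, rfl⟩ := (hsplit π).1 ⟨hπ, hcl.2⟩
    refine ⟨(π₁, π₂), ?_, rfl⟩
    rw [Finset.mem_product, Finset.mem_filter]
    exact ⟨⟨h1, (component_mul hI haV hVB (hp1 _ h1) (hp2 _ h2)).1 hc⟩, h2⟩
  · intro x hx
    rw [Finset.mem_product, Finset.mem_filter] at hx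
    exact (hw V B hVB _ hx.1.1 _ hx.2).symm

end Families

/-! ### Traces along permutations -/

section TraceAlong

variable {d N : ℕ} {A B : Finset ℤ} {σ σ' : Equiv.Perm ℤ} {W W' : ℤ → Matrix (Fin d) (Fin d) ℂ}

theorem trAlong_union (h : ∀ x ∈ A, ∀ y ∈ B, ¬ σ.SameCycle x y) :
    trAlong N (A ∪ B) σ W = trAlong N A σ W * trAlong N B σ W := by
  classical
  have hd : Disjoint A B := by
    rw [Finset.disjoint_left]
    exact fun x hx hx' => h x hx x hx' (Equiv.Perm.SameCycle.refl _ _)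
  have fA : ∀ k ∈ A, (A ∪ B).filter (fun l => σ.SameCycle k l) = A.filter (fun l => σ.SameCycle k l) := by
    intro k hk
    rw [Finset.filter_union, Finset.filter_false_of_mem (s := B) (fun y hy => h k hk y hy),
      Finset.union_empty]
  have fB : ∀ k ∈ B, (A ∪ B).filter (fun l => σ.SameCycle k l) = B.filter (fun l => σ.SameCycle k l) := by
    intro k hk
    rw [Finset.filter_union, Finset.filter_false_of_mem (s := A) (fun y hy h' => h y hy k hk h'.symm),
      Finset.empty_union]
  unfold trAlong
  rw [Finset.filter_union, Finset.prod_union (Finset.disjoint_filter_filter hd)]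
  congr 1
  · refine Finset.prod_congr (Finset.filter_congr fun k hk => ?_) fun k hk => ?_
    · refine ⟨fun h' l hl => h' l (Finset.mem_union_left _ hl), fun h' l hl hkl => ?_⟩
      rcases Finset.mem_union.1 hl with hl | hl
      · exact h' l hl hkl
      · exact absurd hkl (h k hk l hl)
    · convert rfl using 6
      exact congrArg _ (fA k (Finset.mem_filter.1 hk).1).symm
  · refine Finset.prod_congr (Finset.filter_congr fun k hk => ?_) fun k hk => ?_
    · refine ⟨fun h' l hl => h' l (Finset.mem_union_right _ hl), fun h' l hl hkl => ?_⟩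
      rcases Finset.mem_union.1 hl with hl | hl
      · exact absurd hkl.symm (h l hl k hk)
      · exact h' l hl hkl
    · convert rfl using 6
      exact congrArg _ (fB k (Finset.mem_filter.1 hk).1).symm

theorem pow_apply_congr (hA : ∀ x ∈ A, σ x ∈ A) (h : ∀ x ∈ A, σ x = σ' x) {x : ℤ} (hx : x ∈ A)
    (j : ℕ) : (σ ^ j) x = (σ' ^ j) x ∧ (σ ^ j) x ∈ A := by
  induction j with
  | zero => exact ⟨rfl, hx⟩
  | succ j ih =>
    rw [pow_succ', pow_succ', Equiv.Perm.mul_apply, Equiv.Perm.mul_apply, ← ih.1]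
    exact ⟨h _ ih.2, hA _ ih.2⟩

theorem trAlong_congr (hσ : IsOfFinOrder σ) (hσ' : IsOfFinOrder σ') (hA : ∀ x ∈ A, σ x ∈ A)
    (h : ∀ x ∈ A, σ x = σ' x) (hW : ∀ x ∈ A, W x = W' x) :
    trAlong N A σ W = trAlong N A σ' W' := by
  classical
  have hsc : ∀ {x y}, x ∈ A → (σ.SameCycle x y ↔ σ'.SameCycle x y) := fun hx =>
    sameCycle_congr hσ hσ' hA h hx
  unfold trAlong
  refine Finset.prod_congr (Finset.filter_congr fun k hk => ?_) fun k hk => ?_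
  · exact forall₂_congr fun l _ => by rw [hsc hk]
  · have hk' := (Finset.mem_filter.1 hk).1
    congr 3
    have hc : A.filter (fun l => σ.SameCycle k l) = A.filter (fun l => σ'.SameCycle k l) :=
      Finset.filter_congr fun l _ => hsc hk'
    rw [hc]
    refine List.map_congr_left fun j _ => ?_
    have := pow_apply_congr hA h hk' j
    rw [← this.1]
    exact hW _ this.2

theorem trAlong_posCycle (o n : ℕ) (hn : 1 ≤ n) :
    trAlong N (posPart (Finset.Icc (o + 1) (o + n))) (posCycle o n) W =
      (N : ℂ)⁻¹ * Matrix.trace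
        (((List.range n).map (fun j : ℕ => W ((o : ℤ) + j + 1))).prod) := by
  classical
  have h1 : (o : ℤ) + (0 : ℕ) + 1 ∈ posPart (Finset.Icc (o + 1) (o + n)) :=
    mem_posPart_Icc.2 ⟨0, hn, rfl⟩
  have hsc := posCycle_sameCycle o n
  unfold trAlong
  rw [Finset.prod_eq_single ((o : ℤ) + (0 : ℕ) + 1)]
  · have hc : ((posPart (Finset.Icc (o + 1) (o + n))).filter
        (fun l => (posCycle o n).SameCycle ((o : ℤ) + (0 : ℕ) + 1) l)).card = n := by
      rw [Finset.filter_true_of_mem fun y hy => hsc _ h1 y hy, posPart,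
        Finset.card_image_of_injective _ Nat.cast_injective, Nat.card_Icc]
      omega
    rw [hc]
    congr 3
    refine List.map_congr_left fun j hj => ?_
    rw [posCycle_pow_apply (by omega), zero_add, Nat.mod_eq_of_lt (List.mem_range.1 hj)]
  · intro k hk hne
    rw [Finset.mem_filter] at hk
    obtain ⟨i, hi, rfl⟩ := mem_posPart_Icc.1 hk.1
    have := hk.2 _ h1 (hsc _ hk.1 _ h1)
    exfalso
    apply hne
    push_cast at *
    omega
  · intro h
    refine absurd (Finset.mem_filter.2 ⟨h1, fun l hl _ => ?_⟩) h
    obtain ⟨i, hi, rfl⟩ := mem_posPart_Icc.1 hl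
    push_cast
    omega

theorem trAlong_one (hN : 1 ≤ N) (A : Finset ℤ) (σ : Equiv.Perm ℤ) :
    trAlong N A σ (signed (fun _ => (1 : Matrix (Fin N) (Fin N) ℂ))) = 1 := by
  classical
  have h : signed (fun _ => (1 : Matrix (Fin N) (Fin N) ℂ)) = fun _ => 1 := by
    funext k
    unfold signed
    split_ifs <;> simp
  unfold trAlong
  refine Finset.prod_eq_one fun k _ => ?_
  rw [h]
  have hN' : (N : ℂ) ≠ 0 := by
    have : N ≠ 0 := by omega
    exact_mod_cast this
  simp [hN']

end TraceAlong

/-! ### Several cycles on disjoint intervals -/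

section Blocks

variable {r : ℕ}

/-- The intervals `{o i + 1, …, o i + n i}`. -/
def intervals (o n : Fin r → ℕ) (i : Fin r) : Finset ℕ := Finset.Icc (o i + 1) (o i + n i)

theorem zero_notMem_intervals (o n : Fin r → ℕ) (i : Fin r) : 0 ∉ intervals o n i := by
  simp [intervals]

variable {o n : Fin r → ℕ} (hI : Pairwise (Function.onFun Disjoint (intervals o n)))
  {A B : Finset (Fin r)}

/-- The permutation with cycles `(o i + 1, …, o i + n i)`, `i ∈ B`. -/
noncomputable def blockPerm (B : Finset (Fin r)) : Equiv.Perm ℤ :=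
  B.noncommProd (fun i => posCycle (o i) (n i)) fun _ _ _ _ hij =>
    permsOn_comm (disjoint_posPart (hI hij)) (posCycle_mem _ _) (posCycle_mem _ _)

theorem blockPerm_insert {i : Fin r} (hi : i ∉ B) :
    blockPerm hI (insert i B) = posCycle (o i) (n i) * blockPerm hI B :=
  Finset.noncommProd_insert_of_notMem _ _ _ _ hi

theorem blockPerm_empty : blockPerm hI ∅ = 1 := Finset.noncommProd_empty _ _

theorem blockPerm_union (h : Disjoint A B) :
    blockPerm hI (A ∪ B) = blockPerm hI A * blockPerm hI B := by
  classical
  induction A using Finset.induction_on with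
  | empty => rw [blockPerm_empty, one_mul, Finset.empty_union]
  | insert i A hi ih =>
    rw [Finset.disjoint_insert_left] at h
    rw [Finset.insert_union, blockPerm_insert hI, blockPerm_insert hI hi, ih h.2, mul_assoc]
    rw [Finset.mem_union]
    exact fun h' => h'.elim hi h.1

theorem unionOn_insert {I : Fin r → Finset ℕ} {i : Fin r} :
    unionOn I (insert i B) = I i ∪ unionOn I B := Finset.biUnion_insert

include hI in
theorem disjoint_unionOn_of_notMem {i : Fin r} (hi : i ∉ B) :
    Disjoint (intervals o n i) (unionOn (intervals o n) B) := by
  have := disjoint_unionOn hI (Finset.disjoint_singleton_left.2 hi)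
  rwa [unionOn, Finset.singleton_biUnion] at this

theorem blockPerm_mem : blockPerm hI B ∈ permsOn (posPart (unionOn (intervals o n) B)) := by
  classical
  induction B using Finset.induction_on with
  | empty => rw [blockPerm_empty]; exact one_mem_permsOn
  | insert i B hi ih =>
    rw [blockPerm_insert hI hi, unionOn_insert, posPart_union]
    exact mul_mem_permsOn_union (posCycle_mem _ _) ih

theorem numCycles_blockPerm (hn : ∀ i, 1 ≤ n i) :
    numCycles (posPart (unionOn (intervals o n) B)) (blockPerm hI B) = B.card := by
  classical
  induction B using Finset.induction_on with
  | empty => simp [numCycles, unionOn, posPart]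
  | insert i B hi ih =>
    have hc : numCycles (posPart (intervals o n i)) (posCycle (o i) (n i)) = 1 := by
      rw [numCycles_eq_nclass]
      have h1 := nclass_le_one_iff (r := cyc (posCycle (o i) (n i))).2
        (posCycle_sameCycle (o i) (n i))
      have h2 := nclass_pos (r := cyc (posCycle (o i) (n i)))
        (S := posPart (intervals o n i)) (posPart_nonempty ⟨o i + 1, by
          have := hn i; simp [intervals]; omega⟩)
      exact le_antisymm h1 h2
    rw [blockPerm_insert hI hi, unionOn_insert, posPart_union, numCycles_mul
      (disjoint_posPart (disjoint_unionOn_of_notMem hI hi)) (posCycle_mem _ _) (blockPerm_mem hI),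
      ih, hc, Finset.card_insert_of_notMem hi, add_comm]

theorem trAlong_blockPerm (hn : ∀ i, 1 ≤ n i) {d N : ℕ} (W : ℤ → Matrix (Fin d) (Fin d) ℂ) :
    trAlong N (posPart (unionOn (intervals o n) B)) (blockPerm hI B) W =
      ∏ i ∈ B, (N : ℂ)⁻¹ * Matrix.trace
        (((List.range (n i)).map (fun j : ℕ => W ((o i : ℤ) + j + 1))).prod) := by
  classical
  induction B using Finset.induction_on with
  | empty => simp [trAlong, unionOn, posPart]
  | insert i B hi ih =>
    have hd := disjoint_posPart (disjoint_unionOn_of_notMem hI hi)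
    have h1 := posCycle_mem (o i) (n i)
    have h2 := blockPerm_mem hI (B := B)
    have h3 := isOfFinOrder_of_mem_permsOn (mul_mem_permsOn_union h1 h2)
    rw [blockPerm_insert hI hi, unionOn_insert, posPart_union, Finset.prod_insert hi, ← ih,
      trAlong_union fun x hx y hy hxy => Finset.disjoint_left.1 hd
        (mem_of_sameCycle h1 ((sameCycle_mul_left hd h1 h2 hx).1 hxy) hx) hy]
    congr 1
    · rw [← trAlong_posCycle _ _ (hn i)]
      refine (trAlong_congr (isOfFinOrder_of_mem_permsOn h1) h3
        (fun x hx => apply_mem_of_mem_permsOn h1 hx)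
        (fun x hx => (mul_apply_left hd h2 hx).symm) fun _ _ => rfl).symm
    · refine (trAlong_congr (isOfFinOrder_of_mem_permsOn h2) h3
        (fun x hx => apply_mem_of_mem_permsOn h2 hx)
        (fun x hx => (mul_apply_right hd h1 h2 hx).symm) fun _ _ => rfl).symm

theorem connectsAll_signConj (ε : ℕ → ℤˣ) {I : Fin r → Finset ℕ} {π : Equiv.Perm ℤ} :
    ConnectsAll I B (signConj ε π) ↔ ConnectsAll I B π := by
  unfold ConnectsAll
  simp only [connects_signConj]

/-- For connected premaps the Euler characteristic is at most two. -/
theorem eulerChar_le_two_of_connectsAll (hn : ∀ i, 1 ≤ n i) {π : Equiv.Perm ℤ}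
    (hB : B.Nonempty) (hπ : π ∈ premaps (unionOn (intervals o n) B))
    (hc : ConnectsAll (intervals o n) B π) :
    eulerChar (unionOn (intervals o n) B) (blockPerm hI B) π ≤ 2 := by
  classical
  obtain ⟨a, ha⟩ := hB
  have h0 : 0 ∉ unionOn (intervals o n) B := zero_notMem_unionOn (zero_notMem_intervals o n)
  have hγ := blockPerm_mem hI (B := B)
  refine (eulerChar_le_two h0 hγ hπ ?_).1
  set q := join (double (blockPerm hI B)) π with hq
  have hneg : ∀ {x y}, q x y → q (-x) (-y) := fun h =>
    (join_neg_iff (minus_double _) ((mem_premaps_iff h0).1 hπ).2.1).2 h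
  let x : Fin r → ℤ := fun i => (o i : ℤ) + (0 : ℕ) + 1
  have hx : ∀ i, x i ∈ posPart (intervals o n i) := fun i => mem_posPart_Icc.2 ⟨0, hn i, rfl⟩
  have hpos : ∀ i ∈ B, ∀ y ∈ posPart (intervals o n i), q y (x i) := by
    intro i hi y hy
    have hd := disjoint_posPart (disjoint_unionOn_of_notMem hI (Finset.notMem_erase i B))
    have h1 := posCycle_mem (o i) (n i)
    have h2 := blockPerm_mem hI (B := B.erase i)
    have e : blockPerm hI B = posCycle (o i) (n i) * blockPerm hI (B.erase i) := by
      rw [← blockPerm_insert hI (Finset.notMem_erase i B), Finset.insert_erase hi]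
    refine exists_join_of_cycle h0 hγ (A := posPart (intervals o n i)) ?_ ?_ ?_ hy (hx i)
    · exact Finset.image_mono _ (Finset.subset_biUnion_of_mem _ hi)
    · intro z hz
      rw [e, mul_apply_left hd h2 hz]
      exact apply_mem_of_mem_permsOn h1 hz
    · intro z hz z' hz'
      rw [e, sameCycle_mul_left hd h1 h2 hz]
      exact posCycle_sameCycle _ _ z hz z' hz'
  have hpm : ∀ i ∈ B, ∀ y ∈ pm (intervals o n i), q y (x i) ∨ q y (-x i) := by
    intro i hi y hy
    rcases ((isHalf_posPart (zero_notMem_intervals o n i)).mem_iff y).1 hy with h | h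
    · exact Or.inl (hpos i hi y h)
    · have := hneg (hpos i hi _ h)
      rw [neg_neg] at this
      exact Or.inr this
  -- Being in the same orbit up to sign is transitive, since the orbits are permuted by negation.
  have htr : ∀ {u v z}, (q u v ∨ q u (-v)) → (q v z ∨ q v (-z)) → (q u z ∨ q u (-z)) := by
    intro u v z h1 h2
    rcases h1 with h1 | h1 <;> rcases h2 with h2 | h2
    · exact Or.inl (q.trans h1 h2)
    · exact Or.inr (q.trans h1 h2)
    · exact Or.inr (q.trans h1 (hneg h2))
    · have := hneg h2
      rw [neg_neg] at this
      exact Or.inl (q.trans h1 this)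
  have hsy : ∀ {u v}, (q u v ∨ q u (-v)) → (q v u ∨ q v (-u)) := by
    intro u v h
    rcases h with h | h
    · exact Or.inl (q.symm h)
    · have := hneg (q.symm h)
      rw [neg_neg] at this
      exact Or.inr this
  -- The intervals in the orbit of `x a` up to sign form a nonempty set `U`. If it were not
  -- everything, connectedness would give a cycle of `π` from `U` to its complement, whose end would
  -- have to lie in `U` too.
  have hall : ∀ i ∈ B, q (x i) (x a) ∨ q (x i) (-x a) := by
    by_contra hn'
    push Not at hn'
    obtain ⟨i, hi, hia⟩ := hn'
    let U := B.filter (fun i => q (x i) (x a) ∨ q (x i) (-x a))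
    obtain ⟨y, hy, z, hz, hyz⟩ := hc U (Finset.filter_subset _ _)
      ⟨a, Finset.mem_filter.2 ⟨ha, Or.inl (q.refl _)⟩⟩ (fun e => by
        have := (Finset.mem_filter.1 (e.symm ▸ hi : i ∈ U)).2
        exact this.elim hia.1 hia.2)
    obtain ⟨j, hj, hyj⟩ := mem_pm_unionOn.1 hy
    obtain ⟨k, hk, hzk⟩ := mem_pm_unionOn.1 hz
    rw [Finset.mem_sdiff] at hk
    obtain ⟨hjB, hja⟩ := Finset.mem_filter.1 hj
    refine hk.2 (Finset.mem_filter.2 ⟨hk.1, ?_⟩)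
    have e1 := hpm j hjB y hyj
    have e2 := hpm k hk.1 z hzk
    have e3 : q z y ∨ q z (-y) := Or.inl (q.symm (cyc_le_join_right _ _ hyz))
    exact htr (htr (hsy e2) (htr e3 e1)) hja
  refine (nclass_le_card (T := {x a, -x a}) fun y hy => ?_).trans Finset.card_le_two
  obtain ⟨i, hi, hyi⟩ := mem_pm_unionOn.1 hy
  rcases htr (hpm i hi y hyi) (hall i hi) with h | h
  · exact ⟨_, by simp, h⟩
  · exact ⟨_, by simp, h⟩

end Blocks

theorem polyTrace_monomial {Ω Λ : Type*} {X : (N : ℕ) → Λ → Ω → Matrix (Fin N) (Fin N) ℂ}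
    (lam : ℕ → Λ) (ε : ℕ → ℤˣ) (N m k : ℕ) (ω : Ω) :
    polyTrace X N (monomial lam ε m k) ω = Matrix.trace (((List.range k).map (fun j : ℕ =>
      signPow (ε (m + j + 1)) (X N (lam (m + j + 1)) ω))).prod) := by
  unfold polyTrace monomial
  rw [map_list_prod, List.map_map]
  simp only [Function.comp_def, FreeAlgebra.lift_ι_apply]

/-! ### Moments and cumulants of traces of monomials -/

section Expansion

variable {Ω : Type*} [MeasurableSpace Ω] {μ : Measure Ω} [IsProbabilityMeasure μ] {Λ : Type*}
  {G : GenusData Λ} {X : (N : ℕ) → Λ → Ω → Matrix (Fin N) (Fin N) ℂ} {r : ℕ} {o n : Fin r → ℕ}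
  (hI : Pairwise (Function.onFun Disjoint (intervals o n))) (lam : ℕ → Λ) (ε : ℕ → ℤˣ)

/-- The contribution of `π` to the moment of the traces with index in `B`. -/
noncomputable def weight (G : GenusData Λ) (N : ℕ) (B : Finset (Fin r)) (π : Equiv.Perm ℤ) : ℂ :=
  (N : ℂ) ^ (eulerChar (unionOn (intervals o n) B) (blockPerm hI B) (signConj ε π) - (B.card : ℤ)) *
    G.f N (unionOn (intervals o n) B) lam π

theorem isRandomMatrix_const {N : ℕ} (M : Matrix (Fin N) (Fin N) ℂ) :
    IsRandomMatrix μ (fun _ => M) := fun _ _ => ⟨measurable_const, fun _ _ => memLp_const _⟩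

/-- The constant matrices `Y_k = 1` are independent of everything and have normalized trace 1.
Passing from `tr` to `Tr` contributes `N` for each trace, and `#(γ)` is the number of traces, so the
exponent `χ - 2#(γ)` becomes `χ - |B|`. -/
theorem integral_prod_polyTrace (hX : IsGenusEnsemble μ G X) (hn : ∀ i, 1 ≤ n i) {N : ℕ}
    (hN : 1 ≤ N) (B : Finset (Fin r)) :
    ∫ ω, ∏ i ∈ B, polyTrace X N (monomial lam ε (o i) (n i)) ω ∂μ =
      ∑ π ∈ G.PM (unionOn (intervals o n) B), weight hI lam ε G N B π := by
  have hN' : (N : ℂ) ≠ 0 := by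
    have : N ≠ 0 := by omega
    exact_mod_cast this
  have h0 : 0 ∉ unionOn (intervals o n) B := zero_notMem_unionOn (zero_notMem_intervals o n)
  have hex := hX.expansion N hN _ h0 _ (blockPerm_mem hI (B := B)) ε lam (fun _ _ => 1)
    (fun _ => isRandomMatrix_const 1) (indepFun_const_right _ _)
  rw [numCycles_blockPerm hI hn] at hex
  simp only [trAlong_one hN, integral_const, probReal_univ, one_smul, mul_one] at hex
  have hl : ∀ ω, ∏ i ∈ B, polyTrace X N (monomial lam ε (o i) (n i)) ω = (N : ℂ) ^ B.card *
      trAlong N (posPart (unionOn (intervals o n) B)) (blockPerm hI B)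
        (fun k => signPow (ε k.natAbs) (X N (lam k.natAbs) ω)) := by
    intro ω
    rw [trAlong_blockPerm hI hn, Finset.prod_mul_distrib, Finset.prod_const, ← mul_assoc,
      ← mul_pow, mul_inv_cancel₀ hN', one_pow, one_mul]
    refine Finset.prod_congr rfl fun i _ => ?_
    rw [polyTrace_monomial]
    have : ∀ j : ℕ, ((o i : ℤ) + j + 1).natAbs = o i + j + 1 := fun j => by omega
    simp only [this]
  simp_rw [hl]
  rw [integral_const_mul, hex, Finset.mul_sum]
  refine Finset.sum_congr rfl fun π _ => ?_
  rw [weight, ← mul_assoc, ← zpow_natCast, ← zpow_add₀ hN']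
  congr 2
  simp only [signConj]
  ring

open scoped Classical in
-- The weights are multiplicative, so by `sum_PM_eq` the sums over connecting premaps satisfy the
-- recursion that determines the cumulants.
theorem cumulantOn_polyTrace (hX : IsGenusEnsemble μ G X) (hn : ∀ i, 1 ≤ n i) {N : ℕ}
    (hN : 1 ≤ N) {B : Finset (Fin r)} (hB : B.Nonempty) :
    cumulantOn μ (fun i => polyTrace X N (monomial lam ε (o i) (n i))) B =
      ∑ π ∈ (G.PM (unionOn (intervals o n) B)).filter
        (fun π => ConnectsAll (intervals o n) B π), weight hI lam ε G N B π := by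
  have hN' : (N : ℂ) ≠ 0 := by
    have : N ≠ 0 := by omega
    exact_mod_cast this
  refine cumulantOn_eq_of_recursion _ (fun B => ∑ π ∈ (G.PM (unionOn (intervals o n) B)).filter
        (fun π => ConnectsAll (intervals o n) B π), weight hI lam ε G N B π) (fun B hB => ?_) hB
  obtain ⟨a, ha⟩ := hB
  refine ⟨a, ha, ?_⟩
  simp_rw [integral_prod_polyTrace hI lam ε hX hn hN]
  refine sum_PM_eq G hX.data (zero_notMem_intervals o n) hI _ (fun V B hVB π₁ h1 π₂ h2 => ?_) ha
  have z1 : 0 ∉ unionOn (intervals o n) V := zero_notMem_unionOn (zero_notMem_intervals o n)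
  have z2 : 0 ∉ unionOn (intervals o n) (B \ V) := zero_notMem_unionOn (zero_notMem_intervals o n)
  have hd := disjoint_unionOn hI (Finset.disjoint_sdiff (s := V) (t := B))
  have hu : unionOn (intervals o n) B =
      unionOn (intervals o n) V ∪ unionOn (intervals o n) (B \ V) := by
    rw [← unionOn_union, Finset.union_sdiff_of_subset hVB]
  have hb : blockPerm hI B = blockPerm hI V * blockPerm hI (B \ V) := by
    rw [← blockPerm_union hI Finset.disjoint_sdiff, Finset.union_sdiff_of_subset hVB]
  have hcard : (B.card : ℤ) = V.card + (B \ V).card := by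
    rw [← Finset.card_sdiff_add_card_eq_card hVB]
    push_cast
    ring
  unfold weight
  rw [hu, hb, signConj_mul, eulerChar_mul z1 hd (blockPerm_mem hI) (blockPerm_mem hI)
    (signConj_mem_premaps ε z1 (hX.data.subset _ z1 h1))
    (signConj_mem_premaps ε z2 (hX.data.subset _ z2 h2)),
    hX.data.mul _ _ z1 z2 hd N hN lam π₁ h1 π₂ h2, hcard,
    show ∀ a b c d : ℤ, a + b - (c + d) = (a - c) + (b - d) by intros; ring, zpow_add₀ hN']
  ring

theorem tendsto_natCast_zpow_mul {e : ℤ} (he : e ≤ 0) {f : ℕ → ℂ} {c : ℂ}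
    (hf : Tendsto f atTop (𝓝 c)) :
    Tendsto (fun N : ℕ => (N : ℂ) ^ e * f N) atTop (𝓝 (if e = 0 then c else 0)) := by
  split_ifs with h
  · simpa [h] using hf
  · have h1 : Tendsto (fun N : ℕ => (N : ℂ) ^ e) atTop (𝓝 0) := by
      obtain ⟨k, hk⟩ : ∃ k : ℕ, e = -((k : ℤ) + 1) := ⟨(-e - 1).toNat, by omega⟩
      have h2 : Tendsto (fun N : ℕ => ((N : ℂ)⁻¹) ^ (k + 1)) atTop (𝓝 0) := by
        have := (tendsto_inv_atTop_nhds_zero_nat (𝕜 := ℂ)).pow (k + 1)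
        simpa using this
      refine h2.congr fun N => ?_
      rw [hk, zpow_neg, inv_pow]
      norm_cast
    simpa using h1.mul hf

open scoped Classical in
-- After scaling, the exponent of `N` is `χ - s ≤ 0`. The value `s = 2` gives the limits for one and
-- two traces. For `r ≥ 3` traces `s = r` leaves the cumulant unscaled, and no premap has `χ = s`.
theorem tendsto_sum_weight (hX : IsGenusEnsemble μ G X) (hn : ∀ i, 1 ≤ n i) {B : Finset (Fin r)}
    (hB : B.Nonempty) (s : ℤ) (hs : 2 ≤ s) :
    Tendsto (fun N : ℕ => (N : ℂ) ^ ((B.card : ℤ) - s) *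
        cumulantOn μ (fun i => polyTrace X N (monomial lam ε (o i) (n i))) B) atTop
      (𝓝 (∑ π ∈ (G.PM (unionOn (intervals o n) B)).filter
        (fun π => ConnectsAll (intervals o n) B π ∧
          eulerChar (unionOn (intervals o n) B) (blockPerm hI B) (signConj ε π) = s),
        limUnder atTop (fun N : ℕ => G.f N (unionOn (intervals o n) B) lam π))) := by
  have h0 : 0 ∉ unionOn (intervals o n) B := zero_notMem_unionOn (zero_notMem_intervals o n)
  have key : Tendsto (fun N : ℕ => ∑ π ∈ (G.PM (unionOn (intervals o n) B)).filter
        (fun π => ConnectsAll (intervals o n) B π),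
        (N : ℂ) ^ (eulerChar (unionOn (intervals o n) B) (blockPerm hI B) (signConj ε π) - s) *
          G.f N (unionOn (intervals o n) B) lam π) atTop
      (𝓝 (∑ π ∈ (G.PM (unionOn (intervals o n) B)).filter
        (fun π => ConnectsAll (intervals o n) B π),
        if eulerChar (unionOn (intervals o n) B) (blockPerm hI B) (signConj ε π) - s = 0 then
          limUnder atTop (fun N : ℕ => G.f N (unionOn (intervals o n) B) lam π) else 0)) := by
    refine tendsto_finsetSum _ fun π hπ => ?_
    obtain ⟨h1, h2⟩ := Finset.mem_filter.1 hπ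
    refine tendsto_natCast_zpow_mul ?_ (tendsto_nhds_limUnder (hX.data.limit _ h0 lam π h1))
    have := eulerChar_le_two_of_connectsAll hI hn hB
      (signConj_mem_premaps ε h0 (hX.data.subset _ h0 h1)) ((connectsAll_signConj ε).2 h2)
    omega
  rw [← Finset.sum_filter, Finset.filter_filter] at key
  simp only [sub_eq_zero] at key
  refine key.congr' ?_
  filter_upwards [eventually_ge_atTop 1] with N hN
  have hN' : (N : ℂ) ≠ 0 := by
    have : N ≠ 0 := by omega
    exact_mod_cast this
  rw [cumulantOn_polyTrace hI lam ε hX hn hN hB, Finset.mul_sum]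
  refine Finset.sum_congr rfl fun π _ => ?_
  rw [weight, ← mul_assoc, ← zpow_add₀ hN']
  congr 2
  ring

end Expansion

/-! ### Noncommutative polynomials: words, multilinearity, transposition -/

section FreeAlg

variable {L : Type*}

/-- The noncommutative monomial of a word. -/
noncomputable def wordMonomial (w : List L) : FreeAlgebra ℂ L := (w.map (FreeAlgebra.ι ℂ)).prod

theorem span_wordMonomial : Submodule.span ℂ (Set.range (wordMonomial (L := L))) = ⊤ := by
  rw [eq_top_iff]
  rintro p -
  induction p using FreeAlgebra.induction with
  | grade0 c =>
    rw [Algebra.algebraMap_eq_smul_one]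
    exact Submodule.smul_mem _ _ (Submodule.subset_span ⟨[], by simp [wordMonomial]⟩)
  | grade1 x => exact Submodule.subset_span ⟨[x], by simp [wordMonomial]⟩
  | mul a b ha hb =>
    have := Submodule.mul_mem_mul ha hb
    rw [Submodule.span_mul_span] at this
    refine Submodule.span_mono ?_ this
    rintro _ ⟨_, ⟨u, rfl⟩, _, ⟨v, rfl⟩, rfl⟩
    exact ⟨u ++ v, by simp [wordMonomial]⟩
  | add a b ha hb => exact Submodule.add_mem _ ha hb

/-- An induction principle for multilinear statements about noncommutative polynomials. -/
theorem multilinear_induction {r : ℕ} {P : (Fin r → FreeAlgebra ℂ L) → Prop}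
    (hmon : ∀ w : Fin r → List L, P (fun i => wordMonomial (w i)))
    (hlin : ∀ (p : Fin r → FreeAlgebra ℂ L) (i : Fin r) (c : ℂ) (a b : FreeAlgebra ℂ L), P (Function.update p i a) → P (Function.update p i b) →
      P (Function.update p i (c • a + b))) (p : Fin r → FreeAlgebra ℂ L) : P p := by
  have key : ∀ s : Finset (Fin r), ∀ p : Fin r → FreeAlgebra ℂ L,
      (∀ i ∉ s, p i ∈ Set.range (wordMonomial (L := L))) → P p := by
    intro s
    induction s using Finset.induction_on with
    | empty =>
      intro p hp
      choose w hw using fun i => hp i (Finset.notMem_empty i)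
      rw [← funext hw]
      exact hmon w
    | insert i s hi ih =>
      intro p hp
      have hmem : p i ∈ Submodule.span ℂ (Set.range (wordMonomial (L := L))) := by
        rw [span_wordMonomial]; trivial
      have hgen : ∀ w, P (Function.update p i (wordMonomial w)) := by
        intro w
        refine ih _ fun j hj => ?_
        by_cases hji : j = i
        · subst hji; rw [Function.update_self]; exact ⟨w, rfl⟩
        · rw [Function.update_of_ne hji]
          exact hp j fun h => (Finset.mem_insert.1 h).elim hji hj
      -- Zero is obtained as `(-1) • 1 + 1`, where 1 is the monomial of the empty word.
      have hz : P (Function.update p i 0) := by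
        have := hlin p i (-1) _ _ (hgen []) (hgen [])
        rwa [neg_smul, one_smul, neg_add_cancel] at this
      have : P (Function.update p i (p i)) := by
        refine Submodule.span_induction (p := fun a _ => P (Function.update p i a)) ?_ hz ?_ ?_ hmem
        · rintro _ ⟨w, rfl⟩
          exact hgen w
        · intro a b _ _ ha hb
          have := hlin p i 1 a b ha hb
          rwa [one_smul] at this
        · intro c a _ ha
          have := hlin p i c a 0 ha hz
          rwa [add_zero] at this
      rwa [Function.update_eq_self] at this
  exact key Finset.univ p fun i h => absurd (Finset.mem_univ i) h

theorem lift_ι_self (p : FreeAlgebra ℂ L) : FreeAlgebra.lift ℂ (FreeAlgebra.ι ℂ) p = p := by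
  have : FreeAlgebra.lift ℂ (FreeAlgebra.ι ℂ) = AlgHom.id ℂ (FreeAlgebra ℂ L) := by
    ext x
    simp
  rw [this]
  rfl

/-- The involution that reverses words and exchanges `x_λ` and `x_{-λ}`. -/
noncomputable def transposeHom (Λ : Type*) :
    FreeAlgebra ℂ (Λ × ℤˣ) →ₐ[ℂ] (FreeAlgebra ℂ (Λ × ℤˣ))ᵐᵒᵖ :=
  FreeAlgebra.lift ℂ (fun l => MulOpposite.op (FreeAlgebra.ι ℂ (l.1, -l.2)))

theorem exists_transpose (Λ : Type*) :
    ∃ t : FreeAlgebra ℂ (Λ × ℤˣ) →ₗ[ℂ] FreeAlgebra ℂ (Λ × ℤˣ),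
      (∀ a b, t (a * b) = t b * t a) ∧ (∀ a, t (t a) = a) ∧
      ∀ (l : Λ) (e : ℤˣ), FreeAlgebra.ι ℂ (l, -e) = t (FreeAlgebra.ι ℂ (l, e)) := by
  let t : FreeAlgebra ℂ (Λ × ℤˣ) →ₗ[ℂ] FreeAlgebra ℂ (Λ × ℤˣ) :=
    (MulOpposite.opLinearEquiv ℂ).symm.toLinearMap ∘ₗ (transposeHom Λ).toLinearMap
  have ht : ∀ a, t a = (transposeHom Λ a).unop := fun _ => rfl
  have hm : ∀ a b, t (a * b) = t b * t a := fun a b => by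
    rw [ht, ht, ht, map_mul, MulOpposite.unop_mul]
  have hι : ∀ (l : Λ) (e : ℤˣ), FreeAlgebra.ι ℂ (l, -e) = t (FreeAlgebra.ι ℂ (l, e)) := by
    intro l e
    rw [ht, transposeHom, FreeAlgebra.lift_ι_apply]
    rfl
  refine ⟨t, hm, fun a => ?_, hι⟩
  induction a using FreeAlgebra.induction with
  | grade0 c =>
    have h1 : t (algebraMap ℂ _ c) = algebraMap ℂ _ c := by
      rw [ht, AlgHom.commutes]
      rfl
    rw [h1, h1]
  | grade1 x =>
    obtain ⟨l, e⟩ := x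
    rw [← hι, ← hι, neg_neg]
  | mul a b ha hb => rw [hm, hm, ha, hb]
  | add a b ha hb => rw [map_add, map_add, ha, hb]

/-- Words can be read off a common sequence of indices along disjoint intervals. -/
theorem exists_intervals {Λ : Type*} {r : ℕ} (hr : 0 < r) (w : Fin r → List (Λ × ℤˣ))
    (hw : ∀ i, w i ≠ []) :
    ∃ (o : Fin r → ℕ) (lam : ℕ → Λ) (ε : ℕ → ℤˣ),
      Pairwise (Function.onFun Disjoint (intervals o (fun i => (w i).length))) ∧
      ∀ i, monomial lam ε (o i) (w i).length = wordMonomial (w i) := by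
  obtain ⟨L, hL⟩ : ∃ L, ∀ i, (w i).length ≤ L :=
    ⟨∑ i, (w i).length, fun i =>
      Finset.single_le_sum (f := fun i => (w i).length) (fun _ _ => Nat.zero_le _) (Finset.mem_univ i)⟩
  let i₀ : Fin r := ⟨0, hr⟩
  let x₀ : Λ × ℤˣ := (w i₀).head (hw i₀)
  have hLpos : 0 < L := lt_of_lt_of_le (List.length_pos_of_ne_nil (hw i₀)) (hL i₀)
  -- With `L` a bound for all lengths, the `i`-th word is written at the positions `i L + 1, i L +
  -- 2, …`; the unused positions carry the arbitrary letter `x₀`.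
  let x : ℕ → Λ × ℤˣ := fun k => if h : (k - 1) / L < r then
    (w ⟨(k - 1) / L, h⟩).getD ((k - 1) % L) x₀ else x₀
  refine ⟨fun i => i * L, fun k => (x k).1, fun k => (x k).2, ?_, ?_⟩
  · have key : ∀ i j : Fin r, i < j → Disjoint (intervals (fun i => (i : ℕ) * L) (fun i => (w i).length) i)
        (intervals (fun i => (i : ℕ) * L) (fun i => (w i).length) j) := by
      intro i j hij
      rw [Finset.disjoint_left]
      intro k hk hk'
      simp only [intervals, Finset.mem_Icc] at hk hk'
      have h1 : ((i : ℕ) + 1) * L ≤ j * L := Nat.mul_le_mul_right _ hij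
      have := hL i
      rw [add_mul] at h1
      omega
    intro i j hij
    rcases lt_or_gt_of_ne hij with h | h
    · exact key i j h
    · exact (key j i h).symm
  · intro i
    unfold monomial wordMonomial
    congr 1
    apply List.ext_getElem
    · simp
    · intro j h1 h2
      simp only [List.length_map, List.length_range] at h1
      simp only [List.getElem_map, List.getElem_range, Prod.mk.eta]
      congr 1
      have hj : j < L := lt_of_lt_of_le h1 (hL i)
      have e1 : ((i : ℕ) * L + j + 1 - 1) / L = i := by
        rw [Nat.add_sub_cancel, add_comm, Nat.add_mul_div_right _ _ hLpos, Nat.div_eq_of_lt hj, zero_add]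
      have e2 : ((i : ℕ) * L + j + 1 - 1) % L = j := by
        rw [Nat.add_sub_cancel, add_comm, Nat.add_mul_mod_self_right, Nat.mod_eq_of_lt hj]
      simp only [x, e1, e2, i.2, dif_pos]
      simp [h1]

end FreeAlg

/-! ### Traces of polynomials -/

section PolyTrace

variable {Ω Λ : Type*} {X : (N : ℕ) → Λ → Ω → Matrix (Fin N) (Fin N) ℂ}

theorem polyTrace_add (N : ℕ) (p q : FreeAlgebra ℂ (Λ × ℤˣ)) (ω : Ω) :
    polyTrace X N (p + q) ω = polyTrace X N p ω + polyTrace X N q ω := by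
  simp [polyTrace, Matrix.trace_add]

theorem polyTrace_smul (N : ℕ) (c : ℂ) (p : FreeAlgebra ℂ (Λ × ℤˣ)) (ω : Ω) :
    polyTrace X N (c • p) ω = c * polyTrace X N p ω := by
  simp [polyTrace, Matrix.trace_smul]

theorem polyTrace_mul_comm (N : ℕ) (p q : FreeAlgebra ℂ (Λ × ℤˣ)) :
    polyTrace X N (p * q) = polyTrace X N (q * p) := by
  funext ω
  unfold polyTrace
  rw [map_mul, map_mul, Matrix.trace_mul_comm]

theorem polyTrace_one (N : ℕ) : polyTrace X N (1 : FreeAlgebra ℂ (Λ × ℤˣ)) = fun _ => (N : ℂ) := by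
  funext ω
  simp [polyTrace]

end PolyTrace

/-! ### The second-order limit distribution -/

section Limit

variable {Ω : Type*} [MeasurableSpace Ω] {μ : Measure Ω} [IsProbabilityMeasure μ] {Λ : Type*}
  {G : GenusData Λ} {X : (N : ℕ) → Λ → Ω → Matrix (Fin N) (Fin N) ℂ} {r : ℕ}

theorem hasMoments_polyTrace (hX : IsGenusEnsemble μ G X) {N : ℕ} (hN : 1 ≤ N)
    (p : FreeAlgebra ℂ (Λ × ℤˣ)) : HasMoments μ (polyTrace X N p) := by
  have key : ∀ i j, HasMoments μ (fun ω =>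
      FreeAlgebra.lift ℂ (fun l : Λ × ℤˣ => signPow l.2 (X N l.1 ω)) p i j) := by
    induction p using FreeAlgebra.induction with
    | grade0 c =>
      intro i j
      simp only [AlgHom.commutes]
      exact HasMoments.const _
    | grade1 x =>
      intro i j
      simp only [FreeAlgebra.lift_ι_apply]
      rcases Int.units_eq_one_or x.2 with h | h
      · simp only [signPow, h, if_true]
        exact (hX.random N hN x.1 i j).2
      · have : (-1 : ℤˣ) ≠ 1 := by decide
        simp only [signPow, h, if_neg this, Matrix.transpose_apply]
        exact (hX.random N hN x.1 j i).2
    | mul a b ha hb =>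
      intro i j
      simp only [map_mul, Matrix.mul_apply]
      exact HasMoments.sum fun k _ => (ha i k).mul (hb k j)
    | add a b ha hb =>
      intro i j
      simp only [map_add, Matrix.add_apply]
      exact (ha i j).add (hb i j)
  unfold polyTrace Matrix.trace
  exact HasMoments.sum fun i _ => key i i

/-- The cumulant of the traces of noncommutative polynomials. -/
noncomputable def traceCumulant (μ : Measure Ω) (X : (N : ℕ) → Λ → Ω → Matrix (Fin N) (Fin N) ℂ)
    (N : ℕ) (p : Fin r → FreeAlgebra ℂ (Λ × ℤˣ)) : ℂ :=
  cumulantOn μ (fun i => polyTrace X N (p i)) Finset.univ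

theorem traceCumulant_update (hX : IsGenusEnsemble μ G X) {N : ℕ} (hN : 1 ≤ N)
    (p : Fin r → FreeAlgebra ℂ (Λ × ℤˣ)) (i : Fin r) (c : ℂ) (a b : FreeAlgebra ℂ (Λ × ℤˣ)) :
    traceCumulant μ X N (Function.update p i (c • a + b)) =
      c * traceCumulant μ X N (Function.update p i a) + traceCumulant μ X N (Function.update p i b) := by
  have key : ∀ a, (fun j => polyTrace X N (Function.update p i a j)) =
      Function.update (fun j => polyTrace X N (p j)) i (polyTrace X N a) := by
    intro a
    funext j
    by_cases h : j = i
    · subst h; simp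
    · simp [Function.update_of_ne h]
  unfold traceCumulant
  rw [key, key, key, ← cumulantOn_update_linear (fun j => polyTrace X N (p j))
    (fun j => hasMoments_polyTrace hX hN (p j)) (hasMoments_polyTrace hX hN a)
    (hasMoments_polyTrace hX hN b) c (Finset.mem_univ i)]
  congr 2
  funext ω
  rw [polyTrace_add, polyTrace_smul]

theorem traceCumulant_eq_zero {N : ℕ} (hr : 2 ≤ r) {p : Fin r → FreeAlgebra ℂ (Λ × ℤˣ)} {i : Fin r}
    (hi : p i = 1) : traceCumulant μ X N p = 0 := by
  refine cumulantOn_eq_zero_of_const (i := i) (c := N) _ ?_ (Finset.mem_univ i) fun h => ?_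
  · rw [hi, polyTrace_one]
  · have := congrArg Finset.card h
    rw [Finset.card_univ, Fintype.card_fin, Finset.card_singleton] at this
    omega

theorem traceCumulant_one (N : ℕ) (p : Fin 1 → FreeAlgebra ℂ (Λ × ℤˣ)) :
    traceCumulant μ X N p = ∫ ω, polyTrace X N (p 0) ω ∂μ := by
  have h := moment_eq_sum_cumulantOn_mul (μ := μ) (fun i => polyTrace X N (p i))
    (Finset.mem_univ (0 : Fin 1))
  have hf : (Finset.univ : Finset (Fin 1)).powerset.filter (fun V => 0 ∈ V) = {Finset.univ} := by
    decide
  rw [hf, Finset.sum_singleton, Finset.sdiff_self] at h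
  simp only [Finset.prod_empty, integral_const, probReal_univ, one_smul, mul_one] at h
  unfold traceCumulant
  rw [← h]
  simp

/-- The scaled cumulants have limits, which vanish for cumulants of order at least three. -/
theorem exists_tendsto_traceCumulant (hX : IsGenusEnsemble μ G X) (hr : 0 < r) {s : ℤ}
    (hs : s = max 2 r) (p : Fin r → FreeAlgebra ℂ (Λ × ℤˣ)) :
    ∃ c, Tendsto (fun N : ℕ => (N : ℂ) ^ ((r : ℤ) - s) * traceCumulant μ X N p) atTop (𝓝 c) ∧
      (2 < s → c = 0) := by
  classical
  have hs2 : 2 ≤ s := by omega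
  induction p using multilinear_induction with
  | hmon w =>
    by_cases hw : ∀ i, w i ≠ []
    · obtain ⟨o, lam, ε, hI, hmon⟩ := exists_intervals hr w hw
      have hn : ∀ i, 1 ≤ (w i).length := fun i => List.length_pos_of_ne_nil (hw i)
      have hne : (Finset.univ : Finset (Fin r)).Nonempty := ⟨⟨0, hr⟩, Finset.mem_univ _⟩
      have h := tendsto_sum_weight hI lam ε hX hn hne s hs2
      rw [Finset.card_univ, Fintype.card_fin] at h
      simp only [hmon] at h
      refine ⟨_, h, fun h2 => ?_⟩
      rw [Finset.filter_false_of_mem, Finset.sum_empty]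
      rintro π hπ ⟨h3, h4⟩
      have z := zero_notMem_unionOn (B := Finset.univ)
        (zero_notMem_intervals o (fun i => (w i).length))
      have := eulerChar_le_two_of_connectsAll hI hn hne
        (signConj_mem_premaps ε z (hX.data.subset _ z hπ)) ((connectsAll_signConj ε).2 h3)
      omega
    -- An empty word has the constant trace `N`. It kills cumulants of order at least two, and for
    -- `r = 1` the scaled expectation is `N⁻¹ N = 1`.
    · push Not at hw
      obtain ⟨i, hi⟩ := hw
      have h1 : wordMonomial (w i) = 1 := by rw [hi]; rfl
      by_cases hr2 : 2 ≤ r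
      · refine ⟨0, ?_, fun _ => rfl⟩
        have hz : ∀ N : ℕ, traceCumulant μ X N (fun i => wordMonomial (w i)) = 0 := fun N =>
          traceCumulant_eq_zero (i := i) hr2 h1
        simp [hz]
      · obtain rfl : r = 1 := by omega
        refine ⟨1, ?_, by omega⟩
        obtain rfl : i = 0 := Subsingleton.elim _ _
        refine tendsto_const_nhds.congr' ?_
        filter_upwards [eventually_ge_atTop 1] with N hN
        have hN' : (N : ℂ) ≠ 0 := by
          have : N ≠ 0 := by omega
          exact_mod_cast this
        have hs' : ((1 : ℕ) : ℤ) - s = -1 := by rw [hs]; norm_num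
        rw [traceCumulant_one, h1, polyTrace_one, hs']
        simp [hN']
  | hlin p i c a b ha hb =>
    obtain ⟨x, hx, hx'⟩ := ha
    obtain ⟨y, hy, hy'⟩ := hb
    refine ⟨c * x + y, ?_, fun h => by rw [hx' h, hy' h, mul_zero, zero_add]⟩
    refine ((hx.const_mul c).add hy).congr' ?_
    filter_upwards [eventually_ge_atTop 1] with N hN
    rw [traceCumulant_update hX hN]
    ring

theorem connectsAll_fin_one {I : Fin 1 → Finset ℕ} {π : Equiv.Perm ℤ} :
    ConnectsAll I Finset.univ π := by
  intro U _ hU hne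
  obtain ⟨i, hi⟩ := hU
  refine absurd ?_ hne
  ext j
  obtain rfl : j = i := Subsingleton.elim j i
  exact iff_of_true hi (Finset.mem_univ j)

theorem unionOn_singleton {I : Fin r → Finset ℕ} (i : Fin r) : unionOn I {i} = I i :=
  Finset.singleton_biUnion

theorem connectsAll_fin_two {I : Fin 2 → Finset ℕ} {π : Equiv.Perm ℤ} :
    ConnectsAll I Finset.univ π ↔ Connects π (pm (I 0)) (pm (I 1)) := by
  have e0 : (Finset.univ : Finset (Fin 2)) \ {0} = {1} := by decide
  have e1 : (Finset.univ : Finset (Fin 2)) \ {1} = {0} := by decide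
  constructor
  · intro h
    have := h {0} (Finset.subset_univ _) (by simp) (by decide)
    rwa [e0, unionOn_singleton, unionOn_singleton] at this
  · intro h U _ hU hne
    have : ∀ U : Finset (Fin 2), U.Nonempty → U ≠ Finset.univ → U = {0} ∨ U = {1} := by decide
    rcases this U hU hne with rfl | rfl
    · rwa [e0, unionOn_singleton, unionOn_singleton]
    · rw [e1, unionOn_singleton, unionOn_singleton]
      exact h.symm

theorem update_pair_zero (p q a : FreeAlgebra ℂ (Λ × ℤˣ)) :
    Function.update ![p, q] 0 a = ![a, q] := by
  funext i
  fin_cases i <;> simp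

theorem update_pair_one (p q a : FreeAlgebra ℂ (Λ × ℤˣ)) :
    Function.update ![p, q] 1 a = ![p, a] := by
  funext i
  fin_cases i <;> simp

theorem update_single (p a : FreeAlgebra ℂ (Λ × ℤˣ)) : Function.update ![p] 0 a = ![a] := by
  funext i
  fin_cases i
  simp

/-- An ensemble with a multiplicative genus expansion has a second-order limit distribution. -/
theorem IsGenusEnsemble.hasNoncrossingLimit (hX : IsGenusEnsemble μ G X) :
    HasNoncrossingLimit μ G X := by
  classical
  have ex1 : ∀ p : FreeAlgebra ℂ (Λ × ℤˣ), ∃ c, Tendsto (fun N : ℕ =>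
      (N : ℂ)⁻¹ * traceCumulant μ X N ![p]) atTop (𝓝 c) := by
    intro p
    obtain ⟨c, hc, -⟩ := exists_tendsto_traceCumulant hX one_pos (s := 2) (by norm_num) ![p]
    refine ⟨c, ?_⟩
    simpa using hc
  have ex2 : ∀ p q : FreeAlgebra ℂ (Λ × ℤˣ), ∃ c, Tendsto (fun N : ℕ =>
      traceCumulant μ X N ![p, q]) atTop (𝓝 c) := by
    intro p q
    obtain ⟨c, hc, -⟩ := exists_tendsto_traceCumulant hX two_pos (s := 2) (by norm_num) ![p, q]
    refine ⟨c, ?_⟩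
    simpa using hc
  -- The functionals are defined as limits; linearity, the trace property and the values at 1 are
  -- inherited from each `N ≥ 1` by uniqueness of limits.
  choose f₁ hf₁ using ex1
  choose f₂ hf₂ using ex2
  have lin1 : ∀ c a b, f₁ (c • a + b) = c * f₁ a + f₁ b := by
    intro c a b
    refine tendsto_nhds_unique (hf₁ _) ((((hf₁ a).const_mul c).add (hf₁ b)).congr' ?_)
    filter_upwards [eventually_ge_atTop 1] with N hN
    have := traceCumulant_update hX hN ![0] 0 c a b
    rw [update_single, update_single, update_single] at this
    rw [this]
    ring
  have lin2l : ∀ c a b q, f₂ (c • a + b) q = c * f₂ a q + f₂ b q := by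
    intro c a b q
    refine tendsto_nhds_unique (hf₂ _ _) ((((hf₂ a q).const_mul c).add (hf₂ b q)).congr' ?_)
    filter_upwards [eventually_ge_atTop 1] with N hN
    have := traceCumulant_update hX hN ![0, q] 0 c a b
    rw [update_pair_zero, update_pair_zero, update_pair_zero] at this
    rw [this]
  have lin2r : ∀ c a b p, f₂ p (c • a + b) = c * f₂ p a + f₂ p b := by
    intro c a b p
    refine tendsto_nhds_unique (hf₂ _ _) ((((hf₂ p a).const_mul c).add (hf₂ p b)).congr' ?_)
    filter_upwards [eventually_ge_atTop 1] with N hN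
    have := traceCumulant_update hX hN ![p, 0] 1 c a b
    rw [update_pair_one, update_pair_one, update_pair_one] at this
    rw [this]
  have z1 : f₁ 0 = 0 := by simpa using lin1 (-1) 0 0
  have z2l : ∀ q, f₂ 0 q = 0 := fun q => by simpa using lin2l (-1) 0 0 q
  have z2r : ∀ p, f₂ p 0 = 0 := fun p => by simpa using lin2r (-1) 0 0 p
  let φ₁ : FreeAlgebra ℂ (Λ × ℤˣ) →ₗ[ℂ] ℂ :=
    { toFun := f₁
      map_add' := fun a b => by simpa using lin1 1 a b
      map_smul' := fun c a => by simpa [z1] using lin1 c a 0 }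
  let φ₂ : FreeAlgebra ℂ (Λ × ℤˣ) →ₗ[ℂ] FreeAlgebra ℂ (Λ × ℤˣ) →ₗ[ℂ] ℂ :=
    LinearMap.mk₂ ℂ f₂ (fun a b q => by simpa using lin2l 1 a b q)
      (fun c a q => by simpa [z2l] using lin2l c a 0 q) (fun p a b => by simpa using lin2r 1 a b p)
      (fun c p a => by simpa [z2r] using lin2r c a 0 p)
  have uniq2 : ∀ a b c d : FreeAlgebra ℂ (Λ × ℤˣ), (∀ N, polyTrace X N a = polyTrace X N c) →
      (∀ N, polyTrace X N b = polyTrace X N d) → f₂ a b = f₂ c d := by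
    intro a b c d h1 h2
    refine tendsto_nhds_unique (hf₂ a b) ((hf₂ c d).congr fun N => ?_)
    unfold traceCumulant
    congr 1
    funext i
    fin_cases i
    · exact (h1 N).symm
    · exact (h2 N).symm
  let S : SecondOrderSpace (FreeAlgebra ℂ (Λ × ℤˣ)) :=
    { φ₁ := φ₁
      φ₂ := φ₂
      φ₁_one := by
        refine tendsto_nhds_unique (hf₁ 1) (tendsto_const_nhds.congr' ?_)
        filter_upwards [eventually_ge_atTop 1] with N hN
        have hN' : (N : ℂ) ≠ 0 := by
          have : N ≠ 0 := by omega
          exact_mod_cast this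
        rw [traceCumulant_one]
        simp [polyTrace_one, hN']
      φ₁_tracial := fun a b => by
        refine tendsto_nhds_unique (hf₁ _) ((hf₁ _).congr fun N => ?_)
        rw [traceCumulant_one, traceCumulant_one]
        simp [polyTrace_mul_comm N a b]
      φ₂_tracial_left := fun a b c =>
        uniq2 _ _ _ _ (fun N => polyTrace_mul_comm N a b) fun _ => rfl
      φ₂_tracial_right := fun a b c =>
        uniq2 _ _ _ _ (fun _ => rfl) fun N => polyTrace_mul_comm N a b
      φ₂_one_left := fun a => by
        refine tendsto_nhds_unique (hf₂ 1 a) (tendsto_const_nhds.congr fun N => ?_)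
        exact (traceCumulant_eq_zero (i := 0) le_rfl (by simp)).symm
      φ₂_one_right := fun a => by
        refine tendsto_nhds_unique (hf₂ a 1) (tendsto_const_nhds.congr fun N => ?_)
        exact (traceCumulant_eq_zero (i := 1) le_rfl (by simp)).symm }
  refine ⟨S, ⟨?_, ?_, ?_, exists_transpose Λ⟩, ?_, ?_⟩
  · intro p
    rw [lift_ι_self]
    refine (hf₁ p).congr fun N => ?_
    have h := moment_eq_sum_cumulantOn_mul (μ := μ) ![fun ω => (N : ℂ)⁻¹ * polyTrace X N p ω]
      (Finset.mem_univ (0 : Fin 1))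
    have hf : (Finset.univ : Finset (Fin 1)).powerset.filter (fun V => 0 ∈ V) = {Finset.univ} := by
      decide
    rw [hf, Finset.sum_singleton, Finset.sdiff_self] at h
    simp only [Finset.prod_empty, integral_const, probReal_univ, one_smul, mul_one] at h
    unfold cumulant
    rw [← h, traceCumulant_one, ← integral_const_mul]
    simp
  · intro p q
    rw [lift_ι_self, lift_ι_self]
    refine (hf₂ p q).congr fun N => ?_
    unfold traceCumulant cumulant
    congr 1
    funext i
    fin_cases i <;> rfl
  · intro k hk p
    -- With `s = k` the power of `N` in front is 1, and `k > 2` makes the limit vanish.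
    obtain ⟨c, hc, h0⟩ := exists_tendsto_traceCumulant hX (r := k) (by omega) (s := k) (by omega) p
    rw [h0 (by omega)] at hc
    simp only [sub_self, zpow_zero, one_mul] at hc
    exact hc
  · intro n hn lam ε
    have hI : Pairwise (Function.onFun Disjoint (intervals (fun _ : Fin 1 => 0) (fun _ => n))) :=
      fun i j hij => absurd (Subsingleton.elim i j) hij
    have h := tendsto_sum_weight hI lam ε hX (fun _ => hn) (B := Finset.univ)
      ⟨0, Finset.mem_univ _⟩ 2 le_rfl
    have hu : unionOn (intervals (fun _ : Fin 1 => 0) (fun _ => n)) Finset.univ = Finset.Icc 1 n := by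
      rw [Finset.univ_unique, unionOn_singleton]
      simp [intervals]
    have hb : blockPerm hI Finset.univ = posCycle 0 n := by
      unfold blockPerm
      simp only [Finset.univ_unique, Finset.noncommProd_singleton]
    rw [hu, hb] at h
    simp only [connectsAll_fin_one, true_and] at h
    rw [limitSum_disc G hX.data lam ε n hn]
    refine tendsto_nhds_unique (hf₁ _) (h.congr fun N => ?_)
    have hc : ((Finset.univ : Finset (Fin 1)).card : ℤ) - 2 = -1 := by simp
    rw [hc, zpow_neg_one]
    unfold traceCumulant
    congr 2
    funext i
    rw [Subsingleton.elim i 0]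
    rfl
  · intro m n hm hn lam ε
    have hI : Pairwise (Function.onFun Disjoint (intervals ![0, m] ![m, n])) := by
      have h01 : Disjoint (intervals ![0, m] ![m, n] 0) (intervals ![0, m] ![m, n] 1) := by
        rw [Finset.disjoint_left]
        intro k hk hk'
        simp [intervals] at hk hk'
        omega
      intro i j hij
      fin_cases i <;> fin_cases j
      · exact absurd rfl hij
      · exact h01
      · exact h01.symm
      · exact absurd rfl hij
    have hn' : ∀ i, 1 ≤ ![m, n] i := by
      intro i
      fin_cases i
      · exact hm
      · exact hn
    have h := tendsto_sum_weight hI lam ε hX hn' (B := Finset.univ)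
      ⟨0, Finset.mem_univ _⟩ 2 le_rfl
    have hun : (Finset.univ : Finset (Fin 2)) = insert 0 {1} := by decide
    have hi0 : intervals ![0, m] ![m, n] 0 = Finset.Icc 1 m := by simp [intervals]
    have hi1 : intervals ![0, m] ![m, n] 1 = Finset.Icc (m + 1) (m + n) := by simp [intervals]
    have hu : unionOn (intervals ![0, m] ![m, n]) Finset.univ = Finset.Icc 1 (m + n) := by
      rw [hun, unionOn_insert, unionOn_singleton, hi0, hi1, Icc_union_Icc]
    have hb : blockPerm hI Finset.univ = posCycle 0 m * posCycle m n := by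
      rw [hun, blockPerm_insert hI (by decide)]
      unfold blockPerm
      rw [Finset.noncommProd_singleton]
      rfl
    rw [hu, hb] at h
    simp only [connectsAll_fin_two, hi0, hi1] at h
    rw [limitSum_annular G hX.data lam ε m n hm hn]
    refine tendsto_nhds_unique (hf₂ _ _) (h.congr fun N => ?_)
    have hc : ((Finset.univ : Finset (Fin 2)).card : ℤ) - 2 = 0 := by simp
    rw [hc, zpow_zero, one_mul]
    unfold traceCumulant
    congr 1
    funext i
    fin_cases i <;> rfl

end Limit

/-! ### Sums over index functions -/

section SumFun

variable {α : Type*} [Inhabited α] {R : Type*} [CommSemiring R] {S T A B P : Finset ℤ}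

/-- The extension of a function on `S` by a default value. -/
def extendFun (S : Finset ℤ) (u : S → α) (x : ℤ) : α := if h : x ∈ S then u ⟨x, h⟩ else default

theorem extendFun_mem {u : S → α} {x : ℤ} (h : x ∈ S) : extendFun S u x = u ⟨x, h⟩ := dif_pos h

theorem extendFun_notMem {u : S → α} {x : ℤ} (h : x ∉ S) : extendFun S u x = default := dif_neg h

variable [Fintype α]

/-- The sum of `F u` over all functions `u` on `S`. -/
def sumFun (S : Finset ℤ) (F : (ℤ → α) → R) : R := ∑ u : S → α, F (extendFun S u)

theorem sumFun_congr {F F' : (ℤ → α) → R} (h : ∀ u, F u = F' u) : sumFun S F = sumFun S F' :=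
  Finset.sum_congr rfl fun _ _ => h _

theorem sumFun_mul_left (c : R) (F : (ℤ → α) → R) :
    sumFun S (fun u => c * F u) = c * sumFun S F := by
  simp only [sumFun, Finset.mul_sum]

theorem sumFun_sum {ι : Type*} (s : Finset ι) (F : ι → (ℤ → α) → R) :
    sumFun S (fun u => ∑ i ∈ s, F i u) = ∑ i ∈ s, sumFun S (F i) := Finset.sum_comm

theorem sumFun_union (h : Disjoint A B) (F : (ℤ → α) → R) :
    sumFun (A ∪ B) F = sumFun A fun u => sumFun B fun v => F fun x => if x ∈ A then u x else v x := by
  unfold sumFun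
  rw [← Fintype.sum_prod_type']
  let e : (↥(A ∪ B) → α) ≃ (A → α) × (B → α) :=
    (Equiv.arrowCongr (Equiv.Finset.union A B h).symm (Equiv.refl α)).trans
      (Equiv.sumArrowEquivProdArrow _ _ _)
  refine Fintype.sum_equiv e _ _ fun u => ?_
  congr 1
  funext x
  by_cases hA : x ∈ A
  · rw [if_pos hA, extendFun_mem hA, extendFun_mem (Finset.mem_union_left _ hA)]
    rfl
  · rw [if_neg hA]
    by_cases hB : x ∈ B
    · rw [extendFun_mem hB, extendFun_mem (Finset.mem_union_right _ hB)]
      rfl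
    · rw [extendFun_notMem hB, extendFun_notMem (by simp [hA, hB])]

theorem sumFun_union_mul (h : Disjoint A B) {F F' : (ℤ → α) → R} (hF : DependsOn F (A : Set ℤ))
    (hF' : DependsOn F' (B : Set ℤ)) :
    sumFun (A ∪ B) (fun u => F u * F' u) = sumFun A F * sumFun B F' := by
  rw [sumFun_union h]
  simp only [sumFun, Finset.sum_mul_sum]
  refine Finset.sum_congr rfl fun u _ => Finset.sum_congr rfl fun v _ => ?_
  congr 1
  · exact hF fun x hx => if_pos hx
  · exact hF' fun x hx => if_neg (Finset.disjoint_right.1 h hx)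

theorem prod_sum_eq_sumFun (g : ℤ → α → R) :
    ∏ k ∈ S, ∑ b, g k b = sumFun S fun u => ∏ k ∈ S, g k (u k) := by
  classical
  unfold sumFun
  rw [← Finset.prod_coe_sort S, Finset.prod_univ_sum, Fintype.piFinset_univ]
  refine Finset.sum_congr rfl fun u _ => ?_
  change _ = ∏ k ∈ S, g k (extendFun S u k)
  rw [← Finset.prod_coe_sort S]
  exact Finset.prod_congr rfl fun k _ => by rw [extendFun_mem k.2]

open scoped Classical in
/-- Functions on `S` that factor through a retraction onto `P`. -/
theorem sumFun_comp {F : (ℤ → α) → R} (hF : DependsOn F (S : Set ℤ)) {q r : ℤ → ℤ}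
    (hq : ∀ x ∈ S, q x ∈ P) (hr : ∀ x ∈ P, r x ∈ S) (hqr : ∀ x ∈ P, q (r x) = x) :
    sumFun P (fun i => F (i ∘ q)) =
      sumFun S (fun w => if ∀ x ∈ S, w x = w (r (q x)) then F w else 0) := by
  unfold sumFun
  rw [← Finset.sum_filter]
  -- The correspondence is `i ↦ i ∘ q` with inverse `w ↦ w ∘ r`; the condition on `w` says that it
  -- factors through `q`.
  refine Finset.sum_bij' (fun i _ => fun s : S => i ⟨q s, hq s s.2⟩)
    (fun w _ => fun x : P => w ⟨r x, hr x x.2⟩) ?_ ?_ ?_ ?_ ?_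
  · intro i _
    refine Finset.mem_filter.2 ⟨Finset.mem_univ _, fun x hx => ?_⟩
    rw [extendFun_mem hx, extendFun_mem (hr _ (hq _ hx))]
    congr 2
    exact (hqr _ (hq x hx)).symm
  · exact fun _ _ => Finset.mem_univ _
  · intro i _
    funext x
    exact congrArg i (Subtype.ext (hqr x x.2))
  · intro w hw
    funext s
    have := (Finset.mem_filter.1 hw).2 s s.2
    rw [extendFun_mem s.2, extendFun_mem (hr _ (hq _ s.2))] at this
    exact this.symm
  · intro i _
    refine hF fun x hx => ?_
    rw [Function.comp_apply, extendFun_mem (hq x hx), extendFun_mem (Finset.mem_coe.1 hx)]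

theorem sumFun_equiv {F : (ℤ → α) → R} (hF : DependsOn F (S : Set ℤ)) (e : Equiv.Perm ℤ)
    (he : ∀ x, e x ∈ P ↔ x ∈ S) : sumFun P (fun i => F (i ∘ e)) = sumFun S F := by
  classical
  rw [sumFun_comp hF (r := ⇑e⁻¹) (fun x hx => (he x).2 hx) (fun x hx => (he _).1 (by simpa using hx))
    fun x _ => by simp]
  exact sumFun_congr fun w => if_pos fun x _ => by simp

end SumFun

/-! ### Products of traces as sums over indices -/

section PathSum

variable {d N : ℕ}

/-- `i` lists the inner indices of the product: the row indices are `a` followed by `i`, the column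
indices are `i` followed by `b`. -/
theorem list_prod_apply (A : ℕ → Matrix (Fin d) (Fin d) ℂ) (m : ℕ) (a b : Fin d) :
    ((List.range (m + 1)).map A).prod a b = ∑ i : Fin m → Fin d,
      ∏ j : Fin (m + 1), A j (Fin.cons (α := fun _ => Fin d) a i j)
        (Fin.snoc (α := fun _ => Fin d) i b j) := by
  induction m generalizing b with
  | zero =>
    rw [Fintype.sum_unique]
    simp [Fin.snoc]
  | succ m ih =>
    rw [List.range_succ, List.map_append, List.prod_append, Matrix.mul_apply]
    simp only [ih, Finset.sum_mul]
    rw [← Fintype.sum_prod_type']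
    refine Fintype.sum_equiv (Fin.snocEquiv (fun _ => Fin d)) _ _ fun x => ?_
    obtain ⟨c, i⟩ := x
    rw [Fin.prod_univ_castSucc (n := m + 1)]
    have e : (Fin.snocEquiv fun _ => Fin d) (c, i) = Fin.snoc (α := fun _ => Fin d) i c := rfl
    rw [e]
    simp only [Fin.snoc_castSucc, Fin.snoc_last, Fin.cons_snoc_eq_snoc_cons,
      Fin.val_castSucc, Fin.val_last, List.map_cons, List.map_nil, List.prod_cons, List.prod_nil,
      mul_one]

/-- Closing up the path with `a = b` makes the list of column indices the rotated list of row
indices. -/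
theorem trace_list_prod (A : ℕ → Matrix (Fin d) (Fin d) ℂ) (m : ℕ) :
    Matrix.trace ((List.range (m + 1)).map A).prod = ∑ i : Fin (m + 1) → Fin d,
      ∏ j : Fin (m + 1), A j (i j) (i (finRotate (m + 1) j)) := by
  unfold Matrix.trace
  simp only [Matrix.diag_apply, list_prod_apply]
  rw [← Fintype.sum_prod_type']
  refine Fintype.sum_equiv (Fin.consEquiv (fun _ => Fin d)) _ _ fun x => ?_
  obtain ⟨a, i⟩ := x
  refine Finset.prod_congr rfl fun j _ => ?_
  rw [Fin.snoc_eq_cons_rotate]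
  rfl

theorem trAlong_of_sameCycle {S : Finset ℤ} {σ : Equiv.Perm ℤ} (hc : ∀ x ∈ S, ∀ y ∈ S, σ.SameCycle x y)
    (hS : S.Nonempty) (X : ℤ → Matrix (Fin d) (Fin d) ℂ) :
    trAlong N S σ X = (N : ℂ)⁻¹ * Matrix.trace
      (((List.range S.card).map (fun j => X ((σ ^ j) (S.min' hS)))).prod) := by
  classical
  have hm := S.min'_mem hS
  unfold trAlong
  have hf : S.filter (fun k => ∀ l ∈ S, σ.SameCycle k l → k ≤ l) = {S.min' hS} := by
    ext k
    rw [Finset.mem_filter, Finset.mem_singleton]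
    constructor
    · rintro ⟨hk, h⟩
      exact le_antisymm (h _ hm (hc _ hk _ hm)) (S.min'_le k hk)
    · rintro rfl
      exact ⟨hm, fun l hl _ => S.min'_le l hl⟩
  rw [hf, Finset.prod_singleton, Finset.filter_true_of_mem fun l hl => hc _ hm _ hl]

/-- The points of a cycle, listed from `k`. -/
theorem exists_cycle_equiv {S : Finset ℤ} {σ : Equiv.Perm ℤ} (hfin : IsOfFinOrder σ)
    (hσ : ∀ x ∈ S, σ x ∈ S) (hc : ∀ x ∈ S, ∀ y ∈ S, σ.SameCycle x y) {k : ℤ} (hk : k ∈ S) :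
    ∃ (m : ℕ) (e : Fin (m + 1) ≃ S), S.card = m + 1 ∧ (∀ j, (e j : ℤ) = (σ ^ (j : ℕ)) k) ∧
      ∀ j, (e (finRotate (m + 1) j) : ℤ) = σ (e j) := by
  classical
  have hper : k ∈ Function.periodicPts σ := by
    refine ⟨orderOf σ, hfin.orderOf_pos, ?_⟩
    change (σ^[orderOf σ]) k = k
    rw [← Equiv.Perm.coe_pow, pow_orderOf_eq_one]
    rfl
  obtain ⟨m, hm⟩ := Nat.exists_eq_add_one_of_ne_zero
    (Function.minimalPeriod_pos_of_mem_periodicPts hper).ne'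
  have hmem : ∀ j : ℕ, (σ ^ j) k ∈ S := by
    intro j
    induction j with
    | zero => exact hk
    | succ j ih => rw [pow_succ', Equiv.Perm.mul_apply]; exact hσ _ ih
  let f : Fin (m + 1) → S := fun j => ⟨(σ ^ (j : ℕ)) k, hmem j⟩
  have hf : Function.Bijective f := by
    constructor
    · intro i j h
      have h' := congrArg Subtype.val h
      simp only [f, Equiv.Perm.coe_pow] at h'
      have := Function.iterate_injOn_Iio_minimalPeriod (f := σ) (x := k)
        (by rw [hm]; exact i.2) (by rw [hm]; exact j.2) h'
      exact Fin.ext this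
    · rintro ⟨y, hy⟩
      obtain ⟨n, hn⟩ := exists_pow_of_sameCycle hfin (hc k hk y hy)
      refine ⟨⟨n % (m + 1), Nat.mod_lt _ (Nat.succ_pos m)⟩, Subtype.ext ?_⟩
      simp only [f, Equiv.Perm.coe_pow]
      rw [← hm, Function.iterate_mod_minimalPeriod_eq, ← Equiv.Perm.coe_pow, hn]
  refine ⟨m, Equiv.ofBijective f hf, ?_, fun j => rfl, fun j => ?_⟩
  · have := Fintype.card_congr (Equiv.ofBijective f hf)
    rw [Fintype.card_fin, Fintype.card_coe] at this
    exact this.symm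
  · change (σ ^ ((finRotate (m + 1) j : Fin (m + 1)) : ℕ)) k = σ ((σ ^ (j : ℕ)) k)
    rw [← Equiv.Perm.mul_apply, ← pow_succ']
    -- The rotation is the successor except at the last position, where the period `m + 1` closes
    -- the cycle.
    rcases lt_or_eq_of_le (Nat.lt_succ_iff.1 j.2) with h | h
    · rw [coe_finRotate_of_ne_last]
      exact fun e => by rw [e, Fin.val_last] at h; exact lt_irrefl _ h
    · have hj : j = Fin.last m := Fin.ext h
      have hp : (σ ^ (m + 1)) k = k := by
        rw [← hm, Equiv.Perm.coe_pow]
        exact Function.isPeriodicPt_minimalPeriod σ k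
      rw [hj, finRotate_last, Fin.val_last, hp]
      rfl

theorem dependsOn_pathProd {α : Type*} {S : Finset ℤ} {σ : Equiv.Perm ℤ} (hσ : ∀ x ∈ S, σ x ∈ S)
    (X : ℤ → α → α → ℂ) :
    DependsOn (fun i : ℤ → α => ∏ s ∈ S, X s (i s) (i (σ s))) (S : Set ℤ) := by
  intro i j h
  refine Finset.prod_congr rfl fun s hs => ?_
  rw [h s hs, h _ (hσ s hs)]

theorem trAlong_eq_sumFun_of_sameCycle [Inhabited (Fin d)] (hN : 1 ≤ N) {S : Finset ℤ}
    {σ : Equiv.Perm ℤ} (hfin : IsOfFinOrder σ) (hσ : ∀ x ∈ S, σ x ∈ S)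
    (hc : ∀ x ∈ S, ∀ y ∈ S, σ.SameCycle x y) (hS : S.Nonempty) (X : ℤ → Matrix (Fin d) (Fin d) ℂ) :
    (N : ℂ) * trAlong N S σ X = sumFun S fun i => ∏ s ∈ S, X s (i s) (i (σ s)) := by
  have hN' : (N : ℂ) ≠ 0 := by
    have : N ≠ 0 := by omega
    exact_mod_cast this
  obtain ⟨m, e, hm, he, he'⟩ := exists_cycle_equiv hfin hσ hc (S.min'_mem hS)
  rw [trAlong_of_sameCycle hc hS, ← mul_assoc, mul_inv_cancel₀ hN', one_mul, hm, trace_list_prod]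
  refine Fintype.sum_equiv (Equiv.arrowCongr e (Equiv.refl _)) _ _ fun i => ?_
  change _ = ∏ s ∈ S, X s (extendFun S _ s) (extendFun S _ (σ s))
  rw [← Finset.prod_coe_sort S]
  refine Fintype.prod_equiv e _ _ fun j => ?_
  rw [← he j, extendFun_mem (e j).2, extendFun_mem (hσ _ (e j).2)]
  have h1 : (⟨σ (e j), hσ _ (e j).2⟩ : S) = e (finRotate (m + 1) j) := Subtype.ext (he' j).symm
  rw [h1]
  simp [Equiv.arrowCongr]

/-- A product of traces along the cycles of `σ` as a sum over all indices. -/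
theorem trAlong_eq_sumFun [Inhabited (Fin d)] (hN : 1 ≤ N) {S : Finset ℤ} {σ : Equiv.Perm ℤ}
    (hfin : IsOfFinOrder σ) (hσ : ∀ x ∈ S, σ x ∈ S) (X : ℤ → Matrix (Fin d) (Fin d) ℂ) :
    (N : ℂ) ^ numCycles S σ * trAlong N S σ X =
      sumFun S fun i => ∏ s ∈ S, X s (i s) (i (σ s)) := by
  classical
  induction S using Finset.strongInduction with
  | H S ih =>
    rcases S.eq_empty_or_nonempty with rfl | ⟨k, hk⟩
    · simp [numCycles, trAlong, sumFun]
    -- One cycle is split off; all the quantities factor over it and the rest.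
    · set C := S.filter (fun l => σ.SameCycle k l) with hC
      have hCS : C ⊆ S := Finset.filter_subset _ _
      have hkC : k ∈ C := Finset.mem_filter.2 ⟨hk, Equiv.Perm.SameCycle.refl _ _⟩
      have hσC : ∀ x ∈ C, σ x ∈ C := fun x hx => Finset.mem_filter.2
        ⟨hσ x (hCS hx), (Finset.mem_filter.1 hx).2.trans (sameCycle_apply_self σ x)⟩
      have hcC : ∀ x ∈ C, ∀ y ∈ C, σ.SameCycle x y := fun x hx y hy =>
        (Finset.mem_filter.1 hx).2.symm.trans (Finset.mem_filter.1 hy).2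
      have hsep : ∀ x ∈ C, ∀ y ∈ S \ C, ¬ σ.SameCycle x y := fun x hx y hy hxy =>
        (Finset.mem_sdiff.1 hy).2 (Finset.mem_filter.2
          ⟨(Finset.mem_sdiff.1 hy).1, (Finset.mem_filter.1 hx).2.trans hxy⟩)
      have hσR : ∀ x ∈ S \ C, σ x ∈ S \ C := fun x hx => by
        rw [Finset.mem_sdiff] at hx ⊢
        exact ⟨hσ x hx.1, fun h => hx.2 (Finset.mem_filter.2
          ⟨hx.1, (Finset.mem_filter.1 h).2.trans (sameCycle_apply_self σ x).symm⟩)⟩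
      have hd : Disjoint C (S \ C) := Finset.disjoint_sdiff
      have hu : S = C ∪ (S \ C) := (Finset.union_sdiff_of_subset hCS).symm
      have hR := ih (S \ C) (Finset.sdiff_ssubset hCS ⟨k, hkC⟩) hσR
      have h1 := trAlong_eq_sumFun_of_sameCycle hN hfin hσC hcC ⟨k, hkC⟩ X
      have hn1 : numCycles C σ = 1 := by
        rw [numCycles_eq_nclass]
        exact le_antisymm (nclass_le_one_iff (r := cyc σ).2 hcC) (nclass_pos ⟨k, hkC⟩)
      have hn : numCycles S σ = 1 + numCycles (S \ C) σ := by
        conv_lhs => rw [hu]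
        rw [numCycles_eq_nclass, nclass_union hsep, ← numCycles_eq_nclass, ← numCycles_eq_nclass, hn1]
      have ht : trAlong N S σ X = trAlong N C σ X * trAlong N (S \ C) σ X := by
        conv_lhs => rw [hu]
        exact trAlong_union hsep
      have hs : (sumFun S fun i => ∏ s ∈ S, X s (i s) (i (σ s))) =
          (sumFun C fun i => ∏ s ∈ C, X s (i s) (i (σ s))) *
          sumFun (S \ C) fun i => ∏ s ∈ S \ C, X s (i s) (i (σ s)) := by
        rw [← sumFun_union_mul hd (dependsOn_pathProd hσC fun s => X s)
          (dependsOn_pathProd hσR fun s => X s), ← hu]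
        refine sumFun_congr fun i => ?_
        rw [← Finset.prod_union hd, ← hu]
      rw [hs, ← h1, ← hR, hn, ht, pow_add, pow_one]
      ring

variable {I : Finset ℕ}

theorem prod_isHalf {S T : Finset ℤ} (hS : IsHalf I S) (hT : IsHalf I T) (g : ℤ → ℂ)
    (hg : ∀ x, g (-x) = g x) : ∏ x ∈ S, g x = ∏ x ∈ T, g x := by
  classical
  refine Finset.prod_bij' (fun x _ => if x ∈ T then x else -x) (fun x _ => if x ∈ S then x else -x)
    ?_ ?_ ?_ ?_ ?_
  · intro x hx
    split_ifs with h
    · exact h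
    · exact ((hT.mem_iff x).1 (hS.subset hx)).resolve_left h
  · intro x hx
    split_ifs with h
    · exact h
    · exact ((hS.mem_iff x).1 (hT.subset hx)).resolve_left h
  · intro x hx
    by_cases h : x ∈ T
    · simp [h, hx]
    · simp [h, hS.not_neg x hx]
  · intro x hx
    by_cases h : x ∈ S
    · simp [h, hx]
    · simp [h, hT.not_neg x hx]
  · intro x hx
    split_ifs
    · rfl
    · exact (hg x).symm

open scoped Classical in
/-- The trace along the particular cycles of a premap as a sum over all index functions on `±I` that
are compatible with the premap. -/
theorem trAlong_particular [Inhabited (Fin d)] (hN : 1 ≤ N) (h0 : 0 ∉ I) {σ : Equiv.Perm ℤ}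
    (hσ : σ ∈ premaps I) (Y : ℕ → Matrix (Fin d) (Fin d) ℂ) :
    (N : ℂ) ^ (numCycles (pm I) σ / 2) * trAlong N (particular I σ) σ (signed Y) =
      sumFun (pm I) fun w => if ∀ x ∈ pm I, w (-σ x) = w x then
        ∏ k ∈ posPart I, Y k.natAbs (w (-k)) (w k) else 0 := by
  have hp := premap_permsOn hσ
  have hfin := isOfFinOrder_of_mem_permsOn hp
  obtain ⟨-, hm, -⟩ := (mem_premaps_iff h0).1 hσ
  have hσneg : ∀ x, σ (-x) = -(σ⁻¹ x) := fun x => by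
    rw [← hm, minus_apply, neg_neg]
  set P := particular I σ with hP
  have hh : IsHalf I P := particular_isHalf h0 hσ
  have hinv : ∀ x ∈ P, σ x ∈ P := fun x hx => particular_saturated hx
    (apply_mem_of_mem_permsOn hp (hh.subset hx)) (sameCycle_apply_self σ x)
  rw [numCycles_premap h0 hσ, Nat.mul_div_cancel_left _ two_pos, trAlong_eq_sumFun hN hfin hinv]
  -- An index function on `±I` compatible with `σ` is determined by its values at `-P`. With `i` on
  -- `P` one has `w(-x) = i(x)` and `w(x) = i(σ x)` for `x ∈ P`, that is `w = i ∘ q`.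
  let q : ℤ → ℤ := fun x => if x ∈ P then σ x else -x
  have hq : ∀ x ∈ pm I, q x ∈ P := by
    intro x hx
    simp only [q]
    split_ifs with h
    · exact hinv x h
    · exact ((hh.mem_iff x).1 hx).resolve_left h
  have hr : ∀ x ∈ P, -x ∈ pm I := fun x hx => neg_mem_pm.2 (hh.subset hx)
  have hqr : ∀ x ∈ P, q (-x) = x := by
    intro x hx
    simp only [q, if_neg (hh.not_neg x hx), neg_neg]
  have hdep : DependsOn (fun w : ℤ → Fin d => ∏ k ∈ posPart I, Y k.natAbs (w (-k)) (w k))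
      (pm I : Set ℤ) := by
    intro w w' h
    refine Finset.prod_congr rfl fun k hk => ?_
    rw [h k (posPart_subset_pm hk), h (-k) (neg_mem_pm.2 (posPart_subset_pm hk))]
  have hmain := sumFun_comp hdep (r := fun x => -x) hq hr hqr
  have hcond : ∀ w : ℤ → Fin d, (∀ x ∈ pm I, w x = w (-q x)) ↔ ∀ x ∈ pm I, w (-σ x) = w x := by
    intro w
    have key : (∀ x ∈ pm I, w x = w (-q x)) ↔ ∀ x ∈ P, w (-σ x) = w x := by
      constructor
      · intro h x hx
        rw [h x (hh.subset hx)]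
        simp only [q, if_pos hx]
      · intro h x hx
        simp only [q]
        split_ifs with h'
        · exact (h x h').symm
        · rw [neg_neg]
    rw [key]
    -- Compatibility on `P` extends to `-P`: for `-x ∈ P` the condition at `x` is the one at
    -- `σ⁻¹(-x)`, because `-σ x = σ⁻¹(-x)`.
    refine ⟨fun h x hx => ?_, fun h x hx => h x (hh.subset hx)⟩
    rcases (hh.mem_iff x).1 hx with h' | h'
    · exact h x h'
    · have h1 : σ⁻¹ (-x) ∈ pm I := apply_mem_of_mem_permsOn (inv_mem_permsOn hp) (hh.subset h')
      have h2 : σ.SameCycle (-x) (σ⁻¹ (-x)) := ⟨-1, by simp⟩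
      have h3 := h _ (particular_saturated h' h1 h2)
      have h4 : σ (σ⁻¹ (-x)) = -x := by simp
      have h5 : -σ x = σ⁻¹ (-x) := by
        have := hσneg (-x)
        rw [neg_neg] at this
        rw [this, neg_neg]
      rw [h4, neg_neg] at h3
      rw [h5, h3]
  simp only [hcond] at hmain
  rw [← hmain]
  refine sumFun_congr fun i => ?_
  -- This extends the summand to an even function on `±I`, so that the product over `I` can be taken
  -- over `P`. At negative points of `P` it is an entry of the transpose.
  let g : ℤ → ℂ := fun k => Y k.natAbs ((i ∘ q) (-|k|)) ((i ∘ q) |k|)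
  have e1 : ∏ k ∈ posPart I, Y k.natAbs ((i ∘ q) (-k)) ((i ∘ q) k) = ∏ k ∈ posPart I, g k := by
    refine Finset.prod_congr rfl fun k hk => ?_
    simp only [g, abs_of_nonneg (mem_posPart.1 hk).1]
  rw [e1, prod_isHalf (isHalf_posPart h0) hh g fun x => by simp only [g, Int.natAbs_neg, abs_neg]]
  refine Finset.prod_congr rfl fun s hs => ?_
  have hs0 := ne_zero_of_mem_pm h0 (hh.subset hs)
  have q1 : q s = σ s := if_pos hs
  have q2 : q (-s) = s := hqr s hs
  simp only [g, signed, Function.comp_apply]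
  rcases lt_or_gt_of_ne hs0 with h | h
  · rw [if_neg (not_lt.2 h.le), abs_of_neg h, neg_neg, q1, q2, Matrix.transpose_apply]
  · rw [if_pos h, abs_of_pos h, q1, q2]

end PathSum

/-! ### Moments of the standard normal distribution -/

section GaussianMoments

/-- The moments of the standard normal distribution. -/
noncomputable def gaussMoment (n : ℕ) : ℝ := ∫ x, x ^ n ∂gaussianReal 0 1

theorem hasDerivAt_gaussianPDFReal (x : ℝ) :
    HasDerivAt (gaussianPDFReal 0 1) (-(x * gaussianPDFReal 0 1 x)) x := by
  have h : gaussianPDFReal 0 1 =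
      fun x => (Real.sqrt (2 * Real.pi * (1 : NNReal)))⁻¹ * Real.exp (-(x - 0) ^ 2 / (2 * (1 : NNReal))) :=
    gaussianPDFReal_def 0 1
  have h2 : HasDerivAt (fun x : ℝ => -(x - 0) ^ 2 / (2 * ((1 : NNReal) : ℝ))) (-x) x := by
    have := (((hasDerivAt_id x).sub_const 0).pow 2).neg.div_const (2 * ((1 : NNReal) : ℝ))
    refine this.congr_deriv ?_
    simp
    ring
  rw [h]
  refine (h2.exp.const_mul _).congr_deriv ?_
  ring

theorem integrable_pow_mul_gaussianPDFReal (n : ℕ) :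
    Integrable fun x : ℝ => x ^ n * gaussianPDFReal 0 1 x := by
  have h := integrable_rpow_mul_exp_neg_mul_sq (b := 1 / 2) (by norm_num) (s := n)
    (by have : (0 : ℝ) ≤ n := n.cast_nonneg
        linarith)
  refine (h.const_mul (Real.sqrt (2 * Real.pi * (1 : NNReal)))⁻¹).congr (Eventually.of_forall fun x => ?_)
  rw [gaussianPDFReal_def]
  simp only [Real.rpow_natCast, NNReal.coe_one, sub_zero, mul_one]
  rw [show -(1 / 2) * x ^ 2 = -x ^ 2 / 2 by ring]
  ring

theorem gaussMoment_eq (n : ℕ) : gaussMoment n = ∫ x : ℝ, x ^ n * gaussianPDFReal 0 1 x := by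
  unfold gaussMoment
  rw [integral_gaussianReal_eq_integral_smul one_ne_zero]
  simp only [smul_eq_mul, mul_comm]

theorem gaussMoment_zero : gaussMoment 0 = 1 := by
  simp [gaussMoment]

/-- Integration by parts against the density, whose derivative at `x` is `-x` times the density. For
`n = 0` the truncated `n - 1` is harmless because of the factor `n`. -/
theorem gaussMoment_succ (n : ℕ) : gaussMoment (n + 1) = n * gaussMoment (n - 1) := by
  have h := integral_mul_deriv_eq_deriv_mul_of_integrable (A := ℝ) (u := fun x : ℝ => x ^ n)
    (u' := fun x => n * x ^ (n - 1)) (v := gaussianPDFReal 0 1)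
    (v' := fun x => -(x * gaussianPDFReal 0 1 x)) (fun x _ => hasDerivAt_pow n x)
    (fun x _ => hasDerivAt_gaussianPDFReal x)
    ((integrable_pow_mul_gaussianPDFReal (n + 1)).neg.congr (Eventually.of_forall fun x => by
      simp only [Pi.neg_apply, Pi.mul_apply]; ring))
    (((integrable_pow_mul_gaussianPDFReal (n - 1)).const_mul (n : ℝ)).congr
      (Eventually.of_forall fun x => by simp only [Pi.mul_apply]; ring))
    (integrable_pow_mul_gaussianPDFReal n)
  rw [gaussMoment_eq, gaussMoment_eq, ← integral_const_mul]
  have e1 : ∀ x : ℝ, x ^ n * -(x * gaussianPDFReal 0 1 x) = -(x ^ (n + 1) * gaussianPDFReal 0 1 x) := by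
    intro x; ring
  simp only [e1, integral_neg, neg_inj, mul_assoc] at h
  exact h

end GaussianMoments

/-! ### Pairings of a finite set -/

section Pairings

variable {S : Finset ℤ} {ρ : Equiv.Perm ℤ}

theorem mem_pairings : ρ ∈ pairings S ↔ ρ ∈ permsOn S ∧ ∀ k ∈ S, ρ k ≠ k ∧ ρ (ρ k) = k := by
  classical
  unfold pairings
  rw [Finset.mem_filter]

theorem pairing_apply_apply (h : ρ ∈ pairings S) (x : ℤ) : ρ (ρ x) = x := by
  by_cases hx : x ∈ S
  · exact ((mem_pairings.1 h).2 x hx).2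
  · rw [mem_permsOn.1 (mem_pairings.1 h).1 x hx, mem_permsOn.1 (mem_pairings.1 h).1 x hx]

/-- The pairings of `S` according to the partner of a given point. -/
theorem sum_pairings {R : Type*} [AddCommMonoid R] {k₀ : ℤ} (hk₀ : k₀ ∈ S) (g : Equiv.Perm ℤ → R) :
    ∑ ρ ∈ pairings S, g ρ = ∑ l ∈ S.erase k₀, ∑ ρ ∈ pairings ((S.erase k₀).erase l),
      g (ρ * Equiv.swap k₀ l) := by
  classical
  rw [Finset.sum_sigma']
  symm
  refine Finset.sum_bij (fun x _ => x.2 * Equiv.swap k₀ x.1) ?_ ?_ ?_ fun _ _ => rfl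
  · rintro ⟨l, ρ⟩ hx
    rw [Finset.mem_sigma, Finset.mem_erase] at hx
    obtain ⟨⟨hl, hlS⟩, hρ⟩ := hx
    simp only at hl hlS hρ ⊢
    obtain ⟨h1, h2⟩ := mem_pairings.1 hρ
    have h1' : ρ ∈ permsOn S := permsOn_mono
      ((Finset.erase_subset _ _).trans (Finset.erase_subset _ _)) h1
    have f1 : ρ k₀ = k₀ := mem_permsOn.1 h1 _ (by simp)
    have f2 : ρ l = l := mem_permsOn.1 h1 _ (by simp)
    refine mem_pairings.2 ⟨mul_mem_permsOn h1' (swap_mem_permsOn hk₀ hlS), fun x hx => ?_⟩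
    simp only [Equiv.Perm.mul_apply]
    by_cases hx1 : x = k₀
    · subst hx1
      rw [Equiv.swap_apply_left, f2, Equiv.swap_apply_right, f1]
      exact ⟨hl, rfl⟩
    by_cases hx2 : x = l
    · subst hx2
      rw [Equiv.swap_apply_right, f1, Equiv.swap_apply_left, f2]
      exact ⟨Ne.symm hl, rfl⟩
    have hxm : x ∈ (S.erase k₀).erase l :=
      Finset.mem_erase.2 ⟨hx2, Finset.mem_erase.2 ⟨hx1, hx⟩⟩
    have hxm' := apply_mem_of_mem_permsOn h1 hxm
    simp only [Finset.mem_erase] at hxm'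
    rw [Equiv.swap_apply_of_ne_of_ne hx1 hx2, Equiv.swap_apply_of_ne_of_ne hxm'.2.1 hxm'.1]
    exact h2 x hxm
  · rintro ⟨l, ρ⟩ hx ⟨l', ρ'⟩ hx' e
    simp only [Finset.mem_sigma] at hx hx' e
    have h1 : (ρ * Equiv.swap k₀ l) k₀ = l := by
      rw [Equiv.Perm.mul_apply, Equiv.swap_apply_left]
      exact mem_permsOn.1 (mem_pairings.1 hx.2).1 _ (by simp)
    have h2 : (ρ' * Equiv.swap k₀ l') k₀ = l' := by
      rw [Equiv.Perm.mul_apply, Equiv.swap_apply_left]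
      exact mem_permsOn.1 (mem_pairings.1 hx'.2).1 _ (by simp)
    have : l = l' := by rw [← h1, e, h2]
    subst this
    rw [mul_right_cancel e]
  · intro ρ hρ
    obtain ⟨h1, h2⟩ := mem_pairings.1 hρ
    have hl := (h2 k₀ hk₀).1
    have hlS := apply_mem_of_mem_permsOn h1 hk₀
    refine ⟨⟨ρ k₀, ρ * Equiv.swap k₀ (ρ k₀)⟩, ?_, by simp [mul_assoc]⟩
    rw [Finset.mem_sigma, Finset.mem_erase]
    refine ⟨⟨hl, hlS⟩, mem_pairings.2 ⟨mem_permsOn.2 fun x hx => ?_, fun x hx => ?_⟩⟩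
    · simp only [Finset.mem_erase, not_and] at hx
      rw [Equiv.Perm.mul_apply]
      by_cases hx1 : x = k₀
      · subst hx1; rw [Equiv.swap_apply_left]; exact pairing_apply_apply hρ _
      by_cases hx2 : x = ρ k₀
      · rw [hx2, Equiv.swap_apply_right]
      rw [Equiv.swap_apply_of_ne_of_ne hx1 hx2]
      exact mem_permsOn.1 h1 _ (hx hx2 hx1)
    · simp only [Finset.mem_erase] at hx
      have e1 : ρ x ≠ k₀ := fun e => hx.1 (by rw [← e, pairing_apply_apply hρ])
      have e2 : ρ x ≠ ρ k₀ := fun e => hx.2.1 (ρ.injective e)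
      rw [Equiv.Perm.mul_apply, Equiv.Perm.mul_apply, Equiv.swap_apply_of_ne_of_ne hx.2.1 hx.1,
        Equiv.swap_apply_of_ne_of_ne e1 e2]
      exact h2 x hx.2.2

end Pairings

/-! ### Wick's formula -/

section Wick

variable {τ : Type*}

open scoped Classical in
/-- The number of pairings of `S` compatible with `t`. -/
noncomputable def pairingCount (S : Finset ℤ) (t : ℤ → τ) : ℕ :=
  ((pairings S).filter (fun ρ => ∀ k ∈ S, t (ρ k) = t k)).card

open scoped Classical in
theorem pairingCount_eq {S : Finset ℤ} (t : ℤ → τ) {k₀ : ℤ} (hk₀ : k₀ ∈ S) :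
    pairingCount S t = ∑ l ∈ (S.erase k₀).filter (fun l => t l = t k₀),
      pairingCount ((S.erase k₀).erase l) t := by
  unfold pairingCount
  simp_rw [Finset.card_filter]
  rw [sum_pairings hk₀, Finset.sum_filter]
  refine Finset.sum_congr rfl fun l hl => ?_
  rw [Finset.mem_erase] at hl
  have key : ∀ ρ ∈ pairings ((S.erase k₀).erase l),
      ((∀ k ∈ S, t ((ρ * Equiv.swap k₀ l) k) = t k) ↔
        t l = t k₀ ∧ ∀ k ∈ (S.erase k₀).erase l, t (ρ k) = t k) := by
    intro ρ hρ
    have h1 := (mem_pairings.1 hρ).1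
    have f1 : ρ k₀ = k₀ := mem_permsOn.1 h1 _ (by simp)
    have f2 : ρ l = l := mem_permsOn.1 h1 _ (by simp)
    constructor
    · intro h
      have h2 := h k₀ hk₀
      rw [Equiv.Perm.mul_apply, Equiv.swap_apply_left, f2] at h2
      refine ⟨h2, fun k hk => ?_⟩
      simp only [Finset.mem_erase] at hk
      have h3 := h k hk.2.2
      rwa [Equiv.Perm.mul_apply, Equiv.swap_apply_of_ne_of_ne hk.2.1 hk.1] at h3
    · rintro ⟨h2, h3⟩ k hk
      rw [Equiv.Perm.mul_apply]
      by_cases hx1 : k = k₀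
      · subst hx1; rw [Equiv.swap_apply_left, f2, h2]
      by_cases hx2 : k = l
      · subst hx2; rw [Equiv.swap_apply_right, f1, h2]
      rw [Equiv.swap_apply_of_ne_of_ne hx1 hx2]
      exact h3 k (Finset.mem_erase.2 ⟨hx2, Finset.mem_erase.2 ⟨hx1, hk⟩⟩)
  split_ifs with h
  · refine Finset.sum_congr rfl fun ρ hρ => ?_
    simp only [key ρ hρ, h, true_and]
  · refine Finset.sum_eq_zero fun ρ hρ => ?_
    rw [if_neg]
    rw [key ρ hρ]
    exact fun h' => h h'.1

variable [Fintype τ]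

open scoped Classical in
-- Both sides obey the same recursion when a point `k₀` is removed: in `m_{n+1} = n m_{n-1}` the
-- factor `n` counts the possible partners of `k₀` with the same label.
theorem prod_gaussMoment_eq (S : Finset ℤ) (t : ℤ → τ) :
    ∏ s, gaussMoment (S.filter (fun k => t k = s)).card = pairingCount S t := by
  classical
  induction S using Finset.strongInduction with
  | H S ih =>
    rcases S.eq_empty_or_nonempty with rfl | ⟨k₀, hk₀⟩
    · have : pairings ∅ = {1} := by
        ext ρ
        rw [mem_pairings, Finset.mem_singleton]
        constructor
        · intro h
          ext x
          exact mem_permsOn.1 h.1 x (Finset.notMem_empty x)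
        · rintro rfl
          exact ⟨one_mem_permsOn, by simp⟩
      simp [gaussMoment_zero, pairingCount, this]
    · rw [pairingCount_eq t hk₀, Nat.cast_sum]
      -- The remaining count does not depend on the partner `l`: two points are removed from the
      -- label of `k₀`, and the other labels are untouched.
      have h1 : ∀ l ∈ (S.erase k₀).filter (fun l => t l = t k₀),
          ((pairingCount ((S.erase k₀).erase l) t : ℕ) : ℝ) =
          gaussMoment (((S.erase k₀).filter (fun k => t k = t k₀)).card - 1) *
            ∏ s ∈ Finset.univ.erase (t k₀), gaussMoment (S.filter (fun k => t k = s)).card := by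
        intro l hl
        obtain ⟨hl, hlt⟩ := Finset.mem_filter.1 hl
        rw [← ih ((S.erase k₀).erase l) ((Finset.erase_subset _ _).trans_ssubset
          (Finset.erase_ssubset hk₀)), ← Finset.mul_prod_erase _ _ (Finset.mem_univ (t k₀))]
        congr 1
        · rw [Finset.filter_erase, Finset.card_erase_of_mem (Finset.mem_filter.2 ⟨hl, hlt⟩)]
        · refine Finset.prod_congr rfl fun s hs => ?_
          rw [Finset.filter_erase, Finset.filter_erase, Finset.erase_eq_of_notMem,
            Finset.erase_eq_of_notMem]
          · exact fun h => (Finset.ne_of_mem_erase hs) (Finset.mem_filter.1 h).2.symm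
          · exact fun h => (Finset.ne_of_mem_erase hs)
              ((Finset.mem_filter.1 (Finset.mem_of_mem_erase h)).2.symm.trans hlt)
      rw [Finset.sum_congr rfl h1, Finset.sum_const, nsmul_eq_mul,
        ← Finset.mul_prod_erase _ _ (Finset.mem_univ (t k₀)), ← mul_assoc]
      congr 1
      have h2 : (S.filter (fun k => t k = t k₀)).card =
          ((S.erase k₀).filter (fun k => t k = t k₀)).card + 1 := by
        rw [Finset.filter_erase, Finset.card_erase_add_one]
        exact Finset.mem_filter.2 ⟨hk₀, rfl⟩
      rw [h2, gaussMoment_succ]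

variable {Ω : Type*} [MeasurableSpace Ω] {μ : Measure Ω}

/-- Wick's formula. -/
theorem integral_prod_gaussian {f : τ → Ω → ℝ} (hf : ∀ t, Measurable (f t)) (hi : iIndepFun f μ)
    (hl : ∀ t, μ.map (f t) = gaussianReal 0 1) (S : Finset ℤ) (t : ℤ → τ) :
    ∫ ω, ∏ k ∈ S, f (t k) ω ∂μ = pairingCount S t := by
  classical
  rw [← prod_gaussMoment_eq]
  have h1 : ∀ ω, ∏ k ∈ S, f (t k) ω = ∏ s, f s ω ^ (S.filter (fun k => t k = s)).card := by
    intro ω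
    rw [← Finset.prod_fiberwise' S t (fun s => f s ω)]
    exact Finset.prod_congr rfl fun s _ => Finset.prod_const _
  simp_rw [h1]
  rw [hi.integral_fun_prod_comp (f := fun s x => x ^ (S.filter (fun k => t k = s)).card)
    (fun s => (hf s).aemeasurable) fun s => (measurable_id.pow_const _).aestronglyMeasurable]
  refine Finset.prod_congr rfl fun s _ => ?_
  unfold gaussMoment
  rw [← hl s, integral_map (f := fun x : ℝ => x ^ _) (hf s).aemeasurable
    (continuous_pow _).aestronglyMeasurable]

theorem hasMoments_gaussian {f : Ω → ℝ} (hf : Measurable f) (hl : μ.map f = gaussianReal 0 1) :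
    HasMoments μ (fun ω => (f ω : ℂ)) := by
  intro p hp
  have h := memLp_id_gaussianReal' (μ := 0) (v := 1) p hp
  rw [← hl, memLp_map_measure_iff (by rw [hl]; exact measurable_id.aestronglyMeasurable) hf.aemeasurable] at h
  exact h.ofReal

end Wick

/-! ### From mixed moments of entries to a genus expansion -/

section Entries

variable {d : ℕ} {I : Finset ℕ} {ε : ℕ → ℤˣ} {γ π : Equiv.Perm ℤ}

theorem disjoint_posPart_negPart_self (h0 : 0 ∉ I) : Disjoint (posPart I) (negPart I) := by
  rw [Finset.disjoint_left]
  intro x hx hx'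
  rw [mem_posPart] at hx
  rw [mem_negPart] at hx'
  have : x = 0 := le_antisymm hx'.1 hx.1
  subst this
  exact h0 hx.2

/-- The indices of a factor are `u(s)` and `u(-s)`, so transposing the matrix is the same as
exchanging `s` and `-s`. -/
theorem signPow_apply_deltaEps (A : Matrix (Fin d) (Fin d) ℂ) (u : ℤ → Fin d) (s : ℤ) :
    signPow (ε s.natAbs) A (u s) (u (-s)) = A ((u ∘ deltaEps ε) s) ((u ∘ deltaEps ε) (-s)) := by
  simp only [Function.comp_apply, deltaEps_apply, signPow]
  rcases Int.units_eq_one_or (ε s.natAbs) with h | h <;> simp [h, Matrix.transpose_apply]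

/-- The index `u(-s)` is the one summed over in the product `A_s B_s`; the outer indices are `u(s)`
and `u(γ s)`. -/
theorem sumFun_path_mul [Inhabited (Fin d)] (h0 : 0 ∉ I) (hγ : γ ∈ permsOn (posPart I))
    (A B : ℤ → Matrix (Fin d) (Fin d) ℂ) :
    (sumFun (posPart I) fun i => ∏ s ∈ posPart I, (A s * B s) (i s) (i (γ s))) =
      sumFun (pm I) fun u => (∏ s ∈ posPart I, A s (u s) (u (-s))) *
        ∏ s ∈ posPart I, B s (u (-s)) (u (γ s)) := by
  have hn : ∀ s ∈ posPart I, -s ∉ posPart I := (isHalf_posPart h0).not_neg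
  have e : pm I = posPart I ∪ negPart I := rfl
  rw [e, sumFun_union (disjoint_posPart_negPart_self h0)]
  refine sumFun_congr fun i => ?_
  simp only [Matrix.mul_apply]
  rw [prod_sum_eq_sumFun (S := posPart I) fun s b => A s (i s) b * B s b (i (γ s))]
  have hdep : DependsOn (fun b : ℤ → Fin d => ∏ s ∈ posPart I, A s (i s) (b s) * B s (b s) (i (γ s)))
      (posPart I : Set ℤ) := fun b b' h => Finset.prod_congr rfl fun s hs => by rw [h s hs]
  rw [← sumFun_equiv (P := negPart I) hdep delta fun x => by
    rw [mem_negPart, mem_posPart, delta_apply, Int.natAbs_neg, Left.neg_nonpos_iff]]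
  refine sumFun_congr fun v => ?_
  rw [Finset.prod_mul_distrib]
  congr 1 <;> refine Finset.prod_congr rfl fun s hs => ?_
  · rw [if_pos hs, if_neg (hn s hs)]
    rfl
  · rw [if_pos (apply_mem_of_mem_permsOn hγ hs), if_neg (hn s hs)]
    rfl

open scoped Classical in
-- Substituting `w = u ∘ γ` turns the condition on `u` into compatibility of `w` with `γ₋⁻¹ δ_ε π
-- δ_ε γ₊`. Since `γ` fixes negative numbers, the entry of `Y_s` at `u(-s), u(γ s)` becomes the one
-- at `w(-s), w(s)`, as in `trAlong_particular`.
theorem sumFun_twist [Inhabited (Fin d)] (h0 : 0 ∉ I) (hγ : γ ∈ permsOn (posPart I))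
    (hπ : π ∈ premaps I) (Y : ℕ → Matrix (Fin d) (Fin d) ℂ) (hd : 1 ≤ d) :
    (sumFun (pm I) fun u => (if ∀ s ∈ pm I, (u ∘ deltaEps ε) (-π s) = (u ∘ deltaEps ε) s then 1 else 0) *
        ∏ s ∈ posPart I, Y s.natAbs (u (-s)) (u (γ s))) =
      (d : ℂ) ^ (numCycles (pm I) (twist γ (signConj ε π)) / 2) *
        trAlong d (particular I (twist γ (signConj ε π))) (twist γ (signConj ε π)) (signed Y) := by
  have hγ' := permsOn_pm_of_posPart hγ
  have hσ := twist_mem_premaps h0 hγ' (signConj_mem_premaps ε h0 hπ)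
  rw [trAlong_particular hd h0 hσ]
  have hp := premap_permsOn hσ
  have hdep : DependsOn (fun w : ℤ → Fin d => if ∀ x ∈ pm I, w (-twist γ (signConj ε π) x) = w x then
      ∏ k ∈ posPart I, Y k.natAbs (w (-k)) (w k) else 0) (pm I : Set ℤ) := by
    intro w w' h
    have h1 : (∀ x ∈ pm I, w (-twist γ (signConj ε π) x) = w x) ↔
        ∀ x ∈ pm I, w' (-twist γ (signConj ε π) x) = w' x :=
      forall₂_congr fun x hx => by
        rw [h x hx, h _ (neg_mem_pm.2 (apply_mem_of_mem_permsOn hp hx))]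
    have h2 : ∏ k ∈ posPart I, Y k.natAbs (w (-k)) (w k) =
        ∏ k ∈ posPart I, Y k.natAbs (w' (-k)) (w' k) := Finset.prod_congr rfl fun k hk => by
      rw [h k (posPart_subset_pm hk), h (-k) (neg_mem_pm.2 (posPart_subset_pm hk))]
    simp only [h1, h2]
  rw [← sumFun_equiv hdep γ (apply_mem_iff_of_mem_permsOn hγ')]
  refine sumFun_congr fun u => ?_
  have h1 : (∀ s ∈ pm I, (u ∘ deltaEps ε) (-π s) = (u ∘ deltaEps ε) s) ↔
      ∀ x ∈ pm I, (u ∘ γ) (-twist γ (signConj ε π) x) = (u ∘ γ) x := by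
    have key : ∀ x, (u ∘ γ) (-twist γ (signConj ε π) x) =
        (u ∘ deltaEps ε) (-π (deltaEps ε (γ x))) := by
      intro x
      have : twist γ (signConj ε π) x = -(γ⁻¹ (-(signConj ε π (γ x)))) := by
        simp only [twist, Equiv.Perm.mul_apply, ← minus_inv, minus_apply]
      simp only [Function.comp_apply]
      rw [this, neg_neg]
      simp [deltaEps_neg]
    simp only [key]
    constructor
    · intro h x hx
      rw [h _ ((deltaEps_mem_pm ε).2 ((apply_mem_iff_of_mem_permsOn hγ' x).2 hx))]
      simp [deltaEps_deltaEps]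
    · intro h s hs
      have := h (γ⁻¹ (deltaEps ε s)) (apply_mem_of_mem_permsOn (inv_mem_permsOn hγ')
        ((deltaEps_mem_pm ε).2 hs))
      simpa [deltaEps_deltaEps] using this
  have h2 : ∏ s ∈ posPart I, Y s.natAbs (u (-s)) (u (γ s)) =
      ∏ k ∈ posPart I, Y k.natAbs ((u ∘ γ) (-k)) ((u ∘ γ) k) := by
    refine Finset.prod_congr rfl fun s hs => ?_
    simp only [Function.comp_apply]
    rw [mem_permsOn.1 hγ _ ((isHalf_posPart h0).not_neg s hs)]
  simp only [h1, h2, ite_mul, one_mul, zero_mul]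

/-- The first count in `χ` is `2 #(γ)`, the second is invariant under conjugation by signs, and the
third is that of the inverse of the twisted premap. -/
theorem eulerChar_twist (h0 : 0 ∉ I) (hγ : γ ∈ permsOn (posPart I)) :
    eulerChar I γ (signConj ε π) - 2 * (numCycles (posPart I) γ : ℤ) =
      ((numCycles (pm I) π / 2 : ℕ) : ℤ) - I.card
        + ((numCycles (pm I) (twist γ (signConj ε π)) / 2 : ℕ) : ℤ) - numCycles (posPart I) γ := by
  have h1 : numCycles (pm I) (γ * (minus γ)⁻¹) = 2 * numCycles (posPart I) γ := by
    rw [numCycles_eq_nclass, numCycles_eq_nclass]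
    exact nclass_cyc_double (isHalf_posPart h0) hγ
  have h2 : γ⁻¹ * (signConj ε π)⁻¹ * minus γ = (twist γ (signConj ε π))⁻¹ := by
    rw [twist]; group
  have h3 : numCycles (pm I) (twist γ (signConj ε π))⁻¹ = numCycles (pm I) (twist γ (signConj ε π)) := by
    rw [numCycles_eq_nclass, numCycles_eq_nclass, nclass_cyc_inv]
  rw [eulerChar, h1, h2, h3, numCycles_signConj, Nat.mul_div_cancel_left _ two_pos]
  ring

variable {Ω Λ : Type*} [MeasurableSpace Ω] {μ : Measure Ω}

theorem integral_prod_mul_prod_of_indepFun {N : ℕ} {A : Λ → Ω → Matrix (Fin N) (Fin N) ℂ}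
    {Y : ℕ → Ω → Matrix (Fin N) (Fin N) ℂ}
    (hA : ∀ l, IsRandomMatrix μ (A l)) (hY : ∀ k, IsRandomMatrix μ (Y k))
    (hind : IndepFun (fun ω (t : Λ × Fin N × Fin N) => A t.1 ω t.2.1 t.2.2)
      (fun ω (t : ℕ × Fin N × Fin N) => Y t.1 ω t.2.1 t.2.2) μ)
    (S : Finset ℤ) (a : ℤ → Λ × Fin N × Fin N) (b : ℤ → ℕ × Fin N × Fin N) :
    ∫ ω, (∏ s ∈ S, A (a s).1 ω (a s).2.1 (a s).2.2) * ∏ s ∈ S, Y (b s).1 ω (b s).2.1 (b s).2.2 ∂μ =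
      (∫ ω, ∏ s ∈ S, A (a s).1 ω (a s).2.1 (a s).2.2 ∂μ) *
        ∫ ω, ∏ s ∈ S, Y (b s).1 ω (b s).2.1 (b s).2.2 ∂μ := by
  have m1 : Measurable fun x : Λ × Fin N × Fin N → ℂ => ∏ s ∈ S, x (a s) :=
    Finset.measurable_prod _ fun s _ => measurable_pi_apply _
  have m2 : Measurable fun x : ℕ × Fin N × Fin N → ℂ => ∏ s ∈ S, x (b s) :=
    Finset.measurable_prod _ fun s _ => measurable_pi_apply _
  have hi := hind.comp m1 m2
  exact hi.integral_fun_mul_eq_mul_integral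
    (Finset.measurable_prod _ fun s _ => (hA _ _ _).1).aestronglyMeasurable
    (Finset.measurable_prod _ fun s _ => (hY _ _ _).1).aestronglyMeasurable

variable [IsProbabilityMeasure μ]

open scoped Classical in
/-- A formula for the mixed moments of the entries gives a genus expansion. -/
theorem isGenusEnsemble_of_entries {G : GenusData Λ}
    {X : (N : ℕ) → Λ → Ω → Matrix (Fin N) (Fin N) ℂ}
    (hr : ∀ N : ℕ, 1 ≤ N → ∀ l : Λ, IsRandomMatrix μ (X N l)) (hG : G.IsMultiplicative)
    (hX : ∀ N : ℕ, 1 ≤ N → ∀ I : Finset ℕ, 0 ∉ I → ∀ (lam : ℕ → Λ) (u : ℤ → Fin N),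
      ∫ ω, ∏ k ∈ posPart I, X N (lam k.natAbs) ω (u k) (u (-k)) ∂μ =
        ∑ π ∈ G.PM I, (N : ℂ) ^ (((numCycles (pm I) π / 2 : ℕ) : ℤ) - I.card) * G.f N I lam π *
          if ∀ s ∈ pm I, u (-π s) = u s then 1 else 0) :
    IsGenusEnsemble μ G X := by
  refine ⟨hr, hG, fun N hN I h0 γ hγ ε lam Y hY hind => ?_⟩
  have hN0 : N ≠ 0 := by omega
  have hN' : (N : ℂ) ≠ 0 := by exact_mod_cast hN0
  let _ : Inhabited (Fin N) := ⟨⟨0, hN⟩⟩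
  have hfin := isOfFinOrder_of_mem_permsOn hγ
  have hYi : ∀ u : ℤ → Fin N, HasMoments μ
      (fun ω => ∏ s ∈ posPart I, Y s.natAbs ω (u (-s)) (u (γ s))) := fun u =>
    HasMoments.prod fun s _ => (hY _ _ _).2
  have hXi : ∀ u : ℤ → Fin N, HasMoments μ
      (fun ω => ∏ s ∈ posPart I, X N (lam s.natAbs) ω (u s) (u (-s))) := fun u =>
    HasMoments.prod fun s _ => (hr N hN _ _ _).2
  -- The traces are expanded over indices on `±I`, and independence separates the entries of the
  -- `X_λ` from those of the `Y_k`. The moment formula is then inserted, and for each `π` the sum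
  -- over the indices is evaluated in `e2`.
  have e1 : (N : ℂ) ^ numCycles (posPart I) γ * ∫ ω, trAlong N (posPart I) γ
        (fun k => signPow (ε k.natAbs) (X N (lam k.natAbs) ω) * Y k.natAbs ω) ∂μ =
      sumFun (pm I) fun u =>
        (∫ ω, ∏ s ∈ posPart I, X N (lam s.natAbs) ω ((u ∘ deltaEps ε) s) ((u ∘ deltaEps ε) (-s)) ∂μ) *
          ∫ ω, ∏ s ∈ posPart I, Y s.natAbs ω (u (-s)) (u (γ s)) ∂μ := by
    rw [← integral_const_mul]
    simp_rw [trAlong_eq_sumFun hN hfin (fun x hx => apply_mem_of_mem_permsOn hγ hx),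
      sumFun_path_mul h0 hγ, signPow_apply_deltaEps]
    unfold sumFun
    rw [integral_finsetSum]
    · refine Finset.sum_congr rfl fun u _ => ?_
      exact integral_prod_mul_prod_of_indepFun (hr N hN) hY hind (posPart I)
        (fun s => (lam s.natAbs, (extendFun (pm I) u ∘ deltaEps ε) s,
          (extendFun (pm I) u ∘ deltaEps ε) (-s)))
        (fun s => (s.natAbs, extendFun (pm I) u (-s), extendFun (pm I) u (γ s)))
    · exact fun u _ => ((hXi _).mul (hYi _)).integrable
  have e2 : ∀ π ∈ G.PM I, (sumFun (pm I) fun u =>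
      (if ∀ s ∈ pm I, (u ∘ deltaEps ε) (-π s) = (u ∘ deltaEps ε) s then 1 else 0) *
        ∫ ω, ∏ s ∈ posPart I, Y s.natAbs ω (u (-s)) (u (γ s)) ∂μ) =
      (N : ℂ) ^ (numCycles (pm I) (twist γ (signConj ε π)) / 2) *
        ∫ ω, trAlong N (particular I (twist γ (signConj ε π))) (twist γ (signConj ε π))
          (signed fun k => Y k ω) ∂μ := by
    intro π hπ
    rw [← integral_const_mul]
    simp_rw [← sumFun_twist h0 hγ (hG.subset I h0 hπ) _ hN]
    unfold sumFun
    rw [integral_finsetSum]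
    · exact Finset.sum_congr rfl fun u _ => (integral_const_mul _ _).symm
    · exact fun u _ => ((hYi _).const_mul _).integrable
  have e3 : (N : ℂ) ^ numCycles (posPart I) γ * ∫ ω, trAlong N (posPart I) γ
        (fun k => signPow (ε k.natAbs) (X N (lam k.natAbs) ω) * Y k.natAbs ω) ∂μ =
      ∑ π ∈ G.PM I, (N : ℂ) ^ (((numCycles (pm I) π / 2 : ℕ) : ℤ) - I.card) * G.f N I lam π *
        ((N : ℂ) ^ (numCycles (pm I) (twist γ (signConj ε π)) / 2) *
        ∫ ω, trAlong N (particular I (twist γ (signConj ε π))) (twist γ (signConj ε π))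
          (signed fun k => Y k ω) ∂μ) := by
    rw [e1]
    refine Eq.trans ?_ (Finset.sum_congr rfl fun π hπ => congrArg
      (fun z => (N : ℂ) ^ (((numCycles (pm I) π / 2 : ℕ) : ℤ) - I.card) * G.f N I lam π * z) (e2 π hπ))
    simp only [← sumFun_mul_left]
    rw [← sumFun_sum]
    refine sumFun_congr fun u => ?_
    rw [hX N hN I h0 lam, Finset.sum_mul]
    exact Finset.sum_congr rfl fun π _ => by ring
  have hNγ : (N : ℂ) ^ numCycles (posPart I) γ ≠ 0 := pow_ne_zero _ hN'
  refine mul_left_cancel₀ hNγ ?_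
  rw [e3, Finset.mul_sum]
  refine Finset.sum_congr rfl fun π _ => ?_
  change _ = _ * ((N : ℂ) ^ (eulerChar I γ (signConj ε π) - 2 * (numCycles (posPart I) γ : ℤ)) *
    G.f N I lam π * ∫ ω, trAlong N (particular I (twist γ (signConj ε π)))
      (twist γ (signConj ε π)) (signed fun k => Y k ω) ∂μ)
  rw [eulerChar_twist h0 hγ, zpow_sub₀ hN' (_ + _), zpow_add₀ hN', zpow_natCast, zpow_natCast]
  field_simp

end Entries

/-! ### Splitting premaps over disjoint index sets -/

section Split

variable {I J K : Finset ℕ} {π π₁ π₂ : Equiv.Perm ℤ}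

theorem minus_eq_inv_iff : minus π = π⁻¹ ↔ ∀ x, π (-π x) = -x := by
  constructor
  · intro h x
    have h1 : minus π (π x) = x := by rw [h]; simp
    rw [minus_apply] at h1
    rw [← h1, neg_neg, h1]
  · intro h
    rw [eq_inv_iff_mul_eq_one]
    ext x
    rw [Equiv.Perm.mul_apply, minus_apply, Equiv.Perm.one_apply, h, neg_neg]

theorem exists_permsOn_eqOn {A : Finset ℤ} (h : ∀ x, π x ∈ A ↔ x ∈ A) :
    ∃ σ ∈ permsOn A, ∀ x ∈ A, σ x = π x := by
  refine ⟨Equiv.Perm.ofSubtype (π.subtypePerm h), mem_permsOn.2 fun x hx =>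
    Equiv.Perm.ofSubtype_apply_of_not_mem _ hx, fun x hx => ?_⟩
  rw [Equiv.Perm.ofSubtype_apply_of_mem _ hx]
  rfl

theorem mul_mem_premaps (h0 : 0 ∉ J ∪ K) (h : Disjoint J K) (h₁ : π₁ ∈ premaps J)
    (h₂ : π₂ ∈ premaps K) : π₁ * π₂ ∈ premaps (J ∪ K) := by
  rw [Finset.mem_union, not_or] at h0
  have hd := disjoint_pm h
  have p₁ := premap_permsOn h₁
  have p₂ := premap_permsOn h₂
  have m₁ := ((mem_premaps_iff h0.1).1 h₁).2
  have m₂ := ((mem_premaps_iff h0.2).1 h₂).2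
  rw [mem_premaps_iff (by simp [h0]), pm_union]
  refine ⟨mul_mem_permsOn_union p₁ p₂, ?_, fun k hk => ?_⟩
  · rw [minus_mul, m₁.1, m₂.1, mul_inv_rev,
      permsOn_comm hd (inv_mem_permsOn p₁) (inv_mem_permsOn p₂)]
  · rcases Finset.mem_union.1 hk with hk | hk
    · rw [mul_apply_left hd p₂ hk]
      exact m₁.2 k hk
    · rw [mul_apply_right hd p₁ p₂ hk]
      exact m₂.2 k hk

theorem not_connects_mul (hd : Disjoint (pm J) (pm K)) (h₁ : π₁ ∈ permsOn (pm J))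
    (h₂ : π₂ ∈ permsOn (pm K)) : ¬ Connects (π₁ * π₂) (pm J) (pm K) := by
  rintro ⟨a, ha, b, hb, hab⟩
  rw [sameCycle_mul_left hd h₁ h₂ ha] at hab
  exact Finset.disjoint_left.1 hd (mem_of_sameCycle h₁ hab ha) hb

theorem restrict_mem_premaps (h0 : 0 ∉ J) {σ : Equiv.Perm ℤ} (hσ : σ ∈ permsOn (pm J))
    (h : ∀ x ∈ pm J, σ x = π x) (hm : minus π = π⁻¹) (hne : ∀ k ∈ pm J, π k ≠ -k) :
    σ ∈ premaps J := by
  refine (mem_premaps_iff h0).2 ⟨hσ, minus_eq_inv_iff.2 fun x => ?_, fun k hk => ?_⟩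
  · by_cases hx : x ∈ pm J
    · rw [h _ (neg_mem_pm.2 (apply_mem_of_mem_permsOn hσ hx)), h x hx, minus_eq_inv_iff.1 hm]
    · rw [mem_permsOn.1 hσ x hx, mem_permsOn.1 hσ]
      rwa [neg_mem_pm]
  · rw [h k hk]
    exact hne k hk

theorem exists_mul_of_not_connects (h0 : 0 ∉ J ∪ K) (hd : Disjoint J K) (h : π ∈ premaps (J ∪ K))
    (hc : ¬ Connects π (pm J) (pm K)) : ∃ π₁ ∈ premaps J, ∃ π₂ ∈ premaps K, π = π₁ * π₂ := by
  obtain ⟨hp, hm, hne⟩ := (mem_premaps_iff h0).1 h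
  rw [Finset.mem_union, not_or] at h0
  rw [pm_union] at hp hne
  have hd' := disjoint_pm hd
  have hJ : ∀ x, π x ∈ pm J ↔ x ∈ pm J := by
    refine fun x => ⟨fun hx => ?_, fun hx => ?_⟩
    · have h1 : x ∈ pm J ∪ pm K := by
        rw [← apply_mem_iff_of_mem_permsOn hp]
        exact Finset.mem_union_left _ hx
      rcases Finset.mem_union.1 h1 with h1 | h1
      · exact h1
      · exact absurd ⟨_, hx, _, h1, (sameCycle_apply_self π x).symm⟩ hc
    · rcases Finset.mem_union.1 (apply_mem_of_mem_permsOn hp (Finset.mem_union_left _ hx)) with h1 | h1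
      · exact h1
      · exact absurd ⟨_, hx, _, h1, sameCycle_apply_self π x⟩ hc
  have hK : ∀ x, π x ∈ pm K ↔ x ∈ pm K := by
    intro x
    have h1 := apply_mem_iff_of_mem_permsOn hp x
    rw [Finset.mem_union, Finset.mem_union, hJ] at h1
    have h2 : x ∈ pm J → x ∉ pm K := fun h => Finset.disjoint_left.1 hd' h
    have h3 : π x ∈ pm J → π x ∉ pm K := fun h => Finset.disjoint_left.1 hd' h
    rw [hJ] at h3
    grind
  obtain ⟨σ₁, p₁, e₁⟩ := exists_permsOn_eqOn hJ
  obtain ⟨σ₂, p₂, e₂⟩ := exists_permsOn_eqOn hK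
  refine ⟨σ₁, restrict_mem_premaps h0.1 p₁ e₁ hm fun k hk => hne k (Finset.mem_union_left _ hk),
    σ₂, restrict_mem_premaps h0.2 p₂ e₂ hm fun k hk => hne k (Finset.mem_union_right _ hk), ?_⟩
  ext x
  by_cases hx : x ∈ pm J
  · rw [mul_apply_left hd' p₂ hx, e₁ x hx]
  by_cases hx' : x ∈ pm K
  · rw [mul_apply_right hd' p₁ p₂ hx', e₂ x hx']
  rw [Equiv.Perm.mul_apply, mem_permsOn.1 p₂ x hx', mem_permsOn.1 p₁ x hx,
    mem_permsOn.1 hp x (by simp [hx, hx'])]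

/-- Premaps cut out by a condition on `x`, `π(x)` and `π²(x)` split into products. -/
theorem split_of_forall {PM : Finset ℕ → Finset (Equiv.Perm ℤ)} {Q : ℤ → ℤ → ℤ → Prop}
    (hPM : ∀ I : Finset ℕ, 0 ∉ I → ∀ π, π ∈ PM I ↔
      π ∈ premaps I ∧ ∀ x ∈ pm I, Q x (π x) (π (π x)))
    (hJ : 0 ∉ J) (hK : 0 ∉ K) (hd : Disjoint J K) (π : Equiv.Perm ℤ) :
    (π ∈ PM (J ∪ K) ∧ ¬ Connects π (pm J) (pm K)) ↔ ∃ π₁ ∈ PM J, ∃ π₂ ∈ PM K, π = π₁ * π₂ := by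
  have h0 : 0 ∉ J ∪ K := by simp [hJ, hK]
  have hd' := disjoint_pm hd
  have key : ∀ π₁ ∈ premaps J, ∀ π₂ ∈ premaps K,
      ((∀ x ∈ pm (J ∪ K), Q x ((π₁ * π₂) x) ((π₁ * π₂) ((π₁ * π₂) x))) ↔
        (∀ x ∈ pm J, Q x (π₁ x) (π₁ (π₁ x))) ∧ ∀ x ∈ pm K, Q x (π₂ x) (π₂ (π₂ x))) := by
    intro π₁ h₁ π₂ h₂
    have p₁ := premap_permsOn h₁
    have p₂ := premap_permsOn h₂
    rw [pm_union, Finset.forall_mem_union]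
    refine and_congr (forall₂_congr fun x hx => ?_) (forall₂_congr fun x hx => ?_)
    · rw [mul_apply_left hd' p₂ hx, mul_apply_left hd' p₂ (apply_mem_of_mem_permsOn p₁ hx)]
    · rw [mul_apply_right hd' p₁ p₂ hx, mul_apply_right hd' p₁ p₂ (apply_mem_of_mem_permsOn p₂ hx)]
  constructor
  · rintro ⟨h, hc⟩
    rw [hPM _ h0] at h
    obtain ⟨π₁, h₁, π₂, h₂, rfl⟩ := exists_mul_of_not_connects h0 hd h.1 hc
    have := (key π₁ h₁ π₂ h₂).1 h.2
    exact ⟨π₁, (hPM J hJ _).2 ⟨h₁, this.1⟩, π₂, (hPM K hK _).2 ⟨h₂, this.2⟩, rfl⟩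
  · rintro ⟨π₁, h₁, π₂, h₂, rfl⟩
    rw [hPM J hJ] at h₁
    rw [hPM K hK] at h₂
    exact ⟨(hPM _ h0 _).2 ⟨mul_mem_premaps h0 hd h₁.1 h₂.1, (key _ h₁.1 _ h₂.1).2 ⟨h₁.2, h₂.2⟩⟩,
      not_connects_mul hd' (premap_permsOn h₁.1) (premap_permsOn h₂.1)⟩

end Split

/-! ### The combinatorial data of the three models -/

section ModelData

variable {I J K : Finset ℕ} {π ρ : Equiv.Perm ℤ}

theorem negOn_apply (x : ℤ) : negOn I x = if x ∈ pm I then -x else x := by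
  change (if x.natAbs ∈ I then -x else x) = _
  simp only [mem_pm]

theorem pairing_mul_negOn_mul_apply (h0 : 0 ∉ I) (hρ : ρ ∈ pairings (posPart I)) {k : ℤ}
    (hk : k ∈ posPart I) :
    (ρ * negOn I * ρ) k = -ρ k ∧ (ρ * negOn I * ρ) (-k) = ρ k := by
  have hp := (mem_pairings.1 hρ).1
  have hn := (isHalf_posPart h0).not_neg
  have h1 := apply_mem_of_mem_permsOn hp hk
  simp only [Equiv.Perm.mul_apply]
  rw [negOn_apply, if_pos (posPart_subset_pm h1), mem_permsOn.1 hp _ (hn _ h1),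
    mem_permsOn.1 hp _ (hn _ hk), negOn_apply, if_pos (neg_mem_pm.2 (posPart_subset_pm hk)), neg_neg]
  exact ⟨rfl, rfl⟩

theorem forall_mem_pm {p : ℤ → Prop} (h0 : 0 ∉ I) :
    (∀ x ∈ pm I, p x) ↔ ∀ k ∈ posPart I, p k ∧ p (-k) := by
  constructor
  · exact fun h k hk => ⟨h k (posPart_subset_pm hk), h _ (neg_mem_pm.2 (posPart_subset_pm hk))⟩
  · intro h x hx
    rcases ((isHalf_posPart h0).mem_iff x).1 hx with hx | hx
    · exact (h x hx).1
    · simpa using (h _ hx).2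

theorem pos_of_mem_posPart (h0 : 0 ∉ I) {k : ℤ} (hk : k ∈ posPart I) : 0 < k :=
  lt_of_le_of_ne (mem_posPart.1 hk).1 (ne_zero_of_mem_pm h0 (posPart_subset_pm hk)).symm

/-- `ρδρ` sends `k` to `-ρ(k)` and `-k` to `ρ(k)`, and `ρ` is recovered as `k ↦ -π(k)`. The
resulting condition is local in `x`, as required by `split_of_forall`. -/
theorem mem_ginibre_iff (h0 : 0 ∉ I) : π ∈ ginibreData.PM I ↔
    π ∈ premaps I ∧ ∀ x ∈ pm I, π (π x) = x ∧ (0 < x → π x < 0) := by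
  classical
  have hn := (isHalf_posPart h0).not_neg
  have hpos : ∀ {k : ℤ}, k ∈ posPart I → 0 < k := pos_of_mem_posPart h0
  have : π ∈ ginibreData.PM I ↔ ∃ ρ ∈ pairings (posPart I), ρ * negOn I * ρ = π := Finset.mem_image
  rw [this]
  constructor
  · rintro ⟨ρ, hρ, rfl⟩
    obtain ⟨hp, h2⟩ := mem_pairings.1 hρ
    have hσ : ∀ k ∈ posPart I, ((ρ * negOn I * ρ) ((ρ * negOn I * ρ) k) = k) ∧
        (ρ * negOn I * ρ) ((ρ * negOn I * ρ) (-k)) = -k := by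
      intro k hk
      have h3 := apply_mem_of_mem_permsOn hp hk
      rw [(pairing_mul_negOn_mul_apply h0 hρ hk).1, (pairing_mul_negOn_mul_apply h0 hρ hk).2,
        (pairing_mul_negOn_mul_apply h0 hρ h3).1, (pairing_mul_negOn_mul_apply h0 hρ h3).2,
        (h2 k hk).2]
      exact ⟨rfl, rfl⟩
    have hmem : ρ * negOn I * ρ ∈ permsOn (pm I) := by
      have hp' := permsOn_mono posPart_subset_pm hp
      refine mul_mem_permsOn (mul_mem_permsOn hp' (mem_permsOn.2 fun x hx => ?_)) hp'
      rw [negOn_apply, if_neg hx]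
    have hall : ∀ x ∈ pm I, (ρ * negOn I * ρ) ((ρ * negOn I * ρ) x) = x ∧
        (ρ * negOn I * ρ) (-(ρ * negOn I * ρ) x) = -x ∧ (ρ * negOn I * ρ) x ≠ -x ∧
        (0 < x → (ρ * negOn I * ρ) x < 0) := by
      rw [forall_mem_pm h0]
      intro k hk
      have h3 := apply_mem_of_mem_permsOn hp hk
      have h4 := hpos hk
      have h5 := hpos h3
      have h6 := (h2 k hk).1
      refine ⟨⟨(hσ k hk).1, ?_, ?_, ?_⟩, (hσ k hk).2, ?_, ?_, ?_⟩
      · rw [(pairing_mul_negOn_mul_apply h0 hρ hk).1, neg_neg,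
          (pairing_mul_negOn_mul_apply h0 hρ h3).1, (h2 k hk).2]
      · rw [(pairing_mul_negOn_mul_apply h0 hρ hk).1]; omega
      · rw [(pairing_mul_negOn_mul_apply h0 hρ hk).1]; omega
      · rw [(pairing_mul_negOn_mul_apply h0 hρ hk).2,
          (pairing_mul_negOn_mul_apply h0 hρ h3).2, (h2 k hk).2, neg_neg]
      · rw [(pairing_mul_negOn_mul_apply h0 hρ hk).2]; omega
      · omega
    refine ⟨(mem_premaps_iff h0).2 ⟨hmem, minus_eq_inv_iff.2 fun x => ?_, fun k hk => (hall k hk).2.2.1⟩,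
      fun x hx => ⟨(hall x hx).1, (hall x hx).2.2.2⟩⟩
    by_cases hx : x ∈ pm I
    · exact (hall x hx).2.1
    · rw [mem_permsOn.1 hmem x hx, mem_permsOn.1 hmem]
      rwa [neg_mem_pm]
  · rintro ⟨hπ, h2⟩
    obtain ⟨hp, hm, hne⟩ := (mem_premaps_iff h0).1 hπ
    rw [minus_eq_inv_iff] at hm
    have hmem : ∀ k ∈ posPart I, -π k ∈ posPart I := by
      intro k hk
      have h3 := (h2 k (posPart_subset_pm hk)).2 (hpos hk)
      have h4 := apply_mem_of_mem_permsOn hp (posPart_subset_pm hk)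
      exact mem_posPart.2 ⟨by omega, by rw [Int.natAbs_neg]; exact mem_pm.1 h4⟩
    let ρ : Equiv.Perm ℤ := Function.Involutive.toPerm
      (fun k : ℤ => if k ∈ posPart I then -π k else k) (by
        intro k
        by_cases h : k ∈ posPart I
        · simp only [h, if_true, hmem k h]
          rw [hm, neg_neg]
        · simp only [h, if_false])
    have hρ1 : ∀ k ∈ posPart I, ρ k = -π k := fun k hk => if_pos hk
    have hρ : ρ ∈ pairings (posPart I) := by
      refine mem_pairings.2 ⟨mem_permsOn.2 fun k hk => if_neg hk, fun k hk => ⟨?_, ?_⟩⟩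
      · rw [hρ1 k hk]
        have := hne k (posPart_subset_pm hk)
        omega
      · rw [hρ1 k hk, hρ1 _ (hmem k hk), hm, neg_neg]
    refine ⟨ρ, hρ, ?_⟩
    have h5 : ∀ x ∈ pm I, (ρ * negOn I * ρ) x = π x := by
      rw [forall_mem_pm h0]
      intro k hk
      rw [(pairing_mul_negOn_mul_apply h0 hρ hk).1, (pairing_mul_negOn_mul_apply h0 hρ hk).2, hρ1 k hk,
        neg_neg]
      refine ⟨rfl, ?_⟩
      have h6 := hm (π k)
      rw [(h2 k (posPart_subset_pm hk)).1] at h6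
      exact h6.symm
    ext x
    by_cases hx : x ∈ pm I
    · exact h5 x hx
    · rw [mem_permsOn.1 hp x hx, Equiv.Perm.mul_apply, Equiv.Perm.mul_apply,
        mem_permsOn.1 (mem_pairings.1 hρ).1 x fun h => hx (posPart_subset_pm h), negOn_apply, if_neg hx,
        mem_permsOn.1 (mem_pairings.1 hρ).1 x fun h => hx (posPart_subset_pm h)]

theorem sum_ginibre (h0 : 0 ∉ I) (g : Equiv.Perm ℤ → ℂ) :
    ∑ π ∈ ginibreData.PM I, g π = ∑ ρ ∈ pairings (posPart I), g (ρ * negOn I * ρ) := by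
  classical
  refine Finset.sum_image fun ρ hρ ρ' hρ' e => ?_
  ext x
  by_cases hx : x ∈ posPart I
  · have h1 := (pairing_mul_negOn_mul_apply h0 hρ hx).2
    have h2 := (pairing_mul_negOn_mul_apply h0 hρ' hx).2
    rw [← h1, ← h2]
    exact congrArg (fun σ : Equiv.Perm ℤ => σ (-x)) e
  · rw [mem_permsOn.1 (mem_pairings.1 hρ).1 x hx, mem_permsOn.1 (mem_pairings.1 hρ').1 x hx]

theorem mem_goe_iff : π ∈ goeData.PM I ↔ π ∈ premaps I ∧ ∀ x ∈ pm I, π x ≠ x ∧ π (π x) = x := by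
  classical
  have : π ∈ goeData.PM I ↔ π ∈ premaps I ∧ π ∈ pairings (pm I) := Finset.mem_inter
  rw [this, mem_pairings]
  exact ⟨fun h => ⟨h.1, h.2.2⟩, fun h => ⟨h.1, premap_permsOn h.1, h.2⟩⟩

theorem ginibreData_isMultiplicative : ginibreData.IsMultiplicative where
  subset _ h0 _ hπ := ((mem_ginibre_iff h0).1 hπ).1
  split _ _ hJ hK hd π := split_of_forall (Q := fun x y z => z = x ∧ (0 < x → y < 0))
    (fun _ h0 _ => mem_ginibre_iff h0) hJ hK hd π
  limit _ _ _ _ _ := ⟨1, tendsto_const_nhds⟩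
  mul _ _ _ _ _ _ _ _ _ _ _ _ := (mul_one 1).symm

theorem goeData_isMultiplicative : goeData.IsMultiplicative where
  subset _ _ _ hπ := (mem_goe_iff.1 hπ).1
  split _ _ hJ hK hd π := split_of_forall (Q := fun x y z => y ≠ x ∧ z = x)
    (fun _ _ _ => mem_goe_iff) hJ hK hd π
  limit _ _ _ _ _ := ⟨1, tendsto_const_nhds⟩
  mul _ _ _ _ _ _ _ _ _ _ _ _ := (mul_one 1).symm

theorem mem_particular {x : ℤ} : x ∈ particular I π ↔ x ∈ pm I ∧ ∃ m ∈ pm I, π.SameCycle x m ∧ 0 < m ∧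
    ∀ l ∈ pm I, π.SameCycle x l → |m| ≤ |l| := by
  classical
  exact Finset.mem_filter

theorem particular_mul {π₁ π₂ : Equiv.Perm ℤ} (hd : Disjoint J K) (h₁ : π₁ ∈ permsOn (pm J))
    (h₂ : π₂ ∈ permsOn (pm K)) :
    particular (J ∪ K) (π₁ * π₂) = particular J π₁ ∪ particular K π₂ := by
  have hd' := disjoint_pm hd
  have key : ∀ {A B : Finset ℕ} {σ τ : Equiv.Perm ℤ}, σ ∈ permsOn (pm A) →
      (∀ x ∈ pm A, ∀ y, τ.SameCycle x y ↔ σ.SameCycle x y) → ∀ x ∈ pm A,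
      (x ∈ particular (A ∪ B) τ ↔ x ∈ particular A σ) := by
    intro A B σ τ hσ h x hx
    rw [mem_particular, mem_particular, pm_union]
    simp only [h x hx]
    constructor
    · rintro ⟨-, m, -, hxm, hm, hl⟩
      exact ⟨hx, m, mem_of_sameCycle hσ hxm hx, hxm, hm, fun l hlA => hl l (Finset.mem_union_left _ hlA)⟩
    · rintro ⟨-, m, hmA, hxm, hm, hl⟩
      exact ⟨Finset.mem_union_left _ hx, m, Finset.mem_union_left _ hmA, hxm, hm,
        fun l _ hxl => hl l (mem_of_sameCycle hσ hxl hx) hxl⟩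
  ext x
  rw [Finset.mem_union]
  by_cases hJ : x ∈ pm J
  · have hK : x ∉ particular K π₂ := fun h =>
      Finset.disjoint_left.1 hd' hJ (mem_particular.1 h).1
    rw [key h₁ (fun x hx y => sameCycle_mul_left hd' h₁ h₂ hx) x hJ]
    exact ⟨Or.inl, fun h => h.resolve_right hK⟩
  have hJ' : x ∉ particular J π₁ := fun h => hJ (mem_particular.1 h).1
  by_cases hK : x ∈ pm K
  · rw [Finset.union_comm J K, key h₂ (fun x hx y => sameCycle_mul_right hd' h₁ h₂ hx) x hK]
    exact ⟨Or.inr, fun h => h.resolve_left hJ'⟩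
  · have hK' : x ∉ particular K π₂ := fun h => hK (mem_particular.1 h).1
    have : x ∉ particular (J ∪ K) (π₁ * π₂) := fun h => by
      have := (mem_particular.1 h).1
      rw [pm_union, Finset.mem_union] at this
      exact this.elim hJ hK
    grind

theorem trAlong_particular_mul {d N : ℕ} (hJ : 0 ∉ J) (hK : 0 ∉ K) (hd : Disjoint J K)
    {π₁ π₂ : Equiv.Perm ℤ} (h₁ : π₁ ∈ premaps J) (h₂ : π₂ ∈ premaps K)
    (W : ℤ → Matrix (Fin d) (Fin d) ℂ) :
    trAlong N (particular (J ∪ K) (π₁ * π₂)) (π₁ * π₂) W =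
      trAlong N (particular J π₁) π₁ W * trAlong N (particular K π₂) π₂ W := by
  have hd' := disjoint_pm hd
  have p₁ := premap_permsOn h₁
  have p₂ := premap_permsOn h₂
  have f := isOfFinOrder_of_mem_permsOn (mul_mem_permsOn_union p₁ p₂)
  have s₁ := (particular_isHalf hJ h₁).subset
  have s₂ := (particular_isHalf hK h₂).subset
  rw [particular_mul hd p₁ p₂, trAlong_union]
  · congr 1
    · exact (trAlong_congr (isOfFinOrder_of_mem_permsOn p₁) f
        (fun x hx => particular_saturated hx (apply_mem_of_mem_permsOn p₁ (s₁ hx))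
          (sameCycle_apply_self _ _))
        (fun x hx => (mul_apply_left hd' p₂ (s₁ hx)).symm) fun _ _ => rfl).symm
    · exact (trAlong_congr (isOfFinOrder_of_mem_permsOn p₂) f
        (fun x hx => particular_saturated hx (apply_mem_of_mem_permsOn p₂ (s₂ hx))
          (sameCycle_apply_self _ _))
        (fun x hx => (mul_apply_right hd' p₁ p₂ (s₂ hx)).symm) fun _ _ => rfl).symm
  · exact fun x hx y hy hxy => not_connects_mul hd' p₁ p₂ ⟨x, s₁ hx, y, s₂ hy, hxy⟩

/-- Each factor is the normalized trace of a nonempty word in the `D_λ` and their transposes, so it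
converges by assumption. -/
theorem exists_tendsto_trAlong {Λ : Type*} {M : ℕ → ℕ}
    {D : (N : ℕ) → Λ → Matrix (Fin (M N)) (Fin (M N)) ℂ} (hD : HasDeterministicLimit M D)
    (lam : ℕ → Λ) (S : Finset ℤ) (σ : Equiv.Perm ℤ) :
    ∃ c : ℂ, Tendsto (fun N => trAlong N S σ (signed fun k => D N (lam k))) atTop (𝓝 c) := by
  classical
  have key : ∀ k ∈ S.filter (fun k => ∀ l ∈ S, σ.SameCycle k l → k ≤ l), ∃ c : ℂ,
      Tendsto (fun N : ℕ => (N : ℂ)⁻¹ * Matrix.trace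
        (((List.range (S.filter (fun l => σ.SameCycle k l)).card).map
          (fun j => signed (fun k => D N (lam k)) ((σ ^ j) k))).prod)) atTop (𝓝 c) := by
    intro k hk
    have hpos : 0 < (S.filter (fun l => σ.SameCycle k l)).card :=
      Finset.card_pos.2 ⟨k, Finset.mem_filter.2 ⟨(Finset.mem_filter.1 hk).1,
        Equiv.Perm.SameCycle.refl _ _⟩⟩
    obtain ⟨c, hc⟩ := hD ((List.range (S.filter (fun l => σ.SameCycle k l)).card).map
      fun j => (lam ((σ ^ j) k).natAbs, if 0 < (σ ^ j) k then 1 else -1)) (by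
        intro h
        rw [List.map_eq_nil_iff, List.range_eq_nil] at h
        omega)
    refine ⟨c, hc.congr fun N => ?_⟩
    rw [List.map_map]
    congr 4
    funext j
    simp only [Function.comp_apply, signed, signPow]
    split_ifs <;> simp_all
  choose! c hc using key
  exact ⟨_, tendsto_finsetProd _ hc⟩

theorem wishartData_isMultiplicative {Λ : Type*} {M : ℕ → ℕ}
    {D : (N : ℕ) → Λ → Matrix (Fin (M N)) (Fin (M N)) ℂ} (hD : HasDeterministicLimit M D) :
    (wishartData M D).IsMultiplicative where
  subset _ _ := Finset.Subset.refl _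
  split _ _ hJ hK hd π := split_of_forall (PM := premaps) (Q := fun _ _ _ => True)
    (fun _ _ _ => by simp) hJ hK hd π
  limit _ _ lam _ _ := exists_tendsto_trAlong hD lam _ _
  mul J K hJ hK hd N _ lam π₁ h₁ π₂ h₂ := by
    have h₁' := inv_mem_premaps hJ h₁
    have h₂' := inv_mem_premaps hK h₂
    have e : (π₁ * π₂)⁻¹ = π₁⁻¹ * π₂⁻¹ := by
      rw [mul_inv_rev, permsOn_comm (disjoint_pm hd) (premap_permsOn h₁') (premap_permsOn h₂')]
    change trAlong N (particular (J ∪ K) (π₁ * π₂)⁻¹) (π₁ * π₂)⁻¹ _ = _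
    rw [e]
    exact trAlong_particular_mul hJ hK hd h₁' h₂' _

end ModelData

/-! ### Pairing premaps and sign choices -/

section PairingCycles

variable {I : Finset ℕ} {S : Finset ℤ} {π ρ : Equiv.Perm ℤ} {ε : ℕ → ℤˣ}

theorem two_mul_numCycles_pairing (h : ρ ∈ pairings S) : 2 * numCycles S ρ = S.card := by
  classical
  obtain ⟨hp, h2⟩ := mem_pairings.1 h
  have hsc : ∀ x y, ρ.SameCycle x y ↔ y = x ∨ y = ρ x := by
    intro x y
    constructor
    · intro hxy
      obtain ⟨n, rfl⟩ := exists_pow_of_sameCycle (isOfFinOrder_of_mem_permsOn hp) hxy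
      clear hxy
      induction n with
      | zero => simp
      | succ n ih =>
        rw [pow_succ', Equiv.Perm.mul_apply]
        rcases ih with ih | ih <;> rw [ih]
        · exact Or.inr rfl
        · exact Or.inl (pairing_apply_apply h x)
    · rintro (rfl | rfl)
      · exact Equiv.Perm.SameCycle.refl _ _
      · exact sameCycle_apply_self _ _
  have hcl : ∀ k ∈ S, S.filter (fun l => ρ.SameCycle k l) = {k, ρ k} := by
    intro k hk
    ext l
    rw [Finset.mem_filter, hsc, Finset.mem_insert, Finset.mem_singleton]
    refine ⟨And.right, fun hl => ⟨?_, hl⟩⟩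
    rcases hl with rfl | rfl
    · exact hk
    · exact apply_mem_of_mem_permsOn hp hk
  unfold numCycles
  rw [Finset.card_eq_sum_card_image (fun k => S.filter (fun l => ρ.SameCycle k l)) S,
    Finset.sum_const_nat (m := 2), mul_comm]
  intro b hb
  obtain ⟨k, hk, rfl⟩ := Finset.mem_image.1 hb
  have : S.filter (fun x => S.filter (fun l => ρ.SameCycle x l) = S.filter (fun l => ρ.SameCycle k l)) =
      {k, ρ k} := by
    rw [← hcl k hk]
    refine Finset.filter_congr fun l hl => ?_
    exact eq_comm.trans (filter_class_eq_iff (r := cyc ρ) hl)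
  rw [this, Finset.card_pair (h2 k hk).1.symm]

theorem card_posPart : (posPart I).card = I.card :=
  Finset.card_image_of_injective _ Nat.cast_injective

/-- An involutive premap satisfies `π = π⁻¹ = δπδ`, so it commutes with negation. -/
theorem goe_apply_neg (h0 : 0 ∉ I) (hπ : π ∈ goeData.PM I) {x : ℤ} (hx : x ∈ pm I) :
    π (-x) = -π x := by
  obtain ⟨h, h2⟩ := mem_goe_iff.1 hπ
  have hm := minus_eq_inv_iff.1 ((mem_premaps_iff h0).1 h).2.1 (π x)
  rw [(h2 x hx).2] at hm
  exact hm

theorem ginibre_subset_goe (h0 : 0 ∉ I) : ginibreData.PM I ⊆ goeData.PM I := by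
  intro π hπ
  obtain ⟨h, h2⟩ := (mem_ginibre_iff h0).1 hπ
  have hm := minus_eq_inv_iff.1 ((mem_premaps_iff h0).1 h).2.1
  refine mem_goe_iff.2 ⟨h, fun x hx => ⟨fun e => ?_, (h2 x hx).1⟩⟩
  have h3 := hm x
  rw [e] at h3
  have h4 := (h2 x hx).2
  have h5 := (h2 (-x) (neg_mem_pm.2 hx)).2
  have := ne_zero_of_mem_pm h0 hx
  omega

theorem numCycles_goe (h0 : 0 ∉ I) (hπ : π ∈ goeData.PM I) : numCycles (pm I) π = I.card := by
  classical
  have h : π ∈ pairings (pm I) := (Finset.mem_inter.1 hπ).2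
  have := two_mul_numCycles_pairing h
  rw [card_pm h0] at this
  omega

theorem signConj_mem_goe (ε : ℕ → ℤˣ) (h0 : 0 ∉ I) (hπ : π ∈ goeData.PM I) :
    signConj ε π ∈ goeData.PM I := by
  obtain ⟨h, h2⟩ := mem_goe_iff.1 hπ
  refine mem_goe_iff.2 ⟨signConj_mem_premaps ε h0 h, fun x hx => ?_⟩
  have h3 := h2 _ ((deltaEps_mem_pm ε).2 hx)
  simp only [Equiv.Perm.mul_apply, deltaEps_deltaEps]
  refine ⟨fun e => h3.1 ?_, by rw [h3.2, deltaEps_deltaEps]⟩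
  rw [← deltaEps_deltaEps ε (π (deltaEps ε x)), e]

theorem signConj_mem_ginibre_iff (h0 : 0 ∉ I) (hπ : π ∈ goeData.PM I) :
    signConj ε π ∈ ginibreData.PM I ↔
      ∀ k ∈ posPart I, (ε k.natAbs : ℤ) * (ε (π k).natAbs : ℤ) * π k < 0 := by
  have hg := mem_goe_iff.1 (signConj_mem_goe ε h0 hπ)
  rw [mem_ginibre_iff h0, and_iff_right hg.1]
  have key : ∀ k ∈ pm I, signConj ε π k = (ε k.natAbs : ℤ) * (ε (π k).natAbs : ℤ) * π k := by
    intro k hk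
    simp only [Equiv.Perm.mul_apply, deltaEps_apply (x := k)]
    rcases Int.units_eq_one_or (ε k.natAbs) with h | h
    · rw [h, Units.val_one, one_mul, one_mul, deltaEps_apply]
    · rw [h]
      simp only [Units.val_neg, Units.val_one, neg_mul, one_mul]
      rw [goe_apply_neg h0 hπ hk, deltaEps_neg, deltaEps_apply]
  constructor
  · intro h k hk
    rw [← key k (posPart_subset_pm hk)]
    exact (h k (posPart_subset_pm hk)).2 (pos_of_mem_posPart h0 hk)
  · intro h x hx
    refine ⟨(hg.2 x hx).2, fun hpos => ?_⟩
    rw [key x hx]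
    exact h x (mem_posPart.2 ⟨hpos.le, mem_pm.1 hx⟩)

open scoped Classical in
/-- The number of choices of signs that take a pairing premap to one without positive pairs. -/
theorem sumFun_signConj_mem_ginibre (h0 : 0 ∉ I) (hπ : π ∈ goeData.PM I) :
    ∃ m : ℕ, I.card = 2 * m ∧ (sumFun (posPart I) fun η : ℤ → ℤˣ =>
      if signConj (fun k => η k) π ∈ ginibreData.PM I then (1 : ℂ) else 0) = 2 ^ m := by
  obtain ⟨h, h2⟩ := mem_goe_iff.1 hπ
  obtain ⟨hp, hm, hne⟩ := (mem_premaps_iff h0).1 h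
  rw [minus_eq_inv_iff] at hm
  set S := posPart I with hS
  -- The map `k ↦ |π k|` pairs `I`. `P` collects the smaller and `R` the larger element of each
  -- pair; the signs on `P` are free and determine those on `R`.
  set R := S.filter (fun k => |π k| < k) with hR
  set P := S.filter (fun k => k < |π k|) with hP
  have hpos : ∀ k ∈ S, 0 < k := fun k hk => pos_of_mem_posPart h0 hk
  have habs : ∀ k ∈ S, |π k| ∈ S := fun k hk => by
    rw [hS, mem_posPart, Int.natAbs_abs]
    exact ⟨abs_nonneg _, mem_pm.1 (apply_mem_of_mem_permsOn hp (posPart_subset_pm hk))⟩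
  have hπabs : ∀ k ∈ S, π |π k| = if π k < 0 then -k else k := by
    intro k hk
    split_ifs with h'
    · rw [abs_of_neg h', hm]
    · rw [abs_of_nonneg (not_lt.1 h'), (h2 k (posPart_subset_pm hk)).2]
  have habs2 : ∀ k ∈ S, |π (|π k|)| = k := by
    intro k hk
    have := hpos k hk
    rw [hπabs k hk]
    split_ifs
    · rw [abs_neg, abs_of_pos this]
    · exact abs_of_pos this
  have hk_ne : ∀ k ∈ S, |π k| ≠ k := by
    intro k hk e
    rcases abs_choice (π k) with h' | h'
    · exact (h2 k (posPart_subset_pm hk)).1 (h' ▸ e)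
    · exact hne k (posPart_subset_pm hk) (by omega)
  have hd : Disjoint P R := Finset.disjoint_filter.2 fun k _ h1 => by omega
  have hu : S = P ∪ R := by
    rw [hP, hR, ← Finset.filter_or]
    refine (Finset.filter_true_of_mem fun k hk => ?_).symm
    have := hk_ne k hk
    omega
  have hRP : ∀ k ∈ R, |π k| ∈ P := by
    intro k hk
    obtain ⟨hkS, hk⟩ := Finset.mem_filter.1 hk
    exact Finset.mem_filter.2 ⟨habs k hkS, by rwa [habs2 k hkS]⟩
  have hPR : ∀ k ∈ P, |π k| ∈ R := by
    intro k hk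
    obtain ⟨hkS, hk⟩ := Finset.mem_filter.1 hk
    exact Finset.mem_filter.2 ⟨habs k hkS, by rwa [habs2 k hkS]⟩
  have hcard : P.card = R.card := Finset.card_bij' (fun k _ => |π k|) (fun k _ => |π k|) hPR hRP
    (fun k hk => habs2 k (Finset.mem_filter.1 hk).1) fun k hk => habs2 k (Finset.mem_filter.1 hk).1
  -- Conjugation by the signs multiplies `π k` by `η(k) η(|π k|)`. The result is negative precisely
  -- when this product equals `c k`.
  let c : ℤ → ℤˣ := fun k => if π k < 0 then 1 else -1
  have hcond : ∀ η : ℤ → ℤˣ, signConj (fun k => η k) π ∈ ginibreData.PM I ↔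
      ∀ k ∈ R, η k = c k * η |π k| := by
    intro η
    rw [signConj_mem_ginibre_iff h0 hπ]
    have h3 : ∀ k ∈ S, ((η (k.natAbs : ℤ) : ℤ) * (η ((π k).natAbs : ℤ) : ℤ) * π k < 0 ↔
        η k = c k * η |π k|) := by
      intro k hk
      have hk0 : π k ≠ 0 := ne_zero_of_mem_pm h0 (apply_mem_of_mem_permsOn hp (posPart_subset_pm hk))
      rw [Int.natCast_natAbs, Int.natCast_natAbs, abs_of_pos (hpos k hk)]
      simp only [c]
      rcases Int.units_eq_one_or (η k) with h1 | h1 <;>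
        rcases Int.units_eq_one_or (η |π k|) with h2 | h2 <;> rw [h1, h2] <;> split_ifs with h4 <;>
        simp <;> omega
    constructor
    · exact fun h' k hk => (h3 k (Finset.mem_filter.1 hk).1).1 (h' k (Finset.mem_filter.1 hk).1)
    · intro h' k hk
      rw [h3 k hk]
      rw [← hS, hu, Finset.mem_union] at hk
      rcases hk with hk | hk
      · have h5 := h' _ (hPR k hk)
        have hkS := (Finset.mem_filter.1 hk).1
        have h6 : c |π k| = c k := by
          have := hpos k hkS
          simp only [c]
          rw [hπabs k hkS]
          split_ifs <;> first | rfl | omega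
        rw [habs2 k hkS, h6] at h5
        rw [h5, ← mul_assoc, Int.units_mul_self, one_mul]
      · exact h' k hk
  refine ⟨P.card, ?_, ?_⟩
  · rw [← card_posPart, ← hS, hu, Finset.card_union_of_disjoint hd, hcard, two_mul]
  · simp only [hcond]
    rw [hu, sumFun_union hd]
    have h7 : ∀ u : ℤ → ℤˣ, (sumFun R fun v : ℤ → ℤˣ => if ∀ k ∈ R,
        (if k ∈ P then u k else v k) = c k * (if |π k| ∈ P then u |π k| else v |π k|)
        then (1 : ℂ) else 0) = 1 := by
      intro u
      have h8 : ∀ v : ℤ → ℤˣ, (if ∀ k ∈ R,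
          (if k ∈ P then u k else v k) = c k * (if |π k| ∈ P then u |π k| else v |π k|)
          then (1 : ℂ) else 0) = ∏ k ∈ R, if v k = c k * u |π k| then 1 else 0 := by
        intro v
        rw [Finset.prod_boole]
        refine if_congr (forall₂_congr fun k hk => ?_) rfl rfl
        rw [if_neg (Finset.disjoint_right.1 hd hk), if_pos (hRP k hk)]
      rw [sumFun_congr h8, ← prod_sum_eq_sumFun fun k b => if b = c k * u |π k| then (1 : ℂ) else 0]
      refine Finset.prod_eq_one fun k _ => ?_
      rw [Finset.sum_ite_eq' Finset.univ, if_pos (Finset.mem_univ _)]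
    simp only [h7]
    simp [sumFun]

open scoped Classical in
theorem sum_ginibre_signConj (h0 : 0 ∉ I) (ε : ℕ → ℤˣ) (g : Equiv.Perm ℤ → ℂ) :
    ∑ π ∈ ginibreData.PM I, g (signConj ε π) =
      ∑ π ∈ goeData.PM I, (if signConj ε π ∈ ginibreData.PM I then 1 else 0) * g π := by
  simp only [ite_mul, one_mul, zero_mul]
  rw [← Finset.sum_filter]
  refine Finset.sum_nbij' (signConj ε) (signConj ε) ?_ ?_ ?_ ?_ ?_
  · intro π hπ
    rw [Finset.mem_filter, signConj_signConj]
    exact ⟨signConj_mem_goe ε h0 (ginibre_subset_goe h0 hπ), hπ⟩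
  · exact fun π hπ => (Finset.mem_filter.1 hπ).2
  · exact fun π _ => signConj_signConj ε π
  · exact fun π _ => signConj_signConj ε π
  · exact fun _ _ => rfl

end PairingCycles

/-! ### Real Ginibre and GOE matrices -/

section GinibreGOE

theorem natCast_zpow_eq {N : ℕ} (m : ℕ) :
    (N : ℂ) ^ ((m : ℤ) - ((2 * m : ℕ) : ℤ)) = (((Real.sqrt N)⁻¹ : ℝ) : ℂ) ^ (2 * m) := by
  have h1 : (((Real.sqrt N)⁻¹ : ℝ) : ℂ) ^ 2 = (N : ℂ)⁻¹ := by
    rw [← Complex.ofReal_pow, inv_pow, Real.sq_sqrt (Nat.cast_nonneg N)]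
    push_cast
    rfl
  rw [pow_mul, h1, show (m : ℤ) - ((2 * m : ℕ) : ℤ) = -(m : ℤ) by push_cast; ring, zpow_neg,
    zpow_natCast, inv_pow]

variable {Ω : Type*} [MeasurableSpace Ω] {μ : Measure Ω}
  {Z : (N : ℕ) → Ω → Matrix (Fin N) (Fin N) ℝ} {I : Finset ℕ} {N : ℕ}

theorem isRandomMatrix_ginibre (hZ : IsGaussianMatrix μ (Z N)) (l : Unit) :
    IsRandomMatrix μ (ginibre Z N l) := by
  obtain ⟨f, hf, -, hl, hX⟩ := hZ
  intro i j
  have e : (fun ω => ginibre Z N l ω i j) =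
      fun ω => (((Real.sqrt N)⁻¹ : ℝ) : ℂ) * (f (i, j) ω : ℂ) := by
    funext ω
    simp only [ginibre, Matrix.map_apply, hX]
    push_cast
    rfl
  rw [e]
  exact ⟨(Complex.measurable_ofReal.comp (hf _)).const_mul _,
    (hasMoments_gaussian (hf _) (hl _)).const_mul _⟩

open scoped Classical in
-- In Wick's formula a pairing `ρ` contributes if the index pairs at `k` and `ρ(k)` agree. This is
-- compatibility of `u` with `ρδρ`. Pairings exist only for even `|I| = 2m`, and then the
-- normalization `N^(-m)` is `N^(m - |I|)`.
theorem integral_prod_ginibre (hZ : IsGaussianMatrix μ (Z N)) (h0 : 0 ∉ I)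
    (u : ℤ → Fin N) :
    ∫ ω, ∏ k ∈ posPart I, ginibre Z N () ω (u k) (u (-k)) ∂μ =
      ∑ π ∈ ginibreData.PM I, (N : ℂ) ^ (((numCycles (pm I) π / 2 : ℕ) : ℤ) - I.card) *
        if ∀ s ∈ pm I, u (-π s) = u s then 1 else 0 := by
  obtain ⟨f, hf, hi, hl, hX⟩ := hZ
  have e : ∀ ω, ∏ k ∈ posPart I, ginibre Z N () ω (u k) (u (-k)) =
      (((Real.sqrt N)⁻¹ ^ I.card * ∏ k ∈ posPart I, f (u k, u (-k)) ω : ℝ) : ℂ) := by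
    intro ω
    rw [← card_posPart (I := I), ← Finset.prod_const, ← Finset.prod_mul_distrib, Complex.ofReal_prod]
    refine Finset.prod_congr rfl fun k _ => ?_
    simp only [ginibre, Matrix.map_apply, hX]
  simp_rw [e]
  rw [integral_complex_ofReal, integral_const_mul,
    integral_prod_gaussian hf hi hl (posPart I) fun k => (u k, u (-k)), pairingCount,
    Finset.card_filter, sum_ginibre h0, Nat.cast_sum, Finset.mul_sum, Complex.ofReal_sum]
  refine Finset.sum_congr rfl fun ρ hρ => ?_
  have hmem : ρ * negOn I * ρ ∈ ginibreData.PM I := Finset.mem_image.2 ⟨ρ, hρ, rfl⟩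
  have hc := two_mul_numCycles_pairing hρ
  rw [card_posPart] at hc
  rw [numCycles_goe h0 (ginibre_subset_goe h0 hmem), ← hc, Nat.mul_div_cancel_left _ two_pos,
    natCast_zpow_eq]
  have hcond : (∀ k ∈ posPart I, (u (ρ k), u (-ρ k)) = (u k, u (-k))) ↔
      ∀ s ∈ pm I, u (-(ρ * negOn I * ρ) s) = u s := by
    rw [forall_mem_pm h0]
    refine forall₂_congr fun k hk => ?_
    rw [(pairing_mul_negOn_mul_apply h0 hρ hk).1, (pairing_mul_negOn_mul_apply h0 hρ hk).2, neg_neg,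
      Prod.mk.injEq]
  simp only [hcond]
  split_ifs <;> simp

theorem goe_apply {Ω : Type*} {Z : (N : ℕ) → Ω → Matrix (Fin N) (Fin N) ℝ} {N : ℕ} (l : Unit) (ω : Ω)
    (a b : Fin N) : goe Z N l ω a b =
    (((Real.sqrt 2)⁻¹ : ℝ) : ℂ) * ∑ e : ℤˣ, signPow e (ginibre Z N () ω) a b := by
  have h : (Finset.univ : Finset ℤˣ) = {1, -1} := rfl
  rw [h, Finset.sum_pair (by decide)]
  simp [goe, ginibre, signPow, Matrix.transpose_apply]
  ring

theorem isRandomMatrix_goe (hZ : IsGaussianMatrix μ (Z N)) (l : Unit) :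
    IsRandomMatrix μ (goe Z N l) := by
  have h := isRandomMatrix_ginibre hZ ()
  intro i j
  have hs : ∀ e : ℤˣ, Measurable (fun ω => signPow e (ginibre Z N () ω) i j) ∧
      HasMoments μ (fun ω => signPow e (ginibre Z N () ω) i j) := by
    intro e
    unfold signPow
    split_ifs
    · exact h i j
    · exact h j i
  simp only [goe_apply]
  exact ⟨(Finset.measurable_sum _ fun e _ => (hs e).1).const_mul _,
    (HasMoments.sum fun e _ => (hs e).2).const_mul _⟩

variable [IsProbabilityMeasure μ]

theorem isGenusEnsemble_ginibre (hZ : ∀ N, 1 ≤ N → IsGaussianMatrix μ (Z N)) :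
    IsGenusEnsemble μ ginibreData (ginibre Z) := by
  refine isGenusEnsemble_of_entries (fun N hN l => isRandomMatrix_ginibre (hZ N hN) l)
    ginibreData_isMultiplicative fun N hN I h0 lam u => ?_
  refine (integral_prod_ginibre (hZ N hN) h0 u).trans (Finset.sum_congr rfl fun π _ => ?_)
  rw [show ginibreData.f N I lam π = 1 from rfl, mul_one]

open scoped Classical in
-- Each GOE entry is a sum over transposition signs of Ginibre entries, and a choice of signs
-- conjugates the Ginibre premaps. Every pairing premap arises from `2^(|I|/2)` choices of signs,
-- which cancels the factor `2^(-|I|/2)`.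
theorem integral_prod_goe (hZ : IsGaussianMatrix μ (Z N)) (h0 : 0 ∉ I)
    (u : ℤ → Fin N) :
    ∫ ω, ∏ k ∈ posPart I, goe Z N () ω (u k) (u (-k)) ∂μ =
      ∑ π ∈ goeData.PM I, (N : ℂ) ^ (((numCycles (pm I) π / 2 : ℕ) : ℤ) - I.card) *
        if ∀ s ∈ pm I, u (-π s) = u s then 1 else 0 := by
  set c : ℂ := (((Real.sqrt 2)⁻¹ : ℝ) : ℂ) with hc
  set g : Equiv.Perm ℤ → ℂ := fun π => (N : ℂ) ^ (((numCycles (pm I) π / 2 : ℕ) : ℤ) - I.card) *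
        if ∀ s ∈ pm I, u (-π s) = u s then 1 else 0 with hg
  have e : ∀ ω, ∏ k ∈ posPart I, goe Z N () ω (u k) (u (-k)) = c ^ I.card *
      sumFun (posPart I) fun η : ℤ → ℤˣ => ∏ k ∈ posPart I,
        ginibre Z N () ω ((u ∘ deltaEps fun k => η k) k) ((u ∘ deltaEps fun k => η k) (-k)) := by
    intro ω
    simp only [goe_apply]
    rw [Finset.prod_mul_distrib, Finset.prod_const, card_posPart,
      prod_sum_eq_sumFun fun k (e : ℤˣ) => signPow e (ginibre Z N () ω) (u k) (u (-k))]
    congr 1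
    refine sumFun_congr fun η => Finset.prod_congr rfl fun k hk => ?_
    have h : η k = η (k.natAbs : ℤ) := by
      rw [Int.natCast_natAbs, abs_of_pos (pos_of_mem_posPart h0 hk)]
    exact (congrArg (fun e => signPow e (ginibre Z N () ω) (u k) (u (-k))) h).trans
      (signPow_apply_deltaEps (ε := fun k : ℕ => η k) _ u k)
  have hmom : ∀ v : ℤ → Fin N, HasMoments μ
      (fun ω => ∏ k ∈ posPart I, ginibre Z N () ω (v k) (v (-k))) := fun v =>
    HasMoments.prod fun s _ => (isRandomMatrix_ginibre hZ () _ _).2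
  have e1 : ∀ ε : ℕ → ℤˣ, ∫ ω, ∏ k ∈ posPart I,
      ginibre Z N () ω ((u ∘ deltaEps ε) k) ((u ∘ deltaEps ε) (-k)) ∂μ =
      ∑ π ∈ goeData.PM I, (if signConj ε π ∈ ginibreData.PM I then 1 else 0) * g π := by
    intro ε
    rw [integral_prod_ginibre hZ h0, ← sum_ginibre_signConj h0]
    refine Finset.sum_congr rfl fun π _ => ?_
    simp only [hg, numCycles_signConj]
    congr 1
    refine if_congr ?_ rfl rfl
    constructor
    · intro h s hs
      have := h _ ((deltaEps_mem_pm ε).2 hs)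
      simpa [deltaEps_deltaEps, deltaEps_neg] using this
    · intro h s hs
      have := h _ ((deltaEps_mem_pm ε).2 hs)
      simpa [deltaEps_deltaEps, deltaEps_neg] using this
  simp_rw [e]
  rw [integral_const_mul]
  unfold sumFun
  rw [integral_finsetSum _ fun η _ => (hmom _).integrable]
  change c ^ I.card * (sumFun (posPart I) fun η : ℤ → ℤˣ => ∫ ω, ∏ k ∈ posPart I,
    ginibre Z N () ω ((u ∘ deltaEps fun k => η k) k) ((u ∘ deltaEps fun k => η k) (-k)) ∂μ) = _
  simp only [e1]
  rw [sumFun_sum, Finset.mul_sum]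
  refine Finset.sum_congr rfl fun π hπ => ?_
  obtain ⟨m, hm, hs⟩ := sumFun_signConj_mem_ginibre h0 hπ
  simp only [mul_comm _ (g π)]
  rw [sumFun_mul_left, hs, hm, pow_mul]
  have h2 : c ^ 2 = 2⁻¹ := by
    rw [hc, ← Complex.ofReal_pow, inv_pow, Real.sq_sqrt (by norm_num)]
    push_cast
    rfl
  rw [h2, mul_left_comm, ← mul_pow, inv_mul_cancel₀ two_ne_zero, one_pow, mul_one]

theorem isGenusEnsemble_goe (hZ : ∀ N, 1 ≤ N → IsGaussianMatrix μ (Z N)) :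
    IsGenusEnsemble μ goeData (goe Z) := by
  refine isGenusEnsemble_of_entries (fun N hN l => isRandomMatrix_goe (hZ N hN) l)
    goeData_isMultiplicative fun N hN I h0 lam u => ?_
  refine (integral_prod_goe (hZ N hN) h0 u).trans (Finset.sum_congr rfl fun π _ => ?_)
  rw [show goeData.f N I lam π = 1 from rfl, mul_one]

end GinibreGOE

/-! ### Real Wishart matrices -/

section Wishart

variable {I : Finset ℕ}

theorem prod_sum_sum_eq_sumFun {α : Type*} [Inhabited α] [Fintype α] (h0 : 0 ∉ I)
    (g : ℤ → α → α → ℂ) : ∏ k ∈ posPart I, ∑ a, ∑ b, g k a b =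
      sumFun (pm I) fun v => ∏ k ∈ posPart I, g k (v k) (v (-k)) := by
  have hn := (isHalf_posPart h0).not_neg
  have e : pm I = posPart I ∪ negPart I := rfl
  rw [e, sumFun_union (disjoint_posPart_negPart_self h0), prod_sum_eq_sumFun fun k a => ∑ b, g k a b]
  refine sumFun_congr fun i => ?_
  rw [prod_sum_eq_sumFun (S := posPart I) fun k b => g k (i k) b]
  have hdep : DependsOn (fun b : ℤ → α => ∏ k ∈ posPart I, g k (i k) (b k)) (posPart I : Set ℤ) :=
    fun b b' h => Finset.prod_congr rfl fun s hs => by rw [h s hs]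
  rw [← sumFun_equiv (P := negPart I) hdep delta fun x => by
    rw [mem_negPart, mem_posPart, delta_apply, Int.natAbs_neg, Left.neg_nonpos_iff]]
  refine sumFun_congr fun v => Finset.prod_congr rfl fun k hk => ?_
  beta_reduce
  rw [if_pos hk, if_neg (hn k hk)]
  rfl

theorem prod_pm {R : Type*} [CommMonoid R] (h0 : 0 ∉ I) (g : ℤ → R) :
    ∏ s ∈ pm I, g s = ∏ k ∈ posPart I, g k * g (-k) := by
  have e : pm I = posPart I ∪ negPart I := rfl
  rw [e, Finset.prod_union (disjoint_posPart_negPart_self h0), Finset.prod_mul_distrib]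
  congr 1
  refine Finset.prod_bij' (fun x _ => -x) (fun x _ => -x) ?_ ?_ ?_ ?_ ?_ <;>
    simp [mem_posPart, mem_negPart]

/-- The pairings of `±I` are the products of the premaps with `δ`. -/
theorem sum_pairings_pm (h0 : 0 ∉ I) (g : Equiv.Perm ℤ → ℂ) :
    ∑ ρ ∈ pairings (pm I), g ρ = ∑ π ∈ premaps I, g (negOn I * π) := by
  have hinv : ∀ σ : Equiv.Perm ℤ, negOn I * (negOn I * σ) = σ := by
    intro σ
    ext x
    simp only [Equiv.Perm.mul_apply, negOn_apply]
    by_cases h : σ x ∈ pm I <;> simp [h, neg_mem_pm]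
  have hno : negOn I ∈ permsOn (pm I) := mem_permsOn.2 fun x hx => by rw [negOn_apply, if_neg hx]
  have hap : ∀ {σ : Equiv.Perm ℤ}, σ ∈ permsOn (pm I) → ∀ x ∈ pm I, (negOn I * σ) x = -σ x :=
    fun hσ x hx => by
      rw [Equiv.Perm.mul_apply, negOn_apply, if_pos (apply_mem_of_mem_permsOn hσ hx)]
  refine Finset.sum_nbij' (fun ρ => negOn I * ρ) (fun π => negOn I * π) ?_ ?_
    (fun ρ _ => hinv ρ) (fun π _ => hinv π) fun ρ _ => by rw [hinv]
  · intro ρ hρ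
    obtain ⟨hp, h2⟩ := mem_pairings.1 hρ
    have hp' := mul_mem_permsOn hno hp
    refine (mem_premaps_iff h0).2 ⟨hp', minus_eq_inv_iff.2 fun x => ?_, fun k hk e => ?_⟩
    · by_cases hx : x ∈ pm I
      · rw [hap hp x hx, neg_neg, hap hp _ (apply_mem_of_mem_permsOn hp hx), (h2 x hx).2]
      · rw [mem_permsOn.1 hp' x hx, mem_permsOn.1 hp' _ (by rwa [neg_mem_pm])]
    · rw [hap hp k hk, neg_inj] at e
      exact (h2 k hk).1 e
  · intro π hπ
    obtain ⟨hp, hm, hne⟩ := (mem_premaps_iff h0).1 hπ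
    refine mem_pairings.2 ⟨mul_mem_permsOn hno hp, fun k hk => ⟨fun e => ?_, ?_⟩⟩
    · rw [hap hp k hk] at e
      exact hne k hk (by omega)
    · rw [hap hp k hk, hap hp _ (neg_mem_pm.2 (apply_mem_of_mem_permsOn hp hk)),
        minus_eq_inv_iff.1 hm, neg_neg]

open scoped Classical in
-- The entries here are at `v(k), v(-k)`, in the order opposite to `trAlong_particular`.
-- Substituting `w ∘ δ` for `v` corrects this and replaces `π` by `π⁻¹`, which is why the weight `f`
-- involves the inverse.
theorem sumFun_premap {d N : ℕ} [Inhabited (Fin d)] (hN : 1 ≤ N) (h0 : 0 ∉ I) {π : Equiv.Perm ℤ}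
    (hπ : π ∈ premaps I) (Y : ℕ → Matrix (Fin d) (Fin d) ℂ) :
    (sumFun (pm I) fun v => if ∀ s ∈ pm I, v (-π s) = v s then
        ∏ k ∈ posPart I, Y k.natAbs (v k) (v (-k)) else 0) =
      (N : ℂ) ^ (numCycles (pm I) π / 2) * trAlong N (particular I π⁻¹) π⁻¹ (signed Y) := by
  have hπ' := inv_mem_premaps h0 hπ
  have hp := premap_permsOn hπ
  have h1 : numCycles (pm I) π⁻¹ = numCycles (pm I) π := by
    rw [numCycles_eq_nclass, numCycles_eq_nclass, nclass_cyc_inv]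
  rw [← h1, trAlong_particular hN h0 hπ']
  have hdep : DependsOn (fun v : ℤ → Fin d => if ∀ s ∈ pm I, v (-π s) = v s then
        ∏ k ∈ posPart I, Y k.natAbs (v k) (v (-k)) else 0) (pm I : Set ℤ) := by
    intro w w' h
    have h1 : (∀ s ∈ pm I, w (-π s) = w s) ↔ ∀ s ∈ pm I, w' (-π s) = w' s :=
      forall₂_congr fun x hx => by
        rw [h x hx, h _ (neg_mem_pm.2 (apply_mem_of_mem_permsOn hp hx))]
    have h2 : ∏ k ∈ posPart I, Y k.natAbs (w k) (w (-k)) =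
        ∏ k ∈ posPart I, Y k.natAbs (w' k) (w' (-k)) := Finset.prod_congr rfl fun k hk => by
      rw [h k (posPart_subset_pm hk), h (-k) (neg_mem_pm.2 (posPart_subset_pm hk))]
    simp only [h1, h2]
  rw [← sumFun_equiv hdep delta fun x => by rw [delta_apply, neg_mem_pm]]
  refine sumFun_congr fun w => ?_
  simp only [Function.comp_apply, delta_apply, neg_neg]
  refine if_congr ⟨fun h x hx => ?_, fun h s hs => ?_⟩ rfl rfl
  · have := h (π⁻¹ x) (apply_mem_of_mem_permsOn (inv_mem_permsOn hp) hx)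
    rw [← this]
    simp
  · have := h (π s) (apply_mem_of_mem_permsOn hp hs)
    rw [← this]
    simp

theorem trAlong_of_isEmpty {d N : ℕ} [IsEmpty (Fin d)] {S : Finset ℤ} (hS : S.Nonempty) (σ : Equiv.Perm ℤ)
    (W : ℤ → Matrix (Fin d) (Fin d) ℂ) : trAlong N S σ W = 0 := by
  classical
  refine Finset.prod_eq_zero (i := S.min' hS)
    (Finset.mem_filter.2 ⟨S.min'_mem hS, fun l hl _ => S.min'_le l hl⟩) ?_
  rw [Matrix.trace, Finset.univ_eq_empty, Finset.sum_empty, mul_zero]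

theorem premaps_empty : premaps ∅ = {1} := by
  have hpm : pm ∅ = ∅ := rfl
  ext π
  rw [mem_premaps_iff (Finset.notMem_empty 0), Finset.mem_singleton, hpm]
  constructor
  · intro h
    ext x
    exact mem_permsOn.1 h.1 x (Finset.notMem_empty x)
  · rintro rfl
    exact ⟨one_mem_permsOn, minus_eq_inv_iff.2 fun x => rfl, by simp⟩

theorem wishart_apply {Ω Λ : Type*} {M : ℕ → ℕ} {D : (N : ℕ) → Λ → Matrix (Fin (M N)) (Fin (M N)) ℂ}
    {X : (N : ℕ) → Ω → Matrix (Fin (M N)) (Fin N) ℝ} {N : ℕ} (l : Λ) (ω : Ω) (a b : Fin N) : wishart M D X N l ω a b =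
    ∑ i, ∑ j, D N l i j * ((X N ω i a : ℂ) * (X N ω j b : ℂ)) := by
  simp only [wishart, Matrix.mul_apply, Matrix.transpose_apply, Matrix.map_apply, Finset.sum_mul]
  rw [Finset.sum_comm]
  exact Finset.sum_congr rfl fun i _ => Finset.sum_congr rfl fun j _ => by ring

variable {Ω Λ : Type*} [MeasurableSpace Ω] {μ : Measure Ω} {M : ℕ → ℕ}
  {D : (N : ℕ) → Λ → Matrix (Fin (M N)) (Fin (M N)) ℂ}
  {X : (N : ℕ) → Ω → Matrix (Fin (M N)) (Fin N) ℝ} {N : ℕ}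

theorem hasMoments_gaussianMatrix {m n : ℕ} {X : Ω → Matrix (Fin m) (Fin n) ℝ}
    (hX : IsGaussianMatrix μ X) (i : Fin m) (j : Fin n) :
    Measurable (fun ω => (X ω i j : ℂ)) ∧ HasMoments μ (fun ω => (X ω i j : ℂ)) := by
  obtain ⟨f, hf, -, hl, hX⟩ := hX
  have e : (fun ω => (X ω i j : ℂ)) = fun ω => (((Real.sqrt n)⁻¹ : ℝ) : ℂ) * (f (i, j) ω : ℂ) := by
    funext ω
    rw [hX, Complex.ofReal_mul]
  rw [e]
  exact ⟨(Complex.measurable_ofReal.comp (hf _)).const_mul _,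
    (hasMoments_gaussian (hf _) (hl _)).const_mul _⟩

theorem isRandomMatrix_wishart (hX : IsGaussianMatrix μ (X N)) (l : Λ) :
    IsRandomMatrix μ (wishart M D X N l) := by
  intro a b
  simp only [wishart_apply]
  have h := fun i j => hasMoments_gaussianMatrix hX i j
  exact ⟨Finset.measurable_sum _ fun i _ => Finset.measurable_sum _ fun j _ =>
      ((h i a).1.mul (h j b).1).const_mul _,
    HasMoments.sum fun i _ => HasMoments.sum fun j _ => ((h i a).2.mul (h j b).2).const_mul _⟩

open scoped Classical in
-- There are `2|I|` entries, labelled by `±I`, so Wick's formula runs over the pairings of `±I`.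
-- Multiplication by `δ` turns these into premaps, and equality of the indices at `s` and its
-- partner becomes the condition at `-π(s)`.
theorem integral_prod_gaussianMatrix {m n : ℕ} {X : Ω → Matrix (Fin m) (Fin n) ℝ}
    (hX : IsGaussianMatrix μ X) (h0 : 0 ∉ I) (v : ℤ → Fin m) (u : ℤ → Fin n) :
    ∫ ω, ∏ s ∈ pm I, (X ω (v s) (u s) : ℂ) ∂μ =
      (n : ℂ)⁻¹ ^ I.card * ∑ π ∈ premaps I,
        if (∀ s ∈ pm I, v (-π s) = v s) ∧ ∀ s ∈ pm I, u (-π s) = u s then 1 else 0 := by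
  obtain ⟨f, hf, hi, hl, hX⟩ := hX
  have e : ∀ ω, ∏ s ∈ pm I, (X ω (v s) (u s) : ℂ) =
      (((n : ℝ)⁻¹ ^ I.card * ∏ s ∈ pm I, f (v s, u s) ω : ℝ) : ℂ) := by
    intro ω
    have h1 : ((n : ℝ)⁻¹) ^ I.card = ∏ s ∈ pm I, (Real.sqrt n)⁻¹ := by
      rw [Finset.prod_const, card_pm h0, pow_mul, inv_pow (Real.sqrt n), Real.sq_sqrt n.cast_nonneg]
    rw [h1, ← Finset.prod_mul_distrib, Complex.ofReal_prod]
    exact Finset.prod_congr rfl fun s _ => by rw [hX]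
  simp_rw [e]
  rw [integral_complex_ofReal, integral_const_mul,
    integral_prod_gaussian hf hi hl (pm I) fun s => (v s, u s), pairingCount, Finset.card_filter,
    Complex.ofReal_mul]
  push_cast
  congr 1
  refine Eq.trans (Finset.sum_congr rfl fun ρ _ => ?_) ((sum_pairings_pm h0 fun ρ =>
    if ∀ k ∈ pm I, (v (ρ k), u (ρ k)) = (v k, u k) then (1 : ℂ) else 0).trans ?_)
  · split_ifs <;> simp
  refine Finset.sum_congr rfl fun π hπ => if_congr ?_ rfl rfl
  rw [← forall₂_and]
  refine forall₂_congr fun s hs => ?_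
  rw [Prod.mk.injEq, Equiv.Perm.mul_apply, negOn_apply,
    if_pos (apply_mem_of_mem_permsOn (premap_permsOn hπ) hs)]

variable [IsProbabilityMeasure μ]

open scoped Classical in
-- Expanding `XᵀDX` introduces row indices `v` on `±I`, with `D_k` at `v(k), v(-k)`. After Wick's
-- formula the conditions on `v` and on `u` separate, and the sum over `v` produces `N^(#(π)/2)
-- f(π)`.
theorem integral_prod_wishart (hX : IsGaussianMatrix μ (X N)) (hN : 1 ≤ N) (h0 : 0 ∉ I)
    (lam : ℕ → Λ) (u : ℤ → Fin N) :
    ∫ ω, ∏ k ∈ posPart I, wishart M D X N (lam k.natAbs) ω (u k) (u (-k)) ∂μ =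
      ∑ π ∈ premaps I, (N : ℂ) ^ (((numCycles (pm I) π / 2 : ℕ) : ℤ) - I.card) *
        trAlong N (particular I π⁻¹) π⁻¹ (signed fun k => D N (lam k)) *
        if ∀ s ∈ pm I, u (-π s) = u s then 1 else 0 := by
  have hN' : (N : ℂ) ≠ 0 := by
    have : N ≠ 0 := by omega
    exact_mod_cast this
  rcases I.eq_empty_or_nonempty with rfl | hI
  · have hp : particular ∅ (1 : Equiv.Perm ℤ)⁻¹ = ∅ := rfl
    have hpm : pm ∅ = ∅ := rfl
    have hpos : posPart ∅ = ∅ := rfl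
    rw [premaps_empty, Finset.sum_singleton, hp, hpm, hpos]
    simp [numCycles, trAlong]
  -- For `M = 0` there are no row indices: the entries of the Wishart matrix vanish, and so do the
  -- traces on the right, since `I` is nonempty.
  rcases Nat.eq_zero_or_pos (M N) with hM | hM
  · obtain ⟨k, hk⟩ := hI
    have hk' : (k : ℤ) ∈ posPart I := mem_posPart.2 ⟨by omega, by simpa using hk⟩
    have hempty : IsEmpty (Fin (M N)) := by rw [hM]; infer_instance
    have h1 : ∀ ω, ∏ k ∈ posPart I, wishart M D X N (lam k.natAbs) ω (u k) (u (-k)) = 0 := fun ω =>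
      Finset.prod_eq_zero hk' (by rw [wishart_apply, Finset.univ_eq_empty, Finset.sum_empty])
    simp only [h1, integral_zero]
    refine (Finset.sum_eq_zero fun π hπ => ?_).symm
    have hh := particular_isHalf h0 (inv_mem_premaps h0 hπ)
    have hne : (particular I π⁻¹).Nonempty := by
      rcases (hh.mem_iff k).1 (posPart_subset_pm hk') with h | h
      · exact ⟨_, h⟩
      · exact ⟨_, h⟩
    rw [trAlong_of_isEmpty hne]
    ring
  · let _ : Inhabited (Fin (M N)) := ⟨⟨0, hM⟩⟩
    have e : ∀ ω, ∏ k ∈ posPart I, wishart M D X N (lam k.natAbs) ω (u k) (u (-k)) =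
        sumFun (pm I) fun v => (∏ k ∈ posPart I, D N (lam k.natAbs) (v k) (v (-k))) *
          ∏ s ∈ pm I, (X N ω (v s) (u s) : ℂ) := by
      intro ω
      simp only [wishart_apply]
      rw [prod_sum_sum_eq_sumFun h0 fun k i j =>
        D N (lam k.natAbs) i j * ((X N ω i (u k) : ℂ) * (X N ω j (u (-k)) : ℂ))]
      refine sumFun_congr fun v => ?_
      rw [Finset.prod_mul_distrib, prod_pm h0]
    simp_rw [e]
    unfold sumFun
    rw [integral_finsetSum _ fun v _ => ((HasMoments.prod fun s _ =>
      (hasMoments_gaussianMatrix hX _ _).2).const_mul _).integrable]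
    simp_rw [integral_const_mul, integral_prod_gaussianMatrix hX h0]
    change (sumFun (pm I) fun v => (∏ k ∈ posPart I, D N (lam k.natAbs) (v k) (v (-k))) *
      ((N : ℂ)⁻¹ ^ I.card * ∑ π ∈ premaps I,
        if (∀ s ∈ pm I, v (-π s) = v s) ∧ ∀ s ∈ pm I, u (-π s) = u s then 1 else 0)) = _
    have e2 : ∀ v : ℤ → Fin (M N), (∏ k ∈ posPart I, D N (lam k.natAbs) (v k) (v (-k))) *
      ((N : ℂ)⁻¹ ^ I.card * ∑ π ∈ premaps I,
        if (∀ s ∈ pm I, v (-π s) = v s) ∧ ∀ s ∈ pm I, u (-π s) = u s then (1 : ℂ) else 0) =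
      ∑ π ∈ premaps I, ((N : ℂ)⁻¹ ^ I.card * if ∀ s ∈ pm I, u (-π s) = u s then 1 else 0) *
        if ∀ s ∈ pm I, v (-π s) = v s then
          ∏ k ∈ posPart I, D N (lam k.natAbs) (v k) (v (-k)) else 0 := by
      intro v
      rw [Finset.mul_sum, Finset.mul_sum]
      refine Finset.sum_congr rfl fun π _ => ?_
      rw [ite_and]
      split_ifs <;> ring
    rw [sumFun_congr e2, sumFun_sum]
    refine Finset.sum_congr rfl fun π hπ => ?_
    rw [sumFun_mul_left, sumFun_premap hN h0 hπ fun k => D N (lam k), zpow_sub₀ hN', zpow_natCast,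
      zpow_natCast, inv_pow]
    field_simp

theorem isGenusEnsemble_wishart (hD : HasDeterministicLimit M D)
    (hX : ∀ N, 1 ≤ N → IsGaussianMatrix μ (X N)) :
    IsGenusEnsemble μ (wishartData M D) (wishart M D X) :=
  isGenusEnsemble_of_entries (fun N hN l => isRandomMatrix_wishart (hX N hN) l)
    (wishartData_isMultiplicative hD) fun N hN _ h0 lam u => integral_prod_wishart (hX N hN) hN h0 lam u

end Wishart

end RealSecondOrder

theorem mainTheorem3 {Ω : Type*} [MeasurableSpace Ω] (μ : MeasureTheory.Measure Ω)
    [MeasureTheory.IsProbabilityMeasure μ] {Λ : Type*} :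
    -- every ensemble with a multiplicative genus expansion
    (∀ (G : RealSecondOrder.GenusData Λ) (X : (N : ℕ) → Λ → Ω → Matrix (Fin N) (Fin N) ℂ),
      RealSecondOrder.IsGenusEnsemble μ G X → RealSecondOrder.HasNoncrossingLimit μ G X) ∧
    -- real Ginibre matrices
    (∀ Z : (N : ℕ) → Ω → Matrix (Fin N) (Fin N) ℝ,
      (∀ N, 1 ≤ N → RealSecondOrder.IsGaussianMatrix μ (Z N)) →
      RealSecondOrder.IsGenusEnsemble μ RealSecondOrder.ginibreData (RealSecondOrder.ginibre Z) ∧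
      RealSecondOrder.HasNoncrossingLimit μ RealSecondOrder.ginibreData
        (RealSecondOrder.ginibre Z)) ∧
    -- GOE matrices
    (∀ Z : (N : ℕ) → Ω → Matrix (Fin N) (Fin N) ℝ,
      (∀ N, 1 ≤ N → RealSecondOrder.IsGaussianMatrix μ (Z N)) →
      RealSecondOrder.IsGenusEnsemble μ RealSecondOrder.goeData (RealSecondOrder.goe Z) ∧
      RealSecondOrder.HasNoncrossingLimit μ RealSecondOrder.goeData (RealSecondOrder.goe Z)) ∧
    -- real Wishart matrices
    (∀ (M : ℕ → ℕ) (D : (N : ℕ) → Λ → Matrix (Fin (M N)) (Fin (M N)) ℂ)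
      (X : (N : ℕ) → Ω → Matrix (Fin (M N)) (Fin N) ℝ),
      RealSecondOrder.HasDeterministicLimit M D →
      (∀ N, 1 ≤ N → RealSecondOrder.IsGaussianMatrix μ (X N)) →
      RealSecondOrder.IsGenusEnsemble μ (RealSecondOrder.wishartData M D)
        (RealSecondOrder.wishart M D X) ∧
      RealSecondOrder.HasNoncrossingLimit μ (RealSecondOrder.wishartData M D)
        (RealSecondOrder.wishart M D X)) := by
  refine ⟨fun G X hX => hX.hasNoncrossingLimit, fun Z hZ => ?_, fun Z hZ => ?_,
    fun M D X hD hX => ?_⟩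
  · have h := RealSecondOrder.isGenusEnsemble_ginibre hZ
    exact ⟨h, h.hasNoncrossingLimit⟩
  · have h := RealSecondOrder.isGenusEnsemble_goe hZ
    exact ⟨h, h.hasNoncrossingLimit⟩
  · have h := RealSecondOrder.isGenusEnsemble_wishart hD hX
    exact ⟨h, h.hasNoncrossingLimit⟩
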